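/- Let $\Omega=\{x\in\mathbb R^3:|x|>1\}$. Let $\dot H^1_0(\Omega)$ denote the space of spherically symmetric complex-valued functions obtained as the closure of the radial functions in $C_c^\infty(\Omega)$ in the norm $\|f\|_{\dot H^1_0(\Omega)}=\|\nabla f\|_{L^2(\Omega)}$ (its elements are functions in $L^6(\Omega)$ with gradient in $L^2(\Omega)$). For radial $f\in C_c^\infty(\Omega)$ and $\lambda>0$ let $\mathcal F_0f(\lambda)=\sqrt{2/\pi}\int_1^\infty \frac{\sin\lambda(s-1)}{s}f(s)\,s^2\,ds$, extended by continuity to a map from $\dot H^1_0(\Omega)$ to $L^2((0,\infty),\lambda^2d\lambda)$, and let $\mathcal F_0^*h(x)=\sqrt{2/\pi}\int_0^\infty\frac{\sin\lambda(|x|-1)}{|x|}h(\lambda)\,d\lambda$. The free Dirichlet propagator on $\dot H^1_0(\Omega)$ is $e^{it\Delta_D}f=\mathcal F_0^*\bigl(e^{-i\lambda^2t}\mathcal F_0f\bigr)$. A global solution of $i\partial_tu+\Delta u=|u|^4u$ on $\mathbb R\times\Omega$ with Dirichlet boundary condition is a function $u\in C(\mathbb R;\dot H^1_0(\Omega))$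 such that for all $t_0,t_1\in\mathbb R$ $$u(t_1)=e^{i(t_1-t_0)\Delta_D}u(t_0)-i\int_{t_0}^{t_1}e^{i(t_1-t)\Delta_D}\bigl(|u(t)|^4u(t)\bigr)\,dt .$$ A pair $(q,r)$ is admissible if $2\le q\le\infty$ and $\frac2q+\frac3r=\frac32$. **Theorem.** For every (radial) $u_0\in\dot H^1_0(\Omega)$ there is a unique global solution $u$ with $u(0)=u_0$. Moreover: 1. $\nabla u\in L^q_tL^r_x(J\times\Omega)$ for every admissible pair $(q,r)$ with $r<3$ and every compact $J\subset\mathbb R$. 2. For every $t\in\mathbb R$, $E(u(t))=\frac12\int_\Omega|\nabla u(t,x)|^2dx+\frac16\int_\Omega|u(t,x)|^6dx=E(u_0)$. 3. If $\|u\|_{L^{10}_{t,x}([0,\infty)\times\Omega)}<\infty$, then there is a unique $v_+\in\dot H^1_0(\Omega)$ with $\lim_{t\to\infty}\|e^{it\Delta_D}v_+-u(t)\|_{\dot H^1_0(\Omega)}=0$. 4. If $\|u\|_{L^{10}_{t,x}((-\infty,0]\times\Omega)}<\infty$, then there is a unique $v_-\in\dot H^1_0(\Omega)$ with $\lim_{t\to-\infty}\|e^{it\Delta_D}v_--u(t)\|_{\dot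 H^1_0(\Omega)}=0$. -/

import Mathlib

open MeasureTheory Filter Topology
open scoped ENNReal ContDiff

namespace ExteriorNLS

noncomputable section

/-- Three-dimensional Euclidean space. -/
abbrev E3 : Type := EuclideanSpace ℝ (Fin 3)

/-- The exterior of the closed unit ball in three dimensions. -/
def Omega : Set E3 := {x | 1 < ‖x‖}

/-- Lebesgue measure on the exterior domain. -/
abbrev volOmega : Measure E3 := volume.restrict Omega

/-- The classical gradient `(∂₁ φ, ∂₂ φ, ∂₃ φ)` of a complex-valued function. -/
def grad (φ : E3 → ℂ) (x : E3) : EuclideanSpace ℂ (Fin 3) :=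
  WithLp.toLp 2 (fun j => fderiv ℝ φ x (EuclideanSpace.single j (1 : ℝ)))

/-- Radial functions in `C_c^∞(Ω)`. -/
structure IsRadialTest (φ : E3 → ℂ) : Prop where
  smooth : ContDiff ℝ ∞ φ
  compact : HasCompactSupport φ
  supp : tsupport φ ⊆ Omega
  radial : ∀ x y : E3, ‖x‖ = ‖y‖ → φ x = φ y

lemma IsRadialTest.zero : IsRadialTest (0 : E3 → ℂ) where
  smooth := contDiff_const
  compact := HasCompactSupport.zero
  supp := by simp [tsupport]
  radial := fun _ _ _ => rfl

lemma IsRadialTest.add {φ ψ : E3 → ℂ} (hφ : IsRadialTest φ) (hψ : IsRadialTest ψ) :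
    IsRadialTest (φ + ψ) where
  smooth := hφ.smooth.add hψ.smooth
  compact := hφ.compact.add hψ.compact
  supp := (tsupport_add φ ψ).trans (Set.union_subset hφ.supp hψ.supp)
  radial := fun x y h => by simp [hφ.radial x y h, hψ.radial x y h]

lemma IsRadialTest.smul (c : ℂ) {φ : E3 → ℂ} (hφ : IsRadialTest φ) :
    IsRadialTest (c • φ) where
  smooth := contDiff_const.smul hφ.smooth
  compact := hφ.compact.smul_left (f := fun _ => c)
  supp := (tsupport_smul_subset_right (fun _ => c) φ).trans hφ.supp
  radial := fun x y h => by simp [hφ.radial x y h]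

lemma IsRadialTest.differentiable {φ : E3 → ℂ} (hφ : IsRadialTest φ) : Differentiable ℝ φ :=
  hφ.smooth.differentiable (by simp)

lemma grad_zero : grad (0 : E3 → ℂ) = 0 := by
  funext x
  ext j
  simp [grad]

lemma grad_add {φ ψ : E3 → ℂ} (hφ : Differentiable ℝ φ) (hψ : Differentiable ℝ ψ) :
    grad (φ + ψ) = grad φ + grad ψ := by
  funext x
  ext j
  simp [grad, fderiv_add (hφ x) (hψ x)]

lemma grad_smul (c : ℂ) {φ : E3 → ℂ} (hφ : Differentiable ℝ φ) :
    grad (c • φ) = c • grad φ := by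
  funext x
  ext j
  simp [grad, fderiv_const_smul (hφ x) c]

instance factOneLeSix : Fact ((1 : ℝ≥0∞) ≤ 6) := ⟨by norm_num⟩

/-- The pairs `(φ, ∇φ)`, `φ` a radial test function, in `L⁶(Ω) × L²(Ω)`. -/
def testPairs :
    Submodule ℂ (Lp ℂ 6 volOmega × Lp (EuclideanSpace ℂ (Fin 3)) 2 volOmega) where
  carrier := {p | ∃ φ : E3 → ℂ, IsRadialTest φ ∧ p.1 =ᵐ[volOmega] φ ∧ p.2 =ᵐ[volOmega] grad φ}
  zero_mem' := ⟨0, IsRadialTest.zero, Lp.coeFn_zero _ _ _, by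
    rw [grad_zero]; exact Lp.coeFn_zero _ _ _⟩
  add_mem' := by
    rintro p p' ⟨φ, hφ, h1, h2⟩ ⟨ψ, hψ, k1, k2⟩
    refine ⟨φ + ψ, hφ.add hψ, (Lp.coeFn_add _ _).trans (h1.add k1), ?_⟩
    rw [grad_add hφ.differentiable hψ.differentiable]
    exact (Lp.coeFn_add _ _).trans (h2.add k2)
  smul_mem' := by
    rintro c p ⟨φ, hφ, h1, h2⟩
    refine ⟨c • φ, hφ.smul c, (Lp.coeFn_smul _ _).trans (h1.const_smul c), ?_⟩
    rw [grad_smul c hφ.differentiable]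
    exact (Lp.coeFn_smul _ _).trans (h2.const_smul c)

/-- The operator norm of the derivative is at most a constant times the length of the gradient. -/
lemma norm_fderiv_le (φ : E3 → ℂ) (x : E3) : ‖fderiv ℝ φ x‖ ≤ 3 * ‖grad φ x‖ := by
  refine ContinuousLinearMap.opNorm_le_bound _ (by positivity) fun v => ?_
  have hv : v = ∑ j, v j • EuclideanSpace.single j (1 : ℝ) := by
    ext i
    simp [Finset.sum_apply, Pi.single_apply]
  have key : ∀ j : Fin 3, ‖fderiv ℝ φ x (v j • EuclideanSpace.single j (1 : ℝ))‖
      ≤ ‖grad φ x‖ * ‖v‖ := by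
    intro j
    rw [map_smul, norm_smul, mul_comm]
    exact mul_le_mul (PiLp.norm_apply_le (grad φ x) j) (PiLp.norm_apply_le v j)
      (norm_nonneg _) (norm_nonneg _)
  calc ‖fderiv ℝ φ x v‖
      = ‖∑ j, fderiv ℝ φ x (v j • EuclideanSpace.single j (1 : ℝ))‖ := by
        conv_lhs => rw [hv, map_sum]
    _ ≤ ∑ _j : Fin 3, ‖grad φ x‖ * ‖v‖ := norm_sum_le_of_le _ fun j _ => key j
    _ = 3 * ‖grad φ x‖ * ‖v‖ := by simp; ring

lemma fderiv_eq_zero_of_notMem {φ : E3 → ℂ} (hφ : IsRadialTest φ) {x : E3} (hx : x ∉ Omega) :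
    fderiv ℝ φ x = 0 := by
  have : x ∉ tsupport (fderiv ℝ φ) := fun h => hx (hφ.supp (tsupport_fderiv_subset ℝ h))
  exact image_eq_zero_of_notMem_tsupport this

lemma measurableSet_Omega : MeasurableSet Omega :=
  (isOpen_lt continuous_const continuous_norm).measurableSet

/-- The Sobolev inequality for radial test functions. -/
lemma exists_sobolev_test : ∃ C : NNReal, ∀ φ : E3 → ℂ, IsRadialTest φ →
    eLpNorm φ 6 volOmega ≤ C * eLpNorm (grad φ) 2 volOmega := by
  have hK : ∃ K : NNReal, ∀ φ : E3 → ℂ, IsRadialTest φ →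
      eLpNorm φ (6 : NNReal) volume ≤ K * eLpNorm (fderiv ℝ φ) (2 : NNReal) volume :=
    ⟨_, fun φ hφ => eLpNorm_le_eLpNorm_fderiv_of_eq_inner (volume : Measure E3)
      (hφ.smooth.of_le (by simp)) hφ.compact (p := 2) (p' := 6) (by norm_num)
      (by simp) (by simp; norm_num)⟩
  obtain ⟨K, hK⟩ := hK
  refine ⟨K * 3, fun φ hφ => ?_⟩
  have hs := hK φ hφ
  have e1 : eLpNorm φ (6 : NNReal) volOmega ≤ eLpNorm φ (6 : NNReal) volume :=
    eLpNorm_mono_measure _ Measure.restrict_le_self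
  have e2 : eLpNorm (fderiv ℝ φ) (2 : NNReal) volume
      = eLpNorm (fderiv ℝ φ) (2 : NNReal) volOmega := by
    have : fderiv ℝ φ = Omega.indicator (fderiv ℝ φ) := by
      funext x
      by_cases hx : x ∈ Omega
      · simp [hx]
      · simp [hx, fderiv_eq_zero_of_notMem hφ hx]
    have gen : ∀ (g : E3 → E3 →L[ℝ] ℂ) (p : ℝ≥0∞),
        eLpNorm (Omega.indicator g) p volume = eLpNorm g p volOmega := fun g p =>
      eLpNorm_indicator_eq_eLpNorm_restrict (f := g) (p := p) measurableSet_Omega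
    rw [← gen, ← this]
  have e3 : eLpNorm (fderiv ℝ φ) (2 : NNReal) volOmega
      ≤ ENNReal.ofReal 3 * eLpNorm (grad φ) (2 : NNReal) volOmega :=
    eLpNorm_le_mul_eLpNorm_of_ae_le_mul (Eventually.of_forall (norm_fderiv_le φ)) _
  have e4 : eLpNorm φ (6 : NNReal) volOmega
      ≤ K * (ENNReal.ofReal 3 * eLpNorm (grad φ) (2 : NNReal) volOmega) := by
    refine (e1.trans hs).trans ?_
    rw [e2]
    gcongr
  rw [← mul_assoc] at e4
  simpa using e4

/-- The Sobolev inequality for the pairs `(φ, ∇φ)` and their limits. -/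
lemma exists_sobolev : ∃ C : ℝ, 0 ≤ C ∧
    ∀ p ∈ testPairs.topologicalClosure, ‖p.1‖ ≤ C * ‖p.2‖ := by
  obtain ⟨C, hC⟩ := exists_sobolev_test
  refine ⟨C, C.2, ?_⟩
  have hcl : IsClosed {p : Lp ℂ 6 volOmega × Lp (EuclideanSpace ℂ (Fin 3)) 2 volOmega |
      ‖p.1‖ ≤ C * ‖p.2‖} := isClosed_le (by fun_prop) (by fun_prop)
  have hsub : (testPairs : Set _) ⊆
      {p : Lp ℂ 6 volOmega × Lp (EuclideanSpace ℂ (Fin 3)) 2 volOmega |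
      ‖p.1‖ ≤ C * ‖p.2‖} := by
    rintro p ⟨φ, hφ, h1, h2⟩
    have hfin : eLpNorm (grad φ) 2 volOmega ≠ ⊤ := by
      rw [← eLpNorm_congr_ae h2]; exact Lp.eLpNorm_ne_top _
    change ‖p.1‖ ≤ C * ‖p.2‖
    rw [Lp.norm_def, Lp.norm_def, eLpNorm_congr_ae h1, eLpNorm_congr_ae h2]
    have := ENNReal.toReal_mono (ENNReal.mul_ne_top ENNReal.coe_ne_top hfin) (hC φ hφ)
    simpa [ENNReal.toReal_mul] using this
  intro p hp
  exact closure_minimal hsub hcl hp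

/-- The space `Ḣ¹₀(Ω)` of spherically symmetric functions: the closure of the radial functions in
`C_c^∞(Ω)` in the norm `‖∇f‖_{L²(Ω)}`. By the Sobolev inequality the completion is realised by the
limits in `L⁶(Ω) × L²(Ω)` of the pairs `(φ, ∇φ)`. -/
def RadialHdot : Type := testPairs.topologicalClosure

namespace RadialHdot

instance : AddCommGroup RadialHdot :=
  inferInstanceAs (AddCommGroup testPairs.topologicalClosure)

instance : Module ℂ RadialHdot :=
  inferInstanceAs (Module ℂ testPairs.topologicalClosure)

/-- The underlying function on `Ω` (a class in `L⁶(Ω)`). -/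
def fn (f : RadialHdot) : Lp ℂ 6 volOmega := f.1.1

/-- The gradient of an element of `Ḣ¹₀(Ω)`, as a linear map into `L²(Ω)`. -/
def gradient : RadialHdot →ₗ[ℂ] Lp (EuclideanSpace ℂ (Fin 3)) 2 volOmega :=
  (LinearMap.snd ℂ _ _).comp testPairs.topologicalClosure.subtype

lemma gradient_injective : Function.Injective gradient := by
  obtain ⟨C, -, hC⟩ := exists_sobolev
  refine (injective_iff_map_eq_zero gradient).2 fun f hf => ?_
  have h2 : f.1.2 = 0 := hf
  have h1 : f.1.1 = 0 := by
    have := hC f.1 f.2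
    rw [h2, norm_zero, mul_zero] at this
    exact norm_le_zero_iff.1 this
  exact Subtype.ext (Prod.ext h1 h2)

/-- The norm of `Ḣ¹₀(Ω)` is `‖f‖ = ‖∇f‖_{L²(Ω)}`. -/
instance : NormedAddCommGroup RadialHdot :=
  NormedAddCommGroup.induced RadialHdot (Lp (EuclideanSpace ℂ (Fin 3)) 2 volOmega)
    gradient gradient_injective

instance : NormedSpace ℂ RadialHdot :=
  NormedSpace.induced ℂ RadialHdot (Lp (EuclideanSpace ℂ (Fin 3)) 2 volOmega) gradient

lemma norm_eq (f : RadialHdot) : ‖f‖ = ‖gradient f‖ := rfl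

/-- `Ḣ¹₀(Ω)` is complete, so that Bochner integrals with values in it are meaningful. -/
instance : CompleteSpace RadialHdot := by
  obtain ⟨C, hC0, hC⟩ := exists_sobolev
  have hclosed : IsComplete (testPairs.topologicalClosure : Set
      (Lp ℂ 6 volOmega × Lp (EuclideanSpace ℂ (Fin 3)) 2 volOmega)) :=
    testPairs.isClosed_topologicalClosure.isComplete
  have : CompleteSpace testPairs.topologicalClosure := hclosed.completeSpace_coe
  refine Metric.complete_of_cauchySeq_tendsto fun u hu => ?_
  let v : ℕ → testPairs.topologicalClosure := u
  have hle : ∀ w : testPairs.topologicalClosure, ‖w‖ ≤ (C + 1) * ‖w.1.2‖ := by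
    intro w
    have hw := hC w.1 w.2
    change max ‖w.1.1‖ ‖w.1.2‖ ≤ _
    refine max_le ?_ ?_ <;> nlinarith [norm_nonneg w.1.2, mul_nonneg hC0 (norm_nonneg w.1.2)]
  have hv : CauchySeq v := by
    rw [Metric.cauchySeq_iff] at hu ⊢
    intro ε hε
    obtain ⟨N, hN⟩ := hu (ε / (C + 1)) (by positivity)
    refine ⟨N, fun m hm n hn => ?_⟩
    have h := hN m hm n hn
    rw [dist_eq_norm] at h ⊢
    have h' : ‖(v m - v n).1.2‖ < ε / (C + 1) := h
    calc ‖v m - v n‖ ≤ (C + 1) * ‖(v m - v n).1.2‖ := hle _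
      _ < (C + 1) * (ε / (C + 1)) := by gcongr
      _ = ε := by field_simp
  obtain ⟨w, hw⟩ := cauchySeq_tendsto_of_complete hv
  rw [tendsto_iff_norm_sub_tendsto_zero] at hw
  let w' : RadialHdot := w
  refine ⟨w', ?_⟩
  refine (tendsto_iff_norm_sub_tendsto_zero (E := RadialHdot)).2 ?_
  refine squeeze_zero (fun _ => norm_nonneg _) (fun n => ?_) hw
  exact le_max_right ‖(v n - w).1.1‖ ‖(v n - w).1.2‖

end RadialHdot

/-- The radial generalised eigenfunctions `φ_λ(x) = sin (λ (|x| - 1)) / |x|` of the Dirichlet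
Laplacian on `Ω`. -/
def eigenfun (lam : ℝ) (x : E3) : ℝ := Real.sin (lam * (‖x‖ - 1)) / ‖x‖

/-- The distorted Fourier transform of a radial test function `φ`,
`(F₀ φ)(λ) = √(2/π) ∫_1^∞ (sin λ(s-1) / s) φ(s) s² ds`, with the radial integral written as an
integral over `Ω` divided by the area `4π` of the unit sphere. -/
def transformTest (φ : E3 → ℂ) (lam : ℝ) : ℂ :=
  ((Real.sqrt (2 / Real.pi) / (4 * Real.pi) : ℝ) : ℂ) *
    ∫ x, (eigenfun lam x : ℂ) * φ x ∂volOmega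

/-- `h` is the distorted Fourier transform `F₀ f` of `f ∈ Ḣ¹₀(Ω)`: the extension by continuity of
`transformTest` to a map from `Ḣ¹₀(Ω)` to `L²((0,∞), λ² dλ)`. -/
def IsTransform (f : RadialHdot) (h : ℝ → ℂ) : Prop :=
  AEStronglyMeasurable h (volume.restrict (Set.Ioi (0 : ℝ))) ∧
  ∃ φ : ℕ → E3 → ℂ, (∀ n, IsRadialTest (φ n)) ∧
    Tendsto (fun n => eLpNorm (fun x => grad (φ n) x - f.gradient x) 2 volOmega) atTop (𝓝 0) ∧
    Tendsto (fun n => eLpNorm (fun lam : ℝ => (lam : ℂ) * (transformTest (φ n) lam - h lam)) 2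
      (volume.restrict (Set.Ioi (0 : ℝ)))) atTop (𝓝 0)

/-- The distorted Fourier transform `F₀ f` of `f ∈ Ḣ¹₀(Ω)`; it is determined up to null sets. -/
def transform (f : RadialHdot) : ℝ → ℂ := Classical.epsilon (IsTransform f)

/-- The adjoint transform `(F₀* h)(x) = √(2/π) ∫_0^∞ (sin λ(|x|-1) / |x|) h(λ) dλ`; the integral
converges absolutely for `x ∈ Ω` when `λ h(λ)` is square integrable. -/
def adjointTransform (h : ℝ → ℂ) (x : E3) : ℂ :=
  (Real.sqrt (2 / Real.pi) : ℂ) * ∫ lam in Set.Ioi (0 : ℝ), (eigenfun lam x : ℂ) * h lam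

/-- The free propagator `e^{itΔ_D} f = F₀* (e^{-iλ²t} F₀ f)` on `Ḣ¹₀(Ω)`: the element of `Ḣ¹₀(Ω)`
given by this function. -/
def propagator (t : ℝ) (f : RadialHdot) : RadialHdot :=
  Classical.epsilon fun g : RadialHdot =>
    g.fn =ᵐ[volOmega] adjointTransform
      fun lam => Complex.exp (-(Complex.I * (lam : ℂ) ^ 2 * (t : ℂ))) * transform f lam

/-- The nonlinearity `F(f) = |f|⁴ f`: the element of `Ḣ¹₀(Ω)` given by this function. -/
def nonlinearity (f : RadialHdot) : RadialHdot :=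
  Classical.epsilon fun g : RadialHdot =>
    g.fn =ᵐ[volOmega] fun x => ((‖f.fn x‖ ^ 4 : ℝ) : ℂ) * f.fn x

/-- A global (strong, radial) solution of `i ∂_t u + Δ u = |u|⁴ u` in `ℝ × Ω` with Dirichlet
boundary condition: `u ∈ C(ℝ; Ḣ¹₀(Ω))` and the Duhamel formula holds between any two times. -/
def IsGlobalSolution (u : ℝ → RadialHdot) : Prop :=
  Continuous u ∧ ∀ t₀ t₁ : ℝ,
    u t₁ = propagator (t₁ - t₀) (u t₀)
      - Complex.I • ∫ t in t₀..t₁, propagator (t₁ - t) (nonlinearity (u t))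

/-- The energy `E(f) = ½ ∫_Ω |∇f|² dx + ⅙ ∫_Ω |f|⁶ dx`. -/
def energy (f : RadialHdot) : ℝ :=
  1 / 2 * ∫ x, ‖f.gradient x‖ ^ 2 ∂volOmega + 1 / 6 * ∫ x, ‖f.fn x‖ ^ 6 ∂volOmega

/-- Admissible pairs: `2 ≤ q ≤ ∞` and `2 / q + 3 / r = 3 / 2`. -/
def Admissible (q r : ℝ≥0∞) : Prop := 2 ≤ q ∧ 2 / q + 3 / r = 3 / 2

/-- The norm of `L^q_t L^r_x(J × Ω)`, as an extended nonnegative number. -/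
def mixedNorm {V : Type*} [NormedAddCommGroup V] (q r : ℝ≥0∞) (J : Set ℝ)
    (w : ℝ → E3 → V) : ℝ≥0∞ :=
  eLpNorm (fun t => eLpNorm (w t) r volOmega) q (volume.restrict J)

/-- Membership in `L^q_t L^r_x(J × Ω)` of a time-dependent function (or family of classes of
functions): it has a jointly measurable representative and finite norm. -/
def MemMixed {V : Type*} [NormedAddCommGroup V] (q r : ℝ≥0∞) (J : Set ℝ)
    (w : ℝ → E3 → V) : Prop :=
  (∃ G : ℝ × E3 → V, AEStronglyMeasurable G ((volume.restrict J).prod volOmega) ∧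
    ∀ᵐ t ∂volume.restrict J, (fun x => G (t, x)) =ᵐ[volOmega] w t) ∧
  mixedNorm q r J w < ⊤

end

end ExteriorNLS

/-! ### Test functions on the half-line and density of their derivatives -/

namespace ExteriorNLS

noncomputable section

/-! Write a radial function as u(r) = w(r - 1)/r with w(0) = 0, and put x = r - 1, p = w'. The
gradient of u has length |p - w/r|/r, and |p|² - |p - w/r|² is the derivative of |w|²/r. Hence p ↦ u
is, up to the factor √(4π), an isometry of L²(0,∞) onto the energy space (`lift`). The Dirichlet
Laplacian for w is the Neumann Laplacian for p, which the cosine transform diagonalises: λ F₀u is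
the cosine transform of p, and the propagator becomes the unitary group `flow t` = C e^{-iλ²t} C
(`propagator_lift`).

Existence needs no dispersive estimate. Cauchy–Schwarz gives |u| ≤ r^{-1/2}‖p‖ and Hardy's
inequality bounds u in L²(dx), so that p ↦ (r|u|⁴u)' is locally Lipschitz on L² (`norm_nl_sub_le`).
For v(t) = `flow (-t)` p(t) the Duhamel formula is an ordinary differential equation with a locally
Lipschitz field (`isGlobalSolution_iff`), to which Picard–Lindelöf applies. Energy is conserved
(`halfEnergy_flow_eq`): truncated to frequencies below n the solution is differentiable in time, the
terms with the Laplacian drop out or integrate by parts into bounded ones, and the remaining rate of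
change tends to 0 as n → ∞. Both terms of the energy are nonnegative, so it bounds the norm and
solutions are global.

Space-time integrability rests on three facts about the half-line flow. The L⁶ Strichartz estimate
(`exists_strichartz`) comes from cubing the oscillatory integral and applying Plancherel in suitable
coordinates. Kato smoothing says that a free wave minus its boundary value is square integrable for
dt dx/x²; dually, a source m of mean zero contributes at most a multiple of ∬ x²|m|² to the squared
norm (`enorm_integral_flow_le`). The source (r|u|⁴u)' has mean zero because r|u|⁴u vanishes at the
boundary and at infinity. A bisection of the time interval combines the two into a retarded estimate
from the weighted space to L⁶ (`exists_retarded_strichartz`). Locally in time this bounds ∇u in L⁶,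
and interpolation with the bounded L² norm gives the admissible pairs.

For scattering, x²|(r|u|⁴u)'|² is bounded by terms of type x²|u|⁸|p|² and x²|u|¹⁰. The second is the
L¹⁰ density; Young's inequality splits the first into a small multiple of |p|⁶ and the L¹⁰ density
again. When the L¹⁰ norm is finite its tail is small, and a bootstrap shows that the weighted norm
of the source is finite on some half-line of time (`exists_lintegral_wNorm_ne_top`). Dual smoothing
then makes v Cauchy. Its limit is the asymptotic state, and it is unique because the flow is
isometric. Time reversal treats t → -∞. -/

/-- Lebesgue measure on the half-line `(0, ∞)`. -/
abbrev halfLine : Measure ℝ := volume.restrict (Set.Ioi (0 : ℝ))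

/-- Square integrable functions on the half-line. -/
abbrev HL2 : Type := Lp ℂ 2 halfLine

/-- Functions in `C_c^∞((0, ∞))`. -/
structure IsHalfTest (w : ℝ → ℂ) : Prop where
  smooth : ContDiff ℝ ∞ w
  compact : HasCompactSupport w
  supp : tsupport w ⊆ Set.Ioi (0 : ℝ)

namespace IsHalfTest

lemma zero : IsHalfTest (0 : ℝ → ℂ) where
  smooth := contDiff_const
  compact := HasCompactSupport.zero
  supp := by simp [tsupport]

lemma add {φ ψ : ℝ → ℂ} (hφ : IsHalfTest φ) (hψ : IsHalfTest ψ) : IsHalfTest (φ + ψ) where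
  smooth := hφ.smooth.add hψ.smooth
  compact := hφ.compact.add hψ.compact
  supp := (tsupport_add φ ψ).trans (Set.union_subset hφ.supp hψ.supp)

lemma smul (c : ℂ) {φ : ℝ → ℂ} (hφ : IsHalfTest φ) : IsHalfTest (c • φ) where
  smooth := contDiff_const.smul hφ.smooth
  compact := hφ.compact.smul_left (f := fun _ => c)
  supp := (tsupport_smul_subset_right (fun _ => c) φ).trans hφ.supp

variable {w : ℝ → ℂ}

lemma differentiable (hw : IsHalfTest w) : Differentiable ℝ w :=
  hw.smooth.differentiable (by simp)

lemma deriv (hw : IsHalfTest w) : IsHalfTest (deriv w) where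
  smooth := by
    have := hw.smooth
    rw [contDiff_infty_iff_deriv] at this
    exact this.2
  compact := hw.compact.deriv
  supp := (tsupport_deriv_subset).trans hw.supp

lemma eq_zero (hw : IsHalfTest w) {x : ℝ} (hx : x ≤ 0) : w x = 0 :=
  image_eq_zero_of_notMem_tsupport fun h => absurd (hw.supp h) (by simpa using hx)

lemma memLp (hw : IsHalfTest w) (p : ℝ≥0∞) : MemLp w p halfLine :=
  (hw.smooth.continuous.memLp_of_hasCompactSupport hw.compact).restrict _

lemma exists_bound (hw : IsHalfTest w) : ∃ a b : ℝ, 0 < a ∧ a ≤ b ∧ ∀ x, x ∉ Set.Icc a b → w x = 0 := by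
  by_cases hne : (tsupport w).Nonempty
  · have hc : IsCompact (tsupport w) := hw.compact
    obtain ⟨a, ha, ha'⟩ := hc.exists_isLeast hne
    obtain ⟨b, hb, hb'⟩ := hc.exists_isGreatest hne
    exact ⟨a, b, hw.supp ha, ha' hb, fun x hx =>
      image_eq_zero_of_notMem_tsupport fun h => hx ⟨ha' h, hb' h⟩⟩
  · refine ⟨1, 1, one_pos, le_rfl, fun x _ => image_eq_zero_of_notMem_tsupport fun h => hne ⟨x, h⟩⟩

lemma of_bound (hs : ContDiff ℝ ∞ w) {a b : ℝ} (ha : 0 < a) (h : ∀ x, x ∉ Set.Icc a b → w x = 0) :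
    IsHalfTest w := by
  have hsub : tsupport w ⊆ Set.Icc a b := by
    refine closure_minimal (fun x hx => ?_) isClosed_Icc
    by_contra hx'
    exact hx (h x hx')
  exact ⟨hs, isCompact_Icc.of_isClosed_subset (isClosed_tsupport w) hsub,
    fun x hx => ha.trans_le (hsub hx).1⟩

/-- A test function on the half-line with vanishing integral has a test function as primitive. -/
lemma exists_primitive (hw : IsHalfTest w) (h0 : ∫ x, w x = 0) :
    ∃ v : ℝ → ℂ, IsHalfTest v ∧ _root_.deriv v = w := by
  obtain ⟨a, b, ha, hab, hz⟩ := hw.exists_bound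
  have hcont := hw.smooth.continuous
  have hd : ∀ x, HasDerivAt (fun x => ∫ y in a..x, w y) (w x) x := fun x =>
    intervalIntegral.integral_hasDerivAt_right (hcont.intervalIntegrable _ _)
      (hcont.stronglyMeasurableAtFilter _ _) hcont.continuousAt
  have hdv : _root_.deriv (fun x => ∫ y in a..x, w y) = w := funext fun x => (hd x).deriv
  refine ⟨fun x => ∫ y in a..x, w y, of_bound (a := a) (b := b) ?_ ha fun x hx => ?_, hdv⟩
  · rw [contDiff_infty_iff_deriv, hdv]
    exact ⟨fun x => (hd x).differentiableAt, hw.smooth⟩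
  · rw [Set.mem_Icc, not_and_or, not_le, not_le] at hx
    have hwi : Integrable w := hcont.integrable_of_hasCompactSupport hw.compact
    rcases hx with hx | hx
    · rw [intervalIntegral.integral_symm, neg_eq_zero,
        intervalIntegral.integral_of_le hx.le]
      rw [integral_Ioc_eq_integral_Ioo]
      exact setIntegral_eq_zero_of_forall_eq_zero fun y hy =>
        hz y (by simp [hy.2])
    -- To the right of the support the primitive equals the full integral, which is zero.
    · rw [intervalIntegral.integral_of_le (hab.trans hx.le), ← h0,
        ← integral_Icc_eq_integral_Ioc]
      refine setIntegral_eq_integral_of_forall_compl_eq_zero fun y hy => hz y ?_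
      intro hy'
      exact hy ⟨hy'.1, hy'.2.trans hx.le⟩

end IsHalfTest

/-- Classes of derivatives of test functions on the half-line. -/
def derivTests : Submodule ℂ HL2 where
  carrier := {p | ∃ w : ℝ → ℂ, IsHalfTest w ∧ p =ᵐ[halfLine] deriv w}
  zero_mem' := ⟨0, IsHalfTest.zero, by
    have : deriv (0 : ℝ → ℂ) = 0 := by funext x; exact deriv_const x (0 : ℂ)
    rw [this]; exact Lp.coeFn_zero _ _ _⟩
  add_mem' := by
    rintro p p' ⟨φ, hφ, h1⟩ ⟨ψ, hψ, k1⟩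
    refine ⟨φ + ψ, hφ.add hψ, (Lp.coeFn_add _ _).trans ?_⟩
    have : deriv (φ + ψ) = deriv φ + deriv ψ := by
      funext x; exact deriv_add (hφ.differentiable x) (hψ.differentiable x)
    rw [this]; exact h1.add k1
  smul_mem' := by
    rintro c p ⟨φ, hφ, h1⟩
    refine ⟨c • φ, hφ.smul c, (Lp.coeFn_smul _ _).trans ?_⟩
    have : deriv (c • φ) = c • deriv φ := by
      funext x; exact deriv_const_smul c (hφ.differentiable x)
    rw [this]; exact h1.const_smul c

/-- A normalised bump centred at 2 with radius 1 stays away from 0. It serves to correct the mean of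
a test function so that the result has a compactly supported primitive. -/
lemma exists_halfTest_integral_eq_one : ∃ θ : ℝ → ℂ, IsHalfTest θ ∧ ∫ x, θ x = 1 := by
  let b : ContDiffBump (2 : ℝ) := ⟨1 / 2, 1, by norm_num, by norm_num⟩
  refine ⟨fun x => ((b.normed volume x : ℝ) : ℂ), ?_, ?_⟩
  · refine IsHalfTest.of_bound (a := 1) (b := 3) ?_ one_pos fun x hx => ?_
    · exact Complex.ofRealCLM.contDiff.comp b.contDiff_normed
    · have : x ∉ Function.support (b.normed volume) := by
        rw [b.support_normed_eq, Real.ball_eq_Ioo]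
        intro h
        have h1 : (2 : ℝ) - 1 < x := h.1
        have h2 : x < 2 + 1 := h.2
        exact hx ⟨by linarith, by linarith⟩
      simpa using this
  · rw [integral_complex_ofReal, b.integral_normed]; simp

/-- The lemma of du Bois-Reymond: a function orthogonal to all derivatives of test functions is
constant, and the only constant in L²(0,∞) is 0. -/
lemma derivTests_dense : derivTests.topologicalClosure = ⊤ := by
  rw [Submodule.topologicalClosure_eq_top_iff, Submodule.eq_bot_iff]
  intro f hf
  obtain ⟨θ, hθ, hθ1⟩ := exists_halfTest_integral_eq_one
  have hint : ∀ g : ℝ → ℂ, IsHalfTest g → Integrable (fun x => g x * f x) halfLine := fun g hg =>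
    MemLp.integrable_mul (hg.memLp 2) (Lp.memLp f)
  have hgi : ∀ g : ℝ → ℂ, IsHalfTest g → ∫ x, g x ∂halfLine = ∫ x, g x := fun g hg =>
    setIntegral_eq_integral_of_forall_compl_eq_zero fun x hx => hg.eq_zero (by simpa using hx)
  have key : ∀ w : ℝ → ℂ, IsHalfTest w → ∫ x, deriv w x * f x ∂halfLine = 0 := by
    intro w hw
    -- The inner product conjugates its first slot, so the bilinear pairing with w' is the inner
    -- product with the derivative of the conjugate of w.
    have hw' : IsHalfTest (fun x => (starRingEnd ℂ) (w x)) := by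
      refine ⟨Complex.conjCLE.contDiff.comp hw.smooth, ?_, ?_⟩
      · exact hw.compact.comp_left (g := starRingEnd ℂ) (by simp)
      · exact (tsupport_comp_subset (g := starRingEnd ℂ) (by simp) w).trans hw.supp
    have hd : deriv (fun x => (starRingEnd ℂ) (w x)) = fun x => (starRingEnd ℂ) (deriv w x) := by
      funext x
      exact ((hw.differentiable x).hasDerivAt.star).deriv
    have hm := hw'.deriv.memLp 2
    have h0 := hf (hm.toLp _) ⟨_, hw', hm.coeFn_toLp⟩
    rw [L2.inner_def] at h0
    rw [← h0]
    refine integral_congr_ae ?_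
    filter_upwards [hm.coeFn_toLp] with x hx
    rw [hx, hd]
    simp [mul_comm]
  have hmain : ∀ g : ℝ → ℂ, IsHalfTest g →
      ∫ x, g x * f x ∂halfLine = (∫ x, g x) * ∫ x, θ x * f x ∂halfLine := by
    intro g hg
    -- Subtracting the mean times θ leaves a function of mean zero, that is, the derivative of a
    -- test function, to which `key` applies.
    have ht : IsHalfTest (g + (-(∫ x, g x)) • θ) := hg.add (hθ.smul _)
    have hz : ∫ x, (g + (-(∫ x, g x)) • θ) x = 0 := by
      have i1 : Integrable g := hg.smooth.continuous.integrable_of_hasCompactSupport hg.compact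
      have i2 : Integrable θ := hθ.smooth.continuous.integrable_of_hasCompactSupport hθ.compact
      simp only [Pi.add_apply, Pi.smul_apply, smul_eq_mul]
      rw [integral_add i1 (i2.const_mul _), integral_const_mul, hθ1]; ring
    obtain ⟨v, hv, hdv⟩ := ht.exists_primitive hz
    have h1 := key v hv
    rw [hdv] at h1
    have : (fun x => (g + (-(∫ x, g x)) • θ) x * f x)
        = fun x => g x * f x + (-(∫ x, g x)) * (θ x * f x) := by
      funext x; simp; ring
    rw [this, integral_add (hint g hg) ((hint θ hθ).const_mul _), integral_const_mul] at h1
    linear_combination h1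
  set c := ∫ x, θ x * f x ∂halfLine with hc
  have hloc : LocallyIntegrableOn (fun x => f x - c) (Set.Ioi (0 : ℝ)) := by
    refine LocallyIntegrableOn.sub ?_ ((locallyIntegrable_const c).locallyIntegrableOn _)
    exact locallyIntegrableOn_of_locallyIntegrable_restrict
      ((Lp.memLp f).locallyIntegrable (by norm_num))
  have hzero := isOpen_Ioi.ae_eq_zero_of_integral_contDiff_smul_eq_zero hloc (by
    intro g hg hgc hgs
    have hG : IsHalfTest (fun x => (g x : ℂ)) := by
      refine ⟨Complex.ofRealCLM.contDiff.comp hg, ?_, ?_⟩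
      · exact hgc.comp_left (g := ((↑) : ℝ → ℂ)) (by simp)
      · exact (tsupport_comp_subset (g := ((↑) : ℝ → ℂ)) (by simp) g).trans hgs
    have e : ∫ x, g x • (f x - c) = ∫ x, g x • (f x - c) ∂halfLine := by
      refine (setIntegral_eq_integral_of_forall_compl_eq_zero fun x hx => ?_).symm
      have : g x = 0 := image_eq_zero_of_notMem_tsupport fun h => hx (hgs h)
      simp [this]
    have i1 := hint _ hG
    have i2 : Integrable (fun x => (g x : ℂ)) halfLine :=
      memLp_one_iff_integrable.1 (hG.memLp 1)
    have : (fun x => g x • (f x - c)) = fun x => (g x : ℂ) * f x - (g x : ℂ) * c := by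
      funext x; rw [Complex.real_smul]; ring
    rw [e, this, integral_sub i1 (i2.mul_const c), integral_mul_const, hmain _ hG, hgi _ hG, sub_self])
  have hfc : f =ᵐ[halfLine] fun _ => c := by
    rw [Filter.EventuallyEq, ae_restrict_iff' measurableSet_Ioi]
    filter_upwards [hzero] with x hx hx'
    exact sub_eq_zero.1 (hx hx')
  have hcm : MemLp (fun _ : ℝ => c) 2 halfLine := (memLp_congr_ae hfc).1 (Lp.memLp f)
  have hc0 : c = 0 := by
    rw [memLp_const_iff (by norm_num) (by norm_num)] at hcm
    simpa using hcm
  rw [Lp.eq_zero_iff_ae_eq_zero]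
  filter_upwards [hfc] with x hx
  simp [hx, hc0]

/-- A closed property that holds for derivatives of test functions holds on `L²(0, ∞)`. -/
lemma HL2.induction_deriv {P : HL2 → Prop} (hcl : IsClosed {p | P p})
    (h : ∀ w : ℝ → ℂ, IsHalfTest w → ∀ p : HL2, p =ᵐ[halfLine] deriv w → P p) (p : HL2) : P p := by
  have hp : p ∈ derivTests.topologicalClosure := by rw [derivTests_dense]; trivial
  exact closure_minimal (s := (derivTests : Set HL2)) (fun q ⟨w, hw, hq⟩ => h w hw q hq) hcl hp

end

end ExteriorNLS

/-! ### Primitives, radial profiles and Hardy's inequality -/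

namespace ExteriorNLS

noncomputable section

/-- The primitive `x ↦ ∫_0^x p` of a function on the half-line. -/
def prim (p : ℝ → ℂ) (x : ℝ) : ℂ := ∫ y in Set.Ioc 0 x, p y

lemma Ioc_restrict_halfLine {a b : ℝ} (ha : 0 ≤ a) :
    halfLine.restrict (Set.Ioc a b) = volume.restrict (Set.Ioc a b) := by
  rw [halfLine, Measure.restrict_restrict measurableSet_Ioc]
  congr 1
  exact Set.inter_eq_left.2 fun x hx => lt_of_le_of_lt ha hx.1

lemma ae_Ioc_of_ae_halfLine {P : ℝ → Prop} (h : ∀ᵐ x ∂halfLine, P x) {a b : ℝ} (ha : 0 ≤ a) :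
    ∀ᵐ x ∂(volume.restrict (Set.Ioc a b)), P x := by
  rw [← Ioc_restrict_halfLine ha]
  exact ae_restrict_of_ae h

lemma prim_congr {p q : ℝ → ℂ} (h : p =ᵐ[halfLine] q) (x : ℝ) : prim p x = prim q x :=
  integral_congr_ae (ae_Ioc_of_ae_halfLine h le_rfl)

lemma HL2.integrableOn (p : HL2) {a b : ℝ} (ha : 0 ≤ a) : IntegrableOn p (Set.Ioc a b) := by
  have h := ((Lp.memLp p).restrict (Set.Ioc a b))
  rw [Ioc_restrict_halfLine ha] at h
  exact h.integrable (by norm_num)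

/-- Cauchy–Schwarz against the indicator of the interval. For b < a both sides are zero, since the
square root of a negative number is 0. -/
lemma norm_setIntegral_le (p : HL2) {a b : ℝ} (ha : 0 ≤ a) :
    ‖∫ y in Set.Ioc a b, p y‖ ≤ √(b - a) * ‖p‖ := by
  have hfin : halfLine (Set.Ioc a b) ≠ ⊤ :=
    (lt_of_le_of_lt (Measure.restrict_apply_le _ _) (by simp)).ne
  have h := L2.inner_indicatorConstLp_one (𝕜 := ℂ) (μ := halfLine) measurableSet_Ioc hfin p
  rw [Ioc_restrict_halfLine ha] at h
  rw [← h]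
  refine (norm_inner_le_norm _ _).trans ?_
  gcongr
  rw [norm_indicatorConstLp (by norm_num) (by norm_num)]
  have : halfLine.real (Set.Ioc a b) = max (b - a) 0 := by
    rw [measureReal_def, Measure.restrict_apply measurableSet_Ioc,
      (Set.inter_eq_left.2 (fun x hx => lt_of_le_of_lt ha hx.1) :
        Set.Ioc a b ∩ Set.Ioi 0 = Set.Ioc a b), Real.volume_Ioc, ENNReal.toReal_ofReal']
  rw [this, norm_one, one_mul]
  rcases le_total (b - a) 0 with h0 | h0
  · rw [max_eq_right h0, Real.zero_rpow (by norm_num)]; exact Real.sqrt_nonneg _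
  · rw [max_eq_left h0, Real.sqrt_eq_rpow]; norm_num

lemma norm_prim_le (p : HL2) (x : ℝ) : ‖prim p x‖ ≤ √x * ‖p‖ := by
  simpa [prim] using norm_setIntegral_le p (b := x) le_rfl

lemma prim_add (p q : HL2) (x : ℝ) : prim (p + q : HL2) x = prim p x + prim q x := by
  rw [prim_congr (Lp.coeFn_add p q)]
  exact integral_add (p.integrableOn le_rfl) (q.integrableOn le_rfl)

lemma prim_smul (c : ℂ) (p : HL2) (x : ℝ) : prim (c • p : HL2) x = c * prim p x := by
  rw [prim_congr (Lp.coeFn_smul c p)]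
  exact integral_const_mul _ _

lemma prim_sub (p q : HL2) (x : ℝ) : prim (p - q : HL2) x = prim p x - prim q x := by
  rw [prim_congr (Lp.coeFn_sub p q)]
  exact integral_sub (p.integrableOn le_rfl) (q.integrableOn le_rfl)

lemma prim_sub_prim (p : HL2) {a b : ℝ} (ha : 0 ≤ a) (hab : a ≤ b) :
    prim p b - prim p a = ∫ y in Set.Ioc a b, p y := by
  have : Set.Ioc 0 b = Set.Ioc 0 a ∪ Set.Ioc a b := (Set.Ioc_union_Ioc_eq_Ioc ha hab).symm
  rw [prim, this, setIntegral_union (Set.Ioc_disjoint_Ioc_of_le le_rfl) measurableSet_Ioc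
    (p.integrableOn le_rfl) (p.integrableOn ha), prim]
  ring

lemma continuous_prim (p : HL2) : Continuous (prim p) := by
  have h : ∀ a b : ℝ, a ≤ b → dist (prim p b) (prim p a) ≤ √(b - a) * ‖p‖ := by
    intro a b hab
    rw [dist_eq_norm]
    rcases le_total 0 a with ha | ha
    · rw [prim_sub_prim p ha hab]; exact norm_setIntegral_le p ha
    · have : prim p a = 0 := by simp [prim, Set.Ioc_eq_empty (not_lt.2 ha)]
      rw [this, sub_zero]
      refine (norm_prim_le p b).trans ?_
      gcongr; linarith
  rw [continuous_iff_continuousAt]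
  intro a
  refine tendsto_iff_dist_tendsto_zero.2 ?_
  have hlim : Tendsto (fun b => √|b - a| * ‖p‖) (𝓝 a) (𝓝 0) := by
    have : Continuous fun b : ℝ => √|b - a| * ‖p‖ := by fun_prop
    simpa using this.tendsto a
  refine squeeze_zero (fun _ => dist_nonneg) (fun b => ?_) hlim
  rcases le_total a b with hab | hab
  · rw [abs_of_nonneg (sub_nonneg.2 hab)]; exact h a b hab
  · rw [abs_sub_comm, abs_of_nonneg (sub_nonneg.2 hab), dist_comm]; exact h b a hab

lemma continuous_prim_apply (x : ℝ) : Continuous fun p : HL2 => prim p x := by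
  refine (LipschitzWith.of_dist_le_mul (K := ⟨√x, Real.sqrt_nonneg _⟩) fun p q => ?_).continuous
  rw [dist_eq_norm, dist_eq_norm, ← prim_sub]
  exact norm_prim_le _ _

lemma prim_deriv {w : ℝ → ℂ} (hw : IsHalfTest w) {x : ℝ} (hx : 0 ≤ x) : prim (deriv w) x = w x := by
  have h := intervalIntegral.integral_deriv_eq_sub' (a := 0) (b := x) (f' := deriv w) w rfl
    (fun y _ => hw.differentiable y) hw.deriv.smooth.continuous.continuousOn
  rw [intervalIntegral.integral_of_le hx, hw.eq_zero le_rfl, sub_zero] at h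
  exact h

/-- The radial profile `u(r) = w(r) / r` at `r = 1 + x`, where `w` has derivative `p`. -/
def profile (p : ℝ → ℂ) (x : ℝ) : ℂ := prim p x / ((1 + x : ℝ) : ℂ)

lemma profile_congr {p q : ℝ → ℂ} (h : p =ᵐ[halfLine] q) : profile p = profile q := by
  funext x; rw [profile, prim_congr h, profile]

/-- The radial Sobolev bound |u| ≤ r^{-1/2}‖p‖, by Cauchy–Schwarz on the primitive. This decay is
what makes the quintic nonlinearity harmless on the energy space. -/
lemma norm_profile_le (p : HL2) {x : ℝ} (hx : 0 ≤ x) : ‖profile p x‖ ≤ (√(1 + x))⁻¹ * ‖p‖ := by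
  rw [profile, norm_div, Complex.norm_real, Real.norm_of_nonneg (by linarith), div_le_iff₀ (by linarith)]
  refine (norm_prim_le p x).trans ?_
  have h1 : √x ≤ √(1 + x) := Real.sqrt_le_sqrt (by linarith)
  have h2 : (√(1 + x))⁻¹ * (1 + x) = √(1 + x) := by
    have : 0 < √(1 + x) := Real.sqrt_pos.2 (by linarith)
    field_simp
    rw [Real.sq_sqrt (by linarith)]
  calc √x * ‖p‖ ≤ √(1 + x) * ‖p‖ := by gcongr
    _ = _ := by rw [mul_right_comm, h2]

lemma norm_profile_le' (p : HL2) {x : ℝ} (hx : 0 ≤ x) : ‖profile p x‖ ≤ ‖p‖ := by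
  refine (norm_profile_le p hx).trans (mul_le_of_le_one_left (norm_nonneg _) ?_)
  refine inv_le_one_of_one_le₀ ?_
  rw [Real.one_le_sqrt]; linarith

lemma profile_sub (p q : HL2) (x : ℝ) : profile (p - q : HL2) x = profile p x - profile q x := by
  simp only [profile, prim_sub, sub_div]

lemma continuous_profile_apply (x : ℝ) : Continuous fun p : HL2 => profile p x :=
  (continuous_prim_apply x).div_const _

lemma measurable_profile (p : HL2) : Measurable (profile p) := by
  unfold profile
  exact (continuous_prim p).measurable.div (by fun_prop)

lemma exists_seq_ae_tendsto {p : ℕ → HL2} {q : HL2} (h : Tendsto p atTop (𝓝 q)) :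
    ∃ ns : ℕ → ℕ, StrictMono ns ∧
      ∀ᵐ x ∂halfLine, Tendsto (fun n => p (ns n) x) atTop (𝓝 (q x)) := by
  exact (tendstoInMeasure_of_tendsto_Lp h).exists_seq_tendsto_ae

/-- The two integrands differ by the derivative of |w|²/(1+x), which vanishes at both ends. The
identity yields both Hardy's inequality and the isometry between L²(0,∞) and the energy space. -/
lemma integral_hardy_test {w : ℝ → ℂ} (hw : IsHalfTest w) :
    ∫ x, ‖deriv w x - w x / ((1 + x : ℝ) : ℂ)‖ ^ 2 ∂halfLine = ∫ x, ‖deriv w x‖ ^ 2 ∂halfLine := by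
  have hd : ∀ x ∈ Set.Ici (0 : ℝ), HasDerivAt (fun x => ‖w x‖ ^ 2 / (1 + x))
      (‖deriv w x‖ ^ 2 - ‖deriv w x - w x / ((1 + x : ℝ) : ℂ)‖ ^ 2) x := by
    intro x hx
    have hx' : (1 : ℝ) + x ≠ 0 := by have : (0:ℝ) ≤ x := hx; positivity
    have h1 := ((hw.differentiable x).hasDerivAt.norm_sq).div
      (((hasDerivAt_id x).const_add 1)) hx'
    refine HasDerivAt.congr_deriv h1 ?_
    have h2 : w x / ((1 + x : ℝ) : ℂ) = (1 + x)⁻¹ • w x := by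
      rw [Complex.real_smul, div_eq_mul_inv, mul_comm]; push_cast; rfl
    rw [h2, @norm_sub_sq_real, inner_smul_right, norm_smul, mul_pow, Real.norm_eq_abs, sq_abs,
      real_inner_comm]
    simp only [id]
    field_simp
    ring
  have hc1 : Continuous fun x => ‖deriv w x‖ ^ 2 := (hw.deriv.smooth.continuous.norm).pow 2
  have i1 : Integrable (fun x => ‖deriv w x‖ ^ 2) halfLine := (hw.deriv.memLp 2).integrable_norm_pow (by norm_num)
  have i2 : Integrable (fun x => ‖deriv w x - w x / ((1 + x : ℝ) : ℂ)‖ ^ 2) halfLine := by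
    refine MemLp.integrable_norm_pow (p := 2) (f := fun x => deriv w x - w x / ((1 + x : ℝ) : ℂ)) ?_ (by norm_num)
    refine (hw.deriv.memLp 2).sub ?_
    refine (hw.memLp 2).of_le ?_ ?_
    · exact (hw.smooth.continuous.measurable.div (by fun_prop)).aestronglyMeasurable
    · rw [ae_restrict_iff' measurableSet_Ioi]
      refine Eventually.of_forall fun x hx => ?_
      have : (0:ℝ) < x := hx
      rw [norm_div, Complex.norm_real, Real.norm_of_nonneg (by linarith)]
      exact div_le_self (norm_nonneg _) (by linarith)
  obtain ⟨a, b, ha, hab, hz⟩ := hw.exists_bound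
  have ht : Tendsto (fun x => ‖w x‖ ^ 2 / (1 + x)) atTop (𝓝 0) := by
    refine tendsto_const_nhds.congr' ?_
    filter_upwards [eventually_gt_atTop b] with x hx
    rw [hz x (by simp [hx])]; simp
  have h := integral_Ioi_of_hasDerivAt_of_tendsto' hd (i1.sub i2) ht
  rw [integral_sub i1 i2, hw.eq_zero le_rfl] at h
  simp only [norm_zero, ne_eq, OfNat.ofNat_ne_zero, not_false_eq_true, zero_pow, zero_div,
    sub_zero] at h
  linarith

lemma norm_sq_eq_integral (p : HL2) : ‖p‖ ^ 2 = ∫ x, ‖p x‖ ^ 2 ∂halfLine := by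
  have h := @inner_self_eq_norm_sq ℂ HL2 _ _ _ p
  rw [L2.inner_def] at h
  have : ∀ x, inner ℂ (p x) (p x) = ((‖p x‖ ^ 2 : ℝ) : ℂ) := fun x => by
    rw [inner_self_eq_norm_sq_to_K]; push_cast; rfl
  simp_rw [this] at h
  rw [integral_complex_ofReal] at h
  exact h.symm

lemma memLp_toLp_norm_sq {f : ℝ → ℂ} (hf : MemLp f 2 halfLine) :
    ‖hf.toLp f‖ ^ 2 = ∫ x, ‖f x‖ ^ 2 ∂halfLine := by
  rw [norm_sq_eq_integral]
  refine integral_congr_ae ?_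
  filter_upwards [hf.coeFn_toLp] with x hx
  rw [hx]

lemma profile_test {w : ℝ → ℂ} (hw : IsHalfTest w) {p : HL2} (hp : p =ᵐ[halfLine] deriv w) {x : ℝ}
    (hx : 0 ≤ x) : profile p x = w x / ((1 + x : ℝ) : ℂ) := by
  rw [profile, prim_congr hp, prim_deriv hw hx]

lemma ae_halfLine_of_forall {P : ℝ → Prop} (h : ∀ x, 0 < x → P x) : ∀ᵐ x ∂halfLine, P x := by
  rw [ae_restrict_iff' measurableSet_Ioi]
  exact Eventually.of_forall h

/-- Hardy's inequality. -/
lemma eLpNorm_profile_le (p : HL2) : eLpNorm (profile p) 2 halfLine ≤ 2 * ‖p‖ₑ := by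
  refine HL2.induction_deriv (P := fun p : HL2 => eLpNorm (profile p) 2 halfLine ≤ 2 * ‖p‖ₑ) ?_ ?_ p
  -- The bound survives L² limits: profiles then converge at every point, and Fatou's lemma applies.
  · refine IsSeqClosed.isClosed fun q p hq hlim => ?_
    refine (Lp.eLpNorm_lim_le_liminf_eLpNorm (f := fun n => profile (q n)) (p := 2)
      (fun n => (measurable_profile _).aestronglyMeasurable) (profile p)
      (Eventually.of_forall fun x => (continuous_profile_apply x).continuousAt.tendsto.comp hlim)).trans ?_
    have h2 : Tendsto (fun n => 2 * ‖q n‖ₑ) atTop (𝓝 (2 * ‖p‖ₑ)) :=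
      ENNReal.Tendsto.const_mul (hlim.enorm) (Or.inr (by norm_num))
    rw [← h2.liminf_eq]
    exact liminf_le_liminf (Eventually.of_forall hq)
  · intro w hw p hp
    have m1 : MemLp (deriv w) 2 halfLine := hw.deriv.memLp 2
    have hpr : profile p =ᵐ[halfLine] fun x => w x / ((1 + x : ℝ) : ℂ) :=
      ae_halfLine_of_forall fun x hx => profile_test hw hp hx.le
    have m2 : MemLp (profile p) 2 halfLine := by
      rw [memLp_congr_ae hpr]
      refine (hw.memLp 2).of_le ?_ ?_
      · exact (hw.smooth.continuous.measurable.div (by fun_prop)).aestronglyMeasurable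
      · refine ae_halfLine_of_forall fun x hx => ?_
        rw [norm_div, Complex.norm_real, Real.norm_of_nonneg (by linarith)]
        exact div_le_self (norm_nonneg _) (by linarith)
    have e1 : m1.toLp _ = p := by
      refine Lp.ext (m1.coeFn_toLp.trans hp.symm)
    have e2 : ‖m1.toLp _ - m2.toLp _‖ ^ 2 = ‖p‖ ^ 2 := by
      have e0 : ‖p‖ ^ 2 = ∫ x, ‖deriv w x‖ ^ 2 ∂halfLine := by
        rw [← memLp_toLp_norm_sq m1, e1]
      rw [← MemLp.toLp_sub, memLp_toLp_norm_sq, e0, ← integral_hardy_test hw]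
      refine integral_congr_ae ?_
      filter_upwards [hpr] with x hx
      simp [hx]
    have e3 : ‖m1.toLp _ - m2.toLp _‖ = ‖p‖ := by
      rwa [sq_eq_sq₀ (norm_nonneg _) (norm_nonneg _)] at e2
    -- The profile is w' - (w' - profile), and both terms have norm ‖p‖; hence the constant 2.
    have e4 : ‖m2.toLp _‖ ≤ 2 * ‖p‖ := by
      calc ‖m2.toLp _‖ = ‖m1.toLp _ - (m1.toLp _ - m2.toLp _)‖ := by rw [sub_sub_cancel]
        _ ≤ ‖m1.toLp _‖ + ‖m1.toLp _ - m2.toLp _‖ := norm_sub_le _ _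
        _ = 2 * ‖p‖ := by rw [e3, e1]; ring
    rw [Lp.norm_toLp] at e4
    rw [← ENNReal.ofReal_toReal m2.eLpNorm_ne_top]
    refine (ENNReal.ofReal_le_ofReal e4).trans ?_
    rw [ENNReal.ofReal_mul (by norm_num), ofReal_norm]
    simp

lemma memLp_profile (p : HL2) : MemLp (profile p) 2 halfLine :=
  ⟨(measurable_profile p).aestronglyMeasurable,
    (eLpNorm_profile_le p).trans_lt (ENNReal.mul_lt_top (by norm_num) (by simp))⟩

/-- The Hardy operator `p ↦ profile p` on `L²(0, ∞)`. -/
def hardy : HL2 →L[ℂ] HL2 :=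
  LinearMap.mkContinuous
    { toFun := fun p => (memLp_profile p).toLp _
      map_add' := fun p q => by
        rw [← MemLp.toLp_add]
        refine MemLp.toLp_congr _ _ (Eventually.of_forall fun x => ?_)
        simp only [profile, prim_add, add_div, Pi.add_apply]
      map_smul' := fun c p => by
        rw [RingHom.id_apply, ← MemLp.toLp_const_smul]
        refine MemLp.toLp_congr _ _ (Eventually.of_forall fun x => ?_)
        simp only [profile, prim_smul, Pi.smul_apply, smul_eq_mul, mul_div_assoc] } 2 fun p => by
    change ‖(memLp_profile p).toLp _‖ ≤ _
    rw [Lp.norm_toLp]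
    refine ENNReal.toReal_le_of_le_ofReal (by positivity) ?_
    refine (eLpNorm_profile_le p).trans_eq ?_
    rw [ENNReal.ofReal_mul (by norm_num), ofReal_norm]
    simp

lemma coeFn_hardy (p : HL2) : hardy p =ᵐ[halfLine] profile p := (memLp_profile p).coeFn_toLp

lemma norm_hardy_le (p : HL2) : ‖hardy p‖ ≤ 2 * ‖p‖ :=
  hardy.le_of_opNorm_le (LinearMap.mkContinuous_norm_le _ (by norm_num) _) p

/-- By density from `integral_hardy_test`. The function p - `hardy p` is r times the radial
derivative of u, so this is the isometry on the half-line. -/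
lemma norm_sub_hardy (p : HL2) : ‖p - hardy p‖ = ‖p‖ := by
  refine HL2.induction_deriv (P := fun p : HL2 => ‖p - hardy p‖ = ‖p‖) ?_ ?_ p
  · exact isClosed_eq (by fun_prop) (by fun_prop)
  · intro w hw p hp
    rw [← sq_eq_sq₀ (norm_nonneg _) (norm_nonneg _), norm_sq_eq_integral, norm_sq_eq_integral]
    have h1 : ∫ x, ‖p x‖ ^ 2 ∂halfLine = ∫ x, ‖deriv w x‖ ^ 2 ∂halfLine := by
      refine integral_congr_ae ?_
      filter_upwards [hp] with x hx
      rw [hx]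
    rw [h1, ← integral_hardy_test hw]
    refine integral_congr_ae ?_
    filter_upwards [hp, Lp.coeFn_sub p (hardy p), coeFn_hardy p,
      ae_halfLine_of_forall fun x hx => profile_test hw hp (le_of_lt hx)] with x h2 h3 h4 h5
    rw [h3, Pi.sub_apply, h2, h4, h5]

end

end ExteriorNLS

/-! ### Identification of the radial energy space with L²(0,∞) -/

namespace ExteriorNLS

noncomputable section

lemma ennreal_pow_le_pow_iff {a b : ℝ≥0∞} {n : ℕ} (hn : n ≠ 0) : a ^ n ≤ b ^ n ↔ a ≤ b := by
  rw [← ENNReal.rpow_natCast, ← ENNReal.rpow_natCast]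
  exact ENNReal.rpow_le_rpow_iff (by positivity)

lemma ennreal_pow_left_injective {n : ℕ} (hn : n ≠ 0) {a b : ℝ≥0∞} (h : a ^ n = b ^ n) : a = b :=
  le_antisymm ((ennreal_pow_le_pow_iff hn).1 h.le) ((ennreal_pow_le_pow_iff hn).1 h.ge)

/-- Polar coordinates; the area 4π is three times the volume of the unit ball. -/
lemma lintegral_fun_norm_E3 (f : ℝ → ℝ≥0∞) (hf : Measurable f) :
    ∫⁻ x : E3, f ‖x‖ = ENNReal.ofReal (4 * Real.pi) *
      ∫⁻ y in Set.Ioi (0 : ℝ), ENNReal.ofReal (y ^ 2) * f y := by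
  have hdim : Module.finrank ℝ E3 = 3 := by simp
  have hball : (volume : Measure E3).toSphere Set.univ = ENNReal.ofReal (4 * Real.pi) := by
    rw [Measure.toSphere_apply_univ, hdim, EuclideanSpace.volume_ball_fin_three, ENNReal.ofReal_one,
      one_pow, one_mul, Nat.cast_ofNat, ← ENNReal.ofReal_ofNat, ← ENNReal.ofReal_mul (by norm_num)]
    congr 1; ring
  calc ∫⁻ x : E3, f ‖x‖
      = ∫⁻ x : ({(0 : E3)}ᶜ : Set E3), f ‖x.1‖ ∂((volume : Measure E3).comap (↑)) := by
        rw [lintegral_subtype_comap (measurableSet_singleton _).compl fun x : E3 => f ‖x‖,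
          restrict_compl_singleton]
    _ = ∫⁻ x, f x.2 ∂((volume : Measure E3).toSphere.prod (.volumeIoiPow (Module.finrank ℝ E3 - 1))) := by
        have := (volume : Measure E3).measurePreserving_homeomorphUnitSphereProd.lintegral_comp
          (f := fun x => f x.2) (by fun_prop)
        simpa using this
    _ = (volume : Measure E3).toSphere Set.univ *
        ∫⁻ x : Set.Ioi (0 : ℝ), f x ∂.volumeIoiPow (Module.finrank ℝ E3 - 1) := by
        rw [lintegral_prod _ (by fun_prop)]
        simp [mul_comm]
    _ = _ := by
        rw [hball, hdim, Measure.volumeIoiPow, lintegral_withDensity_eq_lintegral_mul _ (by fun_prop)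
          (by fun_prop)]
        congr 1
        exact lintegral_subtype_comap measurableSet_Ioi
          fun y : ℝ => ENNReal.ofReal (y ^ (3 - 1)) * f y

/-- Integration of radial functions over `Ω`. -/
lemma lintegral_radial (f : ℝ → ℝ≥0∞) (hf : Measurable f) :
    ∫⁻ x, f (‖x‖ - 1) ∂volOmega = ENNReal.ofReal (4 * Real.pi) *
      ∫⁻ x, ENNReal.ofReal ((1 + x) ^ 2) * f x ∂halfLine := by
  have h1 : ∫⁻ x, f (‖x‖ - 1) ∂volOmega
      = ∫⁻ x : E3, (Set.Ioi (1 : ℝ)).indicator (fun y => f (y - 1)) ‖x‖ := by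
    rw [← lintegral_indicator measurableSet_Omega]
    rfl
  rw [h1, lintegral_fun_norm_E3 _ (Measurable.indicator (by fun_prop) measurableSet_Ioi)]
  congr 1
  have h2 : ∫⁻ x, ENNReal.ofReal ((1 + x) ^ 2) * f x ∂halfLine
      = ∫⁻ y : ℝ, (Set.Ioi (0 : ℝ)).indicator
          (fun x => ENNReal.ofReal ((1 + x) ^ 2) * f x) (y - 1) := by
    rw [lintegral_sub_right_eq_self
      (fun y => (Set.Ioi (0 : ℝ)).indicator (fun x => ENNReal.ofReal ((1 + x) ^ 2) * f x) y) 1,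
      lintegral_indicator measurableSet_Ioi]
  rw [h2, ← lintegral_indicator measurableSet_Ioi]
  refine lintegral_congr fun y => ?_
  by_cases hy : 1 < y
  · have h0 : (0 : ℝ) < y := by linarith
    simp [Set.indicator, hy, h0]
  · simp [Set.indicator, hy]

/-- Null sets of radii pull back to null sets of Ω, so almost everywhere statements on the half-line
transfer to radial functions on Ω. -/
lemma quasiMeasurePreserving_radius :
    Measure.QuasiMeasurePreserving (fun x : E3 => ‖x‖ - 1) volOmega halfLine := by
  refine ⟨by fun_prop, Measure.AbsolutelyContinuous.mk fun s hs h0 => ?_⟩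
  rw [Measure.map_apply (by fun_prop) hs]
  have h := lintegral_radial (s.indicator 1) (measurable_one.indicator hs)
  have h1 : ∫⁻ x, s.indicator (1 : ℝ → ℝ≥0∞) (‖x‖ - 1) ∂volOmega
      = volOmega ((fun x : E3 => ‖x‖ - 1) ⁻¹' s) := by
    rw [← lintegral_indicator_one (hs.preimage (by fun_prop))]
    rfl
  rw [← h1, h]
  have h2 : (fun x => ENNReal.ofReal ((1 + x) ^ 2) * s.indicator (1 : ℝ → ℝ≥0∞) x) =ᵐ[halfLine] 0 := by
    have : ∀ᵐ x ∂halfLine, x ∉ s := measure_eq_zero_iff_ae_notMem.1 h0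
    filter_upwards [this] with x hx
    simp [hx]
  rw [lintegral_congr_ae h2]
  simp

lemma ae_volOmega_of_ae_halfLine {P : ℝ → Prop} (h : ∀ᵐ x ∂halfLine, P x) :
    ∀ᵐ x ∂volOmega, P (‖x‖ - 1) := quasiMeasurePreserving_radius.ae h

lemma ae_volOmega_of_forall {P : E3 → Prop} (h : ∀ x, 1 < ‖x‖ → P x) : ∀ᵐ x ∂volOmega, P x := by
  rw [ae_restrict_iff' measurableSet_Omega]
  exact Eventually.of_forall h

lemma ae_halfLine_of_ae_volOmega {P : ℝ → Prop} (hP : MeasurableSet {x | P x})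
    (h : ∀ᵐ x ∂volOmega, P (‖x‖ - 1)) : ∀ᵐ x ∂halfLine, P x := by
  have hs : MeasurableSet {x | ¬ P x} := hP.compl
  have h1 := lintegral_radial ({x | ¬ P x}.indicator 1) (measurable_one.indicator hs)
  have h0 : ∫⁻ x, {x | ¬ P x}.indicator (1 : ℝ → ℝ≥0∞) (‖x‖ - 1) ∂volOmega = 0 := by
    rw [← lintegral_zero (μ := volOmega)]
    refine lintegral_congr_ae ?_
    filter_upwards [h] with x hx
    simp [hx]
  rw [h0] at h1
  have h2 := (mul_eq_zero.1 h1.symm).resolve_left (by simp [Real.pi_pos])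
  rw [lintegral_eq_zero_iff (by
    exact Measurable.mul (by fun_prop) (measurable_one.indicator hs))] at h2
  filter_upwards [h2, ae_halfLine_of_forall (P := fun x => 0 < x) (fun x hx => hx)] with x hx hx0
  by_contra hc
  have : ((1 + x) ^ 2 : ℝ) ≤ 0 := by simpa [hc] using hx
  nlinarith

/-- The radial function on `Ω` with profile `profile p`. -/
def radialFn (p : ℝ → ℂ) (x : E3) : ℂ := profile p (‖x‖ - 1)

/-- The gradient of `radialFn p`. -/
def radialGrad (p : ℝ → ℂ) (x : E3) : EuclideanSpace ℂ (Fin 3) :=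
  WithLp.toLp 2 fun j => (p (‖x‖ - 1) - profile p (‖x‖ - 1)) / ((‖x‖ ^ 2 : ℝ) : ℂ) * (x j : ℂ)

lemma norm_radialGrad (p : ℝ → ℂ) (x : E3) :
    ‖radialGrad p x‖ = ‖p (‖x‖ - 1) - profile p (‖x‖ - 1)‖ / ‖x‖ := by
  have h1 : ‖x‖ ^ 2 = ∑ j, ‖x j‖ ^ 2 := EuclideanSpace.norm_sq_eq x
  rw [radialGrad, EuclideanSpace.norm_eq]
  simp only [norm_mul, norm_div, Complex.norm_real, mul_pow, norm_pow, norm_norm]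
  rw [← Finset.mul_sum, ← h1, ← mul_pow, Real.sqrt_sq (by positivity)]
  rcases eq_or_ne ‖x‖ 0 with h | h
  · simp [h]
  · field_simp

lemma measurable_HL2 (p : HL2) : Measurable p := (Lp.stronglyMeasurable p).measurable

lemma measurable_radialFn (p : HL2) : Measurable (radialFn p) :=
  (measurable_profile p).comp (by fun_prop)

lemma measurable_radialGrad (p : HL2) : Measurable (radialGrad p) := by
  unfold radialGrad
  have h1 := measurable_HL2 p
  have h2 := measurable_profile p
  refine (WithLp.measurable_toLp 2 _).comp ?_
  refine measurable_pi_lambda _ fun j => ?_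
  fun_prop

/-- The Jacobian r² cancels the factor r^{-2} of the squared gradient and leaves ‖p - `hardy p`‖² =
‖p‖². -/
lemma lintegral_radialGrad (p : HL2) :
    ∫⁻ x, ‖radialGrad p x‖ₑ ^ 2 ∂volOmega = ENNReal.ofReal (4 * Real.pi * ‖p‖ ^ 2) := by
  have hm : Measurable fun x => ‖p x - profile p x‖ₑ :=
    ((measurable_HL2 p).sub (measurable_profile p)).enorm
  have h1 : ∫⁻ x, ‖radialGrad p x‖ₑ ^ 2 ∂volOmega
      = ∫⁻ x : E3, (fun y => ENNReal.ofReal ((1 + y) ^ 2)⁻¹ * ‖p y - profile p y‖ₑ ^ 2)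
          (‖x‖ - 1) ∂volOmega := by
    refine lintegral_congr_ae (ae_volOmega_of_forall fun x hx => ?_)
    have : ‖radialGrad p x‖ ^ 2
        = ((1 + (‖x‖ - 1)) ^ 2)⁻¹ * ‖p (‖x‖ - 1) - profile p (‖x‖ - 1)‖ ^ 2 := by
      rw [norm_radialGrad, div_pow, add_sub_cancel]; ring
    simp only
    rw [← ofReal_norm, ← ofReal_norm, ← ENNReal.ofReal_pow (norm_nonneg _),
      ← ENNReal.ofReal_pow (norm_nonneg _), this, ENNReal.ofReal_mul (by positivity)]
  have h2 : ∫⁻ x, ENNReal.ofReal ((1 + x) ^ 2) *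
      (ENNReal.ofReal ((1 + x) ^ 2)⁻¹ * ‖p x - profile p x‖ₑ ^ 2) ∂halfLine
      = ∫⁻ x, ‖(p - hardy p : HL2) x‖ₑ ^ 2 ∂halfLine := by
    refine lintegral_congr_ae ?_
    filter_upwards [Lp.coeFn_sub p (hardy p), coeFn_hardy p,
      ae_halfLine_of_forall (P := fun x => 0 < x) (fun x hx => hx)] with x h1 h2 h3
    rw [h1, Pi.sub_apply, h2, ← mul_assoc, ← ENNReal.ofReal_mul (by positivity),
      mul_inv_cancel₀ (by positivity), ENNReal.ofReal_one, one_mul]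
  have h3 : ∫⁻ x, ‖(p - hardy p : HL2) x‖ₑ ^ 2 ∂halfLine = ENNReal.ofReal (‖p‖ ^ 2) := by
    have := Lp.norm_def (p - hardy p)
    rw [norm_sub_hardy] at this
    have h4 := eLpNorm_nnreal_pow_eq_lintegral (μ := halfLine) (f := (p - hardy p : HL2)) (p := 2)
      (by norm_num)
    simp only [NNReal.coe_ofNat, ENNReal.coe_ofNat, ENNReal.rpow_ofNat] at h4
    rw [← h4, this, ENNReal.ofReal_pow ENNReal.toReal_nonneg, ENNReal.ofReal_toReal (Lp.eLpNorm_ne_top _)]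
  rw [h1, lintegral_radial (fun y => ENNReal.ofReal ((1 + y) ^ 2)⁻¹ * ‖p y - profile p y‖ₑ ^ 2)
    (by fun_prop), h2, h3, ← ENNReal.ofReal_mul (by positivity)]

lemma eLpNorm_radialGrad (p : HL2) :
    eLpNorm (radialGrad p) 2 volOmega = ENNReal.ofReal (√(4 * Real.pi) * ‖p‖) := by
  have h4 := eLpNorm_nnreal_pow_eq_lintegral (μ := volOmega) (f := radialGrad p) (p := 2)
    (by norm_num)
  simp only [NNReal.coe_ofNat, ENNReal.coe_ofNat, ENNReal.rpow_ofNat] at h4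
  rw [lintegral_radialGrad] at h4
  have h5 : ENNReal.ofReal (4 * Real.pi * ‖p‖ ^ 2) = (ENNReal.ofReal (√(4 * Real.pi) * ‖p‖)) ^ 2 := by
    rw [← ENNReal.ofReal_pow (by positivity), mul_pow, Real.sq_sqrt (by positivity)]
  rw [h5] at h4
  exact ennreal_pow_left_injective (n := 2) (by norm_num) h4

lemma lintegral_radialFn_pow (p : HL2) (k : ℕ) :
    ∫⁻ x, ‖radialFn p x‖ₑ ^ k ∂volOmega = ENNReal.ofReal (4 * Real.pi) *
      ∫⁻ x, ENNReal.ofReal ((1 + x) ^ 2) * ‖profile p x‖ₑ ^ k ∂halfLine :=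
  lintegral_radial (fun y => ‖profile p y‖ₑ ^ k) ((measurable_profile p).enorm.pow_const _)

lemma sq_mul_norm_profile_pow_four_le (p : HL2) {x : ℝ} (hx : 0 ≤ x) :
    (1 + x) ^ 2 * ‖profile p x‖ ^ 4 ≤ ‖p‖ ^ 4 := by
  have h := norm_profile_le p hx
  have hs : 0 < √(1 + x) := Real.sqrt_pos.2 (by linarith)
  have h2 : √(1 + x) * ‖profile p x‖ ≤ ‖p‖ := by
    rwa [inv_mul_eq_div, le_div_iff₀ hs, mul_comm] at h
  have h3 : (√(1 + x) * ‖profile p x‖) ^ 4 ≤ ‖p‖ ^ 4 := by gcongr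
  have h4 : √(1 + x) ^ 4 = (1 + x) ^ 2 := by
    rw [show (4 : ℕ) = 2 * 2 from rfl, pow_mul, Real.sq_sqrt (by linarith)]
  rwa [mul_pow, h4] at h3

/-- Since r²|u|⁴ is bounded by ‖p‖⁴, the integrand is at most ‖p‖⁴|u|², and Hardy's inequality
integrates |u|². -/
lemma lintegral_profile_six_le (p : HL2) :
    ∫⁻ x, ENNReal.ofReal ((1 + x) ^ 2) * ‖profile p x‖ₑ ^ 6 ∂halfLine
      ≤ ENNReal.ofReal (4 * ‖p‖ ^ 6) := by
  have h4 := eLpNorm_nnreal_pow_eq_lintegral (μ := halfLine) (f := profile p) (p := 2)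
    (by norm_num)
  simp only [NNReal.coe_ofNat, ENNReal.coe_ofNat, ENNReal.rpow_ofNat] at h4
  calc ∫⁻ x, ENNReal.ofReal ((1 + x) ^ 2) * ‖profile p x‖ₑ ^ 6 ∂halfLine
      ≤ ∫⁻ x, ENNReal.ofReal (‖p‖ ^ 4) * ‖profile p x‖ₑ ^ 2 ∂halfLine := by
        refine lintegral_mono_ae (ae_halfLine_of_forall fun x hx => ?_)
        rw [← ofReal_norm, ← ENNReal.ofReal_pow (norm_nonneg _), ← ENNReal.ofReal_pow (norm_nonneg _),
          ← ENNReal.ofReal_mul (by positivity), ← ENNReal.ofReal_mul (by positivity)]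
        refine ENNReal.ofReal_le_ofReal ?_
        have := sq_mul_norm_profile_pow_four_le p hx.le
        calc (1 + x) ^ 2 * ‖profile p x‖ ^ 6 = ((1 + x) ^ 2 * ‖profile p x‖ ^ 4) * ‖profile p x‖ ^ 2 := by ring
          _ ≤ _ := by gcongr
    _ = ENNReal.ofReal (‖p‖ ^ 4) * eLpNorm (profile p) 2 halfLine ^ 2 := by
        rw [lintegral_const_mul _ ((measurable_profile p).enorm.pow_const _), h4]
    _ ≤ ENNReal.ofReal (‖p‖ ^ 4) * (2 * ‖p‖ₑ) ^ 2 := by gcongr; exact eLpNorm_profile_le p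
    _ = ENNReal.ofReal (4 * ‖p‖ ^ 6) := by
        have h2 : (2 : ℝ≥0∞) ^ 2 = ENNReal.ofReal 4 := by norm_num
        rw [← ofReal_norm, mul_pow, ← ENNReal.ofReal_pow (norm_nonneg _), h2,
          ← ENNReal.ofReal_mul (by positivity), ← ENNReal.ofReal_mul (by positivity)]
        congr 1; ring

lemma eLpNorm_radialFn_le (p : HL2) :
    eLpNorm (radialFn p) 6 volOmega ≤ ENNReal.ofReal (16 * Real.pi * ‖p‖) := by
  have h4 := eLpNorm_nnreal_pow_eq_lintegral (μ := volOmega) (f := radialFn p) (p := 6)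
    (by norm_num)
  simp only [NNReal.coe_ofNat, ENNReal.coe_ofNat, ENNReal.rpow_ofNat] at h4
  rw [lintegral_radialFn_pow] at h4
  refine (ennreal_pow_le_pow_iff (n := 6) (by norm_num)).1 ?_
  rw [h4]
  refine (mul_le_mul_right (lintegral_profile_six_le p) _).trans ?_
  rw [← ENNReal.ofReal_mul (by positivity), ← ENNReal.ofReal_pow (by positivity)]
  refine ENNReal.ofReal_le_ofReal ?_
  rw [mul_pow]
  -- The sixth power of the norm is at most 16π‖p‖⁶; as 16π ≥ 1, this is below (16π‖p‖)⁶. Sharpness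
  -- plays no role.
  have h1 : (1 : ℝ) ≤ 16 * Real.pi := by have := Real.pi_gt_three; linarith
  have h2 : 16 * Real.pi ≤ (16 * Real.pi) ^ 6 := le_self_pow₀ h1 (by norm_num)
  calc 4 * Real.pi * (4 * ‖p‖ ^ 6) = 16 * Real.pi * ‖p‖ ^ 6 := by ring
    _ ≤ _ := by gcongr

lemma memLp_radialFn (p : HL2) : MemLp (radialFn p) 6 volOmega :=
  ⟨(measurable_radialFn p).aestronglyMeasurable, (eLpNorm_radialFn_le p).trans_lt ENNReal.ofReal_lt_top⟩

lemma memLp_radialGrad (p : HL2) : MemLp (radialGrad p) 2 volOmega :=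
  ⟨(measurable_radialGrad p).aestronglyMeasurable, by rw [eLpNorm_radialGrad]; exact ENNReal.ofReal_lt_top⟩

lemma radialFn_congr {p q : ℝ → ℂ} (h : p =ᵐ[halfLine] q) : radialFn p = radialFn q := by
  funext x; rw [radialFn, profile_congr h, radialFn]

lemma radialGrad_congr {p q : ℝ → ℂ} (h : p =ᵐ[halfLine] q) :
    radialGrad p =ᵐ[volOmega] radialGrad q := by
  filter_upwards [ae_volOmega_of_ae_halfLine h] with x hx
  rw [radialGrad, radialGrad, profile_congr h, hx]

/-- The pair `(f, ∇f)` belonging to the derivative `p` of `r f(r)`, as a bounded operator. -/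
def radialPair : HL2 →L[ℂ] Lp ℂ 6 volOmega × Lp (EuclideanSpace ℂ (Fin 3)) 2 volOmega :=
  LinearMap.mkContinuous
    { toFun := fun p => ((memLp_radialFn p).toLp _, (memLp_radialGrad p).toLp _)
      map_add' := fun p q => by
        refine Prod.ext ?_ ?_
        · change (memLp_radialFn (p + q)).toLp _ = (memLp_radialFn p).toLp _ + (memLp_radialFn q).toLp _
          rw [← MemLp.toLp_add]
          refine MemLp.toLp_congr _ _ (Eventually.of_forall fun x => ?_)
          simp only [radialFn, profile, prim_add, add_div, Pi.add_apply]
        · change (memLp_radialGrad (p + q)).toLp _ = (memLp_radialGrad p).toLp _ + (memLp_radialGrad q).toLp _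
          rw [← MemLp.toLp_add]
          refine MemLp.toLp_congr _ _ ?_
          filter_upwards [ae_volOmega_of_ae_halfLine (Lp.coeFn_add p q)] with x hx
          ext j
          simp only [radialGrad, hx, profile, prim_add, Pi.add_apply, PiLp.add_apply]
          ring
      map_smul' := fun c p => by
        refine Prod.ext ?_ ?_
        · change (memLp_radialFn (c • p)).toLp _ = c • (memLp_radialFn p).toLp _
          rw [← MemLp.toLp_const_smul]
          refine MemLp.toLp_congr _ _ (Eventually.of_forall fun x => ?_)
          simp only [radialFn, profile, prim_smul, Pi.smul_apply, smul_eq_mul, mul_div_assoc]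
        · change (memLp_radialGrad (c • p)).toLp _ = c • (memLp_radialGrad p).toLp _
          rw [← MemLp.toLp_const_smul]
          refine MemLp.toLp_congr _ _ ?_
          filter_upwards [ae_volOmega_of_ae_halfLine (Lp.coeFn_smul c p)] with x hx
          ext j
          simp only [radialGrad, hx, profile, prim_smul, Pi.smul_apply, PiLp.smul_apply, smul_eq_mul]
          ring } (16 * Real.pi) fun p => by
    change max ‖(memLp_radialFn p).toLp _‖ ‖(memLp_radialGrad p).toLp _‖ ≤ _
    have hpi := Real.pi_gt_three
    refine max_le ?_ ?_
    · rw [Lp.norm_toLp]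
      exact ENNReal.toReal_le_of_le_ofReal (by positivity) (eLpNorm_radialFn_le p)
    · rw [Lp.norm_toLp, eLpNorm_radialGrad, ENNReal.toReal_ofReal (by positivity)]
      gcongr
      rw [Real.sqrt_le_left (by positivity)]
      nlinarith

lemma coeFn_radialPair_fst (p : HL2) : (radialPair p).1 =ᵐ[volOmega] radialFn p :=
  (memLp_radialFn p).coeFn_toLp

lemma coeFn_radialPair_snd (p : HL2) : (radialPair p).2 =ᵐ[volOmega] radialGrad p :=
  (memLp_radialGrad p).coeFn_toLp

lemma norm_radialPair_snd (p : HL2) : ‖(radialPair p).2‖ = √(4 * Real.pi) * ‖p‖ := by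
  change ‖(memLp_radialGrad p).toLp _‖ = _
  rw [Lp.norm_toLp, eLpNorm_radialGrad, ENNReal.toReal_ofReal (by positivity)]

/-- The radial function on `ℝ³` with `r f(r) = w(r - 1)`. -/
def liftTest (w : ℝ → ℂ) (x : E3) : ℂ := w (‖x‖ - 1) / (‖x‖ : ℂ)

lemma isRadialTest_liftTest {w : ℝ → ℂ} (hw : IsHalfTest w) : IsRadialTest (liftTest w) := by
  obtain ⟨a, b, ha, hab, hz⟩ := hw.exists_bound
  have hz' : ∀ x : E3, x ∉ {x : E3 | 1 + a ≤ ‖x‖ ∧ ‖x‖ ≤ 1 + b} → liftTest w x = 0 := by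
    intro x hx
    have : w (‖x‖ - 1) = 0 := hz _ fun h => hx ⟨by linarith [h.1], by linarith [h.2]⟩
    simp [liftTest, this]
  have hcl : IsClosed {x : E3 | 1 + a ≤ ‖x‖ ∧ ‖x‖ ≤ 1 + b} :=
    (isClosed_le continuous_const continuous_norm).inter (isClosed_le continuous_norm continuous_const)
  have hsub : tsupport (liftTest w) ⊆ {x : E3 | 1 + a ≤ ‖x‖ ∧ ‖x‖ ≤ 1 + b} := by
    refine closure_minimal (fun x hx => ?_) hcl
    by_contra hx'
    exact hx (hz' x hx')
  refine ⟨?_, ?_, fun x hx => ?_, fun x y hxy => ?_⟩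
  · rw [contDiff_iff_contDiffAt]
    intro x
    rcases eq_or_ne x 0 with rfl | hx
    · have : liftTest w =ᶠ[𝓝 0] fun _ => 0 := by
        filter_upwards [Metric.ball_mem_nhds (0 : E3) one_pos] with y hy
        refine hz' y fun h => ?_
        have h1 : ‖y‖ < 1 := by simpa using hy
        linarith [h.1]
      exact contDiffAt_const.congr_of_eventuallyEq this
    · have hn : ContDiffAt ℝ ∞ (fun y : E3 => ‖y‖) x := contDiffAt_norm ℝ hx
      have h1 : ContDiffAt ℝ ∞ (fun y : E3 => w (‖y‖ - 1)) x :=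
        (hw.smooth.contDiffAt).comp x (hn.sub contDiffAt_const)
      have h2 : ContDiffAt ℝ ∞ (fun y : E3 => (‖y‖ : ℂ)) x :=
        (Complex.ofRealCLM.contDiff.contDiffAt).comp x hn
      change ContDiffAt ℝ ∞ (fun y : E3 => w (‖y‖ - 1) / (‖y‖ : ℂ)) x
      simp only [div_eq_mul_inv]
      exact h1.mul (h2.inv (by exact_mod_cast norm_ne_zero_iff.2 hx))
  · exact (isCompact_closedBall (0 : E3) (1 + b)).of_isClosed_subset (isClosed_tsupport _)
      fun x hx => by simpa using (hsub hx).2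
  · have := (hsub hx).1
    change 1 < ‖x‖
    linarith
  · simp [liftTest, hxy]

lemma liftTest_eq {w : ℝ → ℂ} (hw : IsHalfTest w) {x : E3} (hx : 1 < ‖x‖) :
    liftTest w x = radialFn (deriv w) x := by
  rw [liftTest, radialFn, profile, prim_deriv hw (by linarith), add_sub_cancel]

lemma grad_liftTest {w : ℝ → ℂ} (hw : IsHalfTest w) {x : E3} (hx : 1 < ‖x‖) :
    grad (liftTest w) x = radialGrad (deriv w) x := by
  have hx0 : x ≠ 0 := by rintro rfl; simp at hx; linarith
  have hn0 : (‖x‖ : ℂ) ≠ 0 := by simpa using hx0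
  ext j
  simp only [grad, radialGrad]
  set e : E3 := EuclideanSpace.single j (1 : ℝ) with he
  have hL : HasDerivAt (fun s : ℝ => liftTest w (x + s • e)) (fderiv ℝ (liftTest w) x e) 0 := by
    have hd := ((isRadialTest_liftTest hw).differentiable x).hasFDerivAt
    have := hd.comp_hasDerivAt_of_eq (0 : ℝ) (f := fun s : ℝ => x + s • e)
      (((hasDerivAt_id (0:ℝ)).smul_const e).const_add x) (by simp)
    simpa [Function.comp_def] using this
  have hN : HasDerivAt (fun s : ℝ => ‖x + s • e‖) (x j / ‖x‖) 0 := by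
    have h1 : HasDerivAt (fun s : ℝ => x + s • e) e 0 := by
      simpa using ((hasDerivAt_id (0:ℝ)).smul_const e).const_add x
    -- The norm is differentiated along a coordinate line as the square root of its square.
    have h2 : HasDerivAt (fun s : ℝ => √(‖x + s • e‖ ^ 2)) (2 * inner ℝ x e / (2 * √(‖x‖ ^ 2))) 0 := by
      have h3 := h1.norm_sq
      simp only [zero_smul, add_zero] at h3
      have h4 := h3.sqrt (by simpa using hx0)
      simpa using h4
    have h5 : inner ℝ x e = x j := by rw [he, EuclideanSpace.inner_single_right]; simp
    simp only [Real.sqrt_sq (norm_nonneg _), h5] at h2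
    convert h2 using 1
    field_simp
  have hW : HasDerivAt (fun s : ℝ => w (‖x + s • e‖ - 1)) ((x j / ‖x‖ : ℝ) • deriv w (‖x‖ - 1)) 0 := by
    have h1 := (hw.differentiable (‖x‖ - 1)).hasDerivAt
    exact HasDerivAt.scomp_of_eq (0 : ℝ) h1 (hN.sub_const 1) (by simp)
  have hM : HasDerivAt (fun s : ℝ => ((‖x + s • e‖ : ℝ) : ℂ)) ((x j / ‖x‖ : ℝ) : ℂ) 0 := hN.ofReal_comp
  have hQ := hW.div hM (by simpa using hx0)
  have := hL.unique hQ
  rw [this, profile, prim_deriv hw (by linarith), add_sub_cancel]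
  simp only [zero_smul, add_zero, Complex.real_smul]
  push_cast
  field_simp

lemma radialPair_mem_testPairs {w : ℝ → ℂ} (hw : IsHalfTest w) {p : HL2}
    (hp : p =ᵐ[halfLine] deriv w) : radialPair p ∈ testPairs := by
  refine ⟨liftTest w, isRadialTest_liftTest hw, ?_, ?_⟩
  · refine (coeFn_radialPair_fst p).trans ?_
    rw [radialFn_congr hp]
    exact ae_volOmega_of_forall fun x hx => (liftTest_eq hw hx).symm
  · refine (coeFn_radialPair_snd p).trans ((radialGrad_congr hp).trans ?_)
    exact ae_volOmega_of_forall fun x hx => (grad_liftTest hw hx).symm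

lemma radialPair_mem (p : HL2) : radialPair p ∈ testPairs.topologicalClosure := by
  refine HL2.induction_deriv (P := fun p => radialPair p ∈ testPairs.topologicalClosure) ?_ ?_ p
  · exact testPairs.isClosed_topologicalClosure.preimage radialPair.continuous
  · exact fun w hw p hp => testPairs.le_topologicalClosure (radialPair_mem_testPairs hw hp)

/-- Every radial test function arises from the half-line, which makes `lift` surjective onto the
closure and not only isometric into it. -/
lemma exists_liftTest_eq {φ : E3 → ℂ} (hφ : IsRadialTest φ) :
    ∃ w, IsHalfTest w ∧ φ = liftTest w := by
  let e : E3 := EuclideanSpace.single 0 (1 : ℝ)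
  have he : ‖e‖ = 1 := by simp [e]
  have hb : ∃ a b : ℝ, 0 < a ∧ ∀ x : E3, φ x ≠ 0 → 1 + a ≤ ‖x‖ ∧ ‖x‖ ≤ 1 + b := by
    by_cases hne : (tsupport φ).Nonempty
    · have hc : IsCompact (tsupport φ) := hφ.compact
      obtain ⟨y, hy, hy'⟩ := hc.exists_isMinOn hne continuous_norm.continuousOn
      obtain ⟨z, hz, hz'⟩ := hc.exists_isMaxOn hne continuous_norm.continuousOn
      have h1 : 1 < ‖y‖ := hφ.supp hy
      refine ⟨‖y‖ - 1, ‖z‖ - 1, by linarith, fun x hx => ?_⟩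
      have hx' : x ∈ tsupport φ := subset_tsupport _ hx
      have h2 : ‖y‖ ≤ ‖x‖ := hy' hx'
      have h3 : ‖x‖ ≤ ‖z‖ := hz' hx'
      constructor <;> linarith
    · exact ⟨1, 1, one_pos, fun x hx => absurd ⟨x, subset_tsupport _ hx⟩ hne⟩
  obtain ⟨a, b, ha, hab⟩ := hb
  -- The profile is read off along a ray. The map x ↦ φ((1+x)e) is even about x = -1; the transition
  -- function, 0 for x ≤ -1 and 1 for x ≥ 0, removes the reflected copy.
  refine ⟨fun x => (Real.smoothTransition (x + 1) : ℂ) * (((1 + x : ℝ) : ℂ) * φ ((1 + x) • e)), ?_, ?_⟩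
  · refine IsHalfTest.of_bound (a := a) (b := b) ?_ ha fun x hx => ?_
    · have h1 : ContDiff ℝ ∞ fun x : ℝ => (Real.smoothTransition (x + 1) : ℂ) :=
        Complex.ofRealCLM.contDiff.comp
          (Real.smoothTransition.contDiff.comp (contDiff_id.add contDiff_const))
      have h2 : ContDiff ℝ ∞ fun x : ℝ => ((1 + x : ℝ) : ℂ) :=
        Complex.ofRealCLM.contDiff.comp (contDiff_const.add contDiff_id)
      have h3 : ContDiff ℝ ∞ fun x : ℝ => φ ((1 + x) • e) :=
        hφ.smooth.comp ((contDiff_const.add contDiff_id).smul contDiff_const)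
      exact h1.mul (h2.mul h3)
    · by_contra hne
      have h1 : φ ((1 + x) • e) ≠ 0 := fun h => hne (by simp [h])
      have h2 : Real.smoothTransition (x + 1) ≠ 0 := fun h => hne (by simp [h])
      have h3 : 0 < x + 1 := by
        by_contra h
        exact h2 (Real.smoothTransition.zero_of_nonpos (not_lt.1 h))
      have h4 := hab _ h1
      rw [norm_smul, he, mul_one, Real.norm_of_nonneg (by linarith)] at h4
      exact hx ⟨by linarith, by linarith⟩
  · funext x
    have hr : φ x = φ ((1 + (‖x‖ - 1)) • e) := by
      refine hφ.radial _ _ ?_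
      rw [norm_smul, he, mul_one, add_sub_cancel, norm_norm]
    by_cases h0 : φ x = 0
    · rw [liftTest, ← hr, h0]; simp
    · have h1 := (hab x h0).1
      have h2 : (‖x‖ : ℂ) ≠ 0 := by
        have : ‖x‖ ≠ 0 := by linarith
        exact_mod_cast this
      rw [liftTest, ← hr, Real.smoothTransition.one_of_one_le (by linarith), add_sub_cancel]
      field_simp
      simp

lemma exists_radialPair_eq {p : Lp ℂ 6 volOmega × Lp (EuclideanSpace ℂ (Fin 3)) 2 volOmega}
    {w : ℝ → ℂ} (hw : IsHalfTest w) (h1 : p.1 =ᵐ[volOmega] liftTest w)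
    (h2 : p.2 =ᵐ[volOmega] grad (liftTest w)) {q : HL2} (hq : q =ᵐ[halfLine] deriv w) :
    radialPair q = p := by
  refine Prod.ext (Lp.ext ?_) (Lp.ext ?_)
  · refine (coeFn_radialPair_fst q).trans (EventuallyEq.trans ?_ h1.symm)
    rw [radialFn_congr hq]
    exact ae_volOmega_of_forall fun x hx => (liftTest_eq hw hx).symm
  · refine (coeFn_radialPair_snd q).trans (EventuallyEq.trans ?_ h2.symm)
    refine (radialGrad_congr hq).trans ?_
    exact ae_volOmega_of_forall fun x hx => (grad_liftTest hw hx).symm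

/-- The gradient component multiplies norms by √(4π) ≥ 1, so the operator is bounded below and its
range is closed. The range therefore contains the closure of the test pairs. -/
lemma isClosed_range_radialPair : IsClosed (Set.range radialPair) := by
  have : AntilipschitzWith 1 radialPair := by
    refine AddMonoidHomClass.antilipschitz_of_bound _ fun p => ?_
    rw [NNReal.coe_one, one_mul]
    refine le_trans ?_ (norm_snd_le _)
    rw [norm_radialPair_snd]
    refine le_mul_of_one_le_left (norm_nonneg _) ?_
    rw [Real.one_le_sqrt]; linarith [Real.pi_gt_three]
  exact this.isClosed_range radialPair.uniformContinuous

lemma mem_range_radialPair {p} (hp : p ∈ testPairs.topologicalClosure) : p ∈ Set.range radialPair := by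
  have hp' : p ∈ closure (testPairs : Set (Lp ℂ 6 volOmega × Lp (EuclideanSpace ℂ (Fin 3)) 2 volOmega)) := hp
  refine closure_minimal ?_ isClosed_range_radialPair hp'
  rintro q ⟨φ, hφ, h1, h2⟩
  obtain ⟨w, hw, rfl⟩ := exists_liftTest_eq hφ
  exact ⟨(hw.deriv.memLp 2).toLp _, exists_radialPair_eq hw h1 h2 (hw.deriv.memLp 2).coeFn_toLp⟩

/-- The radial function `f` with `(r f)' = p`, as an element of `Ḣ¹₀(Ω)`. -/
def liftLin : HL2 →ₗ[ℂ] RadialHdot where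
  toFun p := (⟨radialPair p, radialPair_mem p⟩ : testPairs.topologicalClosure)
  map_add' p q := Subtype.ext (map_add radialPair p q)
  map_smul' c p := Subtype.ext (map_smul radialPair c p)

lemma norm_liftLin (p : HL2) : ‖liftLin p‖ = √(4 * Real.pi) * ‖p‖ := norm_radialPair_snd p

lemma bijective_liftLin : Function.Bijective liftLin := by
  constructor
  · refine (injective_iff_map_eq_zero _).2 fun p hp => ?_
    have h2 := norm_liftLin p
    rw [hp, norm_zero] at h2
    have h3 : √(4 * Real.pi) ≠ 0 := (Real.sqrt_pos.2 (by positivity)).ne'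
    exact norm_eq_zero.1 ((mul_eq_zero.1 h2.symm).resolve_left h3)
  · rintro ⟨f, hf⟩
    obtain ⟨p, rfl⟩ := mem_range_radialPair hf
    exact ⟨p, rfl⟩

lemma norm_ofBijective_symm_le (f : RadialHdot) :
    ‖(LinearEquiv.ofBijective liftLin bijective_liftLin).symm f‖ ≤ 1 * ‖f‖ := by
  obtain ⟨p, rfl⟩ := bijective_liftLin.2 f
  rw [LinearEquiv.ofBijective_symm_apply_apply, one_mul, norm_liftLin]
  refine le_mul_of_one_le_left (norm_nonneg _) ?_
  rw [Real.one_le_sqrt]; linarith [Real.pi_gt_three]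

/-- The parametrisation of `Ḣ¹₀(Ω)` by `L²(0, ∞)`: the radial function `f` corresponds to
`p = (r f)'`. -/
def lift : HL2 ≃L[ℂ] RadialHdot :=
  (LinearEquiv.ofBijective liftLin bijective_liftLin).toContinuousLinearEquivOfBounds
    (√(4 * Real.pi)) 1 (fun p => (norm_liftLin p).le) norm_ofBijective_symm_le

lemma fn_lift (p : HL2) : (lift p).fn =ᵐ[volOmega] radialFn p := coeFn_radialPair_fst p

lemma gradient_lift (p : HL2) : (lift p).gradient =ᵐ[volOmega] radialGrad p :=
  coeFn_radialPair_snd p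

lemma norm_lift (p : HL2) : ‖lift p‖ = √(4 * Real.pi) * ‖p‖ := norm_radialPair_snd p

end

end ExteriorNLS

/-! ### L² bounds for oscillatory integrals -/

namespace ExteriorNLS

noncomputable section

section SchurPlancherel

variable {X : Type*} [MeasurableSpace X]

lemma ennreal_two_mul_le (a b : ℝ≥0∞) : 2 * a * b ≤ a ^ 2 + b ^ 2 := by
  induction a with
  | top => simp
  | coe a =>
    induction b with
    | top => simp
    | coe b =>
      have h : 2 * a * b ≤ a ^ 2 + b ^ 2 := by
        rw [← NNReal.coe_le_coe]
        push_cast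
        exact two_mul_le_add_sq (a : ℝ) b
      exact_mod_cast h

/-- The oscillatory integral `∫ e^{i y φ(ξ)} k(ξ) dν(ξ)`. -/
def oscInt (ν : Measure X) (φ : X → ℝ) (k : X → ℂ) (y : ℝ) : ℂ :=
  ∫ ξ, Complex.exp (Complex.I * ((y * φ ξ : ℝ) : ℂ)) * k ξ ∂ν

lemma norm_exp_I_mul_ofReal' (s : ℝ) : ‖Complex.exp (Complex.I * (s : ℂ))‖ = 1 := by
  rw [mul_comm]; exact Complex.norm_exp_ofReal_mul_I s

lemma integral_gaussian_oscillation {ε : ℝ} (hε : 0 < ε) (s : ℝ) :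
    ∫ y : ℝ, Complex.exp (Complex.I * ((y * s : ℝ) : ℂ)) * ((Real.exp (-ε * y ^ 2) : ℝ) : ℂ)
      = ((√(Real.pi / ε) * Real.exp (-(1 / (4 * ε)) * s ^ 2) : ℝ) : ℂ) := by
  have h := fourierIntegral_gaussian (b := (ε : ℂ)) (by simpa using hε) (s : ℂ)
  have e1 : ∀ y : ℝ, Complex.exp (Complex.I * ((y * s : ℝ) : ℂ)) * ((Real.exp (-ε * y ^ 2) : ℝ) : ℂ)
      = Complex.exp (Complex.I * (s : ℂ) * (y : ℂ)) * Complex.exp (-(ε : ℂ) * (y : ℂ) ^ 2) := by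
    intro y
    push_cast
    congr 2
    ring
  simp_rw [e1]
  rw [h]
  have e2 : ((Real.pi : ℂ) / (ε : ℂ)) ^ (1 / 2 : ℂ) = ((√(Real.pi / ε) : ℝ) : ℂ) := by
    rw [Real.sqrt_eq_rpow, Complex.ofReal_cpow (by positivity)]
    push_cast
    norm_num
  rw [e2]
  push_cast
  congr 2
  field_simp

/-- The mass depends neither on ε nor on the centre, so the estimates below are uniform as the
Gaussian regularisation is removed. -/
lemma lintegral_gaussian_kernel {ε : ℝ} (hε : 0 < ε) (a : ℝ) :
    ∫⁻ s, ENNReal.ofReal (√(Real.pi / ε) * Real.exp (-(1 / (4 * ε)) * (a - s) ^ 2))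
      = ENNReal.ofReal (2 * Real.pi) := by
  rw [lintegral_sub_left_eq_self
    (fun s => ENNReal.ofReal (√(Real.pi / ε) * Real.exp (-(1 / (4 * ε)) * s ^ 2))) a]
  have hi := (integrable_exp_neg_mul_sq (b := 1 / (4 * ε)) (by positivity)).const_mul (√(Real.pi / ε))
  rw [← ofReal_integral_eq_lintegral_ofReal hi (Eventually.of_forall fun s => by positivity),
    integral_const_mul, integral_gaussian, ← Real.sqrt_mul (by positivity)]
  congr 1
  have : Real.pi / ε * (Real.pi / (1 / (4 * ε))) = (2 * Real.pi) ^ 2 := by field_simp; ring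
  rw [this, Real.sqrt_sq (by positivity)]

lemma lintegral_gaussian_kernel_map {ν : Measure X} {φ : X → ℝ} (hφ : Measurable φ)
    {A : ℝ≥0∞} (hA : ν.map φ ≤ A • volume) {ε : ℝ} (hε : 0 < ε) (a : ℝ) :
    ∫⁻ ξ, ENNReal.ofReal (√(Real.pi / ε) * Real.exp (-(1 / (4 * ε)) * (a - φ ξ) ^ 2)) ∂ν
      ≤ A * ENNReal.ofReal (2 * Real.pi) := by
  have h1 := lintegral_map (μ := ν) (g := φ)
    (f := fun s => ENNReal.ofReal (√(Real.pi / ε) * Real.exp (-(1 / (4 * ε)) * (a - s) ^ 2)))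
    (by fun_prop) hφ
  rw [← h1]
  refine (lintegral_mono' hA le_rfl).trans ?_
  rw [lintegral_smul_measure, lintegral_gaussian_kernel hε, smul_eq_mul]

lemma measurable_oscInt {ν : Measure X} [SFinite ν] {φ : X → ℝ} (hφ : Measurable φ) {k : X → ℂ}
    (hk : Measurable k) : Measurable (oscInt ν φ k) := by
  have : StronglyMeasurable (Function.uncurry fun (y : ℝ) (ξ : X) =>
      Complex.exp (Complex.I * ((y * φ ξ : ℝ) : ℂ)) * k ξ) := by
    refine Measurable.stronglyMeasurable ?_
    unfold Function.uncurry
    fun_prop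
  exact this.integral_prod_right.measurable

/-- A TT* argument: expanding |∫e^{iyφ}k|² and integrating out y leaves the kernel γ(φ(ξ) - φ(η))
against k(ξ) times the conjugate of k(η). The density bound on φ limits the mass of each row to 2πA,
and Schur's test in the form 2ab ≤ a² + b² concludes. -/
lemma lintegral_gaussian_oscInt_le {ν : Measure X} [SFinite ν] {φ : X → ℝ} (hφ : Measurable φ)
    {A : ℝ≥0∞} (hA : ν.map φ ≤ A • volume) {k : X → ℂ} (hkm : Measurable k) (hk : Integrable k ν)
    {ε : ℝ} (hε : 0 < ε) :
    ∫⁻ y, ENNReal.ofReal (Real.exp (-ε * y ^ 2)) * ‖oscInt ν φ k y‖ₑ ^ 2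
      ≤ ENNReal.ofReal (2 * Real.pi) * A * ∫⁻ ξ, ‖k ξ‖ₑ ^ 2 ∂ν := by
  set γ : ℝ → ℝ := fun s => √(Real.pi / ε) * Real.exp (-(1 / (4 * ε)) * s ^ 2) with hγ
  have hγm : Measurable γ := by fun_prop
  have hγ0 : ∀ s, 0 ≤ γ s := fun s => by positivity
  let F : ℝ → X × X → ℂ := fun y p => ((Real.exp (-ε * y ^ 2) : ℝ) : ℂ) *
    ((Complex.exp (Complex.I * ((y * φ p.1 : ℝ) : ℂ)) * k p.1) *
      (starRingEnd ℂ) (Complex.exp (Complex.I * ((y * φ p.2 : ℝ) : ℂ)) * k p.2))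
  have hFe : ∀ y p, F y p = (Complex.exp (Complex.I * ((y * (φ p.1 - φ p.2) : ℝ) : ℂ)) *
      ((Real.exp (-ε * y ^ 2) : ℝ) : ℂ)) * (k p.1 * (starRingEnd ℂ) (k p.2)) := by
    intro y p
    have : (starRingEnd ℂ) (Complex.exp (Complex.I * ((y * φ p.2 : ℝ) : ℂ)))
        = Complex.exp (-(Complex.I * ((y * φ p.2 : ℝ) : ℂ))) := by
      rw [← Complex.exp_conj, map_mul, Complex.conj_I, Complex.conj_ofReal, neg_mul]
    simp only [F, map_mul, this]
    have e : Complex.exp (Complex.I * ((y * (φ p.1 - φ p.2) : ℝ) : ℂ))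
        = Complex.exp (Complex.I * ((y * φ p.1 : ℝ) : ℂ)) *
          Complex.exp (-(Complex.I * ((y * φ p.2 : ℝ) : ℂ))) := by
      rw [← Complex.exp_add]; congr 1; push_cast; ring
    rw [e]; ring
  have hkk : Integrable (fun p : X × X => k p.1 * (starRingEnd ℂ) (k p.2)) (ν.prod ν) := by
    refine Integrable.mul_prod (f := k) (g := fun η => (starRingEnd ℂ) (k η)) hk ?_
    exact (LinearIsometryEquiv.integrable_comp_iff (φ := k) Complex.conjLIE).2 hk
  have hgauss : Integrable (fun y : ℝ => ((Real.exp (-ε * y ^ 2) : ℝ) : ℂ)) :=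
    (integrable_exp_neg_mul_sq hε).ofReal
  have hFi : Integrable (Function.uncurry F) (volume.prod (ν.prod ν)) := by
    refine Integrable.mono (Integrable.mul_prod hgauss hkk) ?_ (Eventually.of_forall ?_)
    · refine Measurable.aestronglyMeasurable ?_
      have hc : Measurable (starRingEnd ℂ) := Complex.continuous_conj.measurable
      change Measurable fun q : ℝ × X × X => F q.1 q.2
      simp only [F]
      fun_prop
    · rintro ⟨y, p⟩
      simp only [Function.uncurry, hFe, norm_mul, norm_exp_I_mul_ofReal', one_mul]
      exact le_rfl
  have hv : ∀ y, ∫ p, F y p ∂(ν.prod ν) =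
      ((Real.exp (-ε * y ^ 2) * ‖oscInt ν φ k y‖ ^ 2 : ℝ) : ℂ) := by
    intro y
    simp only [F]
    rw [integral_const_mul]
    rw [integral_prod_mul (fun ξ => Complex.exp (Complex.I * ((y * φ ξ : ℝ) : ℂ)) * k ξ)
      (fun η => (starRingEnd ℂ) (Complex.exp (Complex.I * ((y * φ η : ℝ) : ℂ)) * k η)),
      integral_conj]
    change _ * (oscInt ν φ k y * (starRingEnd ℂ) (oscInt ν φ k y)) = _
    rw [Complex.mul_conj, Complex.normSq_eq_norm_sq]
    push_cast; rfl
  have hsw := integral_integral_swap hFi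
  have hinner : ∀ p : X × X, ∫ y, F y p = ((γ (φ p.1 - φ p.2) : ℝ) : ℂ) * (k p.1 * (starRingEnd ℂ) (k p.2)) := by
    intro p
    simp_rw [hFe]
    rw [integral_mul_const, integral_gaussian_oscillation hε]
  simp_rw [hv, hinner] at hsw
  rw [integral_complex_ofReal] at hsw
  have hint : Integrable (fun y => Real.exp (-ε * y ^ 2) * ‖oscInt ν φ k y‖ ^ 2) := by
    have h1 := hFi.integral_prod_left
    have h2 : (fun y => ∫ p, Function.uncurry F (y, p) ∂(ν.prod ν))
        = fun y => ((Real.exp (-ε * y ^ 2) * ‖oscInt ν φ k y‖ ^ 2 : ℝ) : ℂ) := funext hv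
    rw [h2] at h1
    exact h1.re.congr (Eventually.of_forall fun y => Complex.ofReal_re _)
  have hL : ∫⁻ y, ENNReal.ofReal (Real.exp (-ε * y ^ 2)) * ‖oscInt ν φ k y‖ₑ ^ 2
      = ENNReal.ofReal (∫ y, Real.exp (-ε * y ^ 2) * ‖oscInt ν φ k y‖ ^ 2) := by
    rw [ofReal_integral_eq_lintegral_ofReal hint (Eventually.of_forall fun y => by positivity)]
    refine lintegral_congr fun y => ?_
    rw [ENNReal.ofReal_mul (by positivity), ENNReal.ofReal_pow (norm_nonneg _), ofReal_norm]
  have hle : ENNReal.ofReal (∫ y, Real.exp (-ε * y ^ 2) * ‖oscInt ν φ k y‖ ^ 2)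
      ≤ ∫⁻ p, ENNReal.ofReal (γ (φ p.1 - φ p.2)) * (‖k p.1‖ₑ * ‖k p.2‖ₑ) ∂(ν.prod ν) := by
    have h0 : 0 ≤ ∫ y, Real.exp (-ε * y ^ 2) * ‖oscInt ν φ k y‖ ^ 2 :=
      integral_nonneg fun y => by positivity
    have h1 : ENNReal.ofReal (∫ y, Real.exp (-ε * y ^ 2) * ‖oscInt ν φ k y‖ ^ 2)
        = ‖((∫ y, Real.exp (-ε * y ^ 2) * ‖oscInt ν φ k y‖ ^ 2 : ℝ) : ℂ)‖ₑ := by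
      rw [← ofReal_norm, Complex.norm_real, Real.norm_of_nonneg h0]
    rw [h1, hsw]
    refine (enorm_integral_le_lintegral_enorm _).trans (lintegral_mono fun p => ?_)
    rw [enorm_mul, enorm_mul, ← ofReal_norm, Complex.norm_real, Real.norm_of_nonneg (hγ0 _)]
    simp only [← ofReal_norm, RCLike.norm_conj]
    exact le_rfl
  rw [hL]
  refine hle.trans ?_
  have hγsymm : ∀ s, γ (-s) = γ s := fun s => by simp [hγ]
  have hone : ∫⁻ p, ENNReal.ofReal (γ (φ p.1 - φ p.2)) * ‖k p.1‖ₑ ^ 2 ∂(ν.prod ν)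
      ≤ ENNReal.ofReal (2 * Real.pi) * A * ∫⁻ ξ, ‖k ξ‖ₑ ^ 2 ∂ν := by
    rw [lintegral_prod _ (by fun_prop), ← lintegral_const_mul _ (by fun_prop)]
    refine lintegral_mono fun ξ => ?_
    simp only
    rw [lintegral_mul_const _ (by fun_prop), mul_comm (ENNReal.ofReal (2 * Real.pi)) A]
    gcongr
    exact lintegral_gaussian_kernel_map hφ hA hε (φ ξ)
  -- The other half of Schur's test, by exchanging the variables and using that γ is even.
  have htwo : ∫⁻ p, ENNReal.ofReal (γ (φ p.1 - φ p.2)) * ‖k p.2‖ₑ ^ 2 ∂(ν.prod ν)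
      ≤ ENNReal.ofReal (2 * Real.pi) * A * ∫⁻ ξ, ‖k ξ‖ₑ ^ 2 ∂ν := by
    rw [← lintegral_prod_swap]
    refine le_trans (lintegral_mono fun p => ?_) hone
    simp only [Prod.fst_swap, Prod.snd_swap]
    rw [← hγsymm, neg_sub]
  have h2 : 2 * ∫⁻ p, ENNReal.ofReal (γ (φ p.1 - φ p.2)) * (‖k p.1‖ₑ * ‖k p.2‖ₑ) ∂(ν.prod ν)
      ≤ 2 * (ENNReal.ofReal (2 * Real.pi) * A * ∫⁻ ξ, ‖k ξ‖ₑ ^ 2 ∂ν) := by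
    rw [← lintegral_const_mul _ (by fun_prop)]
    calc ∫⁻ p, 2 * (ENNReal.ofReal (γ (φ p.1 - φ p.2)) * (‖k p.1‖ₑ * ‖k p.2‖ₑ)) ∂(ν.prod ν)
        ≤ ∫⁻ p, (ENNReal.ofReal (γ (φ p.1 - φ p.2)) * ‖k p.1‖ₑ ^ 2 +
            ENNReal.ofReal (γ (φ p.1 - φ p.2)) * ‖k p.2‖ₑ ^ 2) ∂(ν.prod ν) := by
          refine lintegral_mono fun p => ?_
          have := ennreal_two_mul_le ‖k p.1‖ₑ ‖k p.2‖ₑ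
          calc 2 * (ENNReal.ofReal (γ (φ p.1 - φ p.2)) * (‖k p.1‖ₑ * ‖k p.2‖ₑ))
              = ENNReal.ofReal (γ (φ p.1 - φ p.2)) * (2 * ‖k p.1‖ₑ * ‖k p.2‖ₑ) := by ring
            _ ≤ ENNReal.ofReal (γ (φ p.1 - φ p.2)) * (‖k p.1‖ₑ ^ 2 + ‖k p.2‖ₑ ^ 2) := by gcongr
            _ = _ := by ring
      _ = _ := lintegral_add_left (by fun_prop) _
      _ ≤ _ := by rw [two_mul]; exact add_le_add hone htwo
  exact (ENNReal.mul_le_mul_iff_right (by norm_num) (by norm_num)).1 h2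

/-- If the phase `φ` pushes `ν` to a measure with density at most `A`, then the oscillatory integral
is bounded from `L²(ν)` to `L²(ℝ)`. -/
lemma lintegral_oscInt_le {ν : Measure X} [SFinite ν] {φ : X → ℝ} (hφ : Measurable φ)
    {A : ℝ≥0∞} (hA : ν.map φ ≤ A • volume) {k : X → ℂ} (hkm : Measurable k) (hk : Integrable k ν) :
    ∫⁻ y, ‖oscInt ν φ k y‖ₑ ^ 2 ≤ ENNReal.ofReal (2 * Real.pi) * A * ∫⁻ ξ, ‖k ξ‖ₑ ^ 2 ∂ν := by
  have hm := measurable_oscInt (ν := ν) hφ hkm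
  -- The Gaussian weight with ε = 1/(n+1) increases to 1, and Fatou's lemma removes it.
  have hlim : ∀ y : ℝ, Tendsto (fun n : ℕ => ENNReal.ofReal (Real.exp (-(1 / ((n : ℝ) + 1)) * y ^ 2)) *
      ‖oscInt ν φ k y‖ₑ ^ 2) atTop (𝓝 (‖oscInt ν φ k y‖ₑ ^ 2)) := by
    intro y
    have h1 : Tendsto (fun n : ℕ => Real.exp (-(1 / ((n : ℝ) + 1)) * y ^ 2)) atTop (𝓝 1) := by
      have h2 := (tendsto_one_div_add_atTop_nhds_zero_nat (𝕜 := ℝ)).neg.mul_const (y ^ 2)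
      have h3 := (Real.continuous_exp.tendsto _).comp h2
      simpa [Function.comp_def] using h3
    have h4 := ENNReal.Tendsto.mul_const (b := ‖oscInt ν φ k y‖ₑ ^ 2) (ENNReal.tendsto_ofReal h1)
      (Or.inl (by simp))
    simpa using h4
  calc ∫⁻ y, ‖oscInt ν φ k y‖ₑ ^ 2
      = ∫⁻ y, liminf (fun n : ℕ => ENNReal.ofReal (Real.exp (-(1 / ((n : ℝ) + 1)) * y ^ 2)) *
          ‖oscInt ν φ k y‖ₑ ^ 2) atTop := lintegral_congr fun y => ((hlim y).liminf_eq).symm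
    _ ≤ liminf (fun n : ℕ => ∫⁻ y, ENNReal.ofReal (Real.exp (-(1 / ((n : ℝ) + 1)) * y ^ 2)) *
          ‖oscInt ν φ k y‖ₑ ^ 2) atTop := lintegral_liminf_le fun n => by fun_prop
    _ ≤ _ := by
      refine (liminf_le_liminf (v := fun _ => ENNReal.ofReal (2 * Real.pi) * A * ∫⁻ ξ, ‖k ξ‖ₑ ^ 2 ∂ν)
        (Eventually.of_forall fun n => ?_)).trans (liminf_const _).le
      exact lintegral_gaussian_oscInt_le hφ hA hkm hk (by positivity)

end SchurPlancherel

end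

end ExteriorNLS

/-! ### The cosine transform on L²(0,∞) -/

namespace ExteriorNLS

noncomputable section

section CosineTransform

open FourierTransform

/-- The cosine transform `√(2/π) ∫_0^∞ cos(λ x) f(x) dx`. -/
def cosFun (f : ℝ → ℂ) (lam : ℝ) : ℂ :=
  (√(2 / Real.pi) : ℂ) * ∫ x, (Real.cos (lam * x) : ℂ) * f x ∂halfLine

lemma cosFun_congr {f g : ℝ → ℂ} (h : f =ᵐ[halfLine] g) : cosFun f = cosFun g := by
  funext lam
  rw [cosFun, cosFun]
  congr 1
  refine integral_congr_ae ?_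
  filter_upwards [h] with x hx
  rw [hx]

lemma integrable_bdd_mul {c : ℝ → ℂ} (hc : Measurable c) {C : ℝ} (hC : ∀ x, ‖c x‖ ≤ C) {f : ℝ → ℂ}
    {μ : Measure ℝ} (hf : Integrable f μ) : Integrable (fun x => c x * f x) μ :=
  hf.bdd_mul hc.aestronglyMeasurable (Eventually.of_forall hC)

lemma norm_ofReal_cos_le (s : ℝ) : ‖((Real.cos s : ℝ) : ℂ)‖ ≤ 1 := by
  rw [Complex.norm_real]; exact Real.abs_cos_le_one s

lemma integrable_cos_mul {f : ℝ → ℂ} (hf : Integrable f halfLine) (lam : ℝ) :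
    Integrable (fun x => (Real.cos (lam * x) : ℂ) * f x) halfLine :=
  integrable_bdd_mul (by fun_prop) (fun _ => norm_ofReal_cos_le _) hf

lemma measurable_cosFun {f : ℝ → ℂ} (hf : AEStronglyMeasurable f halfLine) : Measurable (cosFun f) := by
  rw [cosFun_congr hf.ae_eq_mk]
  have hm : Measurable (hf.mk f) := hf.stronglyMeasurable_mk.measurable
  have : StronglyMeasurable (Function.uncurry fun (lam x : ℝ) =>
      (Real.cos (lam * x) : ℂ) * hf.mk f x) := by
    refine Measurable.stronglyMeasurable ?_
    unfold Function.uncurry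
    fun_prop
  exact this.integral_prod_right.measurable.const_mul _

lemma cosFun_eq_oscInt {f : ℝ → ℂ} (hf : Integrable f halfLine) (lam : ℝ) :
    cosFun f lam = (√(2 / Real.pi) : ℂ) *
      ((oscInt halfLine id f lam + oscInt halfLine id f (-lam)) / 2) := by
  have hi : ∀ y : ℝ, Integrable (fun x => Complex.exp (Complex.I * ((y * x : ℝ) : ℂ)) * f x) halfLine :=
    fun y => integrable_bdd_mul (by fun_prop) (fun x => (norm_exp_I_mul_ofReal' _).le) hf
  rw [cosFun, oscInt, oscInt]
  simp only [id]
  rw [← integral_add (hi lam) (hi (-lam)), ← integral_div]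
  congr 2
  funext x
  rw [Complex.ofReal_cos, Complex.cos]
  have e1 : Complex.I * ((lam * x : ℝ) : ℂ) = ((lam * x : ℝ) : ℂ) * Complex.I := mul_comm _ _
  have e2 : Complex.I * ((-lam * x : ℝ) : ℂ) = -((lam * x : ℝ) : ℂ) * Complex.I := by
    push_cast; ring
  rw [e1, e2]; ring

lemma lintegral_sq_eq_eLpNorm {α E : Type*} [MeasurableSpace α] [NormedAddCommGroup E]
    (f : α → E) (μ : Measure α) : ∫⁻ x, ‖f x‖ₑ ^ 2 ∂μ = eLpNorm f 2 μ ^ 2 := by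
  have h4 := eLpNorm_nnreal_pow_eq_lintegral (μ := μ) (f := f) (p := 2) (by norm_num)
  simpa using h4.symm

lemma lintegral_pow_eq_eLpNorm {α E : Type*} [MeasurableSpace α] [ENorm E]
    (f : α → E) (μ : Measure α) {k : ℕ} (hk : k ≠ 0) :
    ∫⁻ x, ‖f x‖ₑ ^ k ∂μ = eLpNorm f k μ ^ k := by
  have h4 := eLpNorm_nnreal_pow_eq_lintegral (μ := μ) (f := f) (p := k) (by exact_mod_cast hk)
  simpa using h4.symm

/-- The cosine is the mean of two exponentials, each covered by `lintegral_oscInt_le` with A = 1.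
The constant is not sharp but suffices to extend the transform to L²; the exact isometry follows
later from inversion and symmetry. -/
lemma lintegral_cosFun_le {f : ℝ → ℂ} (hf : Integrable f halfLine) :
    ∫⁻ lam, ‖cosFun f lam‖ₑ ^ 2 ∂halfLine ≤ 4 * ∫⁻ x, ‖f x‖ₑ ^ 2 ∂halfLine := by
  have hae := hf.aestronglyMeasurable
  set g := hae.mk f with hg
  have hgm : Measurable g := hae.stronglyMeasurable_mk.measurable
  have hgi : Integrable g halfLine := hf.congr hae.ae_eq_mk
  have e1 : ∫⁻ x, ‖f x‖ₑ ^ 2 ∂halfLine = ∫⁻ x, ‖g x‖ₑ ^ 2 ∂halfLine := by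
    refine lintegral_congr_ae ?_
    filter_upwards [hae.ae_eq_mk] with x hx
    rw [hx]
  rw [e1, cosFun_congr hae.ae_eq_mk]
  have hA : halfLine.map id ≤ (1 : ℝ≥0∞) • volume := by
    rw [Measure.map_id, one_smul]; exact Measure.restrict_le_self
  have hO := lintegral_oscInt_le (ν := halfLine) measurable_id hA hgm hgi
  have hOm := measurable_oscInt (ν := halfLine) measurable_id hgm
  rw [mul_one] at hO
  have hpt : ∀ lam, ‖cosFun g lam‖ₑ ^ 2 ≤ ENNReal.ofReal (1 / Real.pi) *
      (‖oscInt halfLine id g lam‖ₑ ^ 2 + ‖oscInt halfLine id g (-lam)‖ₑ ^ 2) := by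
    intro lam
    rw [cosFun_eq_oscInt hgi]
    simp only [← ofReal_norm, ← ENNReal.ofReal_pow (norm_nonneg _)]
    rw [← ENNReal.ofReal_add (by positivity) (by positivity), ← ENNReal.ofReal_mul (by positivity)]
    refine ENNReal.ofReal_le_ofReal ?_
    rw [norm_mul, norm_div, Complex.norm_real, Real.norm_of_nonneg (Real.sqrt_nonneg _), mul_pow,
      Real.sq_sqrt (by positivity), Complex.norm_ofNat, div_pow]
    have h1 := norm_add_le (oscInt halfLine id g lam) (oscInt halfLine id g (-lam))
    set a := ‖oscInt halfLine id g lam‖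
    set b := ‖oscInt halfLine id g (-lam)‖
    have h2 : ‖oscInt halfLine id g lam + oscInt halfLine id g (-lam)‖ ^ 2 ≤ (a + b) ^ 2 := by gcongr
    have h3 : (a + b) ^ 2 ≤ 2 * (a ^ 2 + b ^ 2) := by nlinarith [sq_nonneg (a - b)]
    calc 2 / Real.pi * (‖oscInt halfLine id g lam + oscInt halfLine id g (-lam)‖ ^ 2 / 2 ^ 2)
        ≤ 2 / Real.pi * (2 * (a ^ 2 + b ^ 2) / 2 ^ 2) := by gcongr; exact h2.trans h3
      _ = _ := by ring
  have hneg : ∫⁻ lam, ‖oscInt halfLine id g (-lam)‖ₑ ^ 2 = ∫⁻ lam, ‖oscInt halfLine id g lam‖ₑ ^ 2 :=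
    lintegral_neg_eq_self (fun lam => ‖oscInt halfLine id g lam‖ₑ ^ 2)
  calc ∫⁻ lam, ‖cosFun g lam‖ₑ ^ 2 ∂halfLine
      ≤ ∫⁻ lam, ‖cosFun g lam‖ₑ ^ 2 := lintegral_mono' Measure.restrict_le_self le_rfl
    _ ≤ ∫⁻ lam, ENNReal.ofReal (1 / Real.pi) *
      (‖oscInt halfLine id g lam‖ₑ ^ 2 + ‖oscInt halfLine id g (-lam)‖ₑ ^ 2) := lintegral_mono hpt
    _ = ENNReal.ofReal (1 / Real.pi) * (2 * ∫⁻ lam, ‖oscInt halfLine id g lam‖ₑ ^ 2) := by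
        rw [lintegral_const_mul _ (by fun_prop), lintegral_add_left (by fun_prop), hneg, two_mul]
    _ ≤ ENNReal.ofReal (1 / Real.pi) * (2 * (ENNReal.ofReal (2 * Real.pi) *
          ∫⁻ x, ‖g x‖ₑ ^ 2 ∂halfLine)) := by gcongr
    _ = 4 * ∫⁻ x, ‖g x‖ₑ ^ 2 ∂halfLine := by
        rw [← mul_assoc, ← mul_assoc]
        congr 1
        rw [← ENNReal.ofReal_ofNat 2, ← ENNReal.ofReal_mul (by positivity),
          ← ENNReal.ofReal_mul (by positivity), ← ENNReal.ofReal_ofNat 4]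
        congr 1
        have := Real.pi_pos
        field_simp; norm_num

lemma eLpNorm_cosFun_le {f : ℝ → ℂ} (hf : Integrable f halfLine) :
    eLpNorm (cosFun f) 2 halfLine ≤ 2 * eLpNorm f 2 halfLine := by
  refine (ennreal_pow_le_pow_iff (n := 2) (by norm_num)).1 ?_
  rw [mul_pow, ← lintegral_sq_eq_eLpNorm, ← lintegral_sq_eq_eLpNorm]
  refine (lintegral_cosFun_le hf).trans_eq ?_
  norm_num

lemma memLp_cosFun {f : ℝ → ℂ} (hf : Integrable f halfLine) (hf2 : MemLp f 2 halfLine) :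
    MemLp (cosFun f) 2 halfLine :=
  ⟨(measurable_cosFun hf.aestronglyMeasurable).aestronglyMeasurable,
    (eLpNorm_cosFun_le hf).trans_lt (ENNReal.mul_lt_top (by norm_num) hf2.eLpNorm_lt_top)⟩

/-- Functions that are integrable and square integrable on the half-line. -/
def integrableSq : Submodule ℂ (ℝ → ℂ) where
  carrier := {f | Integrable f halfLine ∧ MemLp f 2 halfLine}
  zero_mem' := ⟨integrable_zero _ _ _, MemLp.zero⟩
  add_mem' := fun h h' => ⟨h.1.add h'.1, h.2.add h'.2⟩
  smul_mem' := fun c _ h => ⟨h.1.smul c, h.2.const_smul c⟩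

/-- The class of a function in `integrableSq`. -/
def integrableSqToLp : integrableSq →ₗ[ℂ] HL2 where
  toFun f := f.2.2.toLp f.1
  map_add' _ _ := rfl
  map_smul' _ _ := rfl

/-- The cosine transform on `integrableSq`. -/
def cosLin : integrableSq →ₗ[ℂ] HL2 where
  toFun f := (memLp_cosFun f.2.1 f.2.2).toLp _
  map_add' f g := by
    rw [← MemLp.toLp_add]
    refine MemLp.toLp_congr _ _ (Eventually.of_forall fun lam => ?_)
    simp only [cosFun, Submodule.coe_add, Pi.add_apply]
    rw [← mul_add, ← integral_add (integrable_cos_mul f.2.1 lam) (integrable_cos_mul g.2.1 lam)]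
    simp only [mul_add]
  map_smul' c f := by
    rw [RingHom.id_apply, ← MemLp.toLp_const_smul]
    refine MemLp.toLp_congr _ _ (Eventually.of_forall fun lam => ?_)
    simp only [cosFun, Submodule.coe_smul, Pi.smul_apply, smul_eq_mul]
    have : (fun x => (Real.cos (lam * x) : ℂ) * (c * f.1 x))
        = fun x => c * ((Real.cos (lam * x) : ℂ) * f.1 x) := by
      funext x; ring
    rw [this, integral_const_mul]
    ring

lemma norm_cosLin_le (f : integrableSq) : ‖cosLin f‖ ≤ 2 * ‖integrableSqToLp f‖ := by
  change ‖(memLp_cosFun f.2.1 f.2.2).toLp _‖ ≤ 2 * ‖f.2.2.toLp f.1‖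
  rw [Lp.norm_toLp, Lp.norm_toLp]
  have := ENNReal.toReal_mono (ENNReal.mul_ne_top (by norm_num) f.2.2.eLpNorm_ne_top)
    (eLpNorm_cosFun_le f.2.1)
  simpa using this

lemma IsHalfTest.mem_integrableSq {g : ℝ → ℂ} (hg : IsHalfTest g) : g ∈ integrableSq :=
  ⟨memLp_one_iff_integrable.1 (hg.memLp 1), hg.memLp 2⟩

lemma denseRange_integrableSqToLp : DenseRange integrableSqToLp := by
  intro p
  refine HL2.induction_deriv (P := fun p => p ∈ closure (Set.range integrableSqToLp))
    isClosed_closure ?_ p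
  intro w hw p hp
  refine subset_closure ⟨⟨deriv w, hw.deriv.mem_integrableSq⟩, ?_⟩
  change (hw.deriv.memLp 2).toLp _ = p
  exact Lp.ext ((hw.deriv.memLp 2).coeFn_toLp.trans hp.symm)

/-- The cosine transform on `L²(0, ∞)`. -/
def cosT : HL2 →L[ℂ] HL2 := cosLin.extendOfNorm integrableSqToLp

lemma cosT_toLp {f : ℝ → ℂ} (hf : Integrable f halfLine) (hf2 : MemLp f 2 halfLine) :
    cosT (hf2.toLp f) = (memLp_cosFun hf hf2).toLp _ :=
  LinearMap.extendOfNorm_eq denseRange_integrableSqToLp ⟨2, norm_cosLin_le⟩ ⟨f, hf, hf2⟩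

lemma coeFn_cosT {p : HL2} {f : ℝ → ℂ} (hp : p =ᵐ[halfLine] f) (hf : Integrable f halfLine) :
    cosT p =ᵐ[halfLine] cosFun f := by
  have hf2 : MemLp f 2 halfLine := (memLp_congr_ae hp).1 (Lp.memLp p)
  have : p = hf2.toLp f := Lp.ext (hp.trans hf2.coeFn_toLp.symm)
  rw [this, cosT_toLp hf hf2]
  exact MemLp.coeFn_toLp _

lemma fourier_even {F : ℝ → ℂ} (hF : Integrable F) (he : ∀ x, F (-x) = F x) (w : ℝ) :
    𝓕 F w = 2 * ∫ v, (Real.cos (2 * Real.pi * w * v) : ℂ) * F v ∂halfLine := by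
  rw [Real.fourier_real_eq_integral_exp_smul]
  simp only [smul_eq_mul]
  set h : ℝ → ℂ := fun v => Complex.exp (↑(-2 * Real.pi * v * w) * Complex.I) * F v with hh
  have hi : Integrable h :=
    integrable_bdd_mul (by fun_prop) (fun x => (Complex.norm_exp_ofReal_mul_I _).le) hF
  have hi' : Integrable fun v => h (-v) := hi.comp_neg
  rw [← intervalIntegral.integral_Iic_add_Ioi (b := 0) hi.integrableOn hi.integrableOn]
  have h1 := integral_comp_neg_Ioi 0 h
  rw [neg_zero] at h1
  rw [← h1, ← integral_add hi'.integrableOn hi.integrableOn, ← integral_const_mul]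
  refine integral_congr_ae (Eventually.of_forall fun v => ?_)
  simp only [hh, he]
  rw [Complex.ofReal_cos, Complex.cos]
  have e1 : ((-2 * Real.pi * -v * w : ℝ) : ℂ) = ((2 * Real.pi * w * v : ℝ) : ℂ) := by
    congr 1; ring
  have e2 : ((-2 * Real.pi * v * w : ℝ) : ℂ) = -((2 * Real.pi * w * v : ℝ) : ℂ) := by
    rw [← Complex.ofReal_neg]; congr 1; ring
  rw [e1, e2]; ring

/-- The even extension g(x) + g(-x) is a Schwartz function, and its Fourier transform, with
frequencies rescaled by 2π, is a multiple of the cosine transform of g. Fourier inversion then says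
that the cosine transform is an involution. -/
lemma cosFun_inversion {g : ℝ → ℂ} (hg : IsHalfTest g) :
    Integrable (cosFun g) halfLine ∧ ∀ x, 0 < x → cosFun (cosFun g) x = g x := by
  have hgn : ContDiff ℝ ∞ fun x => g (-x) := hg.smooth.comp contDiff_neg
  have hgc : HasCompactSupport fun x => g (-x) := hg.compact.comp_homeomorph (Homeomorph.neg ℝ)
  let E : SchwartzMap ℝ ℂ := (hg.compact.add hgc).toSchwartzMap (hg.smooth.add hgn)
  have hE : ∀ x, E x = g x + g (-x) := fun x => rfl
  have hEe : ∀ x, E (-x) = E x := fun x => by rw [hE, hE, neg_neg, add_comm]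
  have hEi : Integrable (E : ℝ → ℂ) := E.integrable
  have hFc : ((𝓕 E : SchwartzMap ℝ ℂ) : ℝ → ℂ) = 𝓕 (E : ℝ → ℂ) := SchwartzMap.fourier_coe E
  have hFi : Integrable (𝓕 (E : ℝ → ℂ)) := by rw [← hFc]; exact (𝓕 E).integrable
  have hFe : ∀ w, 𝓕 (E : ℝ → ℂ) (-w) = 𝓕 (E : ℝ → ℂ) w := by
    intro w
    rw [fourier_even hEi hEe, fourier_even hEi hEe]
    congr 2
    funext v
    rw [show 2 * Real.pi * -w * v = -(2 * Real.pi * w * v) by ring, Real.cos_neg]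
  have hpi := Real.pi_pos
  have hc : cosFun g = fun lam => ((√(2 / Real.pi) / 2 : ℝ) : ℂ) * 𝓕 (E : ℝ → ℂ) (lam / (2 * Real.pi)) := by
    funext lam
    rw [fourier_even hEi hEe, cosFun]
    have : ∫ x, (Real.cos (lam * x) : ℂ) * g x ∂halfLine
        = ∫ v, (Real.cos (2 * Real.pi * (lam / (2 * Real.pi)) * v) : ℂ) * E v ∂halfLine := by
      refine integral_congr_ae (ae_halfLine_of_forall fun x hx => ?_)
      simp only
      rw [hE, hg.eq_zero (x := -x) (by linarith), add_zero, mul_div_cancel₀ _ (by positivity)]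
    rw [this]
    push_cast
    ring
  constructor
  · rw [hc]
    have : Integrable fun lam : ℝ => 𝓕 (E : ℝ → ℂ) (lam / (2 * Real.pi)) :=
      hFi.comp_div (by positivity)
    exact (this.const_mul _).restrict
  · intro x hx
    have hinv : 𝓕 (𝓕 (E : ℝ → ℂ)) x = g x := by
      have h1 := E.continuous.fourierInv_fourier_eq hEi hFi
      have h2 := congrFun h1 (-x)
      rw [Real.fourierInv_eq_fourier_neg, neg_neg, hEe] at h2
      rw [h2, hE, hg.eq_zero (x := -x) (by linarith), add_zero]
    rw [← hinv, fourier_even hFi hFe, hc, cosFun]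
    have h3 := integral_comp_mul_left_Ioi
      (fun lam => (Real.cos (x * lam) : ℂ) * 𝓕 (E : ℝ → ℂ) (lam / (2 * Real.pi))) 0
      (b := 2 * Real.pi) (by positivity)
    rw [mul_zero] at h3
    have h4 : ∫ v, (Real.cos (2 * Real.pi * x * v) : ℂ) * 𝓕 (E : ℝ → ℂ) v ∂halfLine
        = (2 * Real.pi)⁻¹ • ∫ lam, (Real.cos (x * lam) : ℂ) * 𝓕 (E : ℝ → ℂ) (lam / (2 * Real.pi)) ∂halfLine := by
      rw [← h3]
      refine integral_congr_ae (Eventually.of_forall fun v => ?_)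
      simp only
      rw [mul_div_cancel_left₀ _ (by positivity : (2 * Real.pi) ≠ 0)]
      congr 3; ring
    rw [h4, Complex.real_smul]
    have h5 : ∫ lam, (Real.cos (x * lam) : ℂ) * (((√(2 / Real.pi) / 2 : ℝ) : ℂ) *
        𝓕 (E : ℝ → ℂ) (lam / (2 * Real.pi))) ∂halfLine = ((√(2 / Real.pi) / 2 : ℝ) : ℂ) *
        ∫ lam, (Real.cos (x * lam) : ℂ) * 𝓕 (E : ℝ → ℂ) (lam / (2 * Real.pi)) ∂halfLine := by
      rw [← integral_const_mul]
      refine integral_congr_ae (Eventually.of_forall fun v => ?_)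
      simp only; ring
    rw [h5, ← mul_assoc, ← mul_assoc]
    congr 1
    have h6 : √(2 / Real.pi) * (√(2 / Real.pi) / 2) = 2 * (2 * Real.pi)⁻¹ := by
      rw [← mul_div_assoc, Real.mul_self_sqrt (by positivity)]
      field_simp
    exact_mod_cast h6

lemma cosT_cosT (p : HL2) : cosT (cosT p) = p := by
  refine HL2.induction_deriv (P := fun p => cosT (cosT p) = p)
    (isClosed_eq (by fun_prop) continuous_id) ?_ p
  intro w hw p hp
  have h1 := cosFun_inversion hw.deriv
  have h2 := coeFn_cosT hp hw.deriv.mem_integrableSq.1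
  refine Lp.ext ((coeFn_cosT h2 h1.1).trans ?_)
  refine EventuallyEq.trans ?_ hp.symm
  exact ae_halfLine_of_forall h1.2

lemma integral_cosFun_mul {f g : ℝ → ℂ} (hf : Integrable f halfLine) (hg : Integrable g halfLine) :
    ∫ lam, cosFun f lam * g lam ∂halfLine = ∫ x, f x * cosFun g x ∂halfLine := by
  have hi : Integrable (Function.uncurry fun (lam x : ℝ) => (Real.cos (lam * x) : ℂ) * f x * g lam)
      (halfLine.prod halfLine) := by
    have h1 := (Integrable.mul_prod hg hf).bdd_mul (c := 1)
      (f := fun q : ℝ × ℝ => (Real.cos (q.1 * q.2) : ℂ))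
      (by refine Measurable.aestronglyMeasurable ?_; fun_prop)
      (Eventually.of_forall fun q => norm_ofReal_cos_le _)
    refine h1.congr (Eventually.of_forall fun q => ?_)
    simp only [Function.uncurry]; ring
  have h := integral_integral_swap hi
  have e1 : ∀ lam, cosFun f lam * g lam
      = (√(2 / Real.pi) : ℂ) * ∫ x, (Real.cos (lam * x) : ℂ) * f x * g lam ∂halfLine := by
    intro lam
    rw [integral_mul_const, cosFun]; ring
  have e2 : ∀ x, f x * cosFun g x
      = (√(2 / Real.pi) : ℂ) * ∫ lam, (Real.cos (lam * x) : ℂ) * f x * g lam ∂halfLine := by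
    intro x
    rw [cosFun, mul_left_comm, ← integral_const_mul]
    congr 2
    funext lam
    rw [mul_comm x lam]; ring
  simp_rw [e1, e2]
  rw [integral_const_mul, integral_const_mul, h]

lemma cosFun_conj (f : ℝ → ℂ) (lam : ℝ) :
    cosFun (fun x => (starRingEnd ℂ) (f x)) lam = (starRingEnd ℂ) (cosFun f lam) := by
  simp only [cosFun, map_mul, Complex.conj_ofReal]
  rw [← integral_conj]
  simp only [map_mul, Complex.conj_ofReal]

/-- The kernel cos(λx) is real and symmetric: Fubini on derivatives of test functions, then density
in each slot. -/
lemma inner_cosT_left (p q : HL2) : inner ℂ (cosT p) q = inner ℂ p (cosT q) := by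
  refine HL2.induction_deriv (P := fun p => ∀ q, inner ℂ (cosT p) q = inner ℂ p (cosT q)) ?_ ?_ p q
  · simp only [Set.ofPred_forall]
    exact isClosed_iInter fun q => isClosed_eq (by fun_prop) (by fun_prop)
  intro w hw p hp q
  refine HL2.induction_deriv (P := fun q => inner ℂ (cosT p) q = inner ℂ p (cosT q)) ?_ ?_ q
  · exact isClosed_eq (by fun_prop) (by fun_prop)
  intro v hv q hq
  have h1 := coeFn_cosT hp hw.deriv.mem_integrableSq.1
  have h2 := coeFn_cosT hq hv.deriv.mem_integrableSq.1
  rw [L2.inner_def, L2.inner_def]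
  have hci : Integrable (fun x => (starRingEnd ℂ) (deriv w x)) halfLine :=
    (LinearIsometryEquiv.integrable_comp_iff (φ := deriv w) Complex.conjLIE).2
      hw.deriv.mem_integrableSq.1
  have h3 := integral_cosFun_mul hci hv.deriv.mem_integrableSq.1
  have e1 : ∫ x, inner ℂ (cosT p x) (q x) ∂halfLine
      = ∫ lam, cosFun (fun x => (starRingEnd ℂ) (deriv w x)) lam * deriv v lam ∂halfLine := by
    refine integral_congr_ae ?_
    filter_upwards [h1, hq] with x hx hx'
    rw [hx, hx', cosFun_conj, RCLike.inner_apply, mul_comm]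
  have e2 : ∫ x, inner ℂ (p x) (cosT q x) ∂halfLine
      = ∫ x, (starRingEnd ℂ) (deriv w x) * cosFun (deriv v) x ∂halfLine := by
    refine integral_congr_ae ?_
    filter_upwards [h2, hp] with x hx hx'
    rw [hx, hx', RCLike.inner_apply, mul_comm]
  rw [e1, e2, h3]

/-- A self-adjoint involution is an isometry. -/
lemma norm_cosT (p : HL2) : ‖cosT p‖ = ‖p‖ := by
  have h : inner ℂ (cosT p) (cosT p) = inner ℂ p p := by rw [inner_cosT_left, cosT_cosT]
  rw [inner_self_eq_norm_sq_to_K, inner_self_eq_norm_sq_to_K] at h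
  have h2 : ‖cosT p‖ ^ 2 = ‖p‖ ^ 2 := by exact_mod_cast h
  rwa [sq_eq_sq₀ (norm_nonneg _) (norm_nonneg _)] at h2

/-- The primitive of a cosine transform is a sine transform. -/
lemma prim_cosT (m : HL2) {x : ℝ} (hx : 0 ≤ x) :
    prim (cosT m) x = (√(2 / Real.pi) : ℂ) *
      ∫ lam, ((Real.sin (lam * x) / lam : ℝ) : ℂ) * m lam ∂halfLine := by
  have hfin : halfLine (Set.Ioc 0 x) ≠ ⊤ :=
    (lt_of_le_of_lt (Measure.restrict_apply_le _ _) (by simp)).ne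
  have h := L2.inner_indicatorConstLp_one (𝕜 := ℂ) (μ := halfLine) measurableSet_Ioc hfin (cosT m)
  rw [Ioc_restrict_halfLine le_rfl] at h
  -- The primitive at x is the pairing with the indicator of (0, x]. Self-adjointness moves the
  -- transform onto the indicator, where it is √(2/π) sin(λx)/λ.
  rw [prim, ← h, ← inner_cosT_left, L2.inner_def]
  have h1 : (indicatorConstLp 2 measurableSet_Ioc hfin (1 : ℂ) : HL2) =ᵐ[halfLine]
      (Set.Ioc 0 x).indicator fun _ => (1 : ℂ) := indicatorConstLp_coeFn
  have hi : Integrable ((Set.Ioc 0 x).indicator fun _ => (1 : ℂ)) halfLine :=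
    (integrable_indicator_iff measurableSet_Ioc).2 (integrableOn_const hfin (by simp))
  have h2 := coeFn_cosT h1 hi
  have h3 : ∀ lam : ℝ, 0 < lam → cosFun ((Set.Ioc 0 x).indicator fun _ => (1 : ℂ)) lam
      = (√(2 / Real.pi) : ℂ) * ((Real.sin (lam * x) / lam : ℝ) : ℂ) := by
    intro lam hlam
    rw [cosFun]
    congr 1
    have e1 : (fun y => (Real.cos (lam * y) : ℂ) * (Set.Ioc 0 x).indicator (fun _ => (1 : ℂ)) y)
        = (Set.Ioc 0 x).indicator fun y => (Real.cos (lam * y) : ℂ) := by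
      funext y
      by_cases hy : y ∈ Set.Ioc 0 x <;> simp [hy]
    rw [e1, integral_indicator measurableSet_Ioc, Ioc_restrict_halfLine le_rfl, integral_complex_ofReal,
      ← intervalIntegral.integral_of_le hx, intervalIntegral.integral_comp_mul_left _ hlam.ne',
      integral_cos]
    simp [div_eq_inv_mul]
  rw [← integral_const_mul]
  refine integral_congr_ae ?_
  filter_upwards [h2, ae_halfLine_of_forall h3] with lam h4 h5
  rw [h4, h5, RCLike.inner_apply, map_mul, Complex.conj_ofReal, Complex.conj_ofReal]
  ring

lemma memLp_bdd_mul {m : ℝ → ℂ} (hm : Measurable m) {C : ℝ} (hC : ∀ x, ‖m x‖ ≤ C) (p : HL2) :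
    MemLp (fun x => m x * p x) 2 halfLine :=
  (Lp.memLp p).of_le_mul (hm.mul (measurable_HL2 p)).aestronglyMeasurable
    (Eventually.of_forall fun x => by rw [norm_mul]; gcongr; exact hC x)

/-- Multiplication by a bounded measurable function on `L²(0, ∞)`. -/
def mulOp (m : ℝ → ℂ) (hm : Measurable m) (C : ℝ) (hC : ∀ x, ‖m x‖ ≤ C) : HL2 →L[ℂ] HL2 :=
  LinearMap.mkContinuous
    { toFun := fun p => (memLp_bdd_mul hm hC p).toLp _
      map_add' := fun p q => by
        rw [← MemLp.toLp_add]
        refine MemLp.toLp_congr (memLp_bdd_mul hm hC (p + q))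
          ((memLp_bdd_mul hm hC p).add (memLp_bdd_mul hm hC q)) ?_
        filter_upwards [Lp.coeFn_add p q] with x hx
        simp only [hx, Pi.add_apply, mul_add]
      map_smul' := fun c p => by
        rw [RingHom.id_apply, ← MemLp.toLp_const_smul]
        refine MemLp.toLp_congr (memLp_bdd_mul hm hC (c • p))
          ((memLp_bdd_mul hm hC p).const_smul c) ?_
        filter_upwards [Lp.coeFn_smul c p] with x hx
        simp only [hx, Pi.smul_apply, smul_eq_mul]
        ring } C fun p => by
    change ‖(memLp_bdd_mul hm hC p).toLp _‖ ≤ C * ‖p‖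
    have hC0 : 0 ≤ C := (norm_nonneg _).trans (hC 0)
    refine Lp.norm_le_mul_norm_of_ae_le_mul ?_
    filter_upwards [(memLp_bdd_mul hm hC p).coeFn_toLp] with x hx
    rw [hx, norm_mul]
    gcongr
    exact hC x

lemma coeFn_mulOp {m : ℝ → ℂ} {hm : Measurable m} {C : ℝ} {hC : ∀ x, ‖m x‖ ≤ C} (p : HL2) :
    mulOp m hm C hC p =ᵐ[halfLine] fun x => m x * p x :=
  (memLp_bdd_mul hm hC p).coeFn_toLp

lemma norm_mulOp_le {m : ℝ → ℂ} {hm : Measurable m} {C : ℝ} {hC : ∀ x, ‖m x‖ ≤ C} (p : HL2) :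
    ‖mulOp m hm C hC p‖ ≤ C * ‖p‖ :=
  (mulOp m hm C hC).le_of_opNorm_le
    (LinearMap.mkContinuous_norm_le _ ((norm_nonneg _).trans (hC 0)) _) p

end CosineTransform

end

end ExteriorNLS

/-! ### The free flow on the half-line -/

namespace ExteriorNLS

noncomputable section

section Propagator

/-- Dominated convergence with majorant (2C)²|p|². It gives the strong continuity of the flow and
the convergence of the frequency cut-offs. -/
lemma tendsto_mulOp {ι : Type*} {l : Filter ι} [l.IsCountablyGenerated] {M : ι → ℝ → ℂ}
    {hM : ∀ i, Measurable (M i)} {C : ℝ} {hC : ∀ i x, ‖M i x‖ ≤ C} {m : ℝ → ℂ} {hm : Measurable m}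
    {hC' : ∀ x, ‖m x‖ ≤ C} (h : ∀ x, 0 < x → Tendsto (fun i => M i x) l (𝓝 (m x))) (p : HL2) :
    Tendsto (fun i => mulOp (M i) (hM i) C (hC i) p) l (𝓝 (mulOp m hm C hC' p)) := by
  rw [tendsto_iff_norm_sub_tendsto_zero]
  have hC0 : 0 ≤ C := (norm_nonneg _).trans (hC' 0)
  have e : ∀ i, ‖mulOp (M i) (hM i) C (hC i) p - mulOp m hm C hC' p‖ ^ 2
      = ∫ x, ‖(M i x - m x) * p x‖ ^ 2 ∂halfLine := by
    intro i
    rw [norm_sq_eq_integral]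
    refine integral_congr_ae ?_
    filter_upwards [Lp.coeFn_sub (mulOp (M i) (hM i) C (hC i) p) (mulOp m hm C hC' p),
      coeFn_mulOp (hm := hM i) (hC := hC i) p, coeFn_mulOp (hm := hm) (hC := hC') p] with x h1 h2 h3
    rw [h1, Pi.sub_apply, h2, h3, sub_mul]
  have hp2 : Integrable (fun x => ‖p x‖ ^ 2) halfLine := (Lp.memLp p).integrable_norm_pow (by norm_num)
  have key : Tendsto (fun i => ∫ x, ‖(M i x - m x) * p x‖ ^ 2 ∂halfLine) l (𝓝 (∫ x, (0 : ℝ) ∂halfLine)) := by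
    refine tendsto_integral_filter_of_dominated_convergence (fun x => (2 * C) ^ 2 * ‖p x‖ ^ 2)
      (Eventually.of_forall fun i => ?_) (Eventually.of_forall fun i => ?_) (hp2.const_mul _)
      (ae_halfLine_of_forall fun x hx => ?_)
    · exact ((((hM i).sub hm).mul (measurable_HL2 p)).norm.pow_const 2).aestronglyMeasurable
    · refine Eventually.of_forall fun x => ?_
      rw [Real.norm_of_nonneg (by positivity), norm_mul, mul_pow]
      gcongr
      calc ‖M i x - m x‖ ≤ ‖M i x‖ + ‖m x‖ := norm_sub_le _ _
        _ ≤ 2 * C := by linarith [hC i x, hC' x]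
    · have h1 : Tendsto (fun i => ‖(M i x - m x) * p x‖ ^ 2) l (𝓝 (‖(m x - m x) * p x‖ ^ 2)) :=
        ((((h x hx).sub_const _).mul_const _).norm).pow 2
      simpa using h1
  rw [integral_zero] at key
  have h2 := key.sqrt
  simp_rw [← e, Real.sqrt_sq (norm_nonneg _), Real.sqrt_zero] at h2
  exact h2

/-- The phase `e^{-iλ²t}`. -/
def phase (t lam : ℝ) : ℂ := Complex.exp (-(Complex.I * (lam : ℂ) ^ 2 * (t : ℂ)))

lemma norm_phase (t lam : ℝ) : ‖phase t lam‖ = 1 := by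
  have : -(Complex.I * (lam : ℂ) ^ 2 * (t : ℂ)) = ((-(lam ^ 2 * t) : ℝ) : ℂ) * Complex.I := by
    push_cast; ring
  rw [phase, this]; exact Complex.norm_exp_ofReal_mul_I _

lemma continuous_phase : Continuous fun q : ℝ × ℝ => phase q.1 q.2 := by
  unfold phase; fun_prop

lemma measurable_phase (t : ℝ) : Measurable (phase t) :=
  (continuous_phase.comp (by fun_prop : Continuous fun lam : ℝ => (t, lam))).measurable

lemma phase_zero (lam : ℝ) : phase 0 lam = 1 := by simp [phase]

lemma phase_add (s t lam : ℝ) : phase (s + t) lam = phase s lam * phase t lam := by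
  rw [phase, phase, phase, ← Complex.exp_add]; congr 1; push_cast; ring

/-- Multiplication by the phase `e^{-iλ²t}`. -/
def phaseOp (t : ℝ) : HL2 →L[ℂ] HL2 :=
  mulOp (phase t) (measurable_phase t) 1 fun x => (norm_phase t x).le

lemma coeFn_phaseOp (t : ℝ) (p : HL2) : phaseOp t p =ᵐ[halfLine] fun x => phase t x * p x :=
  coeFn_mulOp p

/-- The free propagator on the half-line, acting on derivatives. -/
def flow (t : ℝ) : HL2 →L[ℂ] HL2 := cosT ∘L phaseOp t ∘L cosT

lemma flow_apply (t : ℝ) (p : HL2) : flow t p = cosT (phaseOp t (cosT p)) := rfl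

lemma phaseOp_add (s t : ℝ) (p : HL2) : phaseOp (s + t) p = phaseOp s (phaseOp t p) := by
  refine Lp.ext ?_
  filter_upwards [coeFn_phaseOp (s + t) p, coeFn_phaseOp s (phaseOp t p), coeFn_phaseOp t p]
    with x h1 h2 h3
  rw [h1, h2, h3, phase_add, mul_assoc]

lemma phaseOp_zero (p : HL2) : phaseOp 0 p = p := by
  refine Lp.ext ?_
  filter_upwards [coeFn_phaseOp 0 p] with x h1
  rw [h1, phase_zero, one_mul]

lemma flow_zero (p : HL2) : flow 0 p = p := by rw [flow_apply, phaseOp_zero, cosT_cosT]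

lemma flow_add (s t : ℝ) (p : HL2) : flow (s + t) p = flow s (flow t p) := by
  simp only [flow_apply, cosT_cosT, phaseOp_add]

lemma flow_neg_flow (t : ℝ) (p : HL2) : flow (-t) (flow t p) = p := by
  rw [← flow_add, neg_add_cancel, flow_zero]

lemma flow_flow_neg (t : ℝ) (p : HL2) : flow t (flow (-t) p) = p := by
  rw [← flow_add, add_neg_cancel, flow_zero]

lemma norm_flow (t : ℝ) (p : HL2) : ‖flow t p‖ = ‖p‖ := by
  have h : ∀ t p, ‖flow t p‖ ≤ ‖p‖ := fun t p => by
    rw [flow_apply, norm_cosT]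
    refine (norm_mulOp_le _).trans ?_
    rw [one_mul, norm_cosT]
  refine le_antisymm (h t p) ?_
  calc ‖p‖ = ‖flow (-t) (flow t p)‖ := by rw [flow_neg_flow]
    _ ≤ _ := h _ _

lemma continuous_flow_apply (p : HL2) : Continuous fun t => flow t p := by
  rw [continuous_iff_continuousAt]
  intro t
  refine (cosT.continuous.tendsto _).comp ?_
  exact tendsto_mulOp (M := phase) (hM := measurable_phase) (C := 1)
    (hC := fun t x => (norm_phase t x).le) (m := phase t) (hm := measurable_phase t)
    (hC' := fun x => (norm_phase t x).le) (l := 𝓝 t) (fun x _ =>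
    (continuous_phase.comp (by fun_prop : Continuous fun t : ℝ => (t, x))).tendsto t) (cosT p)

/-- Strong continuity becomes joint continuity because the flow is isometric: the error q - p is
transported without growth. -/
lemma tendsto_flow {ι : Type*} {l : Filter ι} {τ : ι → ℝ} {q : ι → HL2} {t : ℝ} {p : HL2}
    (hτ : Tendsto τ l (𝓝 t)) (hq : Tendsto q l (𝓝 p)) :
    Tendsto (fun i => flow (τ i) (q i)) l (𝓝 (flow t p)) := by
  have h1 : Tendsto (fun i => flow (τ i) p) l (𝓝 (flow t p)) :=
    ((continuous_flow_apply p).tendsto t).comp hτ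
  have h2 : Tendsto (fun i => flow (τ i) (q i - p)) l (𝓝 0) := by
    rw [tendsto_zero_iff_norm_tendsto_zero]
    simp_rw [norm_flow]
    exact tendsto_iff_norm_sub_tendsto_zero.1 hq
  have h3 := h2.add h1
  simpa using h3

lemma continuous_flow {X : Type*} [TopologicalSpace X] {τ : X → ℝ} {q : X → HL2}
    (hτ : Continuous τ) (hq : Continuous q) : Continuous fun i => flow (τ i) (q i) :=
  continuous_iff_continuousAt.2 fun i => tendsto_flow (hτ.tendsto i) (hq.tendsto i)

lemma inner_phaseOp (t : ℝ) (p q : HL2) : inner ℂ (phaseOp t p) q = inner ℂ p (phaseOp (-t) q) := by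
  rw [L2.inner_def, L2.inner_def]
  refine integral_congr_ae ?_
  filter_upwards [coeFn_phaseOp t p, coeFn_phaseOp (-t) q] with x h1 h2
  rw [h1, h2, RCLike.inner_apply, RCLike.inner_apply, map_mul]
  have : (starRingEnd ℂ) (phase t x) = phase (-t) x := by
    rw [phase, phase, ← Complex.exp_conj]
    congr 1
    simp
  rw [this]; ring

lemma inner_flow (t : ℝ) (p q : HL2) : inner ℂ (flow t p) q = inner ℂ p (flow (-t) q) := by
  rw [flow_apply, flow_apply, inner_cosT_left, inner_phaseOp, inner_cosT_left]

end Propagator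

/-! ### Integration by parts and recovery of p from the function -/

section IntegrationByParts

lemma continuous_integral_mul {G : ℝ → ℂ} (hG : MemLp G 2 halfLine) :
    Continuous fun d : HL2 => ∫ x, G x * d x ∂halfLine := by
  have hc : MemLp (fun x => (starRingEnd ℂ) (G x)) 2 halfLine := hG.star
  have : (fun d : HL2 => ∫ x, G x * d x ∂halfLine) = fun d : HL2 => inner ℂ (hc.toLp _) d := by
    funext d
    rw [L2.inner_def]
    refine integral_congr_ae ?_
    filter_upwards [hc.coeFn_toLp] with x hx
    rw [hx, RCLike.inner_apply, Complex.conj_conj, mul_comm]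
  rw [this]
  fun_prop

lemma memLp_indicator_Ioc {G : ℝ → ℂ} (hG : Continuous G) (X : ℝ) :
    MemLp ((Set.Ioc 0 X).indicator G) 2 halfLine := by
  obtain ⟨M, hM⟩ := (isCompact_Icc (a := (0 : ℝ)) (b := X)).exists_bound_of_continuousOn hG.continuousOn
  have h1 : MemLp ((Set.Ioc 0 X).indicator fun _ => M) 2 halfLine :=
    memLp_indicator_const 2 measurableSet_Ioc M (Or.inr
      (lt_of_le_of_lt (Measure.restrict_apply_le _ _) (by simp)).ne)
  refine h1.of_le ((hG.measurable.indicator measurableSet_Ioc).aestronglyMeasurable)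
    (Eventually.of_forall fun x => ?_)
  by_cases hx : x ∈ Set.Ioc 0 X
  · simp only [hx, Set.indicator_of_mem]
    exact (hM x ⟨hx.1.le, hx.2⟩).trans (le_abs_self M)
  · simp [hx]

lemma integral_indicator_mul (G d : ℝ → ℂ) (X : ℝ) :
    ∫ x, (Set.Ioc 0 X).indicator G x * d x ∂halfLine = ∫ x in Set.Ioc 0 X, G x * d x := by
  rw [← Ioc_restrict_halfLine le_rfl, ← integral_indicator measurableSet_Ioc]
  refine integral_congr_ae (Eventually.of_forall fun x => ?_)
  by_cases hx : x ∈ Set.Ioc 0 X <;> simp [hx]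

/-- Integration by parts on `(0, X]` against a primitive. -/
lemma integral_mul_eq_prim {v : ℝ → ℂ} (hv : ContDiff ℝ 1 v) (d : HL2) {X : ℝ} (hX : 0 ≤ X) :
    ∫ x in Set.Ioc 0 X, v x * d x = v X * prim d X - ∫ x in Set.Ioc 0 X, deriv v x * prim d x := by
  have hv' : Continuous (deriv v) := hv.continuous_deriv le_rfl
  -- The primitive is (1+x) times `hardy d`; this turns the last integral into an L² pairing,
  -- continuous in d, so that the identity may be checked on derivatives of test functions.
  have hpr : ∀ d : HL2, ∫ x in Set.Ioc 0 X, deriv v x * prim d x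
      = ∫ x, (Set.Ioc 0 X).indicator (fun x => deriv v x * ((1 + x : ℝ) : ℂ)) x * hardy d x ∂halfLine := by
    intro d
    rw [integral_indicator_mul]
    refine integral_congr_ae ?_
    filter_upwards [ae_Ioc_of_ae_halfLine (coeFn_hardy d) (b := X) le_rfl,
      ae_restrict_mem measurableSet_Ioc] with x hx hx'
    have : ((1 + x : ℝ) : ℂ) ≠ 0 := by
      have : (1 + x : ℝ) ≠ 0 := by linarith [hx'.1]
      exact_mod_cast this
    rw [hx, profile]
    field_simp
  refine HL2.induction_deriv (P := fun d : HL2 => ∫ x in Set.Ioc 0 X, v x * d x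
    = v X * prim d X - ∫ x in Set.Ioc 0 X, deriv v x * prim d x) ?_ ?_ d
  · refine isClosed_eq ?_ ?_
    · have e : (fun d : HL2 => ∫ x in Set.Ioc 0 X, v x * d x)
          = fun d : HL2 => ∫ x, (Set.Ioc 0 X).indicator v x * d x ∂halfLine :=
        funext fun d => (integral_indicator_mul v d X).symm
      rw [e]
      exact continuous_integral_mul (memLp_indicator_Ioc hv.continuous X)
    · have e : (fun d : HL2 => v X * prim d X - ∫ x in Set.Ioc 0 X, deriv v x * prim d x)
          = fun d : HL2 => v X * prim d X - ∫ x, (Set.Ioc 0 X).indicator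
            (fun x => deriv v x * ((1 + x : ℝ) : ℂ)) x * hardy d x ∂halfLine :=
        funext fun d => by rw [hpr]
      rw [e]
      refine ((continuous_prim_apply X).const_mul _).sub ?_
      exact (continuous_integral_mul (memLp_indicator_Ioc (by fun_prop) X)).comp hardy.continuous
  · intro w hw d hd
    have h := intervalIntegral.integral_mul_deriv_eq_deriv_mul (a := 0) (b := X) (u := v) (v := w)
      (u' := deriv v) (v' := deriv w)
      (fun x _ => (hv.differentiable (by norm_num) x).hasDerivAt)
      (fun x _ => (hw.differentiable x).hasDerivAt)
      (hv'.intervalIntegrable _ _) (hw.deriv.smooth.continuous.intervalIntegrable _ _)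
    rw [hw.eq_zero le_rfl, mul_zero, sub_zero, intervalIntegral.integral_of_le hX,
      intervalIntegral.integral_of_le hX] at h
    have e1 : ∫ x in Set.Ioc 0 X, v x * d x = ∫ x in Set.Ioc 0 X, v x * deriv w x := by
      refine integral_congr_ae ?_
      filter_upwards [ae_Ioc_of_ae_halfLine hd (b := X) le_rfl] with x hx
      rw [hx]
    have e2 : ∫ x in Set.Ioc 0 X, deriv v x * prim d x = ∫ x in Set.Ioc 0 X, deriv v x * w x := by
      refine setIntegral_congr_fun measurableSet_Ioc fun x hx => ?_
      rw [prim_congr hd, prim_deriv hw hx.1.le]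
    rw [e1, e2, h, prim_congr hd, prim_deriv hw hX]

/-- Integrating by parts against derivatives of test functions leaves only the primitive of d, so d
is orthogonal to a dense set. -/
lemma eq_zero_of_prim_eq_zero (d : HL2) (h : ∀ x, 0 < x → prim d x = 0) : d = 0 := by
  have key : ∀ q : HL2, inner ℂ q d = 0 := by
    refine HL2.induction_deriv (isClosed_eq (by fun_prop) continuous_const) ?_
    intro w hw q hq
    obtain ⟨a, b, ha, hab, hz⟩ := hw.deriv.exists_bound
    have hX : 0 ≤ b := ha.le.trans hab
    have hcs : ContDiff ℝ 1 fun x => (starRingEnd ℂ) (deriv w x) :=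
      Complex.conjCLE.contDiff.comp (hw.deriv.smooth.of_le (by norm_cast))
    have h1 := integral_mul_eq_prim hcs d (X := b) hX
    have h2 : ∫ x in Set.Ioc 0 b, deriv (fun x => (starRingEnd ℂ) (deriv w x)) x * prim d x = 0 :=
      setIntegral_eq_zero_of_forall_eq_zero fun x hx => by rw [h x hx.1, mul_zero]
    rw [h2, h b (ha.trans_le hab), mul_zero, sub_zero] at h1
    rw [L2.inner_def, ← h1, ← integral_indicator_mul]
    refine integral_congr_ae ?_
    filter_upwards [hq, ae_halfLine_of_forall (P := fun x => 0 < x) (fun x hx => hx)] with x hx hx0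
    rw [hx, RCLike.inner_apply]
    by_cases hxb : x ∈ Set.Ioc 0 b
    · simp [hxb, mul_comm]
    · have : deriv w x = 0 := hz x fun hc => hxb ⟨hx0, hc.2⟩
      simp [this]
  exact inner_self_eq_zero.1 (key d)

/-- The function determines the continuous primitive of p, hence p and the gradient. Therefore the
choices made in `propagator` and `nonlinearity`, which constrain only the function, are determined
as soon as a witness exists. -/
lemma fn_injective : Function.Injective RadialHdot.fn := by
  intro f g hfg
  obtain ⟨p, rfl⟩ := lift.surjective f
  obtain ⟨q, rfl⟩ := lift.surjective g
  congr 1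
  have h1 : radialFn p =ᵐ[volOmega] radialFn q :=
    (fn_lift p).symm.trans (hfg ▸ fn_lift q)
  have h2 : ∀ᵐ x ∂halfLine, profile p x = profile q x :=
    ae_halfLine_of_ae_volOmega (measurableSet_eq_fun (measurable_profile p) (measurable_profile q)) h1
  have h3 : ∀ᵐ x ∂halfLine, prim p x = prim q x := by
    filter_upwards [h2, ae_halfLine_of_forall (P := fun x => 0 < x) (fun x hx => hx)] with x hx hx0
    have : ((1 + x : ℝ) : ℂ) ≠ 0 := by
      have : (1 + x : ℝ) ≠ 0 := by linarith
      exact_mod_cast this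
    rw [profile, profile] at hx
    field_simp at hx
    exact hx
  have h4 : Set.EqOn (prim p) (prim q) (Set.Ioi 0) :=
    Measure.eqOn_open_of_ae_eq h3 isOpen_Ioi (continuous_prim p).continuousOn (continuous_prim q).continuousOn
  refine sub_eq_zero.1 (eq_zero_of_prim_eq_zero (p - q) fun x hx => ?_)
  rw [prim_sub, h4 hx, sub_self]

end IntegrationByParts

/-! ### The nonlinearity as a locally Lipschitz map of L²(0,∞) -/

section Nonlinearity

open scoped ComplexConjugate

/-- The derivative of `r |u|⁴ u` in terms of `p = (r u)'`. -/
def nlFun (p : ℝ → ℂ) (x : ℝ) : ℂ :=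
  3 * (profile p x ^ 2 * conj (profile p x) ^ 2) * p x +
    2 * (profile p x ^ 3 * conj (profile p x)) * conj (p x) -
    4 * (profile p x ^ 3 * conj (profile p x) ^ 2)

lemma norm_nlFun_le (p : ℝ → ℂ) (x : ℝ) :
    ‖nlFun p x‖ ≤ 5 * ‖profile p x‖ ^ 4 * ‖p x‖ + 4 * ‖profile p x‖ ^ 5 := by
  refine (norm_sub_le _ _).trans ((add_le_add_left (norm_add_le _ _) _).trans_eq ?_)
  simp only [norm_mul, norm_pow, RCLike.norm_conj, Complex.norm_ofNat]
  ring

lemma measurable_nlFun (p : HL2) : Measurable (nlFun p) := by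
  have h1 := measurable_profile p
  have h2 := measurable_HL2 p
  have hc : Measurable (conj : ℂ → ℂ) := Complex.continuous_conj.measurable
  unfold nlFun
  fun_prop

lemma norm_pow_sub_pow_le' {a b : ℂ} {R : ℝ} (ha : ‖a‖ ≤ R) (hb : ‖b‖ ≤ R) (n : ℕ) :
    ‖a ^ (n + 1) - b ^ (n + 1)‖ ≤ (n + 1) * R ^ n * ‖a - b‖ := by
  induction n with
  | zero => simp
  | succ n ih =>
    have hR : 0 ≤ R := (norm_nonneg _).trans ha
    have e : a ^ (n + 1 + 1) - b ^ (n + 1 + 1) = a * (a ^ (n + 1) - b ^ (n + 1)) + (a - b) * b ^ (n + 1) := by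
      ring
    rw [e]
    refine (norm_add_le _ _).trans ?_
    rw [norm_mul, norm_mul, norm_pow]
    calc ‖a‖ * ‖a ^ (n + 1) - b ^ (n + 1)‖ + ‖a - b‖ * ‖b‖ ^ (n + 1)
        ≤ R * ((n + 1) * R ^ n * ‖a - b‖) + ‖a - b‖ * R ^ (n + 1) := by gcongr
      _ = _ := by push_cast; ring

lemma norm_monomial_sub_le {a b : ℂ} {R : ℝ} (ha : ‖a‖ ≤ R) (hb : ‖b‖ ≤ R) (m n : ℕ) :
    ‖a ^ (m + 1) * conj a ^ (n + 1) - b ^ (m + 1) * conj b ^ (n + 1)‖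
      ≤ (m + n + 2) * R ^ (m + n + 1) * ‖a - b‖ := by
  have hR : 0 ≤ R := (norm_nonneg _).trans ha
  have e : a ^ (m + 1) * conj a ^ (n + 1) - b ^ (m + 1) * conj b ^ (n + 1)
      = (a ^ (m + 1) - b ^ (m + 1)) * conj a ^ (n + 1) + b ^ (m + 1) * conj (a ^ (n + 1) - b ^ (n + 1)) := by
    rw [map_sub, map_pow, map_pow]; ring
  rw [e]
  refine (norm_add_le _ _).trans ?_
  rw [norm_mul, norm_mul, norm_pow, norm_pow, RCLike.norm_conj, RCLike.norm_conj]
  calc ‖a ^ (m + 1) - b ^ (m + 1)‖ * ‖a‖ ^ (n + 1) + ‖b‖ ^ (m + 1) * ‖a ^ (n + 1) - b ^ (n + 1)‖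
      ≤ ((m + 1) * R ^ m * ‖a - b‖) * R ^ (n + 1) + R ^ (m + 1) * ((n + 1) * R ^ n * ‖a - b‖) := by
        gcongr
        · exact norm_pow_sub_pow_le' ha hb m
        · exact norm_pow_sub_pow_le' ha hb n
    _ = _ := by ring

/-- Telescoping: the difference falls on p with coefficient (3+2)R⁴, on a quartic monomial in u with
3·4 + 2·4 = 20, or on the quintic monomial with 4·5 = 20. -/
lemma norm_nlFun_sub_le {p q : HL2} {R : ℝ} (hp : ‖p‖ ≤ R) (hq : ‖q‖ ≤ R) {x : ℝ} (hx : 0 ≤ x) :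
    ‖nlFun p x - nlFun q x‖ ≤ 5 * R ^ 4 * ‖p x - q x‖ + 20 * R ^ 3 * ‖p - q‖ * ‖q x‖ +
      20 * R ^ 4 * ‖profile (p - q : HL2) x‖ := by
  have hR : 0 ≤ R := (norm_nonneg _).trans hp
  set a := profile p x with ha
  set b := profile q x with hb
  have haR : ‖a‖ ≤ R := (norm_profile_le' p hx).trans hp
  have hbR : ‖b‖ ≤ R := (norm_profile_le' q hx).trans hq
  have hd : ‖a - b‖ ≤ ‖p - q‖ := by
    rw [ha, hb, ← profile_sub]; exact norm_profile_le' _ hx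
  have e : nlFun p x - nlFun q x =
      3 * (a ^ 2 * conj a ^ 2) * (p x - q x) + 3 * (a ^ 2 * conj a ^ 2 - b ^ 2 * conj b ^ 2) * q x +
      (2 * (a ^ 3 * conj a) * conj (p x - q x) + 2 * (a ^ 3 * conj a - b ^ 3 * conj b) * conj (q x)) -
      4 * (a ^ 3 * conj a ^ 2 - b ^ 3 * conj b ^ 2) := by
    rw [nlFun, nlFun, ← ha, ← hb, map_sub]; ring
  have m1 := norm_monomial_sub_le haR hbR 1 1
  have m2 := norm_monomial_sub_le haR hbR 2 0
  have m3 := norm_monomial_sub_le haR hbR 2 1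
  norm_num at m1 m2 m3
  rw [e, profile_sub, ← ha, ← hb]
  refine (norm_sub_le _ _).trans ?_
  refine (add_le_add_left ((norm_add_le _ _).trans (add_le_add (norm_add_le _ _) (norm_add_le _ _))) _).trans ?_
  simp only [norm_mul, norm_pow, RCLike.norm_conj, Complex.norm_ofNat]
  have a4 : ‖a‖ ^ 2 * ‖a‖ ^ 2 ≤ R ^ 4 := by
    calc ‖a‖ ^ 2 * ‖a‖ ^ 2 = ‖a‖ ^ 4 := by ring
      _ ≤ R ^ 4 := by gcongr
  have a4' : ‖a‖ ^ 3 * ‖a‖ ≤ R ^ 4 := by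
    calc ‖a‖ ^ 3 * ‖a‖ = ‖a‖ ^ 4 := by ring
      _ ≤ R ^ 4 := by gcongr
  have m1' : ‖a ^ 2 * conj a ^ 2 - b ^ 2 * conj b ^ 2‖ ≤ 4 * R ^ 3 * ‖p - q‖ :=
    m1.trans (by gcongr)
  have m2' : ‖a ^ 3 * conj a - b ^ 3 * conj b‖ ≤ 4 * R ^ 3 * ‖p - q‖ :=
    m2.trans (by gcongr)
  calc 3 * (‖a‖ ^ 2 * ‖a‖ ^ 2) * ‖p x - q x‖ + 3 * ‖a ^ 2 * conj a ^ 2 - b ^ 2 * conj b ^ 2‖ * ‖q x‖ +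
      (2 * (‖a‖ ^ 3 * ‖a‖) * ‖p x - q x‖ + 2 * ‖a ^ 3 * conj a - b ^ 3 * conj b‖ * ‖q x‖) +
      4 * ‖a ^ 3 * conj a ^ 2 - b ^ 3 * conj b ^ 2‖
      ≤ 3 * R ^ 4 * ‖p x - q x‖ + 3 * (4 * R ^ 3 * ‖p - q‖) * ‖q x‖ +
      (2 * R ^ 4 * ‖p x - q x‖ + 2 * (4 * R ^ 3 * ‖p - q‖) * ‖q x‖) +
      4 * (5 * R ^ 4 * ‖a - b‖) := by gcongr
    _ = _ := by ring

lemma memLp_nlFun (p : HL2) : MemLp (nlFun p) 2 halfLine := by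
  have h1 : MemLp (fun x => 5 * ‖p‖ ^ 4 * ‖p x‖ + 4 * ‖p‖ ^ 4 * ‖profile p x‖) 2 halfLine :=
    ((Lp.memLp p).norm.const_mul _).add ((memLp_profile p).norm.const_mul _)
  refine h1.of_le (measurable_nlFun p).aestronglyMeasurable (ae_halfLine_of_forall fun x hx => ?_)
  rw [Real.norm_of_nonneg (by positivity)]
  refine (norm_nlFun_le p x).trans ?_
  have := norm_profile_le' p hx.le
  calc 5 * ‖profile p x‖ ^ 4 * ‖p x‖ + 4 * ‖profile p x‖ ^ 5
      = 5 * ‖profile p x‖ ^ 4 * ‖p x‖ + 4 * ‖profile p x‖ ^ 4 * ‖profile p x‖ := by ring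
    _ ≤ _ := by gcongr

/-- The nonlinearity on the half-line, acting on derivatives. -/
def nl (p : HL2) : HL2 := (memLp_nlFun p).toLp _

lemma coeFn_nl (p : HL2) : nl p =ᵐ[halfLine] nlFun p := (memLp_nlFun p).coeFn_toLp

/-- The constant is 65 = 5 + 20 + 2·20, the last term through Hardy's inequality. Being locally
Lipschitz on the energy space itself is what reduces existence to an ordinary differential equation.
-/
lemma norm_nl_sub_le {p q : HL2} {R : ℝ} (hp : ‖p‖ ≤ R) (hq : ‖q‖ ≤ R) :
    ‖nl p - nl q‖ ≤ 65 * R ^ 4 * ‖p - q‖ := by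
  have hR : 0 ≤ R := (norm_nonneg _).trans hp
  have g1 : MemLp (fun x => 5 * R ^ 4 * ‖(p - q : HL2) x‖) 2 halfLine := (Lp.memLp (p - q)).norm.const_mul _
  have g2 : MemLp (fun x => 20 * R ^ 3 * ‖p - q‖ * ‖q x‖) 2 halfLine := (Lp.memLp q).norm.const_mul _
  have g3 : MemLp (fun x => 20 * R ^ 4 * ‖profile (p - q : HL2) x‖) 2 halfLine :=
    (memLp_profile (p - q)).norm.const_mul _
  have key : ‖nl p - nl q‖ ≤ ‖g1.toLp _ + g2.toLp _ + g3.toLp _‖ := by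
    refine Lp.norm_le_norm_of_ae_le ?_
    filter_upwards [Lp.coeFn_sub (nl p) (nl q), coeFn_nl p, coeFn_nl q, Lp.coeFn_add (g1.toLp _ + g2.toLp _) (g3.toLp _),
      Lp.coeFn_add (g1.toLp _) (g2.toLp _), g1.coeFn_toLp, g2.coeFn_toLp, g3.coeFn_toLp, Lp.coeFn_sub p q,
      ae_halfLine_of_forall (P := fun x => 0 < x) (fun x hx => hx)] with x h1 h2 h3 h4 h5 h6 h7 h8 h9 h10
    rw [h1, Pi.sub_apply, h2, h3, h4, Pi.add_apply, h5, Pi.add_apply, h6, h7, h8, h9, Pi.sub_apply]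
    exact (norm_nlFun_sub_le hp hq h10.le).trans (le_abs_self _)
  have n1 : ‖g1.toLp _‖ ≤ 5 * R ^ 4 * ‖p - q‖ := by
    refine Lp.norm_le_mul_norm_of_ae_le_mul ?_
    filter_upwards [g1.coeFn_toLp] with x hx
    rw [hx, Real.norm_of_nonneg (by positivity)]
  have n2 : ‖g2.toLp _‖ ≤ 20 * R ^ 3 * ‖p - q‖ * ‖q‖ := by
    refine Lp.norm_le_mul_norm_of_ae_le_mul ?_
    filter_upwards [g2.coeFn_toLp] with x hx
    rw [hx, Real.norm_of_nonneg (by positivity)]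
  have n3 : ‖g3.toLp _‖ ≤ 20 * R ^ 4 * ‖hardy (p - q)‖ := by
    refine Lp.norm_le_mul_norm_of_ae_le_mul ?_
    filter_upwards [g3.coeFn_toLp, coeFn_hardy (p - q)] with x hx hx'
    rw [hx, hx', Real.norm_of_nonneg (by positivity)]
  have n4 := norm_hardy_le (p - q)
  calc ‖nl p - nl q‖ ≤ ‖g1.toLp _‖ + ‖g2.toLp _‖ + ‖g3.toLp _‖ := key.trans (norm_add₃_le)
    _ ≤ 5 * R ^ 4 * ‖p - q‖ + 20 * R ^ 3 * ‖p - q‖ * ‖q‖ + 20 * R ^ 4 * ‖hardy (p - q)‖ := by gcongr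
    _ ≤ 5 * R ^ 4 * ‖p - q‖ + 20 * R ^ 3 * ‖p - q‖ * R + 20 * R ^ 4 * (2 * ‖p - q‖) := by gcongr
    _ = _ := by ring

lemma nl_zero : nl 0 = 0 := by
  refine Lp.ext ?_
  have h0 : ∀ x, profile (0 : HL2) x = 0 := fun x => by
    have := prim_smul 0 (0 : HL2) x
    rw [zero_smul, zero_mul] at this
    rw [profile, this, zero_div]
  filter_upwards [coeFn_nl 0, Lp.coeFn_zero ℂ 2 halfLine] with x h1 h2
  rw [h1, h2, nlFun, h0]; simp

lemma norm_nl_le (p : HL2) : ‖nl p‖ ≤ 65 * ‖p‖ ^ 5 := by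
  have := norm_nl_sub_le (p := p) (q := 0) (R := ‖p‖) le_rfl (by simp)
  rw [nl_zero, sub_zero, sub_zero] at this
  exact this.trans_eq (by ring)

lemma continuous_nl : Continuous nl := by
  rw [continuous_iff_continuousAt]
  intro p
  refine tendsto_iff_norm_sub_tendsto_zero.2 ?_
  have hlim : Tendsto (fun q => 65 * (‖p‖ + 1) ^ 4 * ‖q - p‖) (𝓝 p) (𝓝 0) := by
    have : Continuous fun q => 65 * (‖p‖ + 1) ^ 4 * ‖q - p‖ := by fun_prop
    simpa using this.tendsto p
  refine squeeze_zero' (Eventually.of_forall fun _ => norm_nonneg _) ?_ hlim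
  filter_upwards [Metric.ball_mem_nhds p one_pos] with q hq
  refine norm_nl_sub_le ?_ (by linarith)
  have h1 : ‖q - p‖ < 1 := by simpa [dist_eq_norm] using hq
  have := norm_le_norm_add_norm_sub' q p
  linarith

lemma hasDerivAt_monomial {u : ℝ → ℂ} {u' : ℂ} {x : ℝ} (hu : HasDerivAt u u' x) :
    HasDerivAt (fun y => u y ^ 3 * conj (u y) ^ 2)
      (3 * u x ^ 2 * u' * conj (u x) ^ 2 + u x ^ 3 * (2 * conj (u x) * conj u')) x := by
  have h1 := hu.fun_pow 3
  have h2 : HasDerivAt (fun y => conj (u y)) (conj u') x := hu.star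
  have h3 := h2.fun_pow 2
  have := h1.mul h3
  refine HasDerivAt.congr_deriv this ?_
  push_cast
  ring

/-- With u' = (p - u)/(1+x), the product rule applied to (1+x)|u|⁴u yields `nlFun`; the
undifferentiated terms add up to 1 - 3 - 2 = -4. Both sides are continuous in p, so derivatives of
test functions suffice. -/
lemma prim_nl (p : HL2) {x : ℝ} (hx : 0 ≤ x) :
    prim (nl p) x = ((1 + x : ℝ) : ℂ) * (profile p x ^ 3 * conj (profile p x) ^ 2) := by
  refine HL2.induction_deriv (P := fun p : HL2 => prim (nl p) x
    = ((1 + x : ℝ) : ℂ) * (profile p x ^ 3 * conj (profile p x) ^ 2)) ?_ ?_ p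
  · have h1 := continuous_profile_apply x
    exact isClosed_eq ((continuous_prim_apply x).comp continuous_nl)
      (continuous_const.mul ((h1.pow 3).mul ((Complex.continuous_conj.comp h1).pow 2)))
  · intro w hw p hp
    set u : ℝ → ℂ := fun y => w y / ((1 + y : ℝ) : ℂ) with hu
    have hne : ∀ y : ℝ, 0 ≤ y → ((1 + y : ℝ) : ℂ) ≠ 0 := fun y hy => by
      have : (1 + y : ℝ) ≠ 0 := by linarith
      exact_mod_cast this
    have hprof : ∀ y, 0 ≤ y → profile p y = u y := fun y hy => profile_test hw hp hy
    have hr : ∀ y : ℝ, HasDerivAt (fun y : ℝ => ((1 + y : ℝ) : ℂ)) 1 y := fun y => by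
      simpa using ((hasDerivAt_id y).const_add 1).ofReal_comp
    have hud : ∀ y, 0 ≤ y → HasDerivAt u ((deriv w y - u y) / ((1 + y : ℝ) : ℂ)) y := by
      intro y hy
      have := (hw.differentiable y).hasDerivAt.div (hr y) (hne y hy)
      refine HasDerivAt.congr_deriv this ?_
      have := hne y hy
      simp only [hu]
      field_simp
    set n : ℝ → ℂ := fun y => 3 * (u y ^ 2 * conj (u y) ^ 2) * deriv w y +
      2 * (u y ^ 3 * conj (u y)) * conj (deriv w y) - 4 * (u y ^ 3 * conj (u y) ^ 2) with hn
    have hZ : ∀ y, 0 ≤ y → HasDerivAt (fun y : ℝ => ((1 + y : ℝ) : ℂ) * (u y ^ 3 * conj (u y) ^ 2)) (n y) y := by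
      intro y hy
      have := (hr y).mul (hasDerivAt_monomial (hud y hy))
      refine HasDerivAt.congr_deriv this ?_
      have := hne y hy
      simp only [hn, map_div₀, map_sub, Complex.conj_ofReal]
      field_simp
      ring
    have huc : ContinuousOn u (Set.Icc 0 x) := fun y hy => (hud y hy.1).continuousAt.continuousWithinAt
    have hcc : ContinuousOn (fun y => conj (u y)) (Set.Icc 0 x) :=
      Complex.continuous_conj.comp_continuousOn huc
    have hwc : Continuous (deriv w) := hw.deriv.smooth.continuous
    have hwcc : Continuous fun y => conj (deriv w y) := Complex.continuous_conj.comp hwc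
    have hnc : ContinuousOn n (Set.Icc 0 x) := by
      simp only [hn]
      fun_prop
    have hF := intervalIntegral.integral_eq_sub_of_hasDerivAt (a := 0) (b := x)
      (f := fun y : ℝ => ((1 + y : ℝ) : ℂ) * (u y ^ 3 * conj (u y) ^ 2)) (f' := n)
      (fun y hy => hZ y (by rw [Set.uIcc_of_le hx] at hy; exact hy.1))
      (by rw [intervalIntegrable_iff_integrableOn_Icc_of_le hx]; exact hnc.integrableOn_Icc)
    have hu0 : u 0 = 0 := by simp [hu, hw.eq_zero le_rfl]
    rw [intervalIntegral.integral_of_le hx, hu0] at hF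
    rw [hprof x hx]
    have e1 : prim (nl p) x = ∫ y in Set.Ioc 0 x, n y := by
      refine integral_congr_ae ?_
      filter_upwards [ae_Ioc_of_ae_halfLine (coeFn_nl p) (b := x) le_rfl,
        ae_Ioc_of_ae_halfLine hp (b := x) le_rfl, ae_restrict_mem measurableSet_Ioc] with y h1 h2 h3
      rw [h1, nlFun, hprof y h3.1.le, h2]
    rw [e1, hF]
    simp

lemma profile_nl (p : HL2) {x : ℝ} (hx : 0 ≤ x) :
    profile (nl p) x = ((‖profile p x‖ ^ 4 : ℝ) : ℂ) * profile p x := by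
  have : ((1 + x : ℝ) : ℂ) ≠ 0 := by
    have : (1 + x : ℝ) ≠ 0 := by linarith
    exact_mod_cast this
  rw [profile, prim_nl p hx, mul_div_cancel_left₀ _ this]
  have h := Complex.mul_conj (profile p x)
  rw [Complex.normSq_eq_norm_sq] at h
  calc profile p x ^ 3 * conj (profile p x) ^ 2
      = (profile p x * conj (profile p x)) ^ 2 * profile p x := by ring
    _ = _ := by rw [h]; push_cast; ring

lemma nonlinearity_lift (p : HL2) : nonlinearity (lift p) = lift (nl p) := by
  have h : (lift (nl p)).fn =ᵐ[volOmega]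
      fun x => ((‖(lift p).fn x‖ ^ 4 : ℝ) : ℂ) * (lift p).fn x := by
    filter_upwards [fn_lift (nl p), fn_lift p,
      ae_volOmega_of_forall (P := fun x => 1 < ‖x‖) (fun x hx => hx)] with x h1 h2 h3
    rw [h1, h2, radialFn, profile_nl p (by linarith), radialFn]
  have h2 := Classical.epsilon_spec (p := fun g : RadialHdot => g.fn =ᵐ[volOmega]
    fun x => ((‖(lift p).fn x‖ ^ 4 : ℝ) : ℂ) * (lift p).fn x) ⟨_, h⟩
  exact fn_injective (Lp.ext (h2.trans h.symm))

end Nonlinearity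

end

end ExteriorNLS

/-! ### The distorted Fourier transform and the propagator in half-line coordinates -/

namespace ExteriorNLS

noncomputable section

section Transform

lemma setIntegral_halfLine_eq {f : ℝ → ℂ} (hf : ∀ x, x ≤ 0 → f x = 0) : ∫ x, f x ∂halfLine = ∫ x, f x :=
  setIntegral_eq_integral_of_forall_compl_eq_zero fun x hx => hf x (by simpa using hx)

lemma integral_radial_test {f : ℝ → ℂ} (hf : ∀ x, x ≤ 0 → f x = 0) :
    ∫ x, f (‖x‖ - 1) / ((‖x‖ ^ 2 : ℝ) : ℂ) ∂volOmega = ((4 * Real.pi : ℝ) : ℂ) * ∫ x, f x ∂halfLine := by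
  have h0 : ∫ x, f (‖x‖ - 1) / ((‖x‖ ^ 2 : ℝ) : ℂ) ∂volOmega
      = ∫ x : E3, f (‖x‖ - 1) / ((‖x‖ ^ 2 : ℝ) : ℂ) :=
    setIntegral_eq_integral_of_forall_compl_eq_zero fun x hx => by
      have : ‖x‖ ≤ 1 := not_lt.1 hx
      rw [hf _ (by linarith), zero_div]
  have h1 := integral_fun_norm_addHaar (volume : Measure E3)
    (fun y : ℝ => f (y - 1) / ((y ^ 2 : ℝ) : ℂ))
  have hdim : Module.finrank ℝ E3 = 3 := by simp
  rw [hdim, Measure.real, EuclideanSpace.volume_ball_fin_three] at h1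
  rw [h0, h1]
  have h2 : ∫ y in Set.Ioi (0 : ℝ), y ^ (3 - 1) • (f (y - 1) / ((y ^ 2 : ℝ) : ℂ))
      = ∫ y in Set.Ioi (0 : ℝ), f (y - 1) := by
    refine setIntegral_congr_fun measurableSet_Ioi fun y hy => ?_
    have hy0 : (0 : ℝ) < y := hy
    have : ((y ^ 2 : ℝ) : ℂ) ≠ 0 := by
      have : y ^ 2 ≠ 0 := by positivity
      exact_mod_cast this
    simp only [Complex.real_smul]
    field_simp
  have h3 : ∫ y in Set.Ioi (0 : ℝ), f (y - 1) = ∫ y, f (y - 1) :=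
    setIntegral_halfLine_eq fun y hy => hf _ (by linarith)
  rw [h2, h3, integral_sub_right_eq_self f 1, setIntegral_halfLine_eq hf]
  rw [ENNReal.ofReal_one, one_pow, one_mul, ENNReal.toReal_ofReal (by positivity)]
  simp only [Complex.real_smul, nsmul_eq_mul]
  push_cast
  ring

lemma IsHalfTest.integrable {w : ℝ → ℂ} (hw : IsHalfTest w) : Integrable w :=
  hw.smooth.continuous.integrable_of_hasCompactSupport hw.compact

/-- An integration by parts: λ sin(λx) is minus the derivative of cos(λx), and w has compact support
in (0,∞). This identifies λ F₀f with the cosine transform of p. -/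
lemma mul_transformTest {w : ℝ → ℂ} (hw : IsHalfTest w) (lam : ℝ) :
    (lam : ℂ) * transformTest (liftTest w) lam = cosFun (deriv w) lam := by
  have e1 : ∫ x, (eigenfun lam x : ℂ) * liftTest w x ∂volOmega
      = ((4 * Real.pi : ℝ) : ℂ) * ∫ x, (Real.sin (lam * x) : ℂ) * w x ∂halfLine := by
    rw [← integral_radial_test (f := fun x => (Real.sin (lam * x) : ℂ) * w x)
      (fun x hx => by rw [hw.eq_zero hx, mul_zero])]
    refine integral_congr_ae (Eventually.of_forall fun x => ?_)
    simp only [eigenfun, liftTest]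
    push_cast
    rw [div_mul_div_comm, sq]
  have hz : ∀ x, x ≤ 0 → deriv w x = 0 := fun x hx => hw.deriv.eq_zero hx
  rw [transformTest, e1, cosFun,
    setIntegral_halfLine_eq (fun x hx => by rw [hw.eq_zero hx, mul_zero]),
    setIntegral_halfLine_eq (fun x hx => by rw [hz x hx, mul_zero])]
  have hd : ∀ x, HasDerivAt (fun x : ℝ => (Real.cos (lam * x) : ℂ)) (-(lam * Real.sin (lam * x) : ℝ) : ℂ) x := by
    intro x
    have h1 : HasDerivAt (fun x : ℝ => lam * x) lam x := by simpa using (hasDerivAt_id x).const_mul lam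
    have := h1.cos.ofReal_comp
    refine HasDerivAt.congr_deriv this ?_
    push_cast; ring
  have ibp := integral_mul_deriv_eq_deriv_mul_of_integrable
    (u := fun x : ℝ => (Real.cos (lam * x) : ℂ)) (v := w) (u' := fun x => (-(lam * Real.sin (lam * x) : ℝ) : ℂ))
    (v' := deriv w) (fun x _ => hd x) (fun x _ => (hw.differentiable x).hasDerivAt)
    (integrable_bdd_mul (by fun_prop) (fun _ => norm_ofReal_cos_le _) hw.deriv.integrable)
    (integrable_bdd_mul (C := |lam|) (by fun_prop) (fun x => by
      rw [norm_neg, Complex.norm_real, norm_mul, Real.norm_eq_abs, Real.norm_eq_abs]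
      exact mul_le_of_le_one_right (abs_nonneg _) (Real.abs_sin_le_one _)) hw.integrable)
    (integrable_bdd_mul (by fun_prop) (fun _ => norm_ofReal_cos_le _) hw.integrable)
  rw [ibp]
  have e2 : ∀ x, (-(lam * Real.sin (lam * x) : ℝ) : ℂ) * w x = -((lam : ℂ) * ((Real.sin (lam * x) : ℂ) * w x)) := by
    intro x; push_cast; ring
  simp_rw [e2]
  rw [integral_neg, neg_neg, integral_const_mul]
  have : (Real.pi : ℂ) ≠ 0 := by exact_mod_cast Real.pi_ne_zero
  push_cast
  field_simp

lemma eLpNorm_eq_ofReal_norm {α E : Type*} [MeasurableSpace α] [NormedAddCommGroup E] {μ : Measure α}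
    {k : ℝ≥0∞} (f : Lp E k μ) : eLpNorm f k μ = ENNReal.ofReal ‖f‖ := by
  rw [Lp.norm_def, ENNReal.ofReal_toReal (Lp.eLpNorm_ne_top f)]

lemma eLpNorm_grad_sub {w : ℝ → ℂ} (hw : IsHalfTest w) {q : HL2} (hq : q =ᵐ[halfLine] deriv w) (p : HL2) :
    eLpNorm (fun x => grad (liftTest w) x - (lift p).gradient x) 2 volOmega
      = ENNReal.ofReal (√(4 * Real.pi) * ‖q - p‖) := by
  rw [← norm_lift, map_sub, RadialHdot.norm_eq, map_sub, ← eLpNorm_eq_ofReal_norm]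
  refine eLpNorm_congr_ae ?_
  filter_upwards [Lp.coeFn_sub (lift q).gradient (lift p).gradient, gradient_lift q,
    radialGrad_congr hq, ae_volOmega_of_forall (P := fun x => 1 < ‖x‖) (fun x hx => hx)] with x h1 h2 h3 h4
  rw [h1, Pi.sub_apply, h2, h3, grad_liftTest hw h4]

lemma coeFn_cosT_deriv {w : ℝ → ℂ} (hw : IsHalfTest w) {q : HL2} (hq : q =ᵐ[halfLine] deriv w) :
    cosT q =ᵐ[halfLine] fun lam => (lam : ℂ) * transformTest (liftTest w) lam := by
  filter_upwards [coeFn_cosT hq hw.deriv.mem_integrableSq.1] with lam h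
  rw [h, mul_transformTest hw]

lemma exists_isTransform (p : HL2) : IsTransform (lift p) fun lam => cosT p lam / lam := by
  have hp : p ∈ derivTests.topologicalClosure := by rw [derivTests_dense]; trivial
  obtain ⟨q, hq, hlim⟩ := mem_closure_iff_seq_limit.1 hp
  choose w hw hqw using hq
  have hlim' := tendsto_iff_norm_sub_tendsto_zero.1 hlim
  refine ⟨((measurable_HL2 _).div (by fun_prop)).aestronglyMeasurable, fun n => liftTest (w n),
    fun n => isRadialTest_liftTest (hw n), ?_, ?_⟩
  · simp_rw [fun n => eLpNorm_grad_sub (hw n) (hqw n) p]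
    have := ENNReal.tendsto_ofReal (hlim'.const_mul (√(4 * Real.pi)))
    simpa using this
  · have e : ∀ n, eLpNorm (fun lam : ℝ => (lam : ℂ) * (transformTest (liftTest (w n)) lam - cosT p lam / lam)) 2
        (volume.restrict (Set.Ioi (0 : ℝ))) = ENNReal.ofReal ‖q n - p‖ := by
      intro n
      rw [← norm_cosT (q n - p), map_sub, ← eLpNorm_eq_ofReal_norm]
      refine eLpNorm_congr_ae ?_
      filter_upwards [Lp.coeFn_sub (cosT (q n)) (cosT p), coeFn_cosT_deriv (hw n) (hqw n),
        ae_halfLine_of_forall (P := fun x => 0 < x) (fun x hx => hx)] with x h1 h2 h3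
      have : (x : ℂ) ≠ 0 := by exact_mod_cast h3.ne'
      rw [h1, Pi.sub_apply, h2]
      field_simp
    simp_rw [e]
    simpa using ENNReal.tendsto_ofReal hlim'

/-- Whatever approximating sequence is chosen, convergence of the gradients forces convergence of
the derivatives on the half-line, and `cosT` is isometric; so λh is independent of the choice. -/
lemma IsTransform.mul_ae_eq {p : HL2} {h : ℝ → ℂ} (hh : IsTransform (lift p) h) :
    (fun lam : ℝ => (lam : ℂ) * h lam) =ᵐ[halfLine] cosT p := by
  obtain ⟨hm, φ, hφ, h1, h2⟩ := hh
  choose w hw hφw using fun n => exists_liftTest_eq (hφ n)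
  let q : ℕ → HL2 := fun n => ((hw n).deriv.memLp 2).toLp _
  have hq : ∀ n, q n =ᵐ[halfLine] deriv (w n) := fun n => ((hw n).deriv.memLp 2).coeFn_toLp
  simp_rw [hφw] at h1 h2
  simp_rw [fun n => eLpNorm_grad_sub (hw n) (hq n) p] at h1
  have h3 : Tendsto (fun n => ENNReal.ofReal ‖q n - p‖) atTop (𝓝 0) := by
    have := ENNReal.Tendsto.const_mul (a := ENNReal.ofReal (√(4 * Real.pi))⁻¹) h1 (Or.inr ENNReal.ofReal_ne_top)
    rw [mul_zero] at this
    refine this.congr fun n => ?_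
    rw [← ENNReal.ofReal_mul (by positivity)]
    congr 1
    have : √(4 * Real.pi) ≠ 0 := by positivity
    field_simp
  have hms : AEStronglyMeasurable (fun lam : ℝ => (lam : ℂ) * h lam) halfLine :=
    (Complex.measurable_ofReal.aestronglyMeasurable).mul hm
  have h4 : ∀ n, eLpNorm (fun lam : ℝ => (lam : ℂ) * h lam - cosT p lam) 2 halfLine
      ≤ ENNReal.ofReal ‖q n - p‖ + eLpNorm (fun lam : ℝ => (lam : ℂ) * (transformTest (liftTest (w n)) lam - h lam)) 2
        (volume.restrict (Set.Ioi (0 : ℝ))) := by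
    intro n
    rw [← norm_cosT (q n - p), map_sub, ← eLpNorm_eq_ofReal_norm]
    have e : (fun lam : ℝ => (lam : ℂ) * h lam - cosT p lam) =ᵐ[halfLine]
        (cosT (q n) - cosT p : HL2) - fun lam : ℝ => (lam : ℂ) * (transformTest (liftTest (w n)) lam - h lam) := by
      filter_upwards [Lp.coeFn_sub (cosT (q n)) (cosT p), coeFn_cosT_deriv (hw n) (hq n)] with x h1 h2
      rw [Pi.sub_apply, h1, Pi.sub_apply, h2]; ring
    have hms2 : AEStronglyMeasurable
        (fun lam : ℝ => (lam : ℂ) * (transformTest (liftTest (w n)) lam - h lam)) halfLine := by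
      have := ((measurable_HL2 (cosT (q n))).aestronglyMeasurable (μ := halfLine)).sub hms
      refine this.congr ?_
      filter_upwards [coeFn_cosT_deriv (hw n) (hq n)] with x h2
      rw [Pi.sub_apply, h2]; ring
    rw [eLpNorm_congr_ae e]
    exact eLpNorm_sub_le (Lp.aestronglyMeasurable _) hms2 (by norm_num)
  have h5 : eLpNorm (fun lam : ℝ => (lam : ℂ) * h lam - cosT p lam) 2 halfLine = 0 := by
    have := ge_of_tendsto' (h3.add h2) h4
    simpa using this
  have h6 := (eLpNorm_eq_zero_iff (hms.sub (Lp.aestronglyMeasurable (cosT p))) (by norm_num)).1 h5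
  filter_upwards [h6] with x hx
  exact sub_eq_zero.1 hx

lemma isTransform_transform (p : HL2) : IsTransform (lift p) (transform (lift p)) :=
  Classical.epsilon_spec (p := IsTransform (lift p)) ⟨_, exists_isTransform p⟩

/-- By `prim_cosT` the primitive of a cosine transform is the sine integral in `adjointTransform`;
its factor 1/λ is the one relating F₀f to `cosT p`. -/
lemma propagator_lift (t : ℝ) (p : HL2) : propagator t (lift p) = lift (flow t p) := by
  have hT := (isTransform_transform p).mul_ae_eq
  have h : (lift (flow t p)).fn =ᵐ[volOmega] adjointTransform
      fun lam => Complex.exp (-(Complex.I * (lam : ℂ) ^ 2 * (t : ℂ))) * transform (lift p) lam := by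
    filter_upwards [fn_lift (flow t p),
      ae_volOmega_of_forall (P := fun x => 1 < ‖x‖) (fun x hx => hx)] with x h1 h3
    rw [h1, radialFn, profile, flow_apply, prim_cosT _ (by linarith), adjointTransform, add_sub_cancel,
      mul_div_assoc, ← integral_div]
    congr 1
    refine integral_congr_ae ?_
    filter_upwards [coeFn_phaseOp t (cosT p), hT,
      ae_halfLine_of_forall (P := fun x => 0 < x) (fun x hx => hx)] with lam k1 k2 k3
    have : (lam : ℂ) ≠ 0 := by exact_mod_cast k3.ne'
    rw [k1, ← k2, eigenfun, phase]
    push_cast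
    field_simp
  have h2 := Classical.epsilon_spec (p := fun g : RadialHdot => g.fn =ᵐ[volOmega] adjointTransform
      fun lam => Complex.exp (-(Complex.I * (lam : ℂ) ^ 2 * (t : ℂ))) * transform (lift p) lam) ⟨_, h⟩
  exact fn_injective (Lp.ext (h2.trans h.symm))

end Transform

end

end ExteriorNLS

/-! ### Reduction to an ordinary differential equation -/

namespace ExteriorNLS

noncomputable section

section Reduction

/-- The vector field of the equation in the interaction picture. -/
def field (t : ℝ) (v : HL2) : HL2 := -Complex.I • flow (-t) (nl (flow t v))

lemma continuous_nl_comp {v : ℝ → HL2} (hv : Continuous v) : Continuous fun t => nl (v t) :=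
  continuous_nl.comp hv

lemma continuous_field_comp {v : ℝ → HL2} (hv : Continuous v) : Continuous fun t => field t (v t) :=
  (continuous_const (y := -Complex.I)).smul
    (continuous_flow continuous_neg (continuous_nl_comp (continuous_flow continuous_id hv)))

lemma norm_field (t : ℝ) (v : HL2) : ‖field t v‖ = ‖nl (flow t v)‖ := by
  rw [field, norm_smul, norm_neg, Complex.norm_I, one_mul, norm_flow]

lemma norm_field_sub_le (t : ℝ) {v w : HL2} {R : ℝ} (hv : ‖v‖ ≤ R) (hw : ‖w‖ ≤ R) :
    ‖field t v - field t w‖ ≤ 65 * R ^ 4 * ‖v - w‖ := by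
  rw [field, field, ← smul_sub, ← map_sub, norm_smul, norm_neg, Complex.norm_I, one_mul, norm_flow]
  refine (norm_nl_sub_le ((norm_flow t v).le.trans hv) ((norm_flow t w).le.trans hw)).trans_eq ?_
  rw [← map_sub, norm_flow]

lemma flow_sub_integral {b : ℝ} {m : ℝ → HL2} (hm : Continuous m) (a s : ℝ) :
    flow b (∫ t in a..s, flow (-t) (m t)) = ∫ t in a..s, flow (b - t) (m t) := by
  have hc : Continuous fun t => flow (-t) (m t) := continuous_flow continuous_neg hm
  rw [← ContinuousLinearMap.intervalIntegral_comp_comm _ (hc.intervalIntegrable _ _)]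
  simp_rw [sub_eq_add_neg, flow_add]

lemma lift_integral {m : ℝ → HL2} (hm : Continuous m) (a b : ℝ) :
    lift (∫ t in a..b, m t) = ∫ t in a..b, lift (m t) :=
  ((lift : HL2 →L[ℂ] RadialHdot).intervalIntegral_comp_comm (hm.intervalIntegrable a b)).symm

lemma duhamel_lift {p : ℝ → HL2} (hp : Continuous p) (a b : ℝ) :
    propagator (b - a) (lift (p a)) - Complex.I • ∫ t in a..b, propagator (b - t) (nonlinearity (lift (p t)))
      = lift (flow (b - a) (p a) - Complex.I • ∫ t in a..b, flow (b - t) (nl (p t))) := by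
  rw [map_sub, map_smul, lift_integral
    (continuous_flow (by fun_prop) (continuous_nl_comp hp))]
  simp_rw [nonlinearity_lift, propagator_lift]

/-- Undoing the free flow removes the unbounded generator: the Duhamel formula becomes an integral
equation with a continuous integrand, equivalent to a differential equation in L². -/
theorem isGlobalSolution_iff {u : ℝ → RadialHdot} :
    IsGlobalSolution u ↔ ∃ v : ℝ → HL2, (∀ t, HasDerivAt v (field t (v t)) t) ∧
      ∀ t, u t = lift (flow t (v t)) := by
  constructor
  · rintro ⟨hu, hD⟩
    set p : ℝ → HL2 := fun t => lift.symm (u t) with hp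
    have hpc : Continuous p := lift.symm.continuous.comp hu
    have hup : ∀ t, u t = lift (p t) := fun t => (lift.apply_symm_apply _).symm
    set v : ℝ → HL2 := fun t => flow (-t) (p t) with hv
    have hfv : ∀ t, flow t (v t) = p t := fun t => flow_flow_neg t _
    have hvc : Continuous v := continuous_flow continuous_neg hpc
    have hfc := continuous_field_comp hvc
    have hint : ∀ b, v b = v 0 + ∫ t in (0 : ℝ)..b, field t (v t) := by
      intro b
      have h1 := hD 0 b
      simp_rw [hup] at h1
      rw [duhamel_lift hpc] at h1
      have h2 := lift.injective h1
      have h3 := congrArg (flow (-b)) h2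
      have h4 : flow (-b) (∫ t in (0:ℝ)..b, flow (b - t) (nl (p t))) = ∫ t in (0:ℝ)..b, flow (-t) (nl (p t)) := by
        rw [← flow_sub_integral (continuous_nl_comp hpc), flow_neg_flow]
      rw [map_sub, map_smul, h4, ← flow_add, ← intervalIntegral.integral_smul] at h3
      rw [show v b = flow (-b) (p b) from rfl, h3, show -b + (b - 0) = -0 by ring, sub_eq_add_neg,
        ← intervalIntegral.integral_neg]
      simp only [field, hfv, neg_smul]
      rfl
    refine ⟨v, fun t => ?_, fun t => by rw [hfv, hup]⟩
    have h1 := (hfc.integral_hasStrictDerivAt 0 t).hasDerivAt.const_add (v 0)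
    exact h1.congr_of_eventuallyEq (Eventually.of_forall hint)
  · rintro ⟨v, hv, hu⟩
    have hvc : Continuous v := continuous_iff_continuousAt.2 fun t => (hv t).continuousAt
    have hpc : Continuous fun t => flow t (v t) := continuous_flow continuous_id hvc
    obtain rfl : u = fun t => lift (flow t (v t)) := funext hu
    refine ⟨lift.continuous.comp hpc, fun a b => ?_⟩
    refine Eq.trans (congrArg lift ?_) (duhamel_lift hpc a b).symm
    have h1 := intervalIntegral.integral_eq_sub_of_hasDerivAt (a := a) (b := b) (fun t _ => hv t)
      ((continuous_field_comp hvc).intervalIntegrable _ _)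
    have h2 : v b = v a + ∫ t in a..b, field t (v t) := by rw [h1]; abel
    have h3 : flow b (∫ t in a..b, field t (v t))
        = -(Complex.I • ∫ t in a..b, flow (b - t) (nl (flow t (v t)))) := by
      rw [← flow_sub_integral (continuous_nl_comp hpc), ← map_smul, ← map_neg,
        ← intervalIntegral.integral_smul, ← intervalIntegral.integral_neg]
      simp only [field, neg_smul]
    rw [h2, map_add, sub_eq_add_neg _ (Complex.I • _), ← flow_add, sub_add_cancel, h3]

end Reduction

end

end ExteriorNLS

/-! ### Differentiability of the potential energy -/

namespace ExteriorNLS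

noncomputable section

section Potential

open scoped ComplexConjugate

/-- The function `r² |u|⁴ u`. -/
def potFun (p : ℝ → ℂ) (x : ℝ) : ℂ :=
  (((1 + x) ^ 2 : ℝ) : ℂ) * (profile p x ^ 3 * conj (profile p x) ^ 2)

lemma measurable_potFun (p : HL2) : Measurable (potFun p) := by
  have h1 := measurable_profile p
  have hc : Measurable (conj : ℂ → ℂ) := Complex.continuous_conj.measurable
  unfold potFun
  fun_prop

/-- The weight r² is absorbed by four factors of size r^{-1/2}R, which leaves the difference of the
profiles to Hardy's inequality. -/
lemma norm_potFun_sub_le {p q : HL2} {R : ℝ} (hp : ‖p‖ ≤ R) (hq : ‖q‖ ≤ R) {x : ℝ} (hx : 0 ≤ x) :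
    ‖potFun p x - potFun q x‖ ≤ 5 * R ^ 4 * ‖profile (p - q : HL2) x‖ := by
  have hs : 0 < √(1 + x) := Real.sqrt_pos.2 (by linarith)
  have hpR : ‖profile p x‖ ≤ (√(1 + x))⁻¹ * R := (norm_profile_le p hx).trans (by gcongr)
  have hqR : ‖profile q x‖ ≤ (√(1 + x))⁻¹ * R := (norm_profile_le q hx).trans (by gcongr)
  have m := norm_monomial_sub_le hpR hqR 2 1
  norm_num at m
  rw [potFun, potFun, ← mul_sub, norm_mul, Complex.norm_real, Real.norm_of_nonneg (by positivity),
    profile_sub]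
  have e : (1 + x) ^ 2 * ((√(1 + x))⁻¹ * R) ^ 4 = R ^ 4 := by
    have h2 : √(1 + x) ^ 4 = (1 + x) ^ 2 := by
      rw [show √(1 + x) ^ 4 = (√(1 + x) ^ 2) ^ 2 by ring, Real.sq_sqrt (by linarith)]
    have : (1 + x) ^ 2 ≠ 0 := by positivity
    rw [mul_pow, inv_pow, h2]
    field_simp
  calc (1 + x) ^ 2 * ‖profile p x ^ 3 * conj (profile p x) ^ 2 - profile q x ^ 3 * conj (profile q x) ^ 2‖
      ≤ (1 + x) ^ 2 * (5 * ((√(1 + x))⁻¹ * R) ^ 4 * ‖profile p x - profile q x‖) := by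
        gcongr
    _ = 5 * ((1 + x) ^ 2 * ((√(1 + x))⁻¹ * R) ^ 4) * ‖profile p x - profile q x‖ := by ring
    _ = _ := by rw [e]

lemma profile_zero (x : ℝ) : profile (0 : HL2) x = 0 := by
  have := prim_smul 0 (0 : HL2) x
  rw [zero_smul, zero_mul] at this
  rw [profile, this, zero_div]

lemma potFun_zero (x : ℝ) : potFun (0 : HL2) x = 0 := by
  rw [potFun, profile_zero]; simp

lemma memLp_potFun (p : HL2) : MemLp (potFun p) 2 halfLine := by
  refine (memLp_profile p).of_le_mul (c := 5 * ‖p‖ ^ 4) (measurable_potFun p).aestronglyMeasurable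
    (ae_halfLine_of_forall fun x hx => ?_)
  have := norm_potFun_sub_le (p := p) (q := 0) (R := ‖p‖) le_rfl (by simp) hx.le
  rwa [potFun_zero, sub_zero, sub_zero] at this

/-- The class of `r² |u|⁴ u`. -/
def pot (p : HL2) : HL2 := (memLp_potFun p).toLp _

lemma coeFn_pot (p : HL2) : pot p =ᵐ[halfLine] potFun p := (memLp_potFun p).coeFn_toLp

lemma norm_pot_sub_le {p q : HL2} {R : ℝ} (hp : ‖p‖ ≤ R) (hq : ‖q‖ ≤ R) :
    ‖pot p - pot q‖ ≤ 10 * R ^ 4 * ‖p - q‖ := by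
  have key : ‖pot p - pot q‖ ≤ 5 * R ^ 4 * ‖hardy (p - q)‖ := by
    refine Lp.norm_le_mul_norm_of_ae_le_mul ?_
    filter_upwards [Lp.coeFn_sub (pot p) (pot q), coeFn_pot p, coeFn_pot q, coeFn_hardy (p - q),
      ae_halfLine_of_forall (P := fun x => 0 < x) (fun x hx => hx)] with x h1 h2 h3 h4 h5
    rw [h1, Pi.sub_apply, h2, h3, h4]
    exact norm_potFun_sub_le hp hq h5.le
  have hR : 0 ≤ R := (norm_nonneg _).trans hp
  have := norm_hardy_le (p - q)
  calc _ ≤ 5 * R ^ 4 * ‖hardy (p - q)‖ := key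
    _ ≤ 5 * R ^ 4 * (2 * ‖p - q‖) := by gcongr
    _ = _ := by ring

lemma pot_zero : pot 0 = 0 := by
  refine Lp.ext ?_
  filter_upwards [coeFn_pot 0, Lp.coeFn_zero ℂ 2 halfLine] with x h1 h2
  rw [h1, h2, potFun_zero]; rfl

lemma norm_pot_le (p : HL2) : ‖pot p‖ ≤ 10 * ‖p‖ ^ 5 := by
  have := norm_pot_sub_le (p := p) (q := 0) (R := ‖p‖) le_rfl (by simp)
  rw [pot_zero, sub_zero, sub_zero] at this
  exact this.trans_eq (by ring)

lemma continuous_of_norm_sub_le {F : HL2 → HL2} {C : ℝ}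
    (h : ∀ p q : HL2, ∀ R, ‖p‖ ≤ R → ‖q‖ ≤ R → ‖F p - F q‖ ≤ C * R ^ 4 * ‖p - q‖) : Continuous F := by
  rw [continuous_iff_continuousAt]
  intro p
  refine tendsto_iff_norm_sub_tendsto_zero.2 ?_
  have hlim : Tendsto (fun q => C * (‖p‖ + 1) ^ 4 * ‖q - p‖) (𝓝 p) (𝓝 0) := by
    have : Continuous fun q => C * (‖p‖ + 1) ^ 4 * ‖q - p‖ := by fun_prop
    simpa using this.tendsto p
  refine squeeze_zero' (Eventually.of_forall fun _ => norm_nonneg _) ?_ hlim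
  filter_upwards [Metric.ball_mem_nhds p one_pos] with q hq
  refine h _ _ _ ?_ (by linarith)
  have h1 : ‖q - p‖ < 1 := by simpa [dist_eq_norm] using hq
  have := norm_le_norm_add_norm_sub' q p
  linarith

lemma continuous_pot : Continuous pot := continuous_of_norm_sub_le fun _ _ _ hp hq => norm_pot_sub_le hp hq

/-- The potential energy on the half-line. -/
def potential (p : HL2) : ℝ := 1 / 6 * ∫ x, (1 + x) ^ 2 * ‖profile p x‖ ^ 6 ∂halfLine

lemma integrable_profile_sq (p : HL2) : Integrable (fun x => ‖profile p x‖ ^ 2) halfLine :=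
  (memLp_profile p).integrable_norm_pow (by norm_num)

lemma integral_profile_sq_le (p : HL2) : ∫ x, ‖profile p x‖ ^ 2 ∂halfLine ≤ 4 * ‖p‖ ^ 2 := by
  have h := norm_hardy_le p
  rw [← memLp_toLp_norm_sq (memLp_profile p)]
  calc ‖hardy p‖ ^ 2 ≤ (2 * ‖p‖) ^ 2 := by gcongr
    _ = _ := by ring

lemma integrable_profile_six (p : HL2) : Integrable (fun x => (1 + x) ^ 2 * ‖profile p x‖ ^ 6) halfLine := by
  refine ((integrable_profile_sq p).const_mul (‖p‖ ^ 4)).mono' ?_ (ae_halfLine_of_forall fun x hx => ?_)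
  · have := measurable_profile p
    exact Measurable.aestronglyMeasurable (by fun_prop)
  · rw [Real.norm_of_nonneg (by positivity)]
    have := sq_mul_norm_profile_pow_four_le p hx.le
    calc (1 + x) ^ 2 * ‖profile p x‖ ^ 6 = (1 + x) ^ 2 * ‖profile p x‖ ^ 4 * ‖profile p x‖ ^ 2 := by ring
      _ ≤ _ := by gcongr

lemma potential_nonneg (p : HL2) : 0 ≤ potential p :=
  mul_nonneg (by norm_num) (integral_nonneg_of_ae (ae_halfLine_of_forall fun x _ => by positivity))

/-- With A = |a|² one has |a+b|² = A + s, where s = 2 Re(b ā) + |b|². Expanding (A+s)³ and removing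
the part linear in b leaves terms quadratic in b. -/
lemma abs_sextic_remainder_le (a b : ℂ) :
    |1 / 6 * ‖a + b‖ ^ 6 - 1 / 6 * ‖a‖ ^ 6 - (b * conj (a ^ 3 * conj a ^ 2)).re|
      ≤ 4 * (‖a‖ + ‖b‖) ^ 4 * ‖b‖ ^ 2 := by
  set A := ‖a‖ ^ 2 with hA
  set M := ‖a‖ + ‖b‖ with hM
  set s := 2 * (b * conj a).re + ‖b‖ ^ 2 with hs
  have e1 : ‖a + b‖ ^ 2 = A + s := by
    rw [hA, hs, ← Complex.normSq_eq_norm_sq, ← Complex.normSq_eq_norm_sq, ← Complex.normSq_eq_norm_sq,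
      Complex.normSq_add, ← Complex.conj_re (b * conj a), map_mul, Complex.conj_conj, mul_comm (conj b)]
    ring
  have e2 : (b * conj (a ^ 3 * conj a ^ 2)).re = A ^ 2 * (b * conj a).re := by
    have h := Complex.mul_conj a
    rw [Complex.normSq_eq_norm_sq, ← hA] at h
    have : b * conj (a ^ 3 * conj a ^ 2) = ((A ^ 2 : ℝ) : ℂ) * (b * conj a) := by
      push_cast
      rw [← h, map_mul, map_pow, map_pow, Complex.conj_conj]; ring
    rw [this, Complex.re_ofReal_mul]
  have e3 : ‖a + b‖ ^ 6 = (A + s) ^ 3 := by rw [← e1]; ring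
  have e4 : ‖a‖ ^ 6 = A ^ 3 := by rw [hA]; ring
  have hre : |(b * conj a).re| ≤ ‖b‖ * ‖a‖ := by
    refine (Complex.abs_re_le_norm _).trans_eq ?_
    rw [norm_mul, RCLike.norm_conj]
  have ha := norm_nonneg a
  have hb := norm_nonneg b
  have hbM : ‖b‖ ≤ M := by linarith
  have hM0 : 0 ≤ M := by positivity
  have hs1 : |s| ≤ 2 * M * ‖b‖ := by
    rw [abs_le] at hre ⊢
    constructor <;> nlinarith
  have hs2 : |s| ≤ 2 * M ^ 2 := hs1.trans (by nlinarith)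
  have hA1 : A ≤ M ^ 2 := by rw [hA]; gcongr; linarith
  have hA0 : 0 ≤ A := by positivity
  have hss : s ^ 2 ≤ 4 * M ^ 2 * ‖b‖ ^ 2 := by
    calc s ^ 2 = |s| ^ 2 := (sq_abs s).symm
      _ ≤ (2 * M * ‖b‖) ^ 2 := by gcongr
      _ = _ := by ring
  have e5 : 1 / 6 * (A + s) ^ 3 - 1 / 6 * A ^ 3 - A ^ 2 * (b * conj a).re
      = 1 / 2 * (A * s ^ 2) + 1 / 6 * (s * s ^ 2) + 1 / 2 * (A ^ 2 * ‖b‖ ^ 2) := by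
    have : (b * conj a).re = (s - ‖b‖ ^ 2) / 2 := by rw [hs]; ring
    rw [this]; ring
  rw [e3, e4, e2, e5]
  -- The three terms have coefficients 2, 4/3 and 1/2, with sum 23/6, rounded up to 4.
  have t1 : |1 / 2 * (A * s ^ 2)| ≤ 1 / 2 * (M ^ 2 * (4 * M ^ 2 * ‖b‖ ^ 2)) := by
    rw [abs_of_nonneg (by positivity)]; gcongr
  have t2 : |1 / 6 * (s * s ^ 2)| ≤ 1 / 6 * (2 * M ^ 2 * (4 * M ^ 2 * ‖b‖ ^ 2)) := by
    rw [abs_mul, abs_mul, abs_of_nonneg (sq_nonneg s), abs_of_pos (by norm_num : (0 : ℝ) < 1 / 6)]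
    gcongr
  have t3 : |1 / 2 * (A ^ 2 * ‖b‖ ^ 2)| ≤ 1 / 2 * ((M ^ 2) ^ 2 * ‖b‖ ^ 2) := by
    rw [abs_of_nonneg (by positivity)]; gcongr
  refine (abs_add_three _ _ _).trans ?_
  have : 0 ≤ M ^ 4 * ‖b‖ ^ 2 := by positivity
  calc _ ≤ _ := add_le_add_three t1 t2 t3
    _ = (23 / 6) * (M ^ 4 * ‖b‖ ^ 2) := by ring
    _ ≤ 4 * (M ^ 4 * ‖b‖ ^ 2) := by linarith
    _ = _ := by ring

lemma re_mul_conj_potFun (q h : ℝ → ℂ) (x : ℝ) : (profile h x * conj (potFun q x)).re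
    = (1 + x) ^ 2 * (profile h x * conj (profile q x ^ 3 * conj (profile q x) ^ 2)).re := by
  rw [potFun, map_mul, Complex.conj_ofReal, mul_left_comm, Complex.re_ofReal_mul]

lemma re_inner_pot_hardy (q h : HL2) : (inner ℂ (pot q) (hardy h)).re
    = ∫ x, (1 + x) ^ 2 * (profile h x * conj (profile q x ^ 3 * conj (profile q x) ^ 2)).re ∂halfLine := by
  have hi := L2.integrable_inner (𝕜 := ℂ) (pot q) (hardy h)
  rw [L2.inner_def]
  refine (integral_re hi).symm.trans (integral_congr_ae ?_)
  filter_upwards [coeFn_pot q, coeFn_hardy h] with x h1 h2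
  rw [h1, h2, RCLike.inner_apply]
  exact re_mul_conj_potFun _ _ _

lemma profile_add (p q : HL2) (x : ℝ) : profile (p + q : HL2) x = profile p x + profile q x := by
  simp only [profile, prim_add, add_div]

/-- The pointwise remainder is integrated with weight r²: four decaying factors absorb the weight,
and Hardy bounds ∫|profile h|² by 4‖h‖². The remainder is quadratic in h, whence Fréchet
differentiability. -/
lemma abs_potential_remainder_le (q h : HL2) :
    |potential (q + h) - potential q - (inner ℂ (pot q) (hardy h)).re|
      ≤ 16 * (‖q‖ + ‖h‖) ^ 4 * ‖h‖ ^ 2 := by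
  have hi := (L2.integrable_inner (𝕜 := ℂ) (pot q) (hardy h)).re
  have hi' : Integrable (fun x => (1 + x) ^ 2 *
      (profile h x * conj (profile q x ^ 3 * conj (profile q x) ^ 2)).re) halfLine := by
    refine hi.congr ?_
    filter_upwards [coeFn_pot q, coeFn_hardy h] with x h1 h2
    rw [h1, h2, RCLike.inner_apply]
    exact re_mul_conj_potFun _ _ _
  have i1 := (integrable_profile_six (q + h)).const_mul (1 / 6)
  have i2 := (integrable_profile_six q).const_mul (1 / 6)
  have i3 : Integrable (fun x => 1 / 6 * ((1 + x) ^ 2 * ‖profile (q + h : HL2) x‖ ^ 6) -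
      1 / 6 * ((1 + x) ^ 2 * ‖profile q x‖ ^ 6)) halfLine := i1.sub i2
  rw [re_inner_pot_hardy, potential, potential, ← integral_const_mul, ← integral_const_mul,
    ← integral_sub i1 i2, ← integral_sub i3 hi', ← Real.norm_eq_abs]
  have key := norm_integral_le_of_norm_le (μ := halfLine)
    (f := fun x => 1 / 6 * ((1 + x) ^ 2 * ‖profile (q + h : HL2) x‖ ^ 6) -
      1 / 6 * ((1 + x) ^ 2 * ‖profile q x‖ ^ 6) - (1 + x) ^ 2 *
      (profile h x * conj (profile q x ^ 3 * conj (profile q x) ^ 2)).re)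
    ((integrable_profile_sq h).const_mul (4 * (‖q‖ + ‖h‖) ^ 4))
    (ae_halfLine_of_forall fun x hx => ?_)
  · refine key.trans ?_
    rw [integral_const_mul]
    have := integral_profile_sq_le h
    calc 4 * (‖q‖ + ‖h‖) ^ 4 * ∫ x, ‖profile h x‖ ^ 2 ∂halfLine
        ≤ 4 * (‖q‖ + ‖h‖) ^ 4 * (4 * ‖h‖ ^ 2) := by gcongr
      _ = _ := by ring
  · have hr := abs_sextic_remainder_le (profile q x) (profile h x)
    have e : 1 / 6 * ((1 + x) ^ 2 * ‖profile (q + h : HL2) x‖ ^ 6) -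
      1 / 6 * ((1 + x) ^ 2 * ‖profile q x‖ ^ 6) - (1 + x) ^ 2 *
      (profile h x * conj (profile q x ^ 3 * conj (profile q x) ^ 2)).re
      = (1 + x) ^ 2 * (1 / 6 * ‖profile q x + profile h x‖ ^ 6 - 1 / 6 * ‖profile q x‖ ^ 6 -
      (profile h x * conj (profile q x ^ 3 * conj (profile q x) ^ 2)).re) := by
      rw [profile_add]; ring
    rw [e, Real.norm_eq_abs, abs_mul, abs_of_nonneg (by positivity)]
    have hs : 0 < √(1 + x) := Real.sqrt_pos.2 (by linarith)
    have hb : (1 + x) ^ 2 * (‖profile q x‖ + ‖profile h x‖) ^ 4 ≤ (‖q‖ + ‖h‖) ^ 4 := by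
      have h2 : √(1 + x) ^ 4 = (1 + x) ^ 2 := by
        rw [show √(1 + x) ^ 4 = (√(1 + x) ^ 2) ^ 2 by ring, Real.sq_sqrt (by linarith)]
      rw [← h2, ← mul_pow]
      gcongr
      have k1 := norm_profile_le q hx.le
      have k2 := norm_profile_le h hx.le
      rw [inv_mul_eq_div, le_div_iff₀' hs] at k1 k2
      linarith
    calc _ ≤ (1 + x) ^ 2 * (4 * (‖profile q x‖ + ‖profile h x‖) ^ 4 * ‖profile h x‖ ^ 2) := by gcongr
      _ = 4 * ((1 + x) ^ 2 * (‖profile q x‖ + ‖profile h x‖) ^ 4) * ‖profile h x‖ ^ 2 := by ring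
      _ ≤ _ := by gcongr

/-- The derivative of the potential energy. -/
def potentialDeriv (q : HL2) : HL2 →L[ℝ] ℝ :=
  Complex.reCLM ∘L ((innerSL ℂ (pot q)) ∘L hardy).restrictScalars ℝ

lemma potentialDeriv_apply (q h : HL2) : potentialDeriv q h = (inner ℂ (pot q) (hardy h)).re := rfl

lemma hasFDerivAt_potential (q : HL2) : HasFDerivAt potential (potentialDeriv q) q := by
  rw [hasFDerivAt_iff_isLittleO_nhds_zero]
  refine Asymptotics.IsBigO.trans_isLittleO (g := fun h : HL2 => ‖h‖ ^ 2) ?_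
    (Asymptotics.isLittleO_norm_pow_id one_lt_two)
  refine Asymptotics.IsBigO.of_bound (16 * (‖q‖ + 1) ^ 4) ?_
  filter_upwards [Metric.ball_mem_nhds (0 : HL2) one_pos] with h hh
  have h1 : ‖h‖ ≤ 1 := by simpa using (Metric.mem_ball.1 hh).le
  rw [potentialDeriv_apply, Real.norm_eq_abs, Real.norm_of_nonneg (by positivity)]
  refine (abs_potential_remainder_le q h).trans ?_
  gcongr

lemma continuous_potential : Continuous potential :=
  continuous_iff_continuousAt.2 fun q => (hasFDerivAt_potential q).continuousAt

end Potential

end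

end ExteriorNLS

/-! ### Frequency truncation and differentiability in time -/

namespace ExteriorNLS

noncomputable section

section LowPass

open scoped ComplexConjugate

/-- The frequency cut-off to `[0, n]`. -/
def cutFun (n : ℕ) : ℝ → ℂ := (Set.Icc (0 : ℝ) n).indicator 1

/-- The symbol of the truncated Laplacian. -/
def lapFun (n : ℕ) (lam : ℝ) : ℂ := ((lam ^ 2 : ℝ) : ℂ) * cutFun n lam

lemma measurable_cutFun (n : ℕ) : Measurable (cutFun n) := measurable_one.indicator measurableSet_Icc

lemma measurable_lapFun (n : ℕ) : Measurable (lapFun n) := by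
  have := measurable_cutFun n
  unfold lapFun; fun_prop

lemma norm_cutFun_le (n : ℕ) (x : ℝ) : ‖cutFun n x‖ ≤ 1 := by
  unfold cutFun
  by_cases hx : x ∈ Set.Icc (0 : ℝ) n <;> simp [hx]

lemma norm_lapFun_le (n : ℕ) (x : ℝ) : ‖lapFun n x‖ ≤ (n : ℝ) ^ 2 := by
  unfold lapFun cutFun
  by_cases hx : x ∈ Set.Icc (0 : ℝ) n
  · simp only [hx, Set.indicator_of_mem, Pi.one_apply, mul_one, Complex.norm_real]
    rw [Real.norm_of_nonneg (by positivity)]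
    have := hx.1
    have := hx.2
    gcongr
  · simp only [hx, not_false_eq_true, Set.indicator_of_notMem, mul_zero, norm_zero]
    positivity

lemma conj_cutFun (n : ℕ) (x : ℝ) : conj (cutFun n x) = cutFun n x := by
  unfold cutFun
  by_cases hx : x ∈ Set.Icc (0 : ℝ) n <;> simp [hx]

lemma cutFun_mul_self (n : ℕ) (x : ℝ) : cutFun n x * cutFun n x = cutFun n x := by
  unfold cutFun
  by_cases hx : x ∈ Set.Icc (0 : ℝ) n <;> simp [hx]

lemma conj_lapFun (n : ℕ) (x : ℝ) : conj (lapFun n x) = lapFun n x := by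
  rw [lapFun, map_mul, conj_cutFun, Complex.conj_ofReal]

/-- The frequency cut-off on the cosine transform side. -/
def cutOp (n : ℕ) : HL2 →L[ℂ] HL2 := mulOp (cutFun n) (measurable_cutFun n) 1 (norm_cutFun_le n)

/-- Multiplication by `λ² 1_{λ ≤ n}`. -/
def lapOp (n : ℕ) : HL2 →L[ℂ] HL2 := mulOp (lapFun n) (measurable_lapFun n) _ (norm_lapFun_le n)

lemma coeFn_cutOp (n : ℕ) (p : HL2) : cutOp n p =ᵐ[halfLine] fun x => cutFun n x * p x := coeFn_mulOp p

lemma coeFn_lapOp (n : ℕ) (p : HL2) : lapOp n p =ᵐ[halfLine] fun x => lapFun n x * p x := coeFn_mulOp p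

/-- The projection to frequencies below `n`. -/
def lowpass (n : ℕ) : HL2 →L[ℂ] HL2 := cosT ∘L cutOp n ∘L cosT

/-- The Laplacian (with sign) restricted to frequencies below `n`. -/
def lap (n : ℕ) : HL2 →L[ℂ] HL2 := cosT ∘L lapOp n ∘L cosT

lemma lowpass_apply (n : ℕ) (p : HL2) : lowpass n p = cosT (cutOp n (cosT p)) := rfl

lemma lap_apply (n : ℕ) (p : HL2) : lap n p = cosT (lapOp n (cosT p)) := rfl

lemma norm_lowpass_le (n : ℕ) (p : HL2) : ‖lowpass n p‖ ≤ ‖p‖ := by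
  rw [lowpass_apply, norm_cosT]
  refine (norm_mulOp_le _).trans ?_
  rw [one_mul, norm_cosT]

lemma tendsto_lowpass (p : HL2) : Tendsto (fun n => lowpass n p) atTop (𝓝 p) := by
  have h : Tendsto (fun n => cutOp n (cosT p)) atTop
      (𝓝 (mulOp (fun _ => 1) measurable_const 1 (by simp) (cosT p))) := by
    refine tendsto_mulOp (M := cutFun) (hM := measurable_cutFun) (C := 1) (hC := norm_cutFun_le)
      (m := fun _ => 1) (hm := measurable_const) (hC' := by simp) (fun x hx => ?_) (cosT p)
    obtain ⟨N, hN⟩ := exists_nat_ge x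
    refine tendsto_const_nhds.congr' ?_
    filter_upwards [eventually_ge_atTop N] with n hn
    have : x ∈ Set.Icc (0 : ℝ) n := ⟨hx.le, hN.trans (by exact_mod_cast hn)⟩
    simp [cutFun, this]
  have e : mulOp (fun _ => (1 : ℂ)) measurable_const 1 (by simp) (cosT p) = cosT p := by
    refine Lp.ext ?_
    filter_upwards [coeFn_mulOp (m := fun _ => (1 : ℂ)) (hm := measurable_const) (C := 1)
      (hC := by simp) (cosT p)] with x hx
    rw [hx, one_mul]
  rw [e] at h
  have h2 := (cosT.continuous.tendsto _).comp h
  rwa [cosT_cosT] at h2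

lemma inner_cutOp (n : ℕ) (p q : HL2) : inner ℂ (cutOp n p) q = inner ℂ p (cutOp n q) := by
  rw [L2.inner_def, L2.inner_def]
  refine integral_congr_ae ?_
  filter_upwards [coeFn_cutOp n p, coeFn_cutOp n q] with x h1 h2
  rw [h1, h2, RCLike.inner_apply, RCLike.inner_apply, map_mul, conj_cutFun]; ring

lemma inner_lowpass (n : ℕ) (p q : HL2) : inner ℂ (lowpass n p) q = inner ℂ p (lowpass n q) := by
  rw [lowpass_apply, lowpass_apply, inner_cosT_left, inner_cutOp, inner_cosT_left]

lemma cutOp_cutOp (n : ℕ) (p : HL2) : cutOp n (cutOp n p) = cutOp n p := by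
  refine Lp.ext ?_
  filter_upwards [coeFn_cutOp n (cutOp n p), coeFn_cutOp n p] with x h1 h2
  rw [h1, h2, ← mul_assoc, cutFun_mul_self]

lemma lowpass_lowpass (n : ℕ) (p : HL2) : lowpass n (lowpass n p) = lowpass n p := by
  simp only [lowpass_apply, cosT_cosT, cutOp_cutOp]

lemma im_inner_lowpass_lap (n : ℕ) (p : HL2) : (inner ℂ (lowpass n p) (lap n p)).im = 0 := by
  have h : inner ℂ (lowpass n p) (lap n p) = inner ℂ (lap n p) (lowpass n p) := by
    rw [lowpass_apply, lap_apply, inner_cosT_left, inner_cosT_left, cosT_cosT, cosT_cosT,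
      L2.inner_def, L2.inner_def]
    refine integral_congr_ae ?_
    filter_upwards [coeFn_cutOp n (cosT p), coeFn_lapOp n (cosT p)] with x h1 h2
    rw [h1, h2, RCLike.inner_apply, RCLike.inner_apply, map_mul, map_mul, conj_cutFun, conj_lapFun]; ring
  have h2 := inner_conj_symm (𝕜 := ℂ) (lowpass n p) (lap n p)
  rw [← h] at h2
  exact Complex.conj_eq_iff_im.1 h2

lemma cutOp_phaseOp (n : ℕ) (t : ℝ) (p : HL2) : cutOp n (phaseOp t p) = phaseOp t (cutOp n p) := by
  refine Lp.ext ?_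
  filter_upwards [coeFn_cutOp n (phaseOp t p), coeFn_cutOp n p, coeFn_phaseOp t p, coeFn_phaseOp t (cutOp n p)]
    with x h1 h2 h3 h4
  rw [h1, h4, h2, h3]; ring

lemma lowpass_flow (n : ℕ) (t : ℝ) (p : HL2) : lowpass n (flow t p) = flow t (lowpass n p) := by
  simp only [lowpass_apply, flow_apply, cosT_cosT, cutOp_phaseOp]

/-- On frequencies up to n the exponent z = -iλ²s satisfies |z| ≤ n²|s| ≤ 1, the range in which |e^z
- 1 - z| ≤ |z|². -/
lemma norm_lowpass_flow_sub_le (n : ℕ) {s : ℝ} (hs : |s| * (n : ℝ) ^ 2 ≤ 1) (g : HL2) :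
    ‖lowpass n (flow s g) - lowpass n g - s • (-Complex.I • lap n g)‖ ≤ (n : ℝ) ^ 4 * s ^ 2 * ‖g‖ := by
  have e : lowpass n (flow s g) - lowpass n g - s • (-Complex.I • lap n g)
      = cosT (cutOp n (phaseOp s (cosT g)) - cutOp n (cosT g) - (s : ℂ) • (-Complex.I • lapOp n (cosT g))) := by
    simp only [lowpass_apply, flow_apply, lap_apply, cosT_cosT, map_sub, map_smul]
    rfl
  rw [e, norm_cosT, ← norm_cosT g]
  refine Lp.norm_le_mul_norm_of_ae_le_mul ?_
  set c := cosT g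
  filter_upwards [Lp.coeFn_sub (cutOp n (phaseOp s c) - cutOp n c) ((s : ℂ) • (-Complex.I • lapOp n c)),
    Lp.coeFn_sub (cutOp n (phaseOp s c)) (cutOp n c), coeFn_cutOp n (phaseOp s c), coeFn_phaseOp s c,
    coeFn_cutOp n c, Lp.coeFn_smul (s : ℂ) (-Complex.I • lapOp n c), Lp.coeFn_smul (-Complex.I) (lapOp n c),
    coeFn_lapOp n c] with x h1 h2 h3 h4 h5 h6 h7 h8
  rw [h1, Pi.sub_apply, h2, Pi.sub_apply, h3, h4, h5, h6, Pi.smul_apply, h7, Pi.smul_apply, h8]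
  set z : ℂ := -(Complex.I * (x : ℂ) ^ 2 * (s : ℂ)) with hz
  have e2 : cutFun n x * (phase s x * c x) - cutFun n x * c x - (s : ℂ) • -Complex.I • (lapFun n x * c x)
      = (cutFun n x * (Complex.exp z - 1 - z)) * c x := by
    rw [phase, ← hz, lapFun, smul_eq_mul, smul_eq_mul]
    rw [hz]; push_cast; ring
  rw [e2, norm_mul]
  gcongr
  by_cases hx : x ∈ Set.Icc (0 : ℝ) n
  · have hz1 : ‖z‖ = x ^ 2 * |s| := by
      rw [hz, norm_neg, norm_mul, norm_mul, Complex.norm_I, one_mul, norm_pow, Complex.norm_real,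
        Complex.norm_real, Real.norm_eq_abs, Real.norm_eq_abs, sq_abs]
    have hxn : x ^ 2 ≤ (n : ℝ) ^ 2 := by
      have := hx.1
      have := hx.2
      gcongr
    have hz2 : ‖z‖ ≤ (n : ℝ) ^ 2 * |s| := by rw [hz1]; gcongr
    rw [norm_mul]
    calc ‖cutFun n x‖ * ‖Complex.exp z - 1 - z‖ ≤ 1 * ‖z‖ ^ 2 := by
          gcongr
          · exact norm_cutFun_le n x
          · exact Complex.norm_exp_sub_one_sub_id_le (hz2.trans (by linarith))
      _ ≤ 1 * ((n : ℝ) ^ 2 * |s|) ^ 2 := by gcongr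
      _ = _ := by rw [mul_pow, sq_abs]; ring
  · simp only [cutFun, hx, not_false_eq_true, Set.indicator_of_notMem, zero_mul, norm_zero]
    positivity

lemma hasDerivAt_lowpass_flow_zero (n : ℕ) (g : HL2) :
    HasDerivAt (fun s => lowpass n (flow s g)) (-Complex.I • lap n g) 0 := by
  rw [hasDerivAt_iff_isLittleO_nhds_zero]
  refine Asymptotics.IsBigO.trans_isLittleO (g := fun s : ℝ => ‖s‖ ^ 2) ?_
    (Asymptotics.isLittleO_norm_pow_id one_lt_two)
  refine Asymptotics.IsBigO.of_bound ((n : ℝ) ^ 4 * ‖g‖) ?_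
  have h1 : Tendsto (fun s : ℝ => |s| * (n : ℝ) ^ 2) (𝓝 0) (𝓝 0) := by
    have : Continuous fun s : ℝ => |s| * (n : ℝ) ^ 2 := by fun_prop
    simpa using this.tendsto 0
  filter_upwards [h1.eventually (ge_mem_nhds one_pos)] with s hs
  rw [zero_add, flow_zero, norm_pow, norm_norm, Real.norm_eq_abs, sq_abs]
  exact (norm_lowpass_flow_sub_le n hs g).trans_eq (by ring)

lemma hasDerivAt_lowpass_flow (n : ℕ) (t : ℝ) (g : HL2) :
    HasDerivAt (fun s => lowpass n (flow s g)) (-Complex.I • lap n (flow t g)) t := by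
  have h := hasDerivAt_lowpass_flow_zero n (flow t g)
  have h2 : HasDerivAt (fun s => s - t) 1 t := (hasDerivAt_id t).sub_const t
  have h' : HasDerivAt (fun s => lowpass n (flow s (flow t g))) (-Complex.I • lap n (flow t g))
      ((fun s => s - t) t) := by simpa using h
  have h3 := HasDerivAt.scomp (h := fun s => s - t) t h' h2
  rw [one_smul] at h3
  refine h3.congr_of_eventuallyEq (Eventually.of_forall fun s => ?_)
  simp only [Function.comp_apply]
  rw [← flow_add, sub_add_cancel]

lemma hasDerivAt_lowpass_flow_comp (n : ℕ) {v : ℝ → HL2} {v' : HL2} {t : ℝ} (hv : HasDerivAt v v' t) :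
    HasDerivAt (fun s => lowpass n (flow s (v s)))
      (-Complex.I • lap n (flow t (v t)) + lowpass n (flow t v')) t := by
  have h1 := hasDerivAt_lowpass_flow n t (v t)
  -- The product rule for a family that is only strongly continuous: the increment of v is treated
  -- through its slopes, carried along by the jointly continuous flow.
  have h2 : HasDerivAt (fun s => lowpass n (flow s (v s - v t))) (lowpass n (flow t v')) t := by
    rw [hasDerivAt_iff_tendsto_slope] at hv ⊢
    have hs : Tendsto (fun s => lowpass n (flow s (slope v t s))) (𝓝[≠] t) (𝓝 (lowpass n (flow t v'))) :=
      ((lowpass n).continuous.tendsto _).comp (tendsto_flow (tendsto_id.mono_left nhdsWithin_le_nhds) hv)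
    refine hs.congr fun s => ?_
    rw [slope_def_module, slope_def_module, sub_self, map_zero, map_zero, sub_zero]
    have : (s - t)⁻¹ • (v s - v t) = (((s - t)⁻¹ : ℝ) : ℂ) • (v s - v t) := (Complex.coe_smul _ _).symm
    rw [this, map_smul, map_smul, Complex.coe_smul]
    rfl
  refine (h1.add h2).congr_of_eventuallyEq (Eventually.of_forall fun s => ?_)
  simp

end LowPass

end

end ExteriorNLS

/-! ### Conservation of energy -/

namespace ExteriorNLS

noncomputable section

section Conservation

open scoped ComplexConjugate

/-- The sine transform. -/
def sinFun (f : ℝ → ℂ) (x : ℝ) : ℂ :=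
  (√(2 / Real.pi) : ℂ) * ∫ lam, (Real.sin (lam * x) : ℂ) * f lam ∂halfLine

lemma norm_ofReal_sin_le (s : ℝ) : ‖((Real.sin s : ℝ) : ℂ)‖ ≤ 1 := by
  rw [Complex.norm_real]; exact Real.abs_sin_le_one s

lemma continuous_sinFun {f : ℝ → ℂ} (hf : Integrable f halfLine) : Continuous (sinFun f) := by
  refine continuous_const.mul (continuous_of_dominated (bound := fun lam => ‖f lam‖) ?_ ?_ hf.norm ?_)
  · exact fun x => (integrable_bdd_mul (by fun_prop) (fun _ => norm_ofReal_sin_le _) hf).aestronglyMeasurable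
  · refine fun x => Eventually.of_forall fun lam => ?_
    rw [norm_mul]
    exact mul_le_of_le_one_left (norm_nonneg _) (norm_ofReal_sin_le _)
  · exact Eventually.of_forall fun lam => by fun_prop

lemma hasDerivAt_cosFun {f : ℝ → ℂ} (hf : Integrable f halfLine)
    (hf' : Integrable (fun lam : ℝ => (lam : ℂ) * f lam) halfLine) (x : ℝ) :
    HasDerivAt (cosFun f) (-sinFun (fun lam : ℝ => (lam : ℂ) * f lam) x) x := by
  have key := hasDerivAt_integral_of_dominated_loc_of_deriv_le (μ := halfLine) (x₀ := x) (s := Set.univ)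
    (F := fun x lam => (Real.cos (x * lam) : ℂ) * f lam)
    (F' := fun x lam => -((Real.sin (lam * x) : ℂ) * ((lam : ℂ) * f lam)))
    (bound := fun lam => ‖(lam : ℂ) * f lam‖) Filter.univ_mem
    (Eventually.of_forall fun y => (integrable_cos_mul hf y).aestronglyMeasurable)
    (integrable_cos_mul hf x)
    (integrable_bdd_mul (by fun_prop) (fun _ => norm_ofReal_sin_le _) hf').aestronglyMeasurable.neg
    (Eventually.of_forall fun lam y _ => ?_) hf'.norm (Eventually.of_forall fun lam y _ => ?_)
  · have h := key.2.const_mul (√(2 / Real.pi) : ℂ)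
    refine HasDerivAt.congr_deriv h ?_
    rw [integral_neg, sinFun, mul_neg]
  · rw [norm_neg, norm_mul]
    exact mul_le_of_le_one_left (norm_nonneg _) (norm_ofReal_sin_le _)
  · have h1 : HasDerivAt (fun y : ℝ => y * lam) lam y := by simpa using (hasDerivAt_id y).mul_const lam
    refine HasDerivAt.congr_deriv (h1.cos.ofReal_comp.mul_const (f lam)) ?_
    rw [mul_comm y lam]; push_cast; ring

lemma integrable_of_eq_zero_above {f : HL2} {g : ℝ → ℂ} (hg : Measurable g) {C : ℝ} {n : ℕ}
    (h : ∀ᵐ x ∂halfLine, ‖g x‖ ≤ C * ‖f x‖ ∧ (x ∉ Set.Ioc (0 : ℝ) n → g x = 0)) : Integrable g halfLine := by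
  have h1 : Integrable ((Set.Ioc (0 : ℝ) n).indicator fun x => C * ‖f x‖) halfLine := by
    rw [integrable_indicator_iff measurableSet_Ioc, IntegrableOn, Ioc_restrict_halfLine le_rfl]
    exact (f.integrableOn le_rfl).norm.const_mul C
  refine h1.mono' hg.aestronglyMeasurable ?_
  filter_upwards [h] with x hx
  by_cases hxn : x ∈ Set.Ioc (0 : ℝ) n
  · simpa [hxn] using hx.1
  · simp [hxn, hx.2 hxn]

/-- The low frequency part is represented by a `C¹` function whose derivative is the primitive of the
truncated Laplacian. -/
lemma exists_lowpass_rep (n : ℕ) (p : HL2) : ∃ F : ℝ → ℂ, ContDiff ℝ 1 F ∧ (∃ C, ∀ x, ‖F x‖ ≤ C) ∧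
    lowpass n p =ᵐ[halfLine] F ∧ ∀ x, 0 ≤ x → deriv F x = -prim (lap n p) x := by
  set c := cosT p with hc
  set m : ℝ → ℂ := fun x => cutFun n x * c x with hm
  have hmm : Measurable m := (measurable_cutFun n).mul (measurable_HL2 c)
  have hz : ∀ x, 0 < x → x ∉ Set.Ioc (0 : ℝ) n → cutFun n x = 0 := by
    intro x hx hxn
    have : x ∉ Set.Icc (0 : ℝ) n := fun h => hxn ⟨hx, h.2⟩
    simp [cutFun, this]
  have i1 : Integrable m halfLine := integrable_of_eq_zero_above (f := c) (C := 1) (n := n) hmm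
    (ae_halfLine_of_forall fun x hx => ⟨by
      rw [norm_mul]; gcongr; exact norm_cutFun_le n x, fun h => by rw [hm]; simp [hz x hx h]⟩)
  have i2 : Integrable (fun x : ℝ => (x : ℂ) * m x) halfLine := by
    refine integrable_of_eq_zero_above (f := c) (C := n) (n := n) (by fun_prop)
      (ae_halfLine_of_forall fun x hx => ⟨?_, fun h => by rw [hm]; simp [hz x hx h]⟩)
    by_cases h : x ∈ Set.Ioc (0 : ℝ) n
    · rw [norm_mul, norm_mul, Complex.norm_real, Real.norm_of_nonneg hx.le, ← mul_assoc]
      gcongr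
      exact (mul_le_of_le_one_right hx.le (norm_cutFun_le n x)).trans h.2
    · simp only [hm, hz x hx h, zero_mul, mul_zero, norm_zero]
      positivity
  have hd := hasDerivAt_cosFun i1 i2
  have hderiv : deriv (cosFun m) = fun x => -sinFun (fun lam : ℝ => (lam : ℂ) * m lam) x :=
    funext fun x => (hd x).deriv
  refine ⟨cosFun m, ?_, ⟨√(2 / Real.pi) * ∫ x, ‖m x‖ ∂halfLine, fun x => ?_⟩, ?_, fun x hx => ?_⟩
  · rw [contDiff_one_iff_deriv, hderiv]
    exact ⟨fun x => (hd x).differentiableAt, (continuous_sinFun i2).neg⟩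
  · rw [cosFun, norm_mul, Complex.norm_real, Real.norm_of_nonneg (Real.sqrt_nonneg _)]
    gcongr
    refine norm_integral_le_of_norm_le i1.norm (Eventually.of_forall fun y => ?_)
    rw [norm_mul]
    exact mul_le_of_le_one_left (norm_nonneg _) (norm_ofReal_cos_le _)
  · exact coeFn_cosT (coeFn_cutOp n c) i1
  · rw [hderiv, lap_apply, prim_cosT _ hx]
    change -sinFun _ x = _
    rw [sinFun]
    congr 2
    refine integral_congr_ae ?_
    filter_upwards [coeFn_lapOp n (cosT p), ae_halfLine_of_forall (P := fun x => 0 < x) (fun x hx => hx)]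
      with y h1 h2
    have : (y : ℂ) ≠ 0 := by exact_mod_cast h2.ne'
    rw [h1, lapFun]
    simp only [hm, hc]
    push_cast
    field_simp

lemma inner_eq_integral_mul (p q : HL2) : inner ℂ p q = ∫ x, conj (p x) * q x ∂halfLine := by
  rw [L2.inner_def]
  refine integral_congr_ae (Eventually.of_forall fun x => ?_)
  simp only [RCLike.inner_apply]; ring

lemma integrable_conj_mul (p q : HL2) : Integrable (fun x => conj (p x) * q x) halfLine := by
  refine (L2.integrable_inner (𝕜 := ℂ) p q).congr (Eventually.of_forall fun x => ?_)
  simp only [RCLike.inner_apply]; ring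

lemma tendsto_setIntegral_Ioc {f : ℝ → ℂ} (hf : Integrable f halfLine) :
    Tendsto (fun n : ℕ => ∫ x in Set.Ioc (0 : ℝ) n, f x) atTop (𝓝 (∫ x, f x ∂halfLine)) := by
  have h := intervalIntegral_tendsto_integral_Ioi (μ := volume) 0 (f := f) hf tendsto_natCast_atTop_atTop
  refine h.congr fun n => ?_
  rw [intervalIntegral.integral_of_le (by positivity)]

/-- The primitive r|u|⁴u is of size r^{-3/2}. The weaker rate stated here is enough to kill boundary
terms at infinity and to give the source mean zero. -/
lemma norm_prim_nl_le (q : HL2) {x : ℝ} (hx : 0 < x) : ‖prim (nl q) x‖ ≤ ‖q‖ ^ 5 * (√x)⁻¹ := by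
  rw [prim_nl q hx.le, norm_mul, norm_mul, norm_pow, norm_pow, RCLike.norm_conj, Complex.norm_real,
    Real.norm_of_nonneg (by linarith)]
  have h := norm_profile_le q hx.le
  have hs : 0 < √x := Real.sqrt_pos.2 hx
  have hs1 : √x ≤ √(1 + x) := Real.sqrt_le_sqrt (by linarith)
  have hs2 : 1 ≤ √(1 + x) := by rw [Real.one_le_sqrt]; linarith
  have hsq : √(1 + x) ^ 2 = 1 + x := Real.sq_sqrt (by linarith)
  set s := √(1 + x)
  calc (1 + x) * (‖profile q x‖ ^ 3 * ‖profile q x‖ ^ 2) = s ^ 2 * ‖profile q x‖ ^ 5 := by rw [hsq]; ring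
    _ ≤ s ^ 2 * (s⁻¹ * ‖q‖) ^ 5 := by gcongr
    _ = ‖q‖ ^ 5 * (s⁻¹ * s⁻¹ * s⁻¹) := by
        have : s ≠ 0 := by positivity
        field_simp
    _ ≤ ‖q‖ ^ 5 * ((√x)⁻¹ * 1 * 1) := by
        have : s⁻¹ ≤ 1 := inv_le_one_of_one_le₀ hs2
        gcongr
    _ = _ := by ring

/-- Integration by parts: the truncated function F has derivative -`prim (lap n p)`, and the
primitive of `nl q` is r|u|⁴u, so their product is r²|u|⁴u against a profile. The boundary term
vanishes at 0 with the primitive, and at infinity because F is bounded and the primitive decays. -/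
lemma inner_pot_hardy_lap (n : ℕ) (p q : HL2) :
    inner ℂ (pot q) (hardy (lap n p)) = inner ℂ (nl q) (lowpass n p) := by
  obtain ⟨F, hF, ⟨C, hC⟩, hFe, hFd⟩ := exists_lowpass_rep n p
  have hFc : ContDiff ℝ 1 fun x => conj (F x) := Complex.conjCLE.contDiff.comp hF
  have hFcd : ∀ x, deriv (fun x => conj (F x)) x = conj (deriv F x) := fun x =>
    ((hF.differentiable (by norm_num) x).hasDerivAt.star).deriv
  have hX : ∀ k : ℕ, ∫ x in Set.Ioc (0 : ℝ) k, conj (nl q x) * lowpass n p x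
      = F k * conj (prim (nl q) k) + ∫ x in Set.Ioc (0 : ℝ) k, conj (pot q x) * hardy (lap n p) x := by
    intro k
    have h := integral_mul_eq_prim hFc (nl q) (X := k) (by positivity)
    have h2 := congrArg conj h
    rw [← integral_conj, map_sub, ← integral_conj, map_mul, Complex.conj_conj] at h2
    have e1 : ∫ x in Set.Ioc (0 : ℝ) k, conj (nl q x) * lowpass n p x
        = ∫ x in Set.Ioc (0 : ℝ) k, conj (conj (F x) * nl q x) := by
      refine integral_congr_ae ?_
      filter_upwards [ae_Ioc_of_ae_halfLine hFe (b := k) le_rfl] with x hx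
      rw [hx, map_mul, Complex.conj_conj, mul_comm]
    have e2 : ∫ x in Set.Ioc (0 : ℝ) k, conj (pot q x) * hardy (lap n p) x
        = -∫ x in Set.Ioc (0 : ℝ) k, conj (deriv (fun x => conj (F x)) x * prim (nl q) x) := by
      rw [← integral_neg]
      refine integral_congr_ae ?_
      filter_upwards [ae_Ioc_of_ae_halfLine (coeFn_pot q) (b := k) le_rfl,
        ae_Ioc_of_ae_halfLine (coeFn_hardy (lap n p)) (b := k) le_rfl, ae_restrict_mem measurableSet_Ioc]
        with x h1 h2 h3
      have h0 : ((1 + x : ℝ) : ℂ) ≠ 0 := by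
        have : (1 + x : ℝ) ≠ 0 := by linarith [h3.1]
        exact_mod_cast this
      rw [h1, h2, hFcd, hFd x h3.1.le, prim_nl q h3.1.le, profile, potFun]
      simp only [map_mul, Complex.conj_conj, map_neg, map_pow, Complex.conj_ofReal]
      push_cast at h0 ⊢
      field_simp
    rw [e1, e2, h2]; ring
  have l1 := tendsto_setIntegral_Ioc (integrable_conj_mul (nl q) (lowpass n p))
  have l2 := tendsto_setIntegral_Ioc (integrable_conj_mul (pot q) (hardy (lap n p)))
  have l3 : Tendsto (fun k : ℕ => F k * conj (prim (nl q) k)) atTop (𝓝 0) := by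
    have hs : Tendsto (fun k : ℕ => C * (‖q‖ ^ 5 * (√(k : ℝ))⁻¹)) atTop (𝓝 0) := by
      have h1 : Tendsto (fun k : ℕ => (√(k : ℝ))⁻¹) atTop (𝓝 0) :=
        tendsto_inv_atTop_zero.comp (Real.tendsto_sqrt_atTop.comp tendsto_natCast_atTop_atTop)
      simpa using (h1.const_mul (‖q‖ ^ 5)).const_mul C
    refine squeeze_zero_norm' ?_ hs
    filter_upwards [eventually_gt_atTop 0] with k hk
    rw [norm_mul, RCLike.norm_conj]
    have hk' : (0 : ℝ) < k := by exact_mod_cast hk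
    exact mul_le_mul (hC k) (norm_prim_nl_le q hk') (norm_nonneg _) ((norm_nonneg _).trans (hC k))
  rw [inner_eq_integral_mul, inner_eq_integral_mul]
  have l4 := l3.add l2
  rw [zero_add] at l4
  refine tendsto_nhds_unique l4 (l1.congr fun k => ?_)
  rw [hX]

/-- The pairing is the integral of the real density r²|u|¹⁰. -/
lemma im_inner_pot_hardy_nl (p : HL2) : (inner ℂ (pot p) (hardy (nl p))).im = 0 := by
  have h : inner ℂ (pot p) (hardy (nl p)) = inner ℂ (hardy (nl p)) (pot p) := by
    rw [inner_eq_integral_mul, inner_eq_integral_mul]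
    refine integral_congr_ae ?_
    filter_upwards [coeFn_pot p, coeFn_hardy (nl p), ae_halfLine_of_forall (P := fun x => 0 < x) (fun x hx => hx)]
      with x h1 h2 h3
    rw [h1, h2, profile, prim_nl p h3.le, potFun]
    simp only [map_mul, Complex.conj_conj, map_pow, Complex.conj_ofReal, map_div₀]
    ring
  have h2 := inner_conj_symm (𝕜 := ℂ) (pot p) (hardy (nl p))
  rw [← h] at h2
  exact Complex.conj_eq_iff_im.1 h2

/-- The energy on the half-line. -/
def halfEnergy (p : HL2) : ℝ := 1 / 2 * ‖p‖ ^ 2 + potential p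

lemma hasDerivAt_halfEnergy {q : ℝ → HL2} {q' : HL2} {t : ℝ} (hq : HasDerivAt q q' t) :
    HasDerivAt (fun s => halfEnergy (q s))
      ((inner ℂ (q t) q').re + (inner ℂ (pot (q t)) (hardy q')).re) t := by
  have h1 : HasDerivAt (fun s => (inner ℂ (q s) (q s)).re) (inner ℂ (q t) q' + inner ℂ q' (q t)).re t :=
    Complex.reCLM.hasFDerivAt.comp_hasDerivAt t (hq.inner ℂ hq)
  have e : ∀ s, (inner ℂ (q s) (q s)).re = ‖q s‖ ^ 2 := fun s => @inner_self_eq_norm_sq ℂ HL2 _ _ _ (q s)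
  simp_rw [e] at h1
  have h2 := (hasFDerivAt_potential (q t)).comp_hasDerivAt t hq
  refine HasDerivAt.congr_deriv ((h1.const_mul (1 / 2)).add h2) ?_
  rw [potentialDeriv_apply, Complex.add_re, ← inner_conj_symm q' (q t), Complex.conj_re]
  ring

/-- The rate of change of the energy of the low frequency part. -/
def energyRate (n : ℕ) (p : HL2) : ℝ :=
  (-Complex.I * (inner ℂ (lowpass n p) (nl p) + inner ℂ (nl (lowpass n p)) (lowpass n p) +
    inner ℂ (pot (lowpass n p)) (hardy (lowpass n (nl p))))).re

lemma flow_field (t : ℝ) (v : HL2) : flow t (field t v) = -Complex.I • nl (flow t v) := by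
  rw [field, map_smul, flow_flow_neg]

/-- The kinetic term with the Laplacian is -i times a real number and drops out; the potential term
with the Laplacian becomes a pairing with `nl` by `inner_pot_hardy_lap`. No unbounded operator
remains, so the rate can be estimated uniformly in n. -/
lemma hasDerivAt_halfEnergy_lowpass (n : ℕ) {v : ℝ → HL2} {t : ℝ} (hv : HasDerivAt v (field t (v t)) t) :
    HasDerivAt (fun s => halfEnergy (lowpass n (flow s (v s)))) (energyRate n (flow t (v t))) t := by
  refine HasDerivAt.congr_deriv (hasDerivAt_halfEnergy (hasDerivAt_lowpass_flow_comp n hv)) ?_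
  rw [flow_field]
  set p := flow t (v t)
  rw [map_smul, ← smul_add, inner_smul_right, map_smul, inner_smul_right, map_add, inner_add_right,
    inner_add_right, inner_pot_hardy_lap, ← inner_lowpass, lowpass_lowpass, energyRate, ← Complex.add_re,
    ← sub_eq_zero, ← Complex.sub_re]
  have h := im_inner_lowpass_lap n p
  have : (-Complex.I * inner ℂ (lowpass n p) (lap n p)).re = 0 := by simp [h]
  rw [← this]
  congr 1
  ring

lemma continuous_energyRate (n : ℕ) : Continuous (energyRate n) := by
  have h1 := continuous_nl
  have h2 := continuous_pot
  unfold energyRate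
  refine Complex.continuous_re.comp (continuous_const.mul ((Continuous.add ?_ ?_).add ?_))
  · exact (lowpass n).continuous.inner h1
  · exact (h1.comp (lowpass n).continuous).inner (lowpass n).continuous
  · exact (h2.comp (lowpass n).continuous).inner
      (hardy.continuous.comp ((lowpass n).continuous.comp h1))

/-- Without truncation the two pairings of p with `nl p` are conjugate and the third term is real,
so the bracket is real and -i makes it purely imaginary. -/
lemma tendsto_energyRate (p : HL2) : Tendsto (fun n => energyRate n p) atTop (𝓝 0) := by
  have l := tendsto_lowpass p
  have l2 := (hardy.continuous.tendsto _).comp (tendsto_lowpass (nl p))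
  have l3 : Tendsto (fun n => energyRate n p) atTop (𝓝 ((-Complex.I * (inner ℂ p (nl p) + inner ℂ (nl p) p +
      inner ℂ (pot p) (hardy (nl p)))).re)) := by
    refine (Complex.continuous_re.tendsto _).comp (Tendsto.const_mul _ ((Tendsto.add ?_ ?_).add ?_))
    · exact l.inner tendsto_const_nhds
    · exact ((continuous_nl.tendsto p).comp l).inner l
    · exact ((continuous_pot.tendsto p).comp l).inner l2
  have h1 := im_inner_pot_hardy_nl p
  have h2 : (inner ℂ p (nl p)).im = -(inner ℂ (nl p) p).im := by
    rw [← inner_conj_symm p (nl p), Complex.conj_im]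
  have : (-Complex.I * (inner ℂ p (nl p) + inner ℂ (nl p) p + inner ℂ (pot p) (hardy (nl p)))).re = 0 := by
    simp [h1, h2]
  rwa [this] at l3

lemma abs_energyRate_le (n : ℕ) {p : HL2} {R : ℝ} (hp : ‖p‖ ≤ R) :
    |energyRate n p| ≤ 130 * R ^ 6 + 1300 * R ^ 10 := by
  have hR : 0 ≤ R := (norm_nonneg _).trans hp
  have h1 := (norm_lowpass_le n p).trans hp
  have h2 := (norm_nl_le p).trans (by gcongr : 65 * ‖p‖ ^ 5 ≤ 65 * R ^ 5)
  have h3 := (norm_nl_le (lowpass n p)).trans (by gcongr : 65 * ‖lowpass n p‖ ^ 5 ≤ 65 * R ^ 5)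
  have h4 := (norm_pot_le (lowpass n p)).trans (by gcongr : 10 * ‖lowpass n p‖ ^ 5 ≤ 10 * R ^ 5)
  have h5 : ‖hardy (lowpass n (nl p))‖ ≤ 2 * (65 * R ^ 5) :=
    (norm_hardy_le _).trans (by have := (norm_lowpass_le n (nl p)).trans h2; gcongr)
  refine (Complex.abs_re_le_norm _).trans ?_
  rw [norm_mul, norm_neg, Complex.norm_I, one_mul]
  refine (norm_add₃_le).trans ?_
  calc _ ≤ ‖lowpass n p‖ * ‖nl p‖ + ‖nl (lowpass n p)‖ * ‖lowpass n p‖ +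
        ‖pot (lowpass n p)‖ * ‖hardy (lowpass n (nl p))‖ :=
        add_le_add_three (norm_inner_le_norm _ _) (norm_inner_le_norm _ _) (norm_inner_le_norm _ _)
    _ ≤ R * (65 * R ^ 5) + (65 * R ^ 5) * R + (10 * R ^ 5) * (2 * (65 * R ^ 5)) := by gcongr
    _ = _ := by ring

lemma continuous_halfEnergy : Continuous halfEnergy := by
  have := continuous_potential
  unfold halfEnergy; fun_prop

/-- The truncated identity is integrated in time and n → ∞ by dominated convergence.
Differentiability only in the interior allows its use up to a possible exit time from a ball. -/
theorem halfEnergy_flow_eq {v : ℝ → HL2} {a b : ℝ} (hab : a ≤ b) (hc : ContinuousOn v (Set.Icc a b))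
    (hd : ∀ t ∈ Set.Ioo a b, HasDerivAt v (field t (v t)) t) :
    halfEnergy (flow b (v b)) = halfEnergy (flow a (v a)) := by
  have hpc : ContinuousOn (fun t => flow t (v t)) (Set.Icc a b) := fun t ht =>
    tendsto_flow (tendsto_id.mono_left nhdsWithin_le_nhds) (hc t ht)
  obtain ⟨R, hR⟩ := isCompact_Icc.exists_bound_of_continuousOn hpc
  have hint : ∀ n, ∫ t in a..b, energyRate n (flow t (v t))
      = halfEnergy (lowpass n (flow b (v b))) - halfEnergy (lowpass n (flow a (v a))) := by
    intro n
    refine intervalIntegral.integral_eq_sub_of_hasDerivAt_of_le hab ?_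
      (fun t ht => hasDerivAt_halfEnergy_lowpass n (hd t ht)) ?_
    · exact continuous_halfEnergy.comp_continuousOn ((lowpass n).continuous.comp_continuousOn hpc)
    · refine ContinuousOn.intervalIntegrable ?_
      rw [Set.uIcc_of_le hab]
      exact (continuous_energyRate n).comp_continuousOn hpc
  have l1 : Tendsto (fun n => ∫ t in a..b, energyRate n (flow t (v t))) atTop (𝓝 (∫ t in a..b, (0 : ℝ))) := by
    refine intervalIntegral.tendsto_integral_filter_of_dominated_convergence
      (fun _ => 130 * R ^ 6 + 1300 * R ^ 10) (Eventually.of_forall fun n => ?_)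
      (Eventually.of_forall fun n => Eventually.of_forall fun t ht => ?_) intervalIntegrable_const
      (Eventually.of_forall fun t ht => tendsto_energyRate _)
    · rw [Set.uIoc_of_le hab]
      exact (((continuous_energyRate n).comp_continuousOn hpc).mono Set.Ioc_subset_Icc_self).aestronglyMeasurable
        measurableSet_Ioc
    · rw [Set.uIoc_of_le hab] at ht
      exact abs_energyRate_le n (hR t ⟨ht.1.le, ht.2⟩)
  have l2 : ∀ p : HL2, Tendsto (fun n => halfEnergy (lowpass n p)) atTop (𝓝 (halfEnergy p)) := fun p =>
    (continuous_halfEnergy.tendsto p).comp (tendsto_lowpass p)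
  simp_rw [hint] at l1
  have := tendsto_nhds_unique l1 ((l2 _).sub (l2 _))
  simp at this
  linarith

end Conservation

end

end ExteriorNLS

/-! ### Global existence and uniqueness -/

namespace ExteriorNLS

noncomputable section

section GlobalExistence

/-- Radial projection to the ball of radius `R`. -/
def ballProj (R : ℝ) (v : HL2) : HL2 := ((R / max R ‖v‖ : ℝ) : ℂ) • v

lemma ballProj_of_le {R : ℝ} (hR : 0 < R) {v : HL2} (hv : ‖v‖ ≤ R) : ballProj R v = v := by
  rw [ballProj, max_eq_left hv, div_self hR.ne', Complex.ofReal_one, one_smul]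

lemma norm_ballProj_le {R : ℝ} (hR : 0 < R) (v : HL2) : ‖ballProj R v‖ ≤ R := by
  have h : 0 < max R ‖v‖ := lt_max_of_lt_left hR
  rw [ballProj, norm_smul, Complex.norm_real, Real.norm_of_nonneg (by positivity), div_mul_eq_mul_div,
    div_le_iff₀ h]
  gcongr
  exact le_max_right _ _

lemma norm_ballProj_sub_le {R : ℝ} (hR : 0 < R) (v w : HL2) :
    ‖ballProj R v - ballProj R w‖ ≤ 2 * ‖v - w‖ := by
  set a := max R ‖v‖ with ha
  set b := max R ‖w‖ with hb
  have ha0 : 0 < a := lt_max_of_lt_left hR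
  have hb0 : 0 < b := lt_max_of_lt_left hR
  have hRa : R ≤ a := le_max_left _ _
  have hwb : ‖w‖ ≤ b := le_max_right _ _
  have hab : |b - a| ≤ ‖v - w‖ := by
    have := abs_max_sub_max_le_abs ‖w‖ ‖v‖ R
    rw [max_comm _ R, max_comm _ R] at this
    exact this.trans ((abs_norm_sub_norm_le w v).trans_eq (norm_sub_rev w v))
  have e : ballProj R v - ballProj R w
      = ((R / a : ℝ) : ℂ) • (v - w) + ((R * (b - a) / (a * b) : ℝ) : ℂ) • w := by
    have : R * (b - a) / (a * b) = R / a - R / b := by field_simp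
    rw [ballProj, ballProj, ← ha, ← hb, this, Complex.ofReal_sub, smul_sub, sub_smul]
    abel
  rw [e]
  refine (norm_add_le _ _).trans ?_
  rw [norm_smul, norm_smul, Complex.norm_real, Complex.norm_real, Real.norm_of_nonneg (by positivity),
    Real.norm_eq_abs, abs_div, abs_mul, abs_of_pos hR, abs_of_pos (mul_pos ha0 hb0)]
  have h1 : R / a ≤ 1 := (div_le_one ha0).2 hRa
  have h2 : R * |b - a| / (a * b) * ‖w‖ ≤ ‖v - w‖ := by
    rw [div_mul_eq_mul_div, div_le_iff₀ (mul_pos ha0 hb0)]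
    calc R * |b - a| * ‖w‖ ≤ a * ‖v - w‖ * b := by gcongr
      _ = _ := by ring
  calc _ ≤ 1 * ‖v - w‖ + ‖v - w‖ := by gcongr
    _ = _ := by ring

lemma potential_le_halfEnergy (p : HL2) : 1 / 2 * ‖p‖ ^ 2 ≤ halfEnergy p :=
  le_add_of_nonneg_right (potential_nonneg p)

/-- A bound for the norm of solutions in terms of the energy. -/
def energyRadius (p : HL2) : ℝ := √(2 * halfEnergy p) + 1

lemma energyRadius_pos (p : HL2) : 0 < energyRadius p := by unfold energyRadius; positivity

/-- The added 1 in `energyRadius` makes the inequality strict, so that a norm equal to the radius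
contradicts conservation. -/
lemma norm_lt_energyRadius {p q : HL2} (h : halfEnergy q = halfEnergy p) : ‖q‖ < energyRadius p := by
  have h1 := potential_le_halfEnergy q
  have : ‖q‖ ≤ √(2 * halfEnergy p) := Real.le_sqrt_of_sq_le (by linarith)
  rw [energyRadius]
  linarith

/-- Consider the time closest to t₀, on either side, at which the norm reaches R. The equation holds
strictly between, so the energy is conserved up to that time and forces the norm below R, a
contradiction. -/
lemma norm_lt_of_hasDerivAt {v : ℝ → HL2} {a b t₀ : ℝ} (hab : t₀ ∈ Set.Icc a b) (hc : ContinuousOn v (Set.Icc a b))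
    {R : ℝ} (hRv : R = energyRadius (flow t₀ (v t₀)))
    (hd : ∀ t ∈ Set.Ioo a b, ‖v t‖ < R → HasDerivAt v (field t (v t)) t) :
    ∀ t ∈ Set.Icc a b, ‖v t‖ < R := by
  have h0 : ‖v t₀‖ < R := by
    rw [← norm_flow t₀, hRv]; exact norm_lt_energyRadius rfl
  by_contra! hcon
  obtain ⟨t, ht, hRt⟩ := hcon
  rcases le_total t₀ t with htt | htt
  · have hcl : IsClosed ({s ∈ Set.Icc t₀ t | R ≤ ‖v s‖}) :=
      (hc.mono (Set.Icc_subset_Icc hab.1 ht.2)).norm.preimage_isClosed_of_isClosed isClosed_Icc isClosed_Ici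
    have hcp : IsCompact ({s ∈ Set.Icc t₀ t | R ≤ ‖v s‖}) :=
      isCompact_Icc.of_isClosed_subset hcl fun s hs => hs.1
    obtain ⟨s, ⟨hs, hRs⟩, hmin⟩ := hcp.exists_isLeast ⟨t, ⟨htt, le_rfl⟩, hRt⟩
    have hlt : ∀ r ∈ Set.Ico t₀ s, ‖v r‖ < R := fun r hr => by
      by_contra! h
      exact absurd (hmin ⟨⟨hr.1, hr.2.le.trans hs.2⟩, h⟩) (not_le.2 hr.2)
    have hE := halfEnergy_flow_eq hs.1 (hc.mono (Set.Icc_subset_Icc hab.1 (hs.2.trans ht.2)))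
      fun r hr => hd r ⟨hab.1.trans_lt hr.1, hr.2.trans_le (hs.2.trans ht.2)⟩ (hlt r ⟨hr.1.le, hr.2⟩)
    have := norm_lt_energyRadius hE
    rw [norm_flow, ← hRv] at this
    linarith
  · have hcl : IsClosed ({s ∈ Set.Icc t t₀ | R ≤ ‖v s‖}) :=
      (hc.mono (Set.Icc_subset_Icc ht.1 hab.2)).norm.preimage_isClosed_of_isClosed isClosed_Icc isClosed_Ici
    have hcp : IsCompact ({s ∈ Set.Icc t t₀ | R ≤ ‖v s‖}) :=
      isCompact_Icc.of_isClosed_subset hcl fun s hs => hs.1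
    obtain ⟨s, ⟨hs, hRs⟩, hmax⟩ := hcp.exists_isGreatest ⟨t, ⟨le_rfl, htt⟩, hRt⟩
    have hlt : ∀ r ∈ Set.Ioc s t₀, ‖v r‖ < R := fun r hr => by
      by_contra! h
      exact absurd (hmax ⟨⟨hs.1.trans hr.1.le, hr.2⟩, h⟩) (not_le.2 hr.1)
    have hE := halfEnergy_flow_eq hs.2 (hc.mono (Set.Icc_subset_Icc (ht.1.trans hs.1) hab.2))
      fun r hr => hd r ⟨(ht.1.trans hs.1).trans_lt hr.1, hr.2.trans_le hab.2⟩ (hlt r ⟨hr.1, hr.2.le⟩)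
    have := norm_lt_energyRadius hE.symm
    rw [norm_flow, ← hRv] at this
    linarith

lemma continuousOn_field (v : HL2) : Continuous fun t => field t v := continuous_field_comp continuous_const

/-- Composed with the projection to the ball of radius R, the field is bounded and globally
Lipschitz, so Picard–Lindelöf works on an interval of any length. The energy bound shows that the
projection never acts. -/
lemma exists_solution_Icc (x₀ : HL2) {T : ℝ} (hT : 0 < T) : ∃ v : ℝ → HL2, v 0 = x₀ ∧
    ∀ t ∈ Set.Ioo (-T) T, HasDerivAt v (field t (v t)) t ∧ ‖v t‖ < energyRadius x₀ := by
  set R := energyRadius x₀ with hR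
  have hR0 : 0 < R := energyRadius_pos x₀
  have h0T : (0 : ℝ) ∈ Set.Icc (-T) T := ⟨by linarith, hT.le⟩
  -- The field is bounded by 65R⁵, so 65R⁵T bounds the distance travelled; 130R⁴ is the local
  -- constant 65R⁴ times the Lipschitz constant 2 of the projection.
  have hPL : IsPicardLindelof (fun t v => field t (ballProj R v)) (⟨0, h0T⟩ : Set.Icc (-T) T) x₀
      (Real.toNNReal (65 * R ^ 5 * T)) 0 (Real.toNNReal (65 * R ^ 5)) (Real.toNNReal (130 * R ^ 4)) := by
    refine ⟨fun t _ => LipschitzWith.lipschitzOnWith (LipschitzWith.of_dist_le_mul fun v w => ?_),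
      fun v _ => (continuousOn_field _).continuousOn, fun t _ v _ => ?_, ?_⟩
    · rw [dist_eq_norm, dist_eq_norm, Real.coe_toNNReal _ (by positivity)]
      refine (norm_field_sub_le t (norm_ballProj_le hR0 v) (norm_ballProj_le hR0 w)).trans ?_
      calc _ ≤ 65 * R ^ 4 * (2 * ‖v - w‖) := by gcongr; exact norm_ballProj_sub_le hR0 v w
        _ = _ := by ring
    · rw [norm_field, Real.coe_toNNReal _ (by positivity)]
      refine (norm_nl_le _).trans ?_
      rw [norm_flow]
      gcongr
      exact norm_ballProj_le hR0 v
    · rw [Real.coe_toNNReal _ (by positivity), Real.coe_toNNReal _ (by positivity)]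
      simp
  obtain ⟨v, hv0, hv⟩ := hPL.exists_eq_forall_mem_Icc_hasDerivWithinAt₀
  have hc : ContinuousOn v (Set.Icc (-T) T) := fun t ht => (hv t ht).continuousWithinAt
  have hd : ∀ t ∈ Set.Ioo (-T) T, ‖v t‖ < R → HasDerivAt v (field t (v t)) t := fun t ht hlt => by
    have := (hv t ⟨ht.1.le, ht.2.le⟩).hasDerivAt (Icc_mem_nhds ht.1 ht.2)
    rwa [ballProj_of_le hR0 hlt.le] at this
  have hv0' : v 0 = x₀ := hv0
  have hlt := norm_lt_of_hasDerivAt h0T hc (R := R) (by rw [flow_zero, hv0']) hd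
  exact ⟨v, hv0', fun t ht => ⟨hd t ht (hlt t ⟨ht.1.le, ht.2.le⟩), hlt t ⟨ht.1.le, ht.2.le⟩⟩⟩

lemma eqOn_of_hasDerivAt {v w : ℝ → HL2} {T R : ℝ} (hT : 0 < T) (h0 : v 0 = w 0)
    (hv : ∀ t ∈ Set.Ioo (-T) T, HasDerivAt v (field t (v t)) t ∧ ‖v t‖ < R)
    (hw : ∀ t ∈ Set.Ioo (-T) T, HasDerivAt w (field t (w t)) t ∧ ‖w t‖ < R) :
    Set.EqOn v w (Set.Ioo (-T) T) := by
  have h0T : (0 : ℝ) ∈ Set.Ioo (-T) T := ⟨by linarith, hT⟩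
  have hR : 0 < R := (norm_nonneg _).trans_lt (hv 0 h0T).2
  refine ODE_solution_unique_of_mem_Ioo (v := field) (s := fun _ => Metric.closedBall 0 R)
    (K := Real.toNNReal (65 * R ^ 4)) (fun t _ => LipschitzOnWith.of_dist_le_mul fun x hx y hy => ?_) h0T
    (fun t ht => ⟨(hv t ht).1, by simpa using (hv t ht).2.le⟩)
    (fun t ht => ⟨(hw t ht).1, by simpa using (hw t ht).2.le⟩) h0
  rw [dist_eq_norm, dist_eq_norm, Real.coe_toNNReal _ (by positivity)]
  exact norm_field_sub_le t (by simpa using hx) (by simpa using hy)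

lemma norm_lt_energyRadius_of_solution {v : ℝ → HL2} (hv : ∀ t, HasDerivAt v (field t (v t)) t) (t : ℝ) :
    ‖v t‖ < energyRadius (v 0) := by
  have hc : Continuous v := continuous_iff_continuousAt.2 fun t => (hv t).continuousAt
  refine norm_lt_of_hasDerivAt (a := -|t|) (b := |t|) (t₀ := 0) (by simp) hc.continuousOn
    (by rw [flow_zero]) (fun s _ _ => hv s) t ⟨neg_abs_le t, le_abs_self t⟩

lemma solution_unique {v w : ℝ → HL2} (hv : ∀ t, HasDerivAt v (field t (v t)) t)
    (hw : ∀ t, HasDerivAt w (field t (w t)) t) (h0 : v 0 = w 0) : v = w := by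
  funext t
  refine eqOn_of_hasDerivAt (T := |t| + 1) (R := energyRadius (v 0)) (by positivity) h0
    (fun s _ => ⟨hv s, norm_lt_energyRadius_of_solution hv s⟩)
    (fun s _ => ⟨hw s, h0 ▸ norm_lt_energyRadius_of_solution hw s⟩) ⟨?_, ?_⟩
  · linarith [neg_abs_le t]
  · linarith [le_abs_self t]

/-- Solutions on growing intervals agree where both live. Taking the index ⌈|t|⌉ at time t gives one
curve that near each time coincides with a single local solution. -/
theorem exists_solution (x₀ : HL2) : ∃ v : ℝ → HL2, v 0 = x₀ ∧ ∀ t, HasDerivAt v (field t (v t)) t := by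
  choose α hα0 hα using fun n : ℕ => exists_solution_Icc x₀ (T := n + 1) (by positivity)
  have hglue : ∀ n m : ℕ, ∀ t : ℝ, |t| < n + 1 → |t| < m + 1 → α n t = α m t := by
    intro n m t hn hm
    refine eqOn_of_hasDerivAt (T := min (n + 1) (m + 1)) (R := energyRadius x₀) (by positivity)
      ((hα0 n).trans (hα0 m).symm) (fun s hs => hα n s ?_) (fun s hs => hα m s ?_) ?_
    · rw [Set.mem_Ioo, ← abs_lt] at hs ⊢
      exact hs.trans_le (min_le_left _ _)
    · rw [Set.mem_Ioo, ← abs_lt] at hs ⊢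
      exact hs.trans_le (min_le_right _ _)
    · rw [Set.mem_Ioo, ← abs_lt]
      exact lt_min hn hm
  have hlt : ∀ t : ℝ, |t| < (⌈|t|⌉₊ : ℝ) + 1 := fun t => by linarith [Nat.le_ceil |t|]
  refine ⟨fun t => α ⌈|t|⌉₊ t, by simp [hα0], fun t => ?_⟩
  have hd := (hα ⌈|t|⌉₊ t (by rw [Set.mem_Ioo, ← abs_lt]; exact hlt t)).1
  refine hd.congr_of_eventuallyEq ?_
  have ho : IsOpen {s : ℝ | |s| < (⌈|t|⌉₊ : ℝ) + 1} := isOpen_lt continuous_abs continuous_const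
  filter_upwards [ho.mem_nhds (hlt t)] with s hs
  exact hglue _ _ s (hlt s) hs

end GlobalExistence

/-! ### The energy in half-line coordinates -/

section Energy

lemma integral_norm_gradient_sq (p : HL2) : ∫ x, ‖(lift p).gradient x‖ ^ 2 ∂volOmega = 4 * Real.pi * ‖p‖ ^ 2 := by
  have hm : AEStronglyMeasurable (fun x => ‖(lift p).gradient x‖ ^ 2) volOmega :=
    (Lp.aestronglyMeasurable _).norm.pow 2
  rw [integral_eq_lintegral_of_nonneg_ae (Eventually.of_forall fun x => by positivity) hm]
  have : ∫⁻ x, ENNReal.ofReal (‖(lift p).gradient x‖ ^ 2) ∂volOmega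
      = ∫⁻ x, ‖radialGrad p x‖ₑ ^ 2 ∂volOmega := by
    refine lintegral_congr_ae ?_
    filter_upwards [gradient_lift p] with x hx
    rw [hx, ENNReal.ofReal_pow (norm_nonneg _), ofReal_norm]
  rw [this, lintegral_radialGrad, ENNReal.toReal_ofReal (by positivity)]

lemma integral_norm_fn_six (p : HL2) : ∫ x, ‖(lift p).fn x‖ ^ 6 ∂volOmega
    = 4 * Real.pi * ∫ x, (1 + x) ^ 2 * ‖profile p x‖ ^ 6 ∂halfLine := by
  have hm : AEStronglyMeasurable (fun x => ‖(lift p).fn x‖ ^ 6) volOmega :=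
    (Lp.aestronglyMeasurable _).norm.pow 6
  rw [integral_eq_lintegral_of_nonneg_ae (Eventually.of_forall fun x => by positivity) hm,
    integral_eq_lintegral_of_nonneg_ae (Eventually.of_forall fun x => by positivity)
    (integrable_profile_six p).aestronglyMeasurable]
  have : ∫⁻ x, ENNReal.ofReal (‖(lift p).fn x‖ ^ 6) ∂volOmega
      = ∫⁻ x, ‖radialFn p x‖ₑ ^ 6 ∂volOmega := by
    refine lintegral_congr_ae ?_
    filter_upwards [fn_lift p] with x hx
    rw [hx, ENNReal.ofReal_pow (norm_nonneg _), ofReal_norm]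
  rw [this, lintegral_radialFn_pow, ENNReal.toReal_mul, ENNReal.toReal_ofReal (by positivity)]
  congr 2
  refine lintegral_congr fun x => ?_
  rw [ENNReal.ofReal_mul (by positivity), ENNReal.ofReal_pow (norm_nonneg _), ofReal_norm]

lemma energy_lift (p : HL2) : energy (lift p) = 4 * Real.pi * halfEnergy p := by
  rw [energy, integral_norm_gradient_sq, integral_norm_fn_six, halfEnergy, potential]
  ring

lemma energy_solution {v : ℝ → HL2} (hv : ∀ t, HasDerivAt v (field t (v t)) t) (t : ℝ) :
    energy (lift (flow t (v t))) = energy (lift (v 0)) := by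
  have hc : Continuous v := continuous_iff_continuousAt.2 fun t => (hv t).continuousAt
  have h0 : flow 0 (v 0) = v 0 := flow_zero _
  rw [energy_lift, energy_lift]
  congr 1
  rcases le_total 0 t with h | h
  · rw [halfEnergy_flow_eq h hc.continuousOn fun s _ => hv s, h0]
  · rw [← halfEnergy_flow_eq h hc.continuousOn fun s _ => hv s, h0]

end Energy

end

end ExteriorNLS

/-! ### Image measures of phase functions -/

namespace ExteriorNLS

noncomputable section

section PhaseMaps

/-- Bounds for the image of a measure under a differentiable injective phase. -/
lemma map_withDensity_le {s : Set ℝ} (hs : MeasurableSet s) {φ φ' : ℝ → ℝ} (hφm : Measurable φ)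
    (hφ : ∀ x ∈ s, HasDerivWithinAt φ (φ' x) s x) (hinj : Set.InjOn φ s) {w : ℝ → ℝ≥0∞}
    (hw : ∀ x ∈ s, w x ≤ ENNReal.ofReal |φ' x|) :
    ((volume.restrict s).withDensity w).map φ ≤ volume := by
  refine Measure.le_iff.2 fun E hE => ?_
  rw [Measure.map_apply hφm hE, withDensity_apply _ (hφm hE), ← lintegral_indicator (hφm hE)]
  calc ∫⁻ x in s, (φ ⁻¹' E).indicator w x
      ≤ ∫⁻ x in s, ENNReal.ofReal |φ' x| * E.indicator 1 (φ x) := by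
        refine setLIntegral_mono' hs fun x hx => ?_
        by_cases hxE : φ x ∈ E
        · have : x ∈ φ ⁻¹' E := hxE
          simpa [this, hxE] using hw x hx
        · have : x ∉ φ ⁻¹' E := hxE
          simp [this]
    _ = ∫⁻ y in φ '' s, E.indicator 1 y := (lintegral_image_eq_lintegral_abs_deriv_mul hs hφ hinj _).symm
    _ ≤ ∫⁻ y, E.indicator 1 y := setLIntegral_le_lintegral _ _
    _ = volume E := by rw [lintegral_indicator_one hE]

/-- In polar coordinates the area element is r dr dθ. The angle contributes 2π, and r is at most
|d(-6r²)/dr| = 12r; the factor 1/12 is given away. -/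
lemma map_neg_six_normSq_le :
    (volume : Measure (ℝ × ℝ)).map (fun z => -6 * (z.1 ^ 2 + z.2 ^ 2)) ≤ ENNReal.ofReal (2 * Real.pi) • volume := by
  have hφm : Measurable fun z : ℝ × ℝ => -6 * (z.1 ^ 2 + z.2 ^ 2) := by fun_prop
  refine Measure.le_iff.2 fun E hE => ?_
  rw [Measure.map_apply hφm hE, ← lintegral_indicator_one (hφm hE), ← lintegral_comp_polarCoord_symm]
  have e : ∀ p : ℝ × ℝ, ((fun z : ℝ × ℝ => -6 * (z.1 ^ 2 + z.2 ^ 2)) ⁻¹' E).indicator (1 : ℝ × ℝ → ℝ≥0∞)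
      (polarCoord.symm p) = E.indicator 1 (-6 * p.1 ^ 2) := by
    intro p
    have : -6 * ((polarCoord.symm p).1 ^ 2 + (polarCoord.symm p).2 ^ 2) = -6 * p.1 ^ 2 := by
      simp only [polarCoord_symm_apply]
      have := Real.sin_sq_add_cos_sq p.2
      linear_combination (-6 * p.1 ^ 2) * this
    by_cases h : -6 * p.1 ^ 2 ∈ E
    · have h' : polarCoord.symm p ∈ (fun z : ℝ × ℝ => -6 * (z.1 ^ 2 + z.2 ^ 2)) ⁻¹' E := by
        rw [Set.mem_preimage, this]; exact h
      rw [Set.indicator_of_mem h', Set.indicator_of_mem h]; rfl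
    · have h' : polarCoord.symm p ∉ (fun z : ℝ × ℝ => -6 * (z.1 ^ 2 + z.2 ^ 2)) ⁻¹' E := by
        rw [Set.mem_preimage, this]; exact h
      rw [Set.indicator_of_notMem h', Set.indicator_of_notMem h]
  simp_rw [e]
  rw [polarCoord_target, Measure.volume_eq_prod, ← Measure.prod_restrict, lintegral_prod _ (by
    have : Measurable (E.indicator (1 : ℝ → ℝ≥0∞)) := measurable_one.indicator hE
    simp only [smul_eq_mul]
    fun_prop)]
  simp only [smul_eq_mul, lintegral_const, Measure.restrict_apply MeasurableSet.univ, Set.univ_inter,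
    Real.volume_Ioo, sub_neg_eq_add]
  rw [lintegral_mul_const' _ _ ENNReal.ofReal_ne_top, Measure.smul_apply, smul_eq_mul, mul_comm, ← two_mul]
  gcongr
  have h := map_withDensity_le (s := Set.Ioi (0 : ℝ)) measurableSet_Ioi (φ := fun r => -6 * r ^ 2)
    (φ' := fun r => -6 * (2 * r)) (by fun_prop)
    (fun r _ => by simpa using ((hasDerivAt_pow 2 r).const_mul (-6 : ℝ)).hasDerivWithinAt)
    (fun r hr r' hr' hrr => by
      have h1 : (0 : ℝ) < r := hr
      have h2 : (0 : ℝ) < r' := hr'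
      have : r ^ 2 = r' ^ 2 := by simp only at hrr; linarith
      exact (sq_eq_sq₀ h1.le h2.le).1 this)
    (w := fun r => ENNReal.ofReal r) (fun r hr => ENNReal.ofReal_le_ofReal (by
      have h1 : (0 : ℝ) < r := hr
      rw [abs_mul, abs_of_pos (by linarith : 0 < 2 * r)]
      norm_num; linarith))
  have h2 := h E
  rw [Measure.map_apply (by fun_prop) hE, withDensity_apply _ (measurableSet_preimage (by fun_prop) hE),
    ← lintegral_indicator (measurableSet_preimage (by fun_prop) hE)] at h2
  refine le_trans (le_of_eq (lintegral_congr fun r => ?_)) h2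
  by_cases hr : -6 * r ^ 2 ∈ E
  · have : r ∈ (fun r : ℝ => -6 * r ^ 2) ⁻¹' E := hr
    rw [Set.indicator_of_mem this, Set.indicator_of_mem hr, Pi.one_apply, mul_one]
  · have : r ∉ (fun r : ℝ => -6 * r ^ 2) ⁻¹' E := hr
    rw [Set.indicator_of_notMem this, Set.indicator_of_notMem hr, mul_zero]

end PhaseMaps

/-! ### The L⁶ Strichartz estimate on the line -/

section CubicChange

/-- Coordinates on `ℝ³` in which `λ₁ + λ₂ + λ₃ = 3a` and `λ₁² + λ₂² + λ₃² = 3a² + 6b² + 6c²`. -/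
def cubicEquiv : (ℝ × ℝ × ℝ) ≃ₗ[ℝ] (ℝ × ℝ × ℝ) where
  toFun z := (z.1 + 2 * z.2.2, z.1 - z.2.2 + √3 * z.2.1, z.1 - z.2.2 - √3 * z.2.1)
  invFun y := ((y.1 + y.2.1 + y.2.2) / 3, (y.2.1 - y.2.2) / (2 * √3),
    (y.1 - (y.1 + y.2.1 + y.2.2) / 3) / 2)
  map_add' z z' := by
    refine Prod.ext ?_ (Prod.ext ?_ ?_) <;> simp only [Prod.fst_add, Prod.snd_add] <;> ring
  map_smul' c z := by
    refine Prod.ext ?_ (Prod.ext ?_ ?_) <;> simp only [Prod.smul_fst, Prod.smul_snd, smul_eq_mul,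
      RingHom.id_apply] <;> ring
  left_inv z := by
    have : √3 ≠ 0 := by positivity
    refine Prod.ext ?_ (Prod.ext ?_ ?_) <;> simp only <;> field_simp <;> ring
  right_inv y := by
    have : √3 ≠ 0 := by positivity
    refine Prod.ext ?_ (Prod.ext ?_ ?_) <;> simp only <;> field_simp <;> ring

lemma cubicEquiv_apply (z : ℝ × ℝ × ℝ) : cubicEquiv z =
    (z.1 + 2 * z.2.2, z.1 - z.2.2 + √3 * z.2.1, z.1 - z.2.2 - √3 * z.2.1) := rfl

lemma measurable_cubicEquiv : Measurable cubicEquiv := by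
  have : (cubicEquiv : ℝ × ℝ × ℝ → ℝ × ℝ × ℝ) = fun z =>
    (z.1 + 2 * z.2.2, z.1 - z.2.2 + √3 * z.2.1, z.1 - z.2.2 - √3 * z.2.1) := rfl
  rw [this]; fun_prop

lemma exists_map_cubicEquiv : ∃ c : ℝ, 0 < c ∧
    (volume : Measure (ℝ × ℝ × ℝ)).map cubicEquiv = ENNReal.ofReal c • volume := by
  have hdet : LinearMap.det (cubicEquiv : (ℝ × ℝ × ℝ) →ₗ[ℝ] (ℝ × ℝ × ℝ)) ≠ 0 :=
    (LinearEquiv.isUnit_det' cubicEquiv).ne_zero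
  have : (volume : Measure (ℝ × ℝ)).IsAddHaarMeasure :=
    inferInstanceAs ((volume : Measure ℝ).prod (volume : Measure ℝ)).IsAddHaarMeasure
  have : (volume : Measure (ℝ × ℝ × ℝ)).IsAddHaarMeasure :=
    inferInstanceAs ((volume : Measure ℝ).prod (volume : Measure (ℝ × ℝ))).IsAddHaarMeasure
  refine ⟨_, abs_pos.2 (inv_ne_zero hdet), ?_⟩
  exact Measure.map_linearMap_addHaar_eq_smul_addHaar volume hdet

/-- The tensor cube of a function. -/
def cube (k : ℝ → ℂ) (y : ℝ × ℝ × ℝ) : ℂ := k y.1 * (k y.2.1 * k y.2.2)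

lemma integral_cube (k : ℝ → ℂ) : ∫ y, cube k y = (∫ x, k x) ^ 3 := by
  have h1 := integral_prod_mul (μ := (volume : Measure ℝ)) (ν := (volume : Measure (ℝ × ℝ)))
    k (fun z : ℝ × ℝ => k z.1 * k z.2)
  have h2 := integral_prod_mul (μ := (volume : Measure ℝ)) (ν := (volume : Measure ℝ)) k k
  rw [← Measure.volume_eq_prod] at h1 h2
  rw [h2] at h1
  exact h1.trans (by ring)

lemma lintegral_cube {k : ℝ → ℂ} (hk : Measurable k) : ∫⁻ y, ‖cube k y‖ₑ ^ 2 = (∫⁻ x, ‖k x‖ₑ ^ 2) ^ 3 := by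
  have h1 := lintegral_prod_mul (μ := (volume : Measure ℝ)) (ν := (volume : Measure (ℝ × ℝ)))
    (f := fun x => ‖k x‖ₑ ^ 2) (g := fun z : ℝ × ℝ => ‖k z.1‖ₑ ^ 2 * ‖k z.2‖ₑ ^ 2) (by fun_prop) (by fun_prop)
  have h2 := lintegral_prod_mul (μ := (volume : Measure ℝ)) (ν := (volume : Measure ℝ))
    (f := fun x => ‖k x‖ₑ ^ 2) (g := fun x => ‖k x‖ₑ ^ 2) (by fun_prop) (by fun_prop)
  rw [← Measure.volume_eq_prod] at h1 h2
  rw [h2] at h1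
  refine Eq.trans (lintegral_congr fun y => ?_) (h1.trans (by ring))
  rw [cube, enorm_mul, enorm_mul, mul_pow, mul_pow]

lemma integrable_cube {k : ℝ → ℂ} (hk : Integrable k) : Integrable (cube k) := by
  have h := hk.mul_prod (hk.mul_prod hk)
  rw [← Measure.volume_eq_prod, ← Measure.volume_eq_prod] at h
  exact h

lemma measurable_cube {k : ℝ → ℂ} (hk : Measurable k) : Measurable (cube k) := by
  unfold cube; fun_prop

/-- Space-time extension operator for the Schrödinger flow on the line. -/
def schrInt (k : ℝ → ℂ) (t x : ℝ) : ℂ :=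
  ∫ lam : ℝ, Complex.exp (Complex.I * ((x * lam - t * lam ^ 2 : ℝ) : ℂ)) * k lam

/-- The L⁶ norm is the L² norm of the cube, and the cube is an oscillatory integral over three
frequencies. In the coordinates of `cubicEquiv` its phase is 3ax - t(3a² + 6b² + 6c²): Plancherel in
x for the variable a, then, for fixed a, Plancherel in t for the variable b² + c². -/
theorem exists_lintegral_schrInt_le : ∃ C : NNReal, ∀ k : ℝ → ℂ, Measurable k → Integrable k →
    ∫⁻ t, ∫⁻ x, ‖schrInt k t x‖ₑ ^ 6 ≤ C * (∫⁻ x, ‖k x‖ₑ ^ 2) ^ 3 := by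
  obtain ⟨c, hc, hmap⟩ := exists_map_cubicEquiv
  set A₁ : ℝ≥0∞ := ENNReal.ofReal (2 * Real.pi) * ENNReal.ofReal |(3 : ℝ)⁻¹| with hA₁
  set A₂ : ℝ≥0∞ := ENNReal.ofReal (2 * Real.pi) * ENNReal.ofReal (2 * Real.pi) with hA₂
  set D : ℝ≥0∞ := ‖((c⁻¹ : ℝ) : ℂ)‖ₑ ^ 2 with hD
  have hfin : D * A₁ * A₂ * ENNReal.ofReal c ≠ ⊤ := by
    simp only [hD, hA₁, hA₂]
    finiteness
  refine ⟨(D * A₁ * A₂ * ENNReal.ofReal c).toNNReal, fun k hkm hk => ?_⟩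
  rw [ENNReal.coe_toNNReal hfin]
  set K : ℝ → ℝ × ℝ → ℂ := fun a z => cube k (cubicEquiv (a, z)) with hK
  have hKm : Measurable (Function.uncurry K) := (measurable_cube hkm).comp measurable_cubicEquiv
  have hemb : MeasurableEmbedding cubicEquiv :=
    (LinearEquiv.toContinuousLinearEquiv cubicEquiv).toHomeomorph.measurableEmbedding
  have hKi : Integrable (Function.uncurry K) (volume.prod volume) := by
    have h1 : Integrable (cube k) ((volume : Measure (ℝ × ℝ × ℝ)).map cubicEquiv) := by
      rw [hmap]; exact (integrable_cube hk).smul_measure ENNReal.ofReal_ne_top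
    exact (hemb.integrable_map_iff).1 h1
  have hKl : ∫⁻ a, ∫⁻ z, ‖K a z‖ₑ ^ 2 = ENNReal.ofReal c * (∫⁻ x, ‖k x‖ₑ ^ 2) ^ 3 := by
    have hm : Measurable fun y => ‖cube k y‖ₑ ^ 2 := (measurable_cube hkm).enorm.pow_const 2
    have h1 := lintegral_map (μ := (volume : Measure (ℝ × ℝ × ℝ))) hm measurable_cubicEquiv
    rw [hmap, lintegral_smul_measure, lintegral_cube hkm, smul_eq_mul, Measure.volume_eq_prod,
      lintegral_prod _ (by exact (hm.comp measurable_cubicEquiv).aemeasurable)] at h1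
    exact h1.symm
  set φ : ℝ × ℝ → ℝ := fun z => -6 * (z.1 ^ 2 + z.2 ^ 2) with hφ
  -- For fixed a, the integral over (b, c). The function J below adds the unimodular factor
  -- e^{-3ita²}, which disappears from absolute values.
  set H : ℝ → ℝ → ℂ := fun t a => oscInt volume φ (K a) t with hH
  have hHm : StronglyMeasurable (Function.uncurry H) := by
    refine StronglyMeasurable.integral_prod_right' (ν := (volume : Measure (ℝ × ℝ)))
      (f := fun p : (ℝ × ℝ) × ℝ × ℝ => Complex.exp (Complex.I * ((p.1.1 * φ p.2 : ℝ) : ℂ)) * K p.1.2 p.2) ?_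
    have h1 : Measurable fun p : (ℝ × ℝ) × ℝ × ℝ => K p.1.2 p.2 :=
      hKm.comp (by fun_prop : Measurable fun p : (ℝ × ℝ) × ℝ × ℝ => (p.1.2, p.2))
    exact Measurable.stronglyMeasurable (by fun_prop)
  set J : ℝ → ℝ → ℂ := fun t a => Complex.exp (Complex.I * ((-3 * t * a ^ 2 : ℝ) : ℂ)) * H t a with hJ
  have hJm : ∀ t, Measurable (J t) := fun t => by
    have : Measurable (H t) := hHm.measurable.comp (by fun_prop : Measurable fun a : ℝ => (t, a))
    simp only [hJ]; fun_prop
  have hosc : ∀ t, Integrable (fun p : ℝ × ℝ × ℝ =>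
      Complex.exp (Complex.I * ((t * φ p.2 : ℝ) : ℂ)) * K p.1 p.2) (volume.prod volume) := fun t =>
    hKi.bdd_mul (c := 1) (Measurable.aestronglyMeasurable (by fun_prop))
      (Eventually.of_forall fun p => (norm_exp_I_mul_ofReal' _).le)
  have hJi : ∀ t, Integrable (J t) := fun t =>
    ((hosc t).integral_prod_left).bdd_mul (c := 1) (Measurable.aestronglyMeasurable (by fun_prop))
      (Eventually.of_forall fun p => (norm_exp_I_mul_ofReal' _).le)
  have hcube : ∀ t x, schrInt k t x ^ 3
      = ((c⁻¹ : ℝ) : ℂ) * oscInt volume (fun a => 3 * a) (J t) x := by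
    intro t x
    set f : ℝ → ℂ := fun lam => Complex.exp (Complex.I * ((x * lam - t * lam ^ 2 : ℝ) : ℂ)) * k lam with hf
    have h1 : ∫ y, cube f (cubicEquiv y) = (c : ℂ) * schrInt k t x ^ 3 := by
      rw [← hemb.integral_map, hmap, integral_smul_measure, integral_cube,
        ENNReal.toReal_ofReal hc.le, Complex.real_smul]
      rfl
    have hpt : ∀ (a : ℝ) (z : ℝ × ℝ), cube f (cubicEquiv (a, z))
        = (Complex.exp (Complex.I * ((x * (3 * a) : ℝ) : ℂ)) *
          Complex.exp (Complex.I * ((-3 * t * a ^ 2 : ℝ) : ℂ))) *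
          (Complex.exp (Complex.I * ((t * φ z : ℝ) : ℂ)) * K a z) := by
      intro a z
      have h3 : ((√3 : ℝ) : ℂ) ^ 2 = 3 := by
        rw [← Complex.ofReal_pow, Real.sq_sqrt (by norm_num)]; norm_num
      have hexp : ∀ A B C' k1 k2 k3 : ℂ, Complex.exp A * k1 * (Complex.exp B * k2 * (Complex.exp C' * k3))
          = Complex.exp (A + (B + C')) * (k1 * (k2 * k3)) := fun A B C' k1 k2 k3 => by
        rw [Complex.exp_add, Complex.exp_add]; ring
      have hexp2 : ∀ A B C' k1 : ℂ, Complex.exp A * Complex.exp B * (Complex.exp C' * k1)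
          = Complex.exp (A + (B + C')) * k1 := fun A B C' k1 => by
        rw [Complex.exp_add, Complex.exp_add]; ring
      simp only [hK, cube, cubicEquiv_apply, hf, hφ]
      rw [hexp, hexp2]
      congr 2
      push_cast
      linear_combination (-2 * Complex.I * t * z.1 ^ 2) * h3
    have h2 : ∫ y, cube f (cubicEquiv y) = oscInt volume (fun a => 3 * a) (J t) x := by
      have hint : Integrable (fun y : ℝ × ℝ × ℝ => cube f (cubicEquiv y)) (volume.prod volume) := by
        have hfi : Integrable f := hk.bdd_mul (c := 1) (Measurable.aestronglyMeasurable (by fun_prop))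
          (Eventually.of_forall fun p => (norm_exp_I_mul_ofReal' _).le)
        have h1 : Integrable (cube f) ((volume : Measure (ℝ × ℝ × ℝ)).map cubicEquiv) := by
          rw [hmap]; exact (integrable_cube hfi).smul_measure ENNReal.ofReal_ne_top
        exact (hemb.integrable_map_iff).1 h1
      rw [Measure.volume_eq_prod, integral_prod _ hint]
      refine integral_congr_ae (Eventually.of_forall fun a => ?_)
      simp only [hpt, hJ, hH]
      rw [integral_const_mul, oscInt, mul_assoc]
    have hc' : (c : ℂ) ≠ 0 := by exact_mod_cast hc.ne'
    rw [← h2, h1, Complex.ofReal_inv, inv_mul_cancel_left₀ hc']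
  have h3map : (volume : Measure ℝ).map (fun a => 3 * a) ≤ ENNReal.ofReal |(3 : ℝ)⁻¹| • volume :=
    (Real.map_volume_mul_left (by norm_num : (3 : ℝ) ≠ 0)).le
  calc ∫⁻ t, ∫⁻ x, ‖schrInt k t x‖ₑ ^ 6
      = ∫⁻ t, D * ∫⁻ x, ‖oscInt volume (fun a => 3 * a) (J t) x‖ₑ ^ 2 := by
        refine lintegral_congr fun t => ?_
        rw [← lintegral_const_mul' _ _ (by simp only [hD]; finiteness)]
        refine lintegral_congr fun x => ?_
        rw [hD, ← mul_pow, ← enorm_mul, ← hcube, enorm_pow]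
        ring
    _ ≤ ∫⁻ t, D * (A₁ * ∫⁻ a, ‖H t a‖ₑ ^ 2) := by
        refine lintegral_mono fun t => ?_
        gcongr
        refine (lintegral_oscInt_le (by fun_prop) h3map (hJm t) (hJi t)).trans_eq ?_
        congr 1
        refine lintegral_congr fun a => ?_
        simp only [hJ]
        rw [enorm_mul, ← ofReal_norm, norm_exp_I_mul_ofReal', ENNReal.ofReal_one, one_mul]
    _ = D * A₁ * ∫⁻ a, ∫⁻ t, ‖H t a‖ₑ ^ 2 := by
        simp_rw [← mul_assoc]
        rw [lintegral_const_mul' _ _ (by simp only [hD, hA₁]; finiteness), lintegral_lintegral_swap]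
        exact (hHm.measurable.enorm.pow_const 2).aemeasurable
    _ ≤ D * A₁ * ∫⁻ a, A₂ * ∫⁻ z, ‖K a z‖ₑ ^ 2 := by
        gcongr 1
        refine lintegral_mono_ae ?_
        filter_upwards [hKi.prod_right_ae] with a ha
        exact lintegral_oscInt_le (by fun_prop) map_neg_six_normSq_le
          (hKm.comp (by fun_prop : Measurable fun z : ℝ × ℝ => (a, z))) ha
    _ = _ := by
        rw [lintegral_const_mul' _ _ (by simp only [hA₂]; finiteness), hKl]
        ring

end CubicChange

end

end ExteriorNLS

/-! ### The L⁶ Strichartz estimate on the half-line -/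

namespace ExteriorNLS

noncomputable section

section Strichartz

/-- Weighted `L^k` integrals are lower semicontinuous for `L²` convergence. -/
lemma lowerSemicontinuous_lintegral (ρ : ℝ → ℝ≥0∞) (hρ : Measurable ρ) (k : ℕ) :
    LowerSemicontinuous fun q : HL2 => ∫⁻ x, ρ x * ‖q x‖ₑ ^ k ∂halfLine := by
  refine (lowerSemicontinuous_iff_isClosed_preimage
    (f := fun q : HL2 => ∫⁻ x, ρ x * ‖q x‖ₑ ^ k ∂halfLine)).2 fun y =>
    IsSeqClosed.isClosed fun q p hq hlim => ?_
  obtain ⟨ns, -, hae⟩ := exists_seq_ae_tendsto hlim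
  change ∫⁻ x, ρ x * ‖p x‖ₑ ^ k ∂halfLine ≤ y
  have hle : ∀ᵐ x ∂halfLine, ρ x * ‖p x‖ₑ ^ k ≤ liminf (fun n => ρ x * ‖q (ns n) x‖ₑ ^ k) atTop := by
    filter_upwards [hae] with x hx
    by_cases hk : k = 0
    · simp [hk]
    have h1 : Tendsto (fun n => ‖q (ns n) x‖ₑ ^ k) atTop (𝓝 (‖p x‖ₑ ^ k)) :=
      ((ENNReal.continuous_pow k).tendsto _).comp hx.enorm
    -- The weight may be infinite, and multiplication by it is continuous only where the limit is
    -- nonzero.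
    by_cases h0 : ‖p x‖ₑ ^ k = 0
    · simp [h0]
    exact (ENNReal.Tendsto.const_mul h1 (Or.inl h0)).liminf_eq.ge
  calc ∫⁻ x, ρ x * ‖p x‖ₑ ^ k ∂halfLine
      ≤ ∫⁻ x, liminf (fun n => ρ x * ‖q (ns n) x‖ₑ ^ k) atTop ∂halfLine := lintegral_mono_ae hle
    _ ≤ liminf (fun n => ∫⁻ x, ρ x * ‖q (ns n) x‖ₑ ^ k ∂halfLine) atTop :=
        lintegral_liminf_le fun n => hρ.mul ((measurable_HL2 _).enorm.pow_const k)
    _ ≤ liminf (fun _ : ℕ => y) atTop := liminf_le_liminf (Eventually.of_forall fun n => hq (ns n))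
    _ = y := liminf_const _

/-- The sixth power of the `L⁶` norm on the half-line. -/
def sixNorm (p : HL2) : ℝ≥0∞ := ∫⁻ x, ‖p x‖ₑ ^ 6 ∂halfLine

lemma lowerSemicontinuous_sixNorm : LowerSemicontinuous sixNorm := by
  have := lowerSemicontinuous_lintegral 1 measurable_one 6
  simp only [Pi.one_apply, one_mul] at this
  exact this

lemma le_liminf_of_lowerSemicontinuous {X : Type*} [TopologicalSpace X] {f : X → ℝ≥0∞}
    (hf : LowerSemicontinuous f) {q : ℕ → X} {p : X} (hq : Tendsto q atTop (𝓝 p)) :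
    f p ≤ liminf (fun n => f (q n)) atTop := by
  refine le_of_forall_lt fun y hy => ?_
  obtain ⟨z, hyz, hz⟩ := exists_between hy
  refine hyz.trans_le (le_liminf_of_le (by isBoundedDefault) ?_)
  exact (hq.eventually (hf p z hz)).mono fun n hn => hn.le

/-- The even extension of a function on the half-line, up to a null set. -/
lemma comp_abs_ae_eq (m : ℝ → ℂ) : (fun x => m |x|) =ᵐ[volume]
    fun x => (Set.Ioi (0 : ℝ)).indicator m x + (Set.Ioi (0 : ℝ)).indicator m (-x) := by
  have h0 : ∀ᵐ x : ℝ, x ≠ 0 := by simp [ae_iff]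
  filter_upwards [h0] with x hx
  rcases lt_or_gt_of_ne hx with h | h
  · simp [Set.indicator, h, h.le, abs_of_neg h]
  · simp [Set.indicator, h, h.le, abs_of_pos h]

lemma integrable_comp_abs {m : ℝ → ℂ} (hm : Integrable m halfLine) : Integrable fun x => m |x| := by
  have h : Integrable ((Set.Ioi (0 : ℝ)).indicator m) := (integrable_indicator_iff measurableSet_Ioi).2 hm
  exact (h.add h.comp_neg).congr (comp_abs_ae_eq m).symm

lemma lintegral_comp_abs {g : ℝ → ℝ≥0∞} (hg : Measurable g) : ∫⁻ x, g |x| = 2 * ∫⁻ x, g x ∂halfLine := by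
  have hi : Measurable ((Set.Ioi (0 : ℝ)).indicator g) := hg.indicator measurableSet_Ioi
  have h0 : ∀ᵐ x : ℝ, x ≠ 0 := by simp [ae_iff]
  have e : (fun x => g |x|) =ᵐ[volume]
      fun x => (Set.Ioi (0 : ℝ)).indicator g x + (Set.Ioi (0 : ℝ)).indicator g (-x) := by
    filter_upwards [h0] with x hx
    rcases lt_or_gt_of_ne hx with h | h
    · simp [Set.indicator, h, h.not_gt, abs_of_neg h]
    · simp [Set.indicator, h, h.not_gt, abs_of_pos h]
  rw [lintegral_congr_ae e, lintegral_add_left hi,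
    (Measure.measurePreserving_neg (volume : Measure ℝ)).lintegral_comp hi,
    lintegral_indicator measurableSet_Ioi, two_mul]

lemma measurable_sixNorm_comp {q : ℝ → HL2} (hq : Continuous q) : Measurable fun t => sixNorm (q t) :=
  (lowerSemicontinuous_sixNorm.comp hq).measurable

/-- The phase is even in λ, so a cosine integral over the half-line is half the exponential integral
of the even extension. -/
lemma cosFun_phase_eq_schrInt {m : ℝ → ℂ} {k : ℝ → ℂ} (hk : Integrable k)
    (hkm : ∀ x, k x = ((√(2 / Real.pi) / 2 : ℝ) : ℂ) * m |x|) (t x : ℝ) :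
    cosFun (fun lam => phase t lam * m lam) x = schrInt k t x := by
  set F : ℝ → ℂ := fun lam => Complex.exp (Complex.I * ((-(t * lam ^ 2) : ℝ) : ℂ)) * k lam with hF
  have hFi : Integrable F := hk.bdd_mul (c := 1) (Measurable.aestronglyMeasurable (by fun_prop))
          (Eventually.of_forall fun p => (norm_exp_I_mul_ofReal' _).le)
  have hFe : ∀ y, F (-y) = F y := fun y => by simp only [hF, hkm, abs_neg, neg_sq]
  have h := fourier_even hFi hFe (-x / (2 * Real.pi))
  rw [Real.fourier_real_eq_integral_exp_smul] at h
  have hpi : (Real.pi : ℝ) ≠ 0 := Real.pi_ne_zero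
  have e1 : schrInt k t x = ∫ v : ℝ, Complex.exp (↑(-2 * Real.pi * v * (-x / (2 * Real.pi))) * Complex.I) • F v := by
    refine integral_congr_ae (Eventually.of_forall fun v => ?_)
    simp only [hF, smul_eq_mul]
    rw [← mul_assoc, ← Complex.exp_add]
    congr 2
    have : -2 * Real.pi * v * (-x / (2 * Real.pi)) = x * v := by field_simp
    rw [this]; push_cast; ring
  rw [e1, h, cosFun, ← integral_const_mul, ← integral_const_mul]
  refine integral_congr_ae (ae_halfLine_of_forall fun v hv => ?_)
  have : 2 * Real.pi * (-x / (2 * Real.pi)) * v = -(x * v) := by field_simp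
  simp only [hF, hkm, abs_of_pos hv, this, Real.cos_neg, phase]
  have e : -(Complex.I * (v : ℂ) ^ 2 * (t : ℂ)) = Complex.I * ((-(t * v ^ 2) : ℝ) : ℂ) := by push_cast; ring
  rw [e]; push_cast; ring

lemma exists_lintegral_cosFun_phase_le : ∃ C : NNReal, ∀ m : ℝ → ℂ, Measurable m → Integrable m halfLine →
    ∫⁻ t, ∫⁻ x, ‖cosFun (fun lam => phase t lam * m lam) x‖ₑ ^ 6 ∂halfLine
      ≤ C * (∫⁻ x, ‖m x‖ₑ ^ 2 ∂halfLine) ^ 3 := by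
  obtain ⟨C, hC⟩ := exists_lintegral_schrInt_le
  set b : ℂ := ((√(2 / Real.pi) / 2 : ℝ) : ℂ) with hb
  refine ⟨C * (‖b‖₊ ^ 2 * 2) ^ 3, fun m hm hi => ?_⟩
  set k : ℝ → ℂ := fun x => b * m |x| with hk
  have hkm : Measurable k := by simp only [hk]; fun_prop
  have hki : Integrable k := by
    exact (integrable_comp_abs hi).const_mul b
  have hl : ∫⁻ x, ‖k x‖ₑ ^ 2 ≤ ‖b‖ₑ ^ 2 * 2 * ∫⁻ x, ‖m x‖ₑ ^ 2 ∂halfLine := by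
    rw [mul_assoc, ← lintegral_comp_abs (g := fun x => ‖m x‖ₑ ^ 2) (by fun_prop),
      ← lintegral_const_mul _ (by fun_prop)]
    refine lintegral_mono fun x => ?_
    rw [enorm_mul, mul_pow]
  calc ∫⁻ t, ∫⁻ x, ‖cosFun (fun lam => phase t lam * m lam) x‖ₑ ^ 6 ∂halfLine
      = ∫⁻ t, ∫⁻ x, ‖schrInt k t x‖ₑ ^ 6 ∂halfLine := by
        simp_rw [fun t x => cosFun_phase_eq_schrInt hki (fun _ => rfl) t x]
    _ ≤ ∫⁻ t, ∫⁻ x, ‖schrInt k t x‖ₑ ^ 6 := lintegral_mono fun t => setLIntegral_le_lintegral _ _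
    _ ≤ C * (∫⁻ x, ‖k x‖ₑ ^ 2) ^ 3 := hC k hkm hki
    _ ≤ C * (‖b‖ₑ ^ 2 * 2 * ∫⁻ x, ‖m x‖ₑ ^ 2 ∂halfLine) ^ 3 := by gcongr
    _ = _ := by push_cast; rw [mul_pow, ← mul_assoc]; rfl

lemma integrable_cutOp (n : ℕ) (p : HL2) : Integrable (cutOp n p) halfLine := by
  refine integrable_of_eq_zero_above (f := p) (C := 1) (n := n) (measurable_HL2 _) ?_
  filter_upwards [coeFn_cutOp n p, ae_halfLine_of_forall (P := fun x => 0 < x) (fun x hx => hx)] with x h1 h2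
  rw [h1, norm_mul]
  refine ⟨by gcongr; exact norm_cutFun_le n x, fun hx => ?_⟩
  have : x ∉ Set.Icc (0 : ℝ) n := fun h => hx ⟨h2, h.2⟩
  simp [cutFun, this]

lemma enorm_sq_eq_lintegral (p : HL2) : ‖p‖ₑ ^ 2 = ∫⁻ x, ‖p x‖ₑ ^ 2 ∂halfLine := by
  rw [lintegral_sq_eq_eLpNorm, Lp.enorm_def]

lemma enorm_eq_of_norm_eq {E F : Type*} [NormedAddCommGroup E] [NormedAddCommGroup F] {a : E} {b : F}
    (h : ‖a‖ = ‖b‖) : ‖a‖ₑ = ‖b‖ₑ := by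
  rw [← ofReal_norm, ← ofReal_norm, h]

/-- The `L⁶` Strichartz estimate on the half-line. -/
theorem exists_strichartz : ∃ C : NNReal, ∀ g : HL2, ∫⁻ t, sixNorm (flow t g) ≤ C * ‖g‖ₑ ^ 6 := by
  obtain ⟨C, hC⟩ := exists_lintegral_cosFun_phase_le
  -- Bounded frequencies make the transform integrable, so that the wave is given by an absolutely
  -- convergent integral. Lower semicontinuity of the L⁶ norm then removes the truncation.
  have hlow : ∀ (n : ℕ) (g : HL2), ∫⁻ t, sixNorm (flow t (lowpass n g)) ≤ C * ‖g‖ₑ ^ 6 := by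
    intro n g
    set m := cutOp n (cosT g) with hm
    have hmi : Integrable m halfLine := integrable_cutOp n _
    have e : ∀ t, flow t (lowpass n g) =ᵐ[halfLine] cosFun fun lam => phase t lam * m lam := fun t => by
      rw [flow_apply, lowpass_apply, cosT_cosT]
      exact coeFn_cosT (coeFn_phaseOp t m) (integrable_bdd_mul (measurable_phase t) (fun x => (norm_phase t x).le) hmi)
    calc ∫⁻ t, sixNorm (flow t (lowpass n g))
        = ∫⁻ t, ∫⁻ x, ‖cosFun (fun lam => phase t lam * m lam) x‖ₑ ^ 6 ∂halfLine := by
          refine lintegral_congr fun t => lintegral_congr_ae ?_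
          filter_upwards [e t] with x hx
          rw [hx]
      _ ≤ C * (∫⁻ x, ‖m x‖ₑ ^ 2 ∂halfLine) ^ 3 := hC m (measurable_HL2 m) hmi
      _ = C * ‖m‖ₑ ^ 6 := by rw [← enorm_sq_eq_lintegral]; ring
      _ ≤ _ := by
        gcongr
        have h1 : ‖lowpass n g‖ₑ = ‖m‖ₑ := enorm_eq_of_norm_eq (by rw [lowpass_apply, norm_cosT])
        rw [← h1, ← ofReal_norm, ← ofReal_norm]
        exact ENNReal.ofReal_le_ofReal (norm_lowpass_le n g)
  refine ⟨C, fun g => ?_⟩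
  have hm : ∀ n, Measurable fun t => sixNorm (flow t (lowpass n g)) := fun n =>
    measurable_sixNorm_comp (continuous_flow_apply _)
  calc ∫⁻ t, sixNorm (flow t g) ≤ ∫⁻ t, liminf (fun n => sixNorm (flow t (lowpass n g))) atTop := by
        refine lintegral_mono fun t => ?_
        have h1 : Tendsto (fun n => flow t (lowpass n g)) atTop (𝓝 (flow t g)) :=
          ((flow t).continuous.tendsto _).comp (tendsto_lowpass g)
        exact le_liminf_of_lowerSemicontinuous lowerSemicontinuous_sixNorm h1
    _ ≤ liminf (fun n => ∫⁻ t, sixNorm (flow t (lowpass n g))) atTop := lintegral_liminf_le hm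
    _ ≤ liminf (fun _ : ℕ => C * ‖g‖ₑ ^ 6) atTop := liminf_le_liminf (Eventually.of_forall fun n => hlow n g)
    _ = _ := liminf_const _

end Strichartz

end

end ExteriorNLS

/-! ### Kato smoothing with a singular weight -/

namespace ExteriorNLS

noncomputable section

section LocalSmoothing

open scoped ComplexConjugate

/-- The low frequency wave with its boundary value removed. -/
def katoFun (m : ℝ → ℂ) (t x : ℝ) : ℂ :=
  (√(2 / Real.pi) : ℂ) * ∫ lam, ((Real.cos (lam * x) - 1 : ℝ) : ℂ) * (phase t lam * m lam) ∂halfLine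

lemma measurable_katoFun {m : ℝ → ℂ} (hm : Measurable m) : Measurable (Function.uncurry (katoFun m)) := by
  refine Measurable.const_mul ?_ _
  refine StronglyMeasurable.measurable ?_
  refine StronglyMeasurable.integral_prod_right' (ν := halfLine)
    (f := fun p : (ℝ × ℝ) × ℝ => ((Real.cos (p.2 * p.1.2) - 1 : ℝ) : ℂ) * (phase p.1.1 p.2 * m p.2)) ?_
  have h1 : Measurable fun p : (ℝ × ℝ) × ℝ => phase p.1.1 p.2 :=
    (continuous_phase.comp (by fun_prop : Continuous fun p : (ℝ × ℝ) × ℝ => (p.1.1, p.2))).measurable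
  exact Measurable.stronglyMeasurable (by fun_prop)

lemma measurable_katoFun_right {m : ℝ → ℂ} (hm : Measurable m) (t : ℝ) : Measurable (katoFun m t) :=
  (measurable_katoFun hm).of_uncurry_left

lemma one_sub_cos_sq_le (y : ℝ) : (Real.cos y - 1) ^ 2 ≤ y ^ 2 := by
  have h1 := Real.one_sub_sq_div_two_le_cos (x := y)
  have h2 := Real.neg_one_le_cos y
  have h3 := Real.cos_le_one y
  nlinarith

lemma one_sub_cos_sq_le' (y : ℝ) : (Real.cos y - 1) ^ 2 ≤ 4 := by
  have h2 := Real.neg_one_le_cos y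
  have h3 := Real.cos_le_one y
  nlinarith

/-- Split at x = 1/λ: below, the integrand is at most λ² and contributes λ; above, it is at most
4/x² and contributes 4λ. -/
lemma lintegral_one_sub_cos_sq_le {lam : ℝ} (hl : 0 < lam) :
    ∫⁻ x, ENNReal.ofReal ((Real.cos (lam * x) - 1) ^ 2 / x ^ 2) ∂halfLine ≤ ENNReal.ofReal (5 * lam) := by
  have hl' : 0 < lam⁻¹ := inv_pos.2 hl
  have hu : Set.Ioi (0 : ℝ) = Set.Ioc 0 lam⁻¹ ∪ Set.Ioi lam⁻¹ := (Set.Ioc_union_Ioi_eq_Ioi hl'.le).symm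
  rw [halfLine, hu]
  refine (lintegral_union_le _ _ _).trans ?_
  have h1 : ∫⁻ x in Set.Ioc 0 lam⁻¹, ENNReal.ofReal ((Real.cos (lam * x) - 1) ^ 2 / x ^ 2) ≤ ENNReal.ofReal lam := by
    calc ∫⁻ x in Set.Ioc 0 lam⁻¹, ENNReal.ofReal ((Real.cos (lam * x) - 1) ^ 2 / x ^ 2)
        ≤ ∫⁻ _ in Set.Ioc 0 lam⁻¹, ENNReal.ofReal (lam ^ 2) := by
          refine setLIntegral_mono' measurableSet_Ioc fun x hx => ENNReal.ofReal_le_ofReal ?_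
          have hx0 : 0 < x := hx.1
          rw [div_le_iff₀ (by positivity), ← mul_pow]
          exact one_sub_cos_sq_le _
      _ = ENNReal.ofReal lam := by
          rw [setLIntegral_const, Real.volume_Ioc, sub_zero, ← ENNReal.ofReal_mul (by positivity)]
          congr 1; field_simp
  have h2 : ∫⁻ x in Set.Ioi lam⁻¹, ENNReal.ofReal ((Real.cos (lam * x) - 1) ^ 2 / x ^ 2)
      ≤ ENNReal.ofReal (4 * lam) := by
    have hi := integrableOn_Ioi_rpow_of_lt (a := -2) (by norm_num) hl'
    calc ∫⁻ x in Set.Ioi lam⁻¹, ENNReal.ofReal ((Real.cos (lam * x) - 1) ^ 2 / x ^ 2)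
        ≤ ∫⁻ x in Set.Ioi lam⁻¹, ENNReal.ofReal (4 * x ^ (-2 : ℝ)) := by
          refine setLIntegral_mono' measurableSet_Ioi fun x hx => ENNReal.ofReal_le_ofReal ?_
          have hx0 : 0 < x := hl'.trans hx
          rw [Real.rpow_neg hx0.le, div_eq_mul_inv, show (2 : ℝ) = ((2 : ℕ) : ℝ) by norm_num, Real.rpow_natCast]
          gcongr
          exact one_sub_cos_sq_le' _
      _ = ENNReal.ofReal (4 * lam) := by
          rw [← ofReal_integral_eq_lintegral_ofReal (hi.const_mul 4), integral_const_mul,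
            integral_Ioi_rpow_of_lt (by norm_num) hl']
          · congr 1
            norm_num
            rw [Real.rpow_neg_one, inv_inv]
          · refine (ae_restrict_iff' measurableSet_Ioi).2 (Eventually.of_forall fun x hx => ?_)
            have hx0 : 0 < x := hl'.trans hx
            positivity
  calc _ ≤ ENNReal.ofReal lam + ENNReal.ofReal (4 * lam) := add_le_add h1 h2
    _ = _ := by rw [← ENNReal.ofReal_add hl.le (by positivity)]; congr 1; ring

/-- The measure `2λ dλ` on the half-line. -/
def freqMeasure : Measure ℝ := halfLine.withDensity fun lam => ENNReal.ofReal (2 * lam)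

instance : SFinite freqMeasure := by unfold freqMeasure; infer_instance

/-- The density 2λ is the Jacobian of λ², so that the time frequency λ² is distributed with density
at most 1. -/
lemma map_freqMeasure_le : freqMeasure.map (fun lam => -lam ^ 2) ≤ (1 : ℝ≥0∞) • volume := by
  rw [one_smul]
  refine map_withDensity_le measurableSet_Ioi (φ' := fun r => -(2 * r)) (by fun_prop)
    (fun r _ => by simpa using (hasDerivAt_pow 2 r).fun_neg.hasDerivWithinAt)
    (fun r hr r' hr' hrr => ?_) (fun r hr => ENNReal.ofReal_le_ofReal ?_)
  · have h1 : (0 : ℝ) < r := hr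
    have h2 : (0 : ℝ) < r' := hr'
    have : r ^ 2 = r' ^ 2 := neg_injective hrr
    exact (sq_eq_sq₀ h1.le h2.le).1 this
  · rw [abs_neg]; exact le_abs_self _

/-- The density of `katoFun` with respect to `2λ dλ`. -/
def katoDensity (m : ℝ → ℂ) (x lam : ℝ) : ℂ :=
  ((√(2 / Real.pi) * (Real.cos (lam * x) - 1) / (2 * lam) : ℝ) : ℂ) * m lam

lemma integrable_katoDensity {m : ℝ → ℂ} (hi : Integrable m halfLine) (x : ℝ) :
    Integrable (katoDensity m x) freqMeasure := by
  rw [freqMeasure, integrable_withDensity_iff_integrable_smul' (by fun_prop)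
    (Eventually.of_forall fun _ => ENNReal.ofReal_lt_top)]
  have h : Integrable (fun lam => ((√(2 / Real.pi) * (Real.cos (lam * x) - 1) : ℝ) : ℂ) * m lam) halfLine := by
    refine integrable_bdd_mul (C := √(2 / Real.pi) * 2) (by fun_prop) (fun lam => ?_) hi
    rw [Complex.norm_real, norm_mul, Real.norm_of_nonneg (Real.sqrt_nonneg _), Real.norm_eq_abs]
    have h2 := Real.neg_one_le_cos (lam * x)
    have h3 := Real.cos_le_one (lam * x)
    gcongr
    rw [abs_le]; constructor <;> linarith
  refine h.congr (ae_halfLine_of_forall fun lam hl => ?_)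
  have : (lam : ℂ) ≠ 0 := by exact_mod_cast hl.ne'
  change _ = (ENNReal.ofReal (2 * lam)).toReal • katoDensity m x lam
  rw [ENNReal.toReal_ofReal (by positivity), Complex.real_smul, katoDensity]
  push_cast
  field_simp

lemma katoFun_eq_oscInt (m : ℝ → ℂ) (t x : ℝ) :
    katoFun m t x = oscInt freqMeasure (fun lam => -lam ^ 2) (katoDensity m x) t := by
  rw [oscInt, freqMeasure, integral_withDensity_eq_integral_toReal_smul (by fun_prop)
      (Eventually.of_forall fun _ => ENNReal.ofReal_lt_top), katoFun,
    ← integral_const_mul]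
  refine integral_congr_ae (ae_halfLine_of_forall fun lam hl => ?_)
  have : (lam : ℂ) ≠ 0 := by exact_mod_cast hl.ne'
  simp only [katoDensity, phase]
  rw [ENNReal.toReal_ofReal (by positivity), Complex.real_smul]
  have e : -(Complex.I * (lam : ℂ) ^ 2 * (t : ℂ)) = Complex.I * ((t * -lam ^ 2 : ℝ) : ℂ) := by push_cast; ring
  rw [e]
  push_cast
  field_simp

lemma lintegral_katoDensity {m : ℝ → ℂ} (hm : Measurable m) (x : ℝ) :
    ENNReal.ofReal (2 * Real.pi) * 1 * ∫⁻ lam, ‖katoDensity m x lam‖ₑ ^ 2 ∂freqMeasure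
      = ∫⁻ lam, ENNReal.ofReal (2 * (Real.cos (lam * x) - 1) ^ 2 / lam) * ‖m lam‖ₑ ^ 2 ∂halfLine := by
  have hkm : Measurable (katoDensity m x) := by unfold katoDensity; fun_prop
  rw [freqMeasure, lintegral_withDensity_eq_lintegral_mul _ (by fun_prop) (by fun_prop), mul_one,
    ← lintegral_const_mul _ (by fun_prop)]
  refine lintegral_congr_ae (ae_halfLine_of_forall fun lam hl => ?_)
  simp only [Pi.mul_apply, katoDensity]
  rw [enorm_mul, mul_pow, ← mul_assoc, ← mul_assoc, ← ofReal_norm, Complex.norm_real,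
    ← ENNReal.ofReal_pow (norm_nonneg _), Real.norm_eq_abs, sq_abs, ← ENNReal.ofReal_mul (by positivity),
    ← ENNReal.ofReal_mul (by positivity)]
  congr 2
  have hp : Real.pi ≠ 0 := Real.pi_ne_zero
  rw [div_pow, mul_pow, Real.sq_sqrt (by positivity)]
  field_simp

/-- For fixed x, Plancherel in t with frequency λ² bounds the time integral by ∫ 2(cos λx -
1)²λ^{-1}|m|² dλ. Integrating in x against x^{-2} costs 5λ, and 5λ·2/λ = 10. Removing the boundary
value is what makes the weight x^{-2} admissible at the origin. -/
lemma lintegral_katoFun_le {m : ℝ → ℂ} (hm : Measurable m) (hi : Integrable m halfLine) :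
    ∫⁻ t, ∫⁻ x, ENNReal.ofReal (1 / x ^ 2) * ‖katoFun m t x‖ₑ ^ 2 ∂halfLine
      ≤ 10 * ∫⁻ lam, ‖m lam‖ₑ ^ 2 ∂halfLine := by
  have hK := measurable_katoFun hm
  calc ∫⁻ t, ∫⁻ x, ENNReal.ofReal (1 / x ^ 2) * ‖katoFun m t x‖ₑ ^ 2 ∂halfLine
      = ∫⁻ x, (∫⁻ t, ENNReal.ofReal (1 / x ^ 2) * ‖katoFun m t x‖ₑ ^ 2) ∂halfLine := by
        refine lintegral_lintegral_swap ?_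
        have : Measurable fun p : ℝ × ℝ => ‖katoFun m p.1 p.2‖ₑ ^ 2 := hK.enorm.pow_const 2
        exact Measurable.aemeasurable (by fun_prop)
    _ ≤ ∫⁻ x, ENNReal.ofReal (1 / x ^ 2) *
        ∫⁻ lam, ENNReal.ofReal (2 * (Real.cos (lam * x) - 1) ^ 2 / lam) * ‖m lam‖ₑ ^ 2 ∂halfLine ∂halfLine := by
        refine lintegral_mono fun x => ?_
        rw [lintegral_const_mul' _ _ ENNReal.ofReal_ne_top]
        refine mul_le_mul' le_rfl ?_
        rw [← lintegral_katoDensity hm]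
        simp_rw [katoFun_eq_oscInt]
        have hkm : Measurable (katoDensity m x) := by unfold katoDensity; fun_prop
        exact lintegral_oscInt_le (by fun_prop) map_freqMeasure_le hkm (integrable_katoDensity hi x)
    _ = ∫⁻ lam, (∫⁻ x, ENNReal.ofReal (1 / x ^ 2) *
        (ENNReal.ofReal (2 * (Real.cos (lam * x) - 1) ^ 2 / lam) * ‖m lam‖ₑ ^ 2) ∂halfLine) ∂halfLine := by
        simp_rw [← lintegral_const_mul' _ _ ENNReal.ofReal_ne_top]
        refine lintegral_lintegral_swap (Measurable.aemeasurable ?_)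
        simp only [Function.uncurry_def]
        fun_prop
    _ ≤ ∫⁻ lam, 10 * ‖m lam‖ₑ ^ 2 ∂halfLine := by
        refine lintegral_mono_ae (ae_halfLine_of_forall fun lam hl => ?_)
        calc ∫⁻ x, ENNReal.ofReal (1 / x ^ 2) *
            (ENNReal.ofReal (2 * (Real.cos (lam * x) - 1) ^ 2 / lam) * ‖m lam‖ₑ ^ 2) ∂halfLine
            = ∫⁻ x, ENNReal.ofReal ((Real.cos (lam * x) - 1) ^ 2 / x ^ 2) *
              (ENNReal.ofReal (2 / lam) * ‖m lam‖ₑ ^ 2) ∂halfLine := by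
              refine lintegral_congr fun x => ?_
              rw [← mul_assoc, ← mul_assoc, ← ENNReal.ofReal_mul (by positivity),
                ← ENNReal.ofReal_mul (by positivity)]
              congr 2; ring
          _ ≤ ENNReal.ofReal (5 * lam) * (ENNReal.ofReal (2 / lam) * ‖m lam‖ₑ ^ 2) := by
              rw [lintegral_mul_const _ (by fun_prop)]
              gcongr
              exact lintegral_one_sub_cos_sq_le hl
          _ = 10 * ‖m lam‖ₑ ^ 2 := by
              rw [← mul_assoc, ← ENNReal.ofReal_mul (by positivity)]
              have : 5 * lam * (2 / lam) = 10 := by field_simp; norm_num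
              rw [this]; norm_num
    _ = _ := lintegral_const_mul _ (by fun_prop)

/-- The weighted norm `∫ x² |m|² dx`. -/
def wNorm (m : HL2) : ℝ≥0∞ := ∫⁻ x, ENNReal.ofReal (x ^ 2) * ‖m x‖ₑ ^ 2 ∂halfLine

lemma lowerSemicontinuous_wNorm : LowerSemicontinuous wNorm :=
  lowerSemicontinuous_lintegral (fun x => ENNReal.ofReal (x ^ 2)) (by fun_prop) 2

lemma measurable_wNorm_comp {q : ℝ → HL2} (hq : Continuous q) : Measurable fun t => wNorm (q t) :=
  (lowerSemicontinuous_wNorm.comp hq).measurable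

/-- Functions with vanishing integral, in the sense of improper integrals. -/
def ZeroMean (m : HL2) : Prop := Tendsto (fun n : ℕ => prim m n) atTop (𝓝 0)

lemma zeroMean_nl (q : HL2) : ZeroMean (nl q) := by
  have h1 : Tendsto (fun k : ℕ => ‖q‖ ^ 5 * (√(k : ℝ))⁻¹) atTop (𝓝 0) := by
    have h1 : Tendsto (fun k : ℕ => (√(k : ℝ))⁻¹) atTop (𝓝 0) :=
      tendsto_inv_atTop_zero.comp (Real.tendsto_sqrt_atTop.comp tendsto_natCast_atTop_atTop)
    simpa using h1.const_mul (‖q‖ ^ 5)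
  refine squeeze_zero_norm' ?_ h1
  filter_upwards [eventually_gt_atTop 0] with k hk
  exact norm_prim_nl_le q (by exact_mod_cast hk)

lemma lintegral_mul_le_sqrt {μ : Measure ℝ} {f g : ℝ → ℝ≥0∞} (hf : AEMeasurable f μ) (hg : AEMeasurable g μ) :
    (∫⁻ x, f x * g x ∂μ) ^ 2 ≤ (∫⁻ x, f x ^ 2 ∂μ) * ∫⁻ x, g x ^ 2 ∂μ := by
  have h := ENNReal.lintegral_mul_le_Lp_mul_Lq μ Real.HolderConjugate.two_two hf hg
  simp only [Pi.mul_apply, ENNReal.rpow_two] at h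
  calc (∫⁻ x, f x * g x ∂μ) ^ 2 ≤ ((∫⁻ x, f x ^ 2 ∂μ) ^ (1 / 2 : ℝ) * (∫⁻ x, g x ^ 2 ∂μ) ^ (1 / 2 : ℝ)) ^ 2 := by
        gcongr
    _ = _ := by
        rw [mul_pow, ← ENNReal.rpow_natCast, ← ENNReal.rpow_natCast, ← ENNReal.rpow_mul, ← ENNReal.rpow_mul]
        norm_num

lemma enorm_setIntegral_conj_mul_le {K m : ℝ → ℂ} (hK : Measurable K) (hm : Measurable m) (n : ℕ) :
    ‖∫ x in Set.Ioc (0 : ℝ) n, conj (K x) * m x‖ₑ ^ 2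
      ≤ (∫⁻ x, ENNReal.ofReal (1 / x ^ 2) * ‖K x‖ₑ ^ 2 ∂halfLine) *
        ∫⁻ x, ENNReal.ofReal (x ^ 2) * ‖m x‖ₑ ^ 2 ∂halfLine := by
  calc ‖∫ x in Set.Ioc (0 : ℝ) n, conj (K x) * m x‖ₑ ^ 2
      ≤ (∫⁻ x in Set.Ioc (0 : ℝ) n, ‖conj (K x) * m x‖ₑ) ^ 2 := by
        gcongr; exact enorm_integral_le_lintegral_enorm _
    _ ≤ (∫⁻ x, ‖conj (K x) * m x‖ₑ ∂halfLine) ^ 2 :=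
        pow_le_pow_left' (lintegral_mono' (Measure.restrict_mono_set _ Set.Ioc_subset_Ioi_self) le_rfl) 2
    _ = (∫⁻ x, (ENNReal.ofReal (1 / x) * ‖K x‖ₑ) * (ENNReal.ofReal x * ‖m x‖ₑ) ∂halfLine) ^ 2 := by
        congr 1
        refine lintegral_congr_ae (ae_halfLine_of_forall fun x hx => ?_)
        simp only []
        rw [enorm_mul, RCLike.enorm_conj, mul_mul_mul_comm, ← ENNReal.ofReal_mul (by positivity),
          one_div_mul_cancel hx.ne', ENNReal.ofReal_one, one_mul]
    _ ≤ _ := lintegral_mul_le_sqrt (Measurable.aemeasurable (by fun_prop)) (Measurable.aemeasurable (by fun_prop))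
    _ = _ := by
        congr 1
        · refine lintegral_congr_ae (ae_halfLine_of_forall fun x hx => ?_)
          simp only []
          rw [mul_pow, ← ENNReal.ofReal_pow (by positivity), div_pow, one_pow]
        · refine lintegral_congr_ae (ae_halfLine_of_forall fun x hx => ?_)
          simp only []
          rw [mul_pow, ← ENNReal.ofReal_pow hx.le]

/-- A source of mean zero does not see the constant κ, so only K is paired with it, by
Cauchy–Schwarz with weights x^{-2} and x². The mean is an improper integral, hence the passage
through (0, n]. -/
lemma enorm_inner_le_of_ae_eq_add_const {f m : HL2} {K : ℝ → ℂ} {κ : ℂ} (hK : Measurable K)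
    (hrep : f =ᵐ[halfLine] fun x => K x + κ) (hm : ZeroMean m) :
    ‖inner ℂ f m‖ₑ ^ 2 ≤ (∫⁻ x, ENNReal.ofReal (1 / x ^ 2) * ‖K x‖ₑ ^ 2 ∂halfLine) * wNorm m := by
  have hbound : ∀ n : ℕ, ‖(∫ x in Set.Ioc (0 : ℝ) n, conj (f x) * m x) - conj κ * prim m n‖ₑ ^ 2
      ≤ (∫⁻ x, ENNReal.ofReal (1 / x ^ 2) * ‖K x‖ₑ ^ 2 ∂halfLine) * wNorm m := by
    intro n
    have i1 : Integrable (fun x => conj (f x) * m x) (volume.restrict (Set.Ioc (0 : ℝ) n)) := by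
      rw [← Ioc_restrict_halfLine le_rfl]
      exact (integrable_conj_mul _ _).restrict
    have i2 : Integrable (fun x => conj κ * m x) (volume.restrict (Set.Ioc (0 : ℝ) n)) :=
      Integrable.const_mul (m.integrableOn le_rfl) _
    have e : (∫ x in Set.Ioc (0 : ℝ) n, conj (f x) * m x) - conj κ * prim m n
        = ∫ x in Set.Ioc (0 : ℝ) n, conj (K x) * m x := by
      rw [prim, ← integral_const_mul, ← integral_sub i1 i2]
      refine integral_congr_ae ?_
      filter_upwards [ae_Ioc_of_ae_halfLine hrep (b := (n : ℝ)) le_rfl] with x hx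
      rw [hx, map_add]; ring
    rw [e]
    exact enorm_setIntegral_conj_mul_le hK (measurable_HL2 m) n
  have hlim : Tendsto (fun n : ℕ => (∫ x in Set.Ioc (0 : ℝ) n, conj (f x) * m x) - conj κ * prim m n)
      atTop (𝓝 (inner ℂ f m)) := by
    have h1 := (tendsto_setIntegral_Ioc (integrable_conj_mul f m)).sub (hm.const_mul (conj κ))
    rw [mul_zero, sub_zero, ← inner_eq_integral_mul] at h1
    exact h1
  exact le_of_tendsto' (((ENNReal.continuous_pow 2).tendsto _).comp hlim.enorm) hbound

/-- Splits a free wave into the part bounded by smoothing and its boundary value, which is constant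
in x. -/
lemma flow_cosT_ae_eq {c : HL2} (hi : Integrable c halfLine) (t : ℝ) :
    flow t (cosT c) =ᵐ[halfLine] fun x => katoFun c t x +
      (√(2 / Real.pi) : ℂ) * ∫ lam, phase t lam * c lam ∂halfLine := by
  have hpi : Integrable (fun lam => phase t lam * c lam) halfLine :=
    integrable_bdd_mul (measurable_phase t) (fun x => (norm_phase t x).le) hi
  rw [flow_apply, cosT_cosT]
  filter_upwards [coeFn_cosT (coeFn_phaseOp t c) hpi] with x hx
  have hci : Integrable (fun lam => (Real.cos (lam * x) : ℂ) * (phase t lam * c lam)) halfLine := by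
    refine (integrable_cos_mul hpi x).congr (Eventually.of_forall fun lam => ?_)
    simp only []
    rw [mul_comm x]
  rw [hx, cosFun, katoFun, ← mul_add]
  congr 1
  have e : ∀ lam : ℝ, ((Real.cos (lam * x) - 1 : ℝ) : ℂ) * (phase t lam * c lam)
      = (Real.cos (lam * x) : ℂ) * (phase t lam * c lam) - phase t lam * c lam := fun lam => by
    rw [Complex.ofReal_sub, sub_mul, Complex.ofReal_one, one_mul]
  simp_rw [e]
  rw [integral_sub hci hpi, sub_add_cancel]
  simp_rw [mul_comm x]

lemma enorm_inner_flow_le {c : HL2} (hi : Integrable c halfLine) (t : ℝ) {m : HL2} (hm : ZeroMean m) :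
    ‖inner ℂ (flow t (cosT c)) m‖ₑ ^ 2
      ≤ (∫⁻ x, ENNReal.ofReal (1 / x ^ 2) * ‖katoFun c t x‖ₑ ^ 2 ∂halfLine) * wNorm m :=
  enorm_inner_le_of_ae_eq_add_const (measurable_katoFun_right (measurable_HL2 c) t) (flow_cosT_ae_eq hi t) hm

end LocalSmoothing

end

end ExteriorNLS

/-! ### Dual smoothing -/

namespace ExteriorNLS

noncomputable section

section DualSmoothing

lemma sq_lintegral_le_of_sq_le_mul {μ : Measure ℝ} {f K W : ℝ → ℝ≥0∞} (hK : AEMeasurable K μ) (hW : AEMeasurable W μ)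
    (h : ∀ t, f t ^ 2 ≤ K t * W t) : (∫⁻ t, f t ∂μ) ^ 2 ≤ (∫⁻ t, K t ∂μ) * ∫⁻ t, W t ∂μ := by
  have hsq : ∀ x : ℝ≥0∞, (x ^ (1 / 2 : ℝ)) ^ 2 = x := fun x => by
    rw [← ENNReal.rpow_natCast, ← ENNReal.rpow_mul]; norm_num
  calc (∫⁻ t, f t ∂μ) ^ 2 ≤ (∫⁻ t, K t ^ (1 / 2 : ℝ) * W t ^ (1 / 2 : ℝ) ∂μ) ^ 2 := by
        gcongr with t
        rw [← ENNReal.pow_le_pow_left_iff two_ne_zero, mul_pow, hsq, hsq]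
        exact h t
    _ ≤ _ := lintegral_mul_le_sqrt (hK.pow_const _) (hW.pow_const _)
    _ = _ := by simp_rw [hsq]

lemma inner_lowpass_self (n : ℕ) (p : HL2) : inner ℂ (lowpass n p) p = ((‖lowpass n p‖ : ℝ) : ℂ) ^ 2 := by
  have h := inner_lowpass n (lowpass n p) p
  rw [lowpass_lowpass] at h
  rw [h, inner_self_eq_norm_sq_to_K]
  rfl

lemma norm_cutOp_cosT (n : ℕ) (p : HL2) : ‖cutOp n (cosT p)‖ = ‖lowpass n p‖ := by
  rw [lowpass_apply, norm_cosT]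

/-- The dual form of Kato smoothing. -/
theorem enorm_integral_flow_neg_le {m : ℝ → HL2} (hm : Continuous m) (hz : ∀ t, ZeroMean (m t)) {a b : ℝ}
    (hab : a ≤ b) :
    ‖∫ t in a..b, flow (-t) (m t)‖ₑ ^ 2 ≤ 10 * ∫⁻ t in Set.Ioc a b, wNorm (m t) := by
  set G := ∫ t in a..b, flow (-t) (m t) with hG
  have hcont : Continuous fun t => flow (-t) (m t) := continuous_flow continuous_neg hm
  -- Duality with the truncation of G itself as test vector: its squared norm is the time integral
  -- of the pairing of its free evolution with m. Truncation makes its transform integrable, as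
  -- smoothing requires.
  have hn : ∀ n : ℕ, ‖lowpass n G‖ₑ ^ 2 ≤ 10 * ∫⁻ t in Set.Ioc a b, wNorm (m t) := by
    intro n
    set c := cutOp n (cosT G) with hc
    have hci : Integrable c halfLine := integrable_cutOp n _
    have e1 : ((‖lowpass n G‖ : ℝ) : ℂ) ^ 2 = ∫ t in a..b, inner ℂ (flow t (cosT c)) (m t) := by
      rw [← inner_lowpass_self]
      have h : inner ℂ (lowpass n G) G = innerSL ℂ (lowpass n G) G := rfl
      rw [h]
      conv_lhs => rw [hG]
      rw [← ContinuousLinearMap.intervalIntegral_comp_comm _ (hcont.intervalIntegrable a b)]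
      refine intervalIntegral.integral_congr fun t _ => ?_
      rw [innerSL_apply_apply]
      rw [inner_flow, hc, ← lowpass_apply]
    have e2 : ‖lowpass n G‖ₑ ^ 2 ≤ ∫⁻ t in Set.Ioc a b, ‖inner ℂ (flow t (cosT c)) (m t)‖ₑ := by
      have h : ‖((‖lowpass n G‖ : ℝ) : ℂ) ^ 2‖ₑ = ‖lowpass n G‖ₑ ^ 2 := by
        rw [enorm_pow]
        congr 1
        exact enorm_eq_of_norm_eq (by simp)
      rw [← h, e1, intervalIntegral.integral_of_le hab]
      exact enorm_integral_le_lintegral_enorm _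
    have e3 : (‖lowpass n G‖ₑ ^ 2) ^ 2 ≤ (10 * ∫⁻ t in Set.Ioc a b, wNorm (m t)) * ‖lowpass n G‖ₑ ^ 2 := by
      have hKm : Measurable fun t => ∫⁻ x, ENNReal.ofReal (1 / x ^ 2) * ‖katoFun c t x‖ₑ ^ 2 ∂halfLine := by
        refine Measurable.lintegral_prod_right'
          (f := fun p : ℝ × ℝ => ENNReal.ofReal (1 / p.2 ^ 2) * ‖katoFun c p.1 p.2‖ₑ ^ 2) ?_
        have : Measurable fun p : ℝ × ℝ => ‖katoFun c p.1 p.2‖ₑ ^ 2 :=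
          (measurable_katoFun (measurable_HL2 c)).enorm.pow_const 2
        fun_prop
      calc (‖lowpass n G‖ₑ ^ 2) ^ 2
          ≤ (∫⁻ t in Set.Ioc a b, ‖inner ℂ (flow t (cosT c)) (m t)‖ₑ) ^ 2 := by gcongr
        _ ≤ (∫⁻ t in Set.Ioc a b, ∫⁻ x, ENNReal.ofReal (1 / x ^ 2) * ‖katoFun c t x‖ₑ ^ 2 ∂halfLine) *
            ∫⁻ t in Set.Ioc a b, wNorm (m t) :=
            sq_lintegral_le_of_sq_le_mul hKm.aemeasurable (measurable_wNorm_comp hm).aemeasurable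
              fun t => enorm_inner_flow_le hci t (hz t)
        _ ≤ (∫⁻ t, ∫⁻ x, ENNReal.ofReal (1 / x ^ 2) * ‖katoFun c t x‖ₑ ^ 2 ∂halfLine) *
            ∫⁻ t in Set.Ioc a b, wNorm (m t) := mul_le_mul' (setLIntegral_le_lintegral _ _) le_rfl
        _ ≤ (10 * ∫⁻ lam, ‖c lam‖ₑ ^ 2 ∂halfLine) * ∫⁻ t in Set.Ioc a b, wNorm (m t) :=
            mul_le_mul' (lintegral_katoFun_le (measurable_HL2 c) hci) le_rfl
        _ = _ := by
            rw [← enorm_sq_eq_lintegral, enorm_eq_of_norm_eq (norm_cutOp_cosT n G)]; ring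
    -- One factor ‖`lowpass n G`‖² is cancelled from both sides.
    rcases eq_or_ne (‖lowpass n G‖ₑ) 0 with h0 | h0
    · rw [h0]; simp
    · rw [sq (‖lowpass n G‖ₑ ^ 2)] at e3
      exact (ENNReal.mul_le_mul_iff_left (pow_ne_zero 2 h0) (ENNReal.pow_ne_top enorm_ne_top)).1 e3
  exact le_of_tendsto' (((ENNReal.continuous_pow 2).tendsto _).comp (tendsto_lowpass G).enorm) hn

lemma setLIntegral_comp_neg (f : ℝ → ℝ≥0∞) (a b : ℝ) :
    ∫⁻ t in Set.Ioc (-b) (-a), f (-t) = ∫⁻ t in Set.Ioc a b, f t := by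
  have h := (Measure.measurePreserving_neg (volume : Measure ℝ)).setLIntegral_comp_preimage_emb
    (MeasurableEquiv.neg ℝ).measurableEmbedding f (Set.Ico a b)
  have e : (fun x : ℝ => -x) ⁻¹' Set.Ico a b = Set.Ioc (-b) (-a) := by
    ext x; simp only [Set.mem_preimage, Set.mem_Ico, Set.mem_Ioc]; constructor <;> intro h <;> constructor <;> linarith [h.1, h.2]
  rw [← setLIntegral_congr (Ico_ae_eq_Ioc (a := a) (b := b)), ← h]
  exact (setLIntegral_congr (Filter.EventuallyEq.of_eq e)).symm

/-- The sign σ covers both directions of time by reflection; the negative one serves scattering in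
the past. -/
theorem enorm_integral_flow_le {σ : ℝ} (hσ : σ = 1 ∨ σ = -1) {m : ℝ → HL2} (hm : Continuous m)
    (hz : ∀ t, ZeroMean (m t)) {a b : ℝ} (hab : a ≤ b) :
    ‖∫ t in a..b, flow (-(σ * t)) (m t)‖ₑ ^ 2 ≤ 10 * ∫⁻ t in Set.Ioc a b, wNorm (m t) := by
  rcases hσ with rfl | rfl
  · simpa only [one_mul] using enorm_integral_flow_neg_le hm hz hab
  · have h := enorm_integral_flow_neg_le (hm.comp continuous_neg) (fun t => hz (-t)) (neg_le_neg hab)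
    have e : ∫ t in (-b)..(-a), flow (-t) (m (-t)) = ∫ t in a..b, flow (-(-1 * t)) (m t) := by
      rw [← intervalIntegral.integral_comp_neg]
      simp
    simp only [Function.comp_apply] at h
    rwa [e, setLIntegral_comp_neg fun t => wNorm (m t)] at h

end DualSmoothing

end

end ExteriorNLS

/-! ### The retarded estimate by bisection of time -/

namespace ExteriorNLS

noncomputable section

section RetardedStrichartz

/-- Iterated bisection at the midpoints of `Ψ`. -/
lemma le_cube_of_bisection {a b : ℝ} (hab : a ≤ b) {Ψ : ℝ → ℝ} (hΨ : ContinuousOn Ψ (Set.Icc a b))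
    (hmono : MonotoneOn Ψ (Set.Icc a b)) {A : ℝ → ℝ → ℝ≥0∞} {N κ : ℝ} (hN : 0 ≤ N) (hκ : 0 ≤ κ)
    (hsplit : ∀ c e d, a ≤ c → c ≤ e → e ≤ d → d ≤ b →
      A c d ≤ A c e + ENNReal.ofReal (N * (Ψ e - Ψ c) ^ 3) + 4 * A e d)
    (hprior : ∀ c d, a ≤ c → c ≤ d → d ≤ b → A c d ≤ ENNReal.ofReal (κ * (Ψ d - Ψ c) ^ 3)) :
    A a b ≤ ENNReal.ofReal (N * (Ψ b - Ψ a) ^ 3) := by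
  -- Bisect where Ψ takes its mean value, so that each half has an eighth of the cube. The prior
  -- constant κ contracts by (1+4)/8 at each step, while N reproduces itself because 1 + 1 + 4 ≤ 8.
  have step : ∀ n : ℕ, ∀ c d, a ≤ c → c ≤ d → d ≤ b →
      A c d ≤ ENNReal.ofReal ((N + (5 / 8) ^ n * κ) * (Ψ d - Ψ c) ^ 3) := by
    intro n
    induction n with
    | zero =>
      intro c d h1 h2 h3
      refine (hprior c d h1 h2 h3).trans (ENNReal.ofReal_le_ofReal ?_)
      have : 0 ≤ Ψ d - Ψ c := sub_nonneg.2 (hmono ⟨h1, h2.trans h3⟩ ⟨h1.trans h2, h3⟩ h2)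
      gcongr
      linarith
    | succ n ih =>
      intro c d h1 h2 h3
      have hcd : 0 ≤ Ψ d - Ψ c := sub_nonneg.2 (hmono ⟨h1, h2.trans h3⟩ ⟨h1.trans h2, h3⟩ h2)
      obtain ⟨e, ⟨he1, he2⟩, he⟩ := intermediate_value_Icc h2 (hΨ.mono (Set.Icc_subset_Icc h1 h3))
        (show (Ψ c + Ψ d) / 2 ∈ Set.Icc (Ψ c) (Ψ d) by constructor <;> linarith)
      have f1 : Ψ e - Ψ c = (Ψ d - Ψ c) / 2 := by rw [he]; ring
      have f2 : Ψ d - Ψ e = (Ψ d - Ψ c) / 2 := by rw [he]; ring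
      have i1 := ih c e h1 he1 (he2.trans h3)
      have i2 := ih e d (h1.trans he1) he2 h3
      have i3 := hsplit c e d h1 he1 he2 h3
      rw [f1] at i1 i3
      rw [f2] at i2
      set δ := (Ψ d - Ψ c) / 2 with hδ
      have hδ0 : 0 ≤ δ := by positivity
      have hcd' : Ψ d - Ψ c = 2 * δ := by rw [hδ]; ring
      set K := N + (5 / 8) ^ n * κ with hK
      have hK0 : 0 ≤ K := by positivity
      calc A c d ≤ A c e + ENNReal.ofReal (N * δ ^ 3) + 4 * A e d := i3
        _ ≤ ENNReal.ofReal (K * δ ^ 3) + ENNReal.ofReal (N * δ ^ 3) + 4 * ENNReal.ofReal (K * δ ^ 3) := by gcongr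
        _ = ENNReal.ofReal (K * δ ^ 3 + N * δ ^ 3 + 4 * (K * δ ^ 3)) := by
            rw [ENNReal.ofReal_add (by positivity) (by positivity), ENNReal.ofReal_add (by positivity) (by positivity),
              ENNReal.ofReal_mul (p := 4) (by norm_num)]
            norm_num
        _ ≤ _ := by
            refine ENNReal.ofReal_le_ofReal ?_
            rw [hcd', hK, pow_succ (5 / 8 : ℝ) n]
            have h4 : 0 ≤ N * δ ^ 3 := by positivity
            nlinarith
  have hlim : Tendsto (fun n : ℕ => ENNReal.ofReal ((N + (5 / 8) ^ n * κ) * (Ψ b - Ψ a) ^ 3)) atTop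
      (𝓝 (ENNReal.ofReal ((N + 0 * κ) * (Ψ b - Ψ a) ^ 3))) := by
    refine (ENNReal.continuous_ofReal.tendsto _).comp ?_
    exact (((tendsto_pow_atTop_nhds_zero_of_lt_one (by norm_num) (by norm_num)).mul_const κ).const_add N).mul_const _
  rw [zero_mul, add_zero] at hlim
  exact ge_of_tendsto' hlim fun n => step n a b le_rfl hab le_rfl

/-- If 4x ≤ y then x + y ≤ (5/4)y and (5/4)⁶ < 4; otherwise x + y ≤ 5x and 5⁶ = 15625. The
coefficient 4 is the one that the bisection tolerates. -/
lemma add_pow_six_le (x y : ℝ≥0∞) : (x + y) ^ 6 ≤ 15625 * x ^ 6 + 4 * y ^ 6 := by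
  rcases eq_or_ne x ⊤ with rfl | hx
  · simp
  rcases eq_or_ne y ⊤ with rfl | hy
  · simp
  lift x to NNReal using hx
  lift y to NNReal using hy
  norm_cast
  rcases le_total (4 * x) y with h | h
  · refine le_trans ?_ le_add_self
    have h' : x + y ≤ (5 / 4) * y := by
      have : (x : ℝ) + y ≤ (5 / 4) * y := by have : (4 : ℝ) * x ≤ y := by exact_mod_cast h
                                             linarith
      exact_mod_cast this
    calc (x + y) ^ 6 ≤ ((5 / 4) * y) ^ 6 := by gcongr
      _ = (5 / 4) ^ 6 * y ^ 6 := by rw [mul_pow]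
      _ ≤ _ := by gcongr; norm_num [div_pow]; rw [div_le_iff₀ (by norm_num)]; norm_num
  · refine le_trans ?_ le_self_add
    calc (x + y) ^ 6 ≤ (x + 4 * x) ^ 6 := by gcongr
      _ = 15625 * x ^ 6 := by ring

lemma sixNorm_add_le (p q : HL2) : sixNorm (p + q) ≤ 15625 * sixNorm p + 4 * sixNorm q := by
  have hp := measurable_HL2 p
  have hq := measurable_HL2 q
  rw [sixNorm, sixNorm, sixNorm, ← lintegral_const_mul _ (by fun_prop), ← lintegral_const_mul _ (by fun_prop),
    ← lintegral_add_left (by fun_prop)]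
  refine lintegral_mono_ae ?_
  filter_upwards [Lp.coeFn_add p q] with x hx
  rw [hx]
  refine le_trans ?_ (add_pow_six_le _ _)
  gcongr
  exact enorm_add_le _ _

lemma sixNorm_smul {c : ℂ} (hc : ‖c‖ = 1) (p : HL2) : sixNorm (c • p) = sixNorm p := by
  refine lintegral_congr_ae ?_
  filter_upwards [Lp.coeFn_smul c p] with x hx
  rw [hx]
  congr 1
  exact enorm_eq_of_norm_eq (by simp [hc])

lemma lintegral_comp_sign {σ : ℝ} (hσ : σ = 1 ∨ σ = -1) (f : ℝ → ℝ≥0∞) : ∫⁻ t, f (σ * t) = ∫⁻ t, f t := by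
  rcases hσ with rfl | rfl
  · simp
  · simp only [neg_one_mul]
    exact (Measure.measurePreserving_neg (volume : Measure ℝ)).lintegral_comp_emb
      (MeasurableEquiv.neg ℝ).measurableEmbedding f

lemma enorm_cosFun_le (f : ℝ → ℂ) (x : ℝ) : ‖cosFun f x‖ₑ ≤ ENNReal.ofReal √(2 / Real.pi) * ∫⁻ y, ‖f y‖ₑ ∂halfLine := by
  rw [cosFun, enorm_mul]
  refine mul_le_mul' (le_of_eq ?_) ((enorm_integral_le_lintegral_enorm _).trans (lintegral_mono fun y => ?_))
  · rw [← ofReal_norm, Complex.norm_real, Real.norm_of_nonneg (Real.sqrt_nonneg _)]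
  · rw [enorm_mul]
    refine mul_le_of_le_one_left' ?_
    rw [← ofReal_norm, ← ENNReal.ofReal_one]
    exact ENNReal.ofReal_le_ofReal (norm_ofReal_cos_le _)

lemma lintegral_cutOp_le (n : ℕ) (q : HL2) : (∫⁻ x, ‖cutOp n q x‖ₑ ∂halfLine) ^ 2 ≤ n * ‖cutOp n q‖ₑ ^ 2 := by
  have hm := measurable_HL2 (cutOp n q)
  calc (∫⁻ x, ‖cutOp n q x‖ₑ ∂halfLine) ^ 2
      = (∫⁻ x, (Set.Ioc (0 : ℝ) n).indicator 1 x * ‖cutOp n q x‖ₑ ∂halfLine) ^ 2 := by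
        congr 1
        refine lintegral_congr_ae ?_
        filter_upwards [coeFn_cutOp n q, ae_halfLine_of_forall (P := fun x => 0 < x) (fun x hx => hx)] with x h1 h2
        by_cases hx : x ∈ Set.Ioc (0 : ℝ) n
        · simp [hx]
        · have : x ∉ Set.Icc (0 : ℝ) n := fun h => hx ⟨h2, h.2⟩
          rw [h1]
          simp [cutFun, this]
    _ ≤ _ := lintegral_mul_le_sqrt ((measurable_one.indicator measurableSet_Ioc).aemeasurable)
        (Measurable.aemeasurable (by fun_prop))
    _ = _ := by
        rw [← enorm_sq_eq_lintegral]
        congr 1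
        have : ∀ x : ℝ, (Set.Ioc (0 : ℝ) n).indicator (1 : ℝ → ℝ≥0∞) x ^ 2 = (Set.Ioc (0 : ℝ) n).indicator 1 x := fun x => by
          by_cases hx : x ∈ Set.Ioc (0 : ℝ) n <;> simp [hx]
        simp_rw [this]
        rw [lintegral_indicator_one measurableSet_Ioc, halfLine, Measure.restrict_apply measurableSet_Ioc,
          Set.inter_eq_left.2 Set.Ioc_subset_Ioi_self]
        simp

/-- Bernstein's inequality for functions of bounded frequency. -/
lemma exists_norm_lowpass_apply_le (n : ℕ) :
    ∃ C : NNReal, ∀ q : HL2, ∀ᵐ x ∂halfLine, ‖lowpass n q x‖ₑ ≤ C * ‖q‖ₑ := by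
  refine ⟨Real.toNNReal √(2 / Real.pi) * n, fun q => ?_⟩
  rw [lowpass_apply]
  filter_upwards [coeFn_cosT (EventuallyEq.refl _ (cutOp n (cosT q))) (integrable_cutOp n _)] with x hx
  rw [hx]
  refine (enorm_cosFun_le _ x).trans ?_
  push_cast
  rw [mul_assoc]
  refine mul_le_mul' le_rfl ((ENNReal.pow_le_pow_left_iff two_ne_zero).1 ((lintegral_cutOp_le n _).trans ?_))
  rw [mul_pow, enorm_eq_of_norm_eq (norm_cutOp_cosT n q), ← ofReal_norm, ← ofReal_norm q]
  refine mul_le_mul' ?_ (pow_le_pow_left' (ENNReal.ofReal_le_ofReal (norm_lowpass_le n q)) 2)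
  exact_mod_cast Nat.le_self_pow two_ne_zero n

/-- A qualitative bound with a constant depending on n. It only starts the bisection and leaves no
trace in the final constant. -/
lemma exists_sixNorm_lowpass_le (n : ℕ) : ∃ C : NNReal, ∀ q : HL2, sixNorm (lowpass n q) ≤ C * ‖q‖ₑ ^ 6 := by
  obtain ⟨C, hC⟩ := exists_norm_lowpass_apply_le n
  refine ⟨C ^ 4, fun q => ?_⟩
  have hm := measurable_HL2 (lowpass n q)
  calc sixNorm (lowpass n q) ≤ ∫⁻ x, (C * ‖q‖ₑ) ^ 4 * ‖lowpass n q x‖ₑ ^ 2 ∂halfLine := by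
        refine lintegral_mono_ae ?_
        filter_upwards [hC q] with x hx
        calc ‖lowpass n q x‖ₑ ^ 6 = ‖lowpass n q x‖ₑ ^ 4 * ‖lowpass n q x‖ₑ ^ 2 := by rw [← pow_add]
          _ ≤ _ := by gcongr
    _ = (C * ‖q‖ₑ) ^ 4 * ‖lowpass n q‖ₑ ^ 2 := by
        rw [lintegral_const_mul _ (by fun_prop), ← enorm_sq_eq_lintegral]
    _ ≤ (C * ‖q‖ₑ) ^ 4 * ‖q‖ₑ ^ 2 := by
        gcongr
        rw [← ofReal_norm, ← ofReal_norm]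
        exact ENNReal.ofReal_le_ofReal (norm_lowpass_le n q)
    _ = _ := by push_cast; ring

/-- The Duhamel integral `∫_c^t e^{-iσsL} m(s) ds`, before the final evolution. -/
def duhamel (σ : ℝ) (m : ℝ → HL2) (c t : ℝ) : HL2 := flow (σ * t) (∫ s in c..t, flow (-(σ * s)) (m s))

lemma continuous_duhamel (σ : ℝ) {m : ℝ → HL2} (hm : Continuous m) (c : ℝ) : Continuous (duhamel σ m c) := by
  have h : Continuous fun s => flow (-(σ * s)) (m s) := continuous_flow (by fun_prop) hm
  exact continuous_flow (by fun_prop) (intervalIntegral.continuous_primitive (fun _ _ => h.intervalIntegrable _ _) c)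

lemma duhamel_eq_add (σ : ℝ) {m : ℝ → HL2} (hm : Continuous m) (c e t : ℝ) :
    duhamel σ m c t = flow (σ * t) (∫ s in c..e, flow (-(σ * s)) (m s)) + duhamel σ m e t := by
  have h : Continuous fun s => flow (-(σ * s)) (m s) := continuous_flow (by fun_prop) hm
  rw [duhamel, duhamel, ← map_add,
    intervalIntegral.integral_add_adjacent_intervals (h.intervalIntegrable _ _) (h.intervalIntegrable _ _)]

lemma norm_duhamel_le (σ : ℝ) {m : ℝ → HL2} {c t M : ℝ} (hct : c ≤ t) (hM : ∀ s ∈ Set.Icc c t, ‖m s‖ ≤ M) :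
    ‖duhamel σ m c t‖ ≤ M * (t - c) := by
  rw [duhamel, norm_flow]
  have h := intervalIntegral.norm_integral_le_of_norm_le_const (a := c) (b := t) (C := M)
    (f := fun s => flow (-(σ * s)) (m s)) fun s hs => by
      rw [norm_flow]
      rw [Set.uIoc_of_le hct] at hs
      exact hM s ⟨hs.1.le, hs.2⟩
  rwa [abs_of_nonneg (sub_nonneg.2 hct)] at h

/-- The inhomogeneous Strichartz estimate with a source in the weighted space. -/
theorem exists_retarded_strichartz : ∃ C : NNReal, ∀ σ : ℝ, (σ = 1 ∨ σ = -1) → ∀ m : ℝ → HL2, Continuous m →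
    (∀ t, ZeroMean (m t)) → ∀ a b : ℝ, a ≤ b →
    ∫⁻ t in Set.Ioc a b, sixNorm (duhamel σ m a t) ≤ C * (∫⁻ t in Set.Ioc a b, wNorm (m t)) ^ 3 := by
  obtain ⟨C₀, hC₀⟩ := exists_strichartz
  -- The number 15625000 is 15625 from `add_pow_six_le` times the cube of the smoothing constant 10;
  -- the added 1 keeps N positive.
  refine ⟨15625000 * C₀ + 1, fun σ hσ m hm hz a b hab => ?_⟩
  set N : ℝ := 15625000 * C₀ + 1 with hN
  have hN0 : 0 < N := by positivity
  have hNN : ((15625000 * C₀ + 1 : NNReal) : ℝ≥0∞) = ENNReal.ofReal N := by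
    rw [← ENNReal.ofReal_coe_nnreal]; congr 1
  rw [hNN]
  have hwm := measurable_wNorm_comp hm
  rcases eq_or_ne (∫⁻ t in Set.Ioc a b, wNorm (m t)) ⊤ with htop | hfin
  · rw [htop]
    simp [hN0]
  set w : ℝ → ℝ := fun t => (wNorm (m t)).toReal with hw
  have hwi : IntegrableOn w (Set.Ioc a b) := integrable_toReal_of_lintegral_ne_top hwm.aemeasurable hfin
  have hw0 : ∀ t, 0 ≤ w t := fun t => ENNReal.toReal_nonneg
  have hwii : ∀ c d, a ≤ c → c ≤ d → d ≤ b → IntervalIntegrable w volume c d := fun c d h1 h2 h3 =>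
    (intervalIntegrable_iff_integrableOn_Ioc_of_le h2).2 (hwi.mono_set (Set.Ioc_subset_Ioc h1 h3))
  have hwl : ∀ c d, a ≤ c → c ≤ d → d ≤ b →
      ∫⁻ t in Set.Ioc c d, wNorm (m t) = ENNReal.ofReal (∫ t in c..d, w t) := by
    intro c d h1 h2 h3
    have hsub := Set.Ioc_subset_Ioc h1 h3
    have hfin' : ∫⁻ t in Set.Ioc c d, wNorm (m t) ≠ ⊤ :=
      ne_top_of_le_ne_top hfin (lintegral_mono_set hsub)
    rw [intervalIntegral.integral_of_le h2, integral_toReal hwm.aemeasurable (ae_lt_top hwm hfin'),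
      ENNReal.ofReal_toReal hfin']
  -- The term δ(t - a) makes Ψ grow at rate at least δ, so that the prior bound, a power of d - c,
  -- is dominated by a cubed increment of Ψ. Both δ and the truncation k are removed at the end.
  have hk : ∀ k : ℕ, ∀ δ : ℝ, 0 < δ → ∫⁻ t in Set.Ioc a b, sixNorm (lowpass k (duhamel σ m a t))
      ≤ ENNReal.ofReal (N * ((∫ t in a..b, w t) + δ * (b - a)) ^ 3) := by
    intro k δ hδ
    set Ψ : ℝ → ℝ := fun t => (∫ s in a..t, w s) + δ * (t - a) with hΨ
    have hdiff : ∀ c d, a ≤ c → c ≤ d → d ≤ b → Ψ d - Ψ c = (∫ s in c..d, w s) + δ * (d - c) := by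
      intro c d h1 h2 h3
      simp only [hΨ]
      rw [← intervalIntegral.integral_add_adjacent_intervals (hwii a c le_rfl h1 (h2.trans h3)) (hwii c d h1 h2 h3)]
      ring
    have hcont : ContinuousOn Ψ (Set.Icc a b) := by
      have h := intervalIntegral.continuousOn_primitive_interval (μ := volume) (f := w) (a := a) (b := b)
        (by rw [Set.uIcc_of_le hab]; exact (integrableOn_Icc_iff_integrableOn_Ioc).2 hwi)
      rw [Set.uIcc_of_le hab] at h
      exact h.add (by fun_prop)
    have hnn : ∀ c d, c ≤ d → 0 ≤ ∫ s in c..d, w s := fun c d h =>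
      intervalIntegral.integral_nonneg h fun _ _ => hw0 _
    have hlow : ∀ c d, a ≤ c → c ≤ d → d ≤ b → δ * (d - c) ≤ Ψ d - Ψ c := fun c d h1 h2 h3 => by
      rw [hdiff c d h1 h2 h3]
      linarith [hnn c d h2]
    have hmono : MonotoneOn Ψ (Set.Icc a b) := fun c hc d hd hcd => by
      have h1 := hlow c d hc.1 hcd hd.2
      have h2 : 0 ≤ δ * (d - c) := mul_nonneg hδ.le (sub_nonneg.2 hcd)
      linarith
    obtain ⟨Ck, hCk⟩ := exists_sixNorm_lowpass_le k
    obtain ⟨M, hM⟩ := (isCompact_Icc (a := a) (b := b)).exists_bound_of_continuousOn hm.continuousOn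
    have hM0 : 0 ≤ M := (norm_nonneg _).trans (hM a ⟨le_rfl, hab⟩)
    have hΨa : Ψ b - Ψ a = (∫ t in a..b, w t) + δ * (b - a) := hdiff a b le_rfl hab le_rfl
    rw [← hΨa]
    refine le_cube_of_bisection (A := fun c d => ∫⁻ t in Set.Ioc c d, sixNorm (lowpass k (duhamel σ m c t)))
      (κ := Ck * M ^ 6 * (b - a) ^ 4 / δ ^ 3) hab hcont hmono hN0.le (by have := sub_nonneg.2 hab; positivity) ?_ ?_
    -- After time e the source on (c, e] acts as a free wave with datum G, bounded by the Strichartz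
    -- estimate and dual smoothing; the source after e restarts the Duhamel integral there.
    · intro c e d h1 h2 h3 h4
      set G := ∫ s in c..e, flow (-(σ * s)) (m s) with hG
      have hGle : ‖G‖ₑ ^ 2 ≤ 10 * ENNReal.ofReal (Ψ e - Ψ c) := by
        refine (enorm_integral_flow_le hσ hm hz h2).trans ?_
        rw [hwl c e h1 h2 (h3.trans h4)]
        gcongr
        rw [hdiff c e h1 h2 (h3.trans h4)]
        have := mul_nonneg hδ.le (sub_nonneg.2 h2)
        linarith
      have hΨ0 : 0 ≤ Ψ e - Ψ c := sub_nonneg.2 (hmono ⟨h1, h2.trans (h3.trans h4)⟩ ⟨h1.trans h2, h3.trans h4⟩ h2)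
      have hmeas : Measurable fun t => sixNorm (lowpass k (duhamel σ m e t)) :=
        measurable_sixNorm_comp ((lowpass k).continuous.comp (continuous_duhamel σ hm e))
      have hmeas' : Measurable fun t => sixNorm (flow (σ * t) (lowpass k G)) :=
        measurable_sixNorm_comp (continuous_flow (by fun_prop) continuous_const)
      have hfree : ∫⁻ t in Set.Ioc e d, 15625 * sixNorm (flow (σ * t) (lowpass k G)) ≤ ENNReal.ofReal (N * (Ψ e - Ψ c) ^ 3) := by
        rw [lintegral_const_mul _ hmeas']
        calc 15625 * ∫⁻ t in Set.Ioc e d, sixNorm (flow (σ * t) (lowpass k G))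
            ≤ 15625 * ∫⁻ t, sixNorm (flow (σ * t) (lowpass k G)) := by gcongr; exact Measure.restrict_le_self
          _ = 15625 * ∫⁻ t, sixNorm (flow t (lowpass k G)) := by
              rw [lintegral_comp_sign hσ fun t => sixNorm (flow t (lowpass k G))]
          _ ≤ 15625 * (C₀ * ‖lowpass k G‖ₑ ^ 6) := by gcongr; exact hC₀ _
          _ ≤ 15625 * (C₀ * ‖G‖ₑ ^ 6) := by
              gcongr
              rw [← ofReal_norm, ← ofReal_norm]
              exact ENNReal.ofReal_le_ofReal (norm_lowpass_le k G)
          _ = 15625 * (C₀ * (‖G‖ₑ ^ 2) ^ 3) := by rw [← pow_mul]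
          _ ≤ 15625 * (C₀ * (10 * ENNReal.ofReal (Ψ e - Ψ c)) ^ 3) := by gcongr
          _ = ENNReal.ofReal (15625000 * C₀ * (Ψ e - Ψ c) ^ 3) := by
              rw [mul_pow, ENNReal.ofReal_mul (by positivity), ENNReal.ofReal_mul (by norm_num),
                ENNReal.ofReal_coe_nnreal, ENNReal.ofReal_pow hΨ0]
              norm_num
              ring
          _ ≤ _ := by
              refine ENNReal.ofReal_le_ofReal ?_
              gcongr
              rw [hN]; linarith
      calc ∫⁻ t in Set.Ioc c d, sixNorm (lowpass k (duhamel σ m c t))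
          = (∫⁻ t in Set.Ioc c e, sixNorm (lowpass k (duhamel σ m c t))) +
            ∫⁻ t in Set.Ioc e d, sixNorm (lowpass k (duhamel σ m c t)) := by
            rw [← Set.Ioc_union_Ioc_eq_Ioc h2 h3, lintegral_union measurableSet_Ioc]
            exact Set.Ioc_disjoint_Ioc_of_le le_rfl
        _ ≤ (∫⁻ t in Set.Ioc c e, sixNorm (lowpass k (duhamel σ m c t))) +
            ∫⁻ t in Set.Ioc e d, (15625 * sixNorm (flow (σ * t) (lowpass k G)) +
              4 * sixNorm (lowpass k (duhamel σ m e t))) := by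
            gcongr with t
            rw [duhamel_eq_add σ hm c e t, map_add, lowpass_flow]
            exact sixNorm_add_le _ _
        _ = (∫⁻ t in Set.Ioc c e, sixNorm (lowpass k (duhamel σ m c t))) +
            ((∫⁻ t in Set.Ioc e d, 15625 * sixNorm (flow (σ * t) (lowpass k G))) +
              4 * ∫⁻ t in Set.Ioc e d, sixNorm (lowpass k (duhamel σ m e t))) := by
            rw [lintegral_add_left (hmeas'.const_mul _), lintegral_const_mul _ hmeas]
        _ ≤ _ := by
            rw [← add_assoc]
            gcongr
    -- The prior bound: the trivial estimate of the Duhamel integral is of order (d - c)⁷, and three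
    -- of these powers are traded for the cube of the increment of Ψ over δ³.
    · intro c d h1 h2 h3
      have hdc : 0 ≤ d - c := sub_nonneg.2 h2
      calc ∫⁻ t in Set.Ioc c d, sixNorm (lowpass k (duhamel σ m c t))
          ≤ ∫⁻ _t in Set.Ioc c d, ENNReal.ofReal (Ck * (M * (d - c)) ^ 6) := by
            refine setLIntegral_mono measurable_const fun t ht => (hCk _).trans ?_
            rw [ENNReal.ofReal_mul (by positivity), ENNReal.ofReal_coe_nnreal, ENNReal.ofReal_pow (by positivity),
              ← ofReal_norm]
            gcongr
            refine (norm_duhamel_le σ ht.1.le fun s hs => hM s ⟨h1.trans hs.1, hs.2.trans (ht.2.trans h3)⟩).trans ?_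
            gcongr
            exact ht.2
        _ = ENNReal.ofReal (Ck * M ^ 6 * (d - c) ^ 4 * (d - c) ^ 3) := by
            rw [setLIntegral_const, Real.volume_Ioc, ← ENNReal.ofReal_mul (by positivity)]
            congr 1; ring
        _ ≤ _ := by
            refine ENNReal.ofReal_le_ofReal ?_
            have h4 : (d - c) ^ 3 ≤ (Ψ d - Ψ c) ^ 3 / δ ^ 3 := by
              rw [le_div_iff₀ (by positivity), ← mul_pow, mul_comm]
              exact pow_le_pow_left₀ (by positivity) (hlow c d h1 h2 h3) 3
            have h5 : d - c ≤ b - a := by linarith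
            calc Ck * M ^ 6 * (d - c) ^ 4 * (d - c) ^ 3 ≤ Ck * M ^ 6 * (b - a) ^ 4 * ((Ψ d - Ψ c) ^ 3 / δ ^ 3) := by
                  gcongr
              _ = _ := by ring
  have hk' : ∀ k : ℕ, ∫⁻ t in Set.Ioc a b, sixNorm (lowpass k (duhamel σ m a t))
      ≤ ENNReal.ofReal N * (∫⁻ t in Set.Ioc a b, wNorm (m t)) ^ 3 := by
    intro k
    have hlim : Tendsto (fun n : ℕ => ENNReal.ofReal (N * ((∫ t in a..b, w t) + (1 / ((n : ℝ) + 1)) * (b - a)) ^ 3)) atTop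
        (𝓝 (ENNReal.ofReal (N * ((∫ t in a..b, w t) + 0 * (b - a)) ^ 3))) := by
      refine (ENNReal.continuous_ofReal.tendsto _).comp ?_
      exact (((tendsto_one_div_add_atTop_nhds_zero_nat.mul_const _).const_add _).pow 3).const_mul _
    refine (ge_of_tendsto' hlim fun n => hk k _ (by positivity)).trans_eq ?_
    rw [zero_mul, add_zero, ENNReal.ofReal_mul hN0.le, ENNReal.ofReal_pow
      (intervalIntegral.integral_nonneg hab fun _ _ => hw0 _), hwl a b le_rfl hab le_rfl]
  calc ∫⁻ t in Set.Ioc a b, sixNorm (duhamel σ m a t)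
      ≤ ∫⁻ t in Set.Ioc a b, liminf (fun k => sixNorm (lowpass k (duhamel σ m a t))) atTop :=
        lintegral_mono fun t => le_liminf_of_lowerSemicontinuous lowerSemicontinuous_sixNorm (tendsto_lowpass _)
    _ ≤ liminf (fun k => ∫⁻ t in Set.Ioc a b, sixNorm (lowpass k (duhamel σ m a t))) atTop :=
        lintegral_liminf_le fun k => measurable_sixNorm_comp ((lowpass k).continuous.comp (continuous_duhamel σ hm a))
    _ ≤ _ := liminf_le_of_le (by isBoundedDefault) fun y hy => by
        obtain ⟨k, hk⟩ := hy.exists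
        exact hk.trans (hk' k)

end RetardedStrichartz

end

end ExteriorNLS

/-! ### Scattering for Duhamel pairs -/

namespace ExteriorNLS

noncomputable section

section Scattering

/-- The tenth power of the `L¹⁰` norm of the profile, up to the area of the sphere. -/
def tenNorm (p : HL2) : ℝ≥0∞ := ∫⁻ x, ENNReal.ofReal ((1 + x) ^ 2) * ‖profile p x‖ₑ ^ 10 ∂halfLine

lemma mul_norm_profile_sq_le (p : HL2) {x : ℝ} (hx : 0 ≤ x) : (1 + x) * ‖profile p x‖ ^ 2 ≤ ‖p‖ ^ 2 := by
  have h := sq_mul_norm_profile_pow_four_le p hx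
  refine (sq_le_sq₀ (by positivity) (by positivity)).1 ?_
  calc ((1 + x) * ‖profile p x‖ ^ 2) ^ 2 = (1 + x) ^ 2 * ‖profile p x‖ ^ 4 := by ring
    _ ≤ ‖p‖ ^ 4 := h
    _ = _ := by ring

/-- Weighted Young inequality with exponents 3 and 3/2, by comparing w with εz². -/
lemma sq_mul_sq_le_add {z w ε : ℝ} (hw : 0 ≤ w) (hε : 0 < ε) :
    z ^ 2 * w ^ 2 ≤ ε ^ 2 * z ^ 6 + ε⁻¹ * w ^ 3 := by
  rcases le_total w (ε * z ^ 2) with h | h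
  · have : z ^ 2 * w ^ 2 ≤ z ^ 2 * (ε * z ^ 2) ^ 2 := by gcongr
    have h2 : 0 ≤ ε⁻¹ * w ^ 3 := by positivity
    nlinarith
  · have h1 : z ^ 2 ≤ ε⁻¹ * w := by rwa [← div_eq_inv_mul, le_div_iff₀ hε, mul_comm]
    have : z ^ 2 * w ^ 2 ≤ (ε⁻¹ * w) * w ^ 2 := by gcongr
    have h2 : 0 ≤ ε ^ 2 * z ^ 6 := by positivity
    nlinarith

/-- Young's inequality splits x²|u|⁸|p|² into |p|⁶ and x³|u|¹². The latter is x|u|², bounded by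
‖p‖², times x²|u|¹⁰, the L¹⁰ density. -/
lemma sq_mul_norm_nlFun_sq_le (p : HL2) {x ε : ℝ} (hx : 0 < x) (hε : 0 < ε) :
    x ^ 2 * ‖nlFun p x‖ ^ 2 ≤ 50 * ε ^ 2 * ‖p x‖ ^ 6 +
      (50 * ε⁻¹ * ‖p‖ ^ 2 + 32) * ((1 + x) ^ 2 * ‖profile p x‖ ^ 10) := by
  have h1 := norm_nlFun_le p x
  have h2 := mul_norm_profile_sq_le p hx.le
  set z := ‖p x‖
  set u := ‖profile p x‖
  have hu : 0 ≤ u := norm_nonneg _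
  have hz : 0 ≤ z := norm_nonneg _
  have h3 := sq_mul_sq_le_add (z := z) (w := x * u ^ 4) (by positivity) hε
  have h4 : (x * u ^ 4) ^ 3 ≤ ‖p‖ ^ 2 * ((1 + x) ^ 2 * u ^ 10) := by
    have : x * u ^ 2 ≤ ‖p‖ ^ 2 := le_trans (by gcongr; linarith) h2
    calc (x * u ^ 4) ^ 3 = (x * u ^ 2) * (x ^ 2 * u ^ 10) := by ring
      _ ≤ ‖p‖ ^ 2 * ((1 + x) ^ 2 * u ^ 10) := by gcongr; linarith
  calc x ^ 2 * ‖nlFun p x‖ ^ 2 ≤ x ^ 2 * (5 * u ^ 4 * z + 4 * u ^ 5) ^ 2 := by gcongr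
    _ ≤ x ^ 2 * (2 * (5 * u ^ 4 * z) ^ 2 + 2 * (4 * u ^ 5) ^ 2) := by
        gcongr
        nlinarith [sq_nonneg (5 * u ^ 4 * z - 4 * u ^ 5)]
    _ = 50 * (z ^ 2 * (x * u ^ 4) ^ 2) + 32 * (x ^ 2 * u ^ 10) := by ring
    _ ≤ 50 * (ε ^ 2 * z ^ 6 + ε⁻¹ * (‖p‖ ^ 2 * ((1 + x) ^ 2 * u ^ 10))) + 32 * ((1 + x) ^ 2 * u ^ 10) := by
        have h5 : ε⁻¹ * (x * u ^ 4) ^ 3 ≤ ε⁻¹ * (‖p‖ ^ 2 * ((1 + x) ^ 2 * u ^ 10)) := by gcongr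
        have h6 : x ^ 2 * u ^ 10 ≤ (1 + x) ^ 2 * u ^ 10 := by gcongr; linarith
        linarith
    _ = _ := by ring

lemma wNorm_nl_eq (p : HL2) : wNorm (nl p) = ∫⁻ x, ENNReal.ofReal (x ^ 2 * ‖nlFun p x‖ ^ 2) ∂halfLine := by
  refine lintegral_congr_ae ?_
  filter_upwards [coeFn_nl p] with x hx
  rw [hx, ENNReal.ofReal_mul (by positivity), ENNReal.ofReal_pow (norm_nonneg _), ofReal_norm]

lemma wNorm_nl_le (p : HL2) {ε : ℝ} (hε : 0 < ε) :
    wNorm (nl p) ≤ ENNReal.ofReal (50 * ε ^ 2) * sixNorm p +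
      ENNReal.ofReal (50 * ε⁻¹ * ‖p‖ ^ 2 + 32) * tenNorm p := by
  have hp := measurable_HL2 p
  have hu := measurable_profile p
  rw [wNorm_nl_eq, sixNorm, tenNorm, ← lintegral_const_mul _ (by fun_prop), ← lintegral_const_mul _ (by fun_prop),
    ← lintegral_add_left (by fun_prop)]
  refine lintegral_mono_ae (ae_halfLine_of_forall fun x hx => ?_)
  rw [← ofReal_norm, ← ofReal_norm, ← ENNReal.ofReal_pow (norm_nonneg _), ← ENNReal.ofReal_pow (norm_nonneg _),
    ← ENNReal.ofReal_mul (by positivity), ← ENNReal.ofReal_mul (by positivity), ← ENNReal.ofReal_mul (by positivity),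
    ← ENNReal.ofReal_add (by positivity) (by positivity)]
  exact ENNReal.ofReal_le_ofReal (sq_mul_norm_nlFun_sq_le p hx hε)

lemma lintegral_ofReal_norm_sq (p : HL2) : ∫⁻ x, ENNReal.ofReal (‖p x‖ ^ 2) ∂halfLine = ENNReal.ofReal (‖p‖ ^ 2) := by
  rw [ENNReal.ofReal_pow (norm_nonneg _), ofReal_norm, enorm_sq_eq_lintegral]
  refine lintegral_congr fun x => ?_
  rw [ENNReal.ofReal_pow (norm_nonneg _), ofReal_norm]

/-- A crude bound by the norm alone, with 178 = 50 + 4·32. It shows that the weighted norm is finite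
on bounded time intervals, without which the bootstrap could not absorb it. -/
lemma wNorm_nl_le_pow (p : HL2) : wNorm (nl p) ≤ ENNReal.ofReal (178 * ‖p‖ ^ 10) := by
  have hp := measurable_HL2 p
  have hu := measurable_profile p
  calc wNorm (nl p) ≤ ∫⁻ x, (ENNReal.ofReal (50 * ‖p‖ ^ 8) * ENNReal.ofReal (‖p x‖ ^ 2) +
        ENNReal.ofReal (32 * ‖p‖ ^ 8) * ENNReal.ofReal (‖profile p x‖ ^ 2)) ∂halfLine := by
        rw [wNorm_nl_eq]
        refine lintegral_mono_ae (ae_halfLine_of_forall fun x hx => ?_)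
        rw [← ENNReal.ofReal_mul (by positivity), ← ENNReal.ofReal_mul (by positivity),
          ← ENNReal.ofReal_add (by positivity) (by positivity)]
        refine ENNReal.ofReal_le_ofReal ?_
        have h1 := norm_nlFun_le p x
        have h2 := sq_mul_norm_profile_pow_four_le p hx.le
        set z := ‖p x‖
        set u := ‖profile p x‖
        have hu : 0 ≤ u := norm_nonneg _
        have hz : 0 ≤ z := norm_nonneg _
        have h3 : x ^ 2 * u ^ 8 ≤ ‖p‖ ^ 8 := by
          calc x ^ 2 * u ^ 8 ≤ ((1 + x) ^ 2) ^ 2 * u ^ 8 := by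
                gcongr
                nlinarith
            _ = ((1 + x) ^ 2 * u ^ 4) ^ 2 := by ring
            _ ≤ (‖p‖ ^ 4) ^ 2 := by gcongr
            _ = _ := by ring
        calc x ^ 2 * ‖nlFun p x‖ ^ 2 ≤ x ^ 2 * (5 * u ^ 4 * z + 4 * u ^ 5) ^ 2 := by gcongr
          _ ≤ x ^ 2 * (2 * (5 * u ^ 4 * z) ^ 2 + 2 * (4 * u ^ 5) ^ 2) := by
              gcongr
              nlinarith [sq_nonneg (5 * u ^ 4 * z - 4 * u ^ 5)]
          _ = (x ^ 2 * u ^ 8) * (50 * z ^ 2 + 32 * u ^ 2) := by ring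
          _ ≤ ‖p‖ ^ 8 * (50 * z ^ 2 + 32 * u ^ 2) := by gcongr
          _ = _ := by ring
    _ = ENNReal.ofReal (50 * ‖p‖ ^ 8) * ENNReal.ofReal (‖p‖ ^ 2) +
        ENNReal.ofReal (32 * ‖p‖ ^ 8) * ENNReal.ofReal (∫ x, ‖profile p x‖ ^ 2 ∂halfLine) := by
        rw [lintegral_add_left (by fun_prop), lintegral_const_mul _ (by fun_prop), lintegral_const_mul _ (by fun_prop),
          lintegral_ofReal_norm_sq,
          ofReal_integral_eq_lintegral_ofReal (integrable_profile_sq p) (Eventually.of_forall fun x => by positivity)]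
    _ ≤ ENNReal.ofReal (50 * ‖p‖ ^ 8) * ENNReal.ofReal (‖p‖ ^ 2) +
        ENNReal.ofReal (32 * ‖p‖ ^ 8) * ENNReal.ofReal (4 * ‖p‖ ^ 2) := by
        gcongr
        exact integral_profile_sq_le p
    _ = _ := by
        rw [← ENNReal.ofReal_mul (by positivity), ← ENNReal.ofReal_mul (by positivity),
          ← ENNReal.ofReal_add (by positivity) (by positivity)]
        congr 1; ring

lemma le_of_bootstrap {φ K₁ K₂ L η δ : ℝ} (hφ : 0 ≤ φ) (hK₁ : 0 ≤ K₁) (hK₂ : 0 ≤ K₂) (hδ : 0 < δ)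
    (hδ1 : δ ≤ 1) (hδK : 50 * δ ^ 2 * K₂ ≤ 1 / 4) (hηL : 50 * δ⁻¹ * L * η ≤ 1 / 4) (hη : 32 * η ≤ 1)
    (h : ∀ ε, 0 < ε → φ ≤ 50 * ε ^ 2 * (K₁ + K₂ * φ ^ 3) + (50 * ε⁻¹ * L + 32) * η) : φ ≤ 100 * K₁ + 3 := by
  -- The hypothesis holds for every ε, so ε may depend on φ. This choice makes both ε²φ³ and η/ε at
  -- most linear in φ, with total coefficient 1/2, so no continuity argument is needed.
  have h1 := h (δ / (1 + φ)) (by positivity)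
  have e1 : (δ / (1 + φ)) ^ 2 ≤ δ ^ 2 := by
    gcongr
    exact div_le_self hδ.le (by linarith)
  have e2 : (δ / (1 + φ)) ^ 2 * φ ^ 3 ≤ δ ^ 2 * φ := by
    have : (δ / (1 + φ)) ^ 2 * φ ^ 3 = δ ^ 2 * φ * (φ / (1 + φ)) ^ 2 := by
      rw [div_pow, div_pow]; ring
    rw [this]
    refine mul_le_of_le_one_right (by positivity) (pow_le_one₀ (by positivity) ?_)
    rw [div_le_one (by positivity)]; linarith
  have e3 : (δ / (1 + φ))⁻¹ = δ⁻¹ * (1 + φ) := by rw [inv_div, div_eq_inv_mul]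
  rw [e3] at h1
  have e4 : 50 * (δ / (1 + φ)) ^ 2 * (K₁ + K₂ * φ ^ 3) ≤ 50 * K₁ + 1 / 4 * φ := by
    have f1 : (δ / (1 + φ)) ^ 2 * K₁ ≤ 1 * K₁ := by
      gcongr
      exact e1.trans (pow_le_one₀ hδ.le hδ1)
    have f2 : K₂ * ((δ / (1 + φ)) ^ 2 * φ ^ 3) ≤ K₂ * (δ ^ 2 * φ) := by gcongr
    have f3 : 50 * δ ^ 2 * K₂ * φ ≤ 1 / 4 * φ := by gcongr
    nlinarith
  have e5 : (50 * (δ⁻¹ * (1 + φ)) * L + 32) * η ≤ 1 / 4 * (1 + φ) + 1 := by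
    have : 50 * δ⁻¹ * L * η * (1 + φ) ≤ 1 / 4 * (1 + φ) := by gcongr
    nlinarith
  linarith

lemma tendsto_setLIntegral_Ioi {f : ℝ → ℝ≥0∞} {T : ℝ} (hf : ∫⁻ t in Set.Ioi T, f t ≠ ⊤) :
    Tendsto (fun s => ∫⁻ t in Set.Ioi s, f t) atTop (𝓝 0) := by
  have h := tendsto_measure_iInter_atTop (μ := volume.withDensity f) (s := fun s : ℝ => Set.Ioi s)
    (fun s => measurableSet_Ioi.nullMeasurableSet) (fun a b hab => Set.Ioi_subset_Ioi hab)
    ⟨T, by rwa [withDensity_apply _ measurableSet_Ioi]⟩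
  have he : ⋂ s : ℝ, Set.Ioi s = ∅ := by
    ext x
    simp only [Set.mem_iInter, Set.mem_Ioi, Set.mem_empty_iff_false, iff_false, not_forall, not_lt]
    exact ⟨x, le_rfl⟩
  rw [he, measure_empty] at h
  refine h.congr fun s => ?_
  simp [withDensity_apply _ measurableSet_Ioi]

lemma setLIntegral_Ioi_le_of_forall {f : ℝ → ℝ≥0∞} {T : ℝ} {B : ℝ≥0∞}
    (h : ∀ b, T ≤ b → ∫⁻ t in Set.Ioc T b, f t ≤ B) : ∫⁻ t in Set.Ioi T, f t ≤ B := by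
  have h1 := tendsto_measure_iUnion_atTop (μ := volume.withDensity f) (s := fun b : ℝ => Set.Ioc T b)
    (fun a b hab => Set.Ioc_subset_Ioc_right hab)
  rw [Set.iUnion_Ioc_right, withDensity_apply _ measurableSet_Ioi] at h1
  refine le_of_tendsto h1 ?_
  filter_upwards [eventually_ge_atTop T] with b hb
  simpa [withDensity_apply _ measurableSet_Ioc] using h b hb

/-- The abstract form of a solution: `p` is the evolution of `v` along the free flow in the direction of
time given by `σ`, and `v` moves by the nonlinearity. -/
structure IsDuhamelPair (σ : ℝ) (c : ℂ) (p v : ℝ → HL2) : Prop where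
  sign : σ = 1 ∨ σ = -1
  norm_const : ‖c‖ = 1
  continuous : Continuous p
  eq_flow : ∀ t, p t = flow (σ * t) (v t)
  sub_eq : ∀ a b, v b - v a = c • ∫ t in a..b, flow (-(σ * t)) (nl (p t))

namespace IsDuhamelPair

variable {σ : ℝ} {c : ℂ} {p v : ℝ → HL2}

lemma enorm_sub_sq_le (h : IsDuhamelPair σ c p v) {a b : ℝ} (hab : a ≤ b) :
    ‖v b - v a‖ₑ ^ 2 ≤ 10 * ∫⁻ t in Set.Ioc a b, wNorm (nl (p t)) := by
  rw [h.sub_eq, enorm_eq_of_norm_eq (b := ∫ t in a..b, flow (-(σ * t)) (nl (p t)))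
    (by rw [norm_smul, h.norm_const, one_mul])]
  exact enorm_integral_flow_le h.sign (continuous_nl_comp h.continuous) (fun t => zeroMean_nl _) hab

lemma eq_add_duhamel (h : IsDuhamelPair σ c p v) (a t : ℝ) :
    p t = flow (σ * t) (v a) + c • duhamel σ (fun s => nl (p s)) a t := by
  rw [h.eq_flow t, duhamel, ← map_smul, ← map_add, ← h.sub_eq, add_sub_cancel]

/-- The free part is bounded by the homogeneous estimate, the Duhamel part by the retarded one,
whose source has mean zero by `zeroMean_nl`. -/
lemma exists_lintegral_sixNorm_le : ∃ C : NNReal, ∀ {σ : ℝ} {c : ℂ} {p v : ℝ → HL2}, IsDuhamelPair σ c p v →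
    ∀ a b, a ≤ b → ∫⁻ t in Set.Ioc a b, sixNorm (p t) ≤
      C * ‖v a‖ₑ ^ 6 + C * (∫⁻ t in Set.Ioc a b, wNorm (nl (p t))) ^ 3 := by
  obtain ⟨C₁, hC₁⟩ := exists_strichartz
  obtain ⟨C₂, hC₂⟩ := exists_retarded_strichartz
  refine ⟨15625 * C₁ + 4 * C₂, fun {σ c p v} h a b hab => ?_⟩
  have hm := continuous_nl_comp h.continuous
  have hmeas : Measurable fun t => sixNorm (flow (σ * t) (v a)) :=
    measurable_sixNorm_comp (continuous_flow (by fun_prop) continuous_const)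
  calc ∫⁻ t in Set.Ioc a b, sixNorm (p t)
      ≤ ∫⁻ t in Set.Ioc a b, (15625 * sixNorm (flow (σ * t) (v a)) + 4 * sixNorm (duhamel σ (fun s => nl (p s)) a t)) := by
        gcongr with t
        conv_lhs => rw [h.eq_add_duhamel a t]
        refine (sixNorm_add_le _ _).trans_eq ?_
        rw [sixNorm_smul h.norm_const]
    _ = 15625 * (∫⁻ t in Set.Ioc a b, sixNorm (flow (σ * t) (v a))) +
        4 * ∫⁻ t in Set.Ioc a b, sixNorm (duhamel σ (fun s => nl (p s)) a t) := by
        rw [lintegral_add_left (hmeas.const_mul _), lintegral_const_mul' _ _ (by norm_num), lintegral_const_mul' _ _ (by norm_num)]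
    _ ≤ 15625 * (C₁ * ‖v a‖ₑ ^ 6) + 4 * (C₂ * (∫⁻ t in Set.Ioc a b, wNorm (nl (p t))) ^ 3) := by
        refine add_le_add (mul_le_mul' le_rfl ?_) (mul_le_mul' le_rfl ?_)
        · refine (setLIntegral_le_lintegral _ _).trans ?_
          rw [lintegral_comp_sign h.sign fun t => sixNorm (flow t (v a))]
          exact hC₁ _
        · exact hC₂ σ h.sign _ hm (fun t => zeroMean_nl _) a b hab
    _ ≤ _ := by
        rw [← mul_assoc, ← mul_assoc]
        push_cast
        gcongr
        · exact le_self_add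
        · exact le_add_self

lemma lintegral_wNorm_ne_top (h : IsDuhamelPair σ c p v) (a b : ℝ) :
    ∫⁻ t in Set.Ioc a b, wNorm (nl (p t)) ≠ ⊤ := by
  obtain ⟨M, hM⟩ := (isCompact_Icc (a := a) (b := b)).exists_bound_of_continuousOn h.continuous.continuousOn
  have : ∫⁻ t in Set.Ioc a b, wNorm (nl (p t)) ≤ ∫⁻ _t in Set.Ioc a b, ENNReal.ofReal (178 * M ^ 10) := by
    refine setLIntegral_mono measurable_const fun t ht => (wNorm_nl_le_pow _).trans (ENNReal.ofReal_le_ofReal ?_)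
    gcongr
    exact hM t ⟨ht.1.le, ht.2⟩
  refine ne_top_of_le_ne_top ?_ this
  rw [setLIntegral_const, Real.volume_Ioc]
  exact ENNReal.mul_ne_top ENNReal.ofReal_ne_top ENNReal.ofReal_ne_top

lemma lintegral_sixNorm_ne_top (h : IsDuhamelPair σ c p v) {a b : ℝ} (hab : a ≤ b) :
    ∫⁻ t in Set.Ioc a b, sixNorm (p t) ≠ ⊤ := by
  obtain ⟨C, hC⟩ := exists_lintegral_sixNorm_le
  refine ne_top_of_le_ne_top ?_ (hC h a b hab)
  refine ENNReal.add_ne_top.2 ⟨ENNReal.mul_ne_top ENNReal.coe_ne_top (ENNReal.pow_ne_top enorm_ne_top),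
    ENNReal.mul_ne_top ENNReal.coe_ne_top (ENNReal.pow_ne_top (h.lintegral_wNorm_ne_top a b))⟩

/-- A bounded solution with finite `L¹⁰` norm in the future has finite weighted norm in the future. -/
lemma exists_lintegral_wNorm_ne_top (h : IsDuhamelPair σ c p v) {M : ℝ} (hM : ∀ t, ‖p t‖ ≤ M)
    (hD : ∫⁻ t in Set.Ioi 0, tenNorm (p t) ≠ ⊤) : ∃ T, ∫⁻ t in Set.Ioi T, wNorm (nl (p t)) ≠ ⊤ := by
  obtain ⟨C, hC⟩ := exists_lintegral_sixNorm_le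
  have hM0 : 0 ≤ M := (norm_nonneg _).trans (hM 0)
  -- Order of the choices: δ from the Strichartz constant, η₀ from δ and the norm bound M, and last
  -- T so late that the L¹⁰ tail is below η₀. The resulting bound does not depend on the right
  -- endpoint b.
  obtain ⟨δ, hδ0, hδ1, hδC⟩ : ∃ δ : ℝ, 0 < δ ∧ δ ≤ 1 ∧ 50 * δ ^ 2 * C ≤ 1 / 4 := by
    refine ⟨1 / (200 * (C + 1)), by positivity, ?_, ?_⟩
    · rw [div_le_one (by positivity)]; linarith [C.coe_nonneg]
    · rw [div_pow, one_pow, mul_one_div, div_mul_eq_mul_div, div_le_iff₀ (by positivity)]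
      nlinarith [C.coe_nonneg]
  have hlim := tendsto_setLIntegral_Ioi hD
  obtain ⟨η₀, hη₀, hη₁, hη₂⟩ : ∃ η₀ : ℝ, 0 < η₀ ∧ 50 * δ⁻¹ * M ^ 2 * η₀ ≤ 1 / 4 ∧ 32 * η₀ ≤ 1 := by
    refine ⟨1 / (200 * δ⁻¹ * M ^ 2 + 32), by positivity, ?_, ?_⟩
    · rw [mul_one_div, div_le_iff₀ (by positivity)]; linarith
    · rw [mul_one_div, div_le_iff₀ (by positivity)]
      have : 0 ≤ 200 * δ⁻¹ * M ^ 2 := by positivity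
      linarith
  obtain ⟨T, hT⟩ := (hlim.eventually (gt_mem_nhds (ENNReal.ofReal_pos.2 hη₀))).exists
  refine ⟨T, ne_top_of_le_ne_top (ENNReal.ofReal_ne_top (r := 100 * (C * M ^ 6) + 3)) ?_⟩
  refine setLIntegral_Ioi_le_of_forall fun b hb => ?_
  have hfin := h.lintegral_wNorm_ne_top T b
  set Φ := ∫⁻ t in Set.Ioc T b, wNorm (nl (p t)) with hΦ
  rw [← ENNReal.ofReal_toReal hfin]
  refine ENNReal.ofReal_le_ofReal ?_
  refine le_of_bootstrap (K₂ := C) (L := M ^ 2) (η := η₀) (δ := δ) ENNReal.toReal_nonneg (by positivity) C.coe_nonneg hδ0 hδ1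
    hδC hη₁ hη₂ fun ε hε => ?_
  have hvT : ‖v T‖ₑ ≤ ENNReal.ofReal M := by
    rw [← ofReal_norm, ← norm_flow (σ * T), ← h.eq_flow]
    exact ENNReal.ofReal_le_ofReal (hM T)
  have key : Φ ≤ ENNReal.ofReal (50 * ε ^ 2 * (C * M ^ 6 + C * Φ.toReal ^ 3) + (50 * ε⁻¹ * M ^ 2 + 32) * η₀) := by
    calc Φ ≤ ∫⁻ t in Set.Ioc T b, (ENNReal.ofReal (50 * ε ^ 2) * sixNorm (p t) +
          ENNReal.ofReal (50 * ε⁻¹ * M ^ 2 + 32) * tenNorm (p t)) := by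
          refine lintegral_mono fun t => (wNorm_nl_le (p t) hε).trans ?_
          gcongr
          exact hM t
      _ = ENNReal.ofReal (50 * ε ^ 2) * (∫⁻ t in Set.Ioc T b, sixNorm (p t)) +
          ENNReal.ofReal (50 * ε⁻¹ * M ^ 2 + 32) * ∫⁻ t in Set.Ioc T b, tenNorm (p t) := by
          rw [lintegral_add_left ((measurable_sixNorm_comp h.continuous).const_mul _),
            lintegral_const_mul' _ _ ENNReal.ofReal_ne_top, lintegral_const_mul' _ _ ENNReal.ofReal_ne_top]
      _ ≤ ENNReal.ofReal (50 * ε ^ 2) * (C * ENNReal.ofReal M ^ 6 + C * Φ ^ 3) +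
          ENNReal.ofReal (50 * ε⁻¹ * M ^ 2 + 32) * ENNReal.ofReal η₀ := by
          refine add_le_add (mul_le_mul' le_rfl ((hC h T b hb).trans ?_)) (mul_le_mul' le_rfl ?_)
          · gcongr
          · exact (lintegral_mono_set Set.Ioc_subset_Ioi_self).trans hT.le
      _ = _ := by
          conv_lhs => rw [← ENNReal.ofReal_toReal hfin, ← ENNReal.ofReal_coe_nnreal]
          rw [← ENNReal.ofReal_pow hM0, ← ENNReal.ofReal_pow ENNReal.toReal_nonneg,
            ← ENNReal.ofReal_mul C.coe_nonneg, ← ENNReal.ofReal_mul C.coe_nonneg, ← ENNReal.ofReal_add (by positivity) (by positivity),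
            ← ENNReal.ofReal_mul (by positivity), ← ENNReal.ofReal_mul (by positivity),
            ← ENNReal.ofReal_add (by positivity) (by positivity)]
  exact (ENNReal.toReal_le_of_le_ofReal (by positivity) key)

/-- Scattering in the abstract setting. -/
theorem exists_tendsto (h : IsDuhamelPair σ c p v) {M : ℝ} (hM : ∀ t, ‖p t‖ ≤ M)
    (hD : ∫⁻ t in Set.Ioi 0, tenNorm (p t) ≠ ⊤) : ∃ w, Tendsto v atTop (𝓝 w) := by
  obtain ⟨T, hT⟩ := h.exists_lintegral_wNorm_ne_top hM hD
  have hlim := tendsto_setLIntegral_Ioi hT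
  refine cauchy_map_iff_exists_tendsto.1 ?_
  rw [Metric.cauchy_iff]
  refine ⟨inferInstance, fun ε hε => ?_⟩
  have hpos : 0 < ENNReal.ofReal ((ε / 2) ^ 2 / 10) := ENNReal.ofReal_pos.2 (by positivity)
  obtain ⟨S, hS⟩ := (hlim.eventually (gt_mem_nhds hpos)).exists
  -- By dual smoothing, increments of v after S are controlled by the tail of the weighted norm.
  have hclose : ∀ b, S ≤ b → ‖v b - v S‖ < ε / 2 := by
    intro b hb
    have h1 : ‖v b - v S‖ₑ ^ 2 < ENNReal.ofReal ((ε / 2) ^ 2) := by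
      refine (h.enorm_sub_sq_le hb).trans_lt ?_
      calc 10 * ∫⁻ t in Set.Ioc S b, wNorm (nl (p t)) ≤ 10 * ∫⁻ t in Set.Ioi S, wNorm (nl (p t)) := by
            gcongr; exact Set.Ioc_subset_Ioi_self
        _ < 10 * ENNReal.ofReal ((ε / 2) ^ 2 / 10) :=
            (ENNReal.mul_lt_mul_iff_right (by norm_num) (by norm_num)).2 hS
        _ = _ := by
            rw [show (10 : ℝ≥0∞) = ENNReal.ofReal 10 by norm_num, ← ENNReal.ofReal_mul (by norm_num)]
            congr 1; ring
    rw [← ofReal_norm, ← ENNReal.ofReal_pow (norm_nonneg _)] at h1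
    have h2 := (ENNReal.ofReal_lt_ofReal_iff (by positivity)).1 h1
    exact lt_of_pow_lt_pow_left₀ 2 (by positivity) h2
  refine ⟨v '' Set.Ici S, image_mem_map (Ici_mem_atTop S), ?_⟩
  rintro _ ⟨a, ha, rfl⟩ _ ⟨b, hb, rfl⟩
  have h1 := hclose a ha
  have h2 := hclose b hb
  calc dist (v a) (v b) ≤ dist (v a) (v S) + dist (v b) (v S) := dist_triangle_right _ _ _
    _ < ε / 2 + ε / 2 := by rw [dist_eq_norm, dist_eq_norm]; exact add_lt_add h1 h2
    _ = ε := by ring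

/-- Reversal of time. -/
lemma reverse (h : IsDuhamelPair σ c p v) : IsDuhamelPair (-σ) (-c) (fun t => p (-t)) (fun t => v (-t)) where
  sign := by rcases h.sign with h | h <;> simp [h]
  norm_const := by rw [norm_neg, h.norm_const]
  continuous := h.continuous.comp continuous_neg
  eq_flow t := by rw [h.eq_flow (-t)]; congr 2; ring
  sub_eq a b := by
    rw [h.sub_eq (-a) (-b), intervalIntegral.integral_symm, smul_neg, neg_smul,
      ← intervalIntegral.integral_comp_neg]
    congr 3
    funext t
    congr 2
    ring

end IsDuhamelPair

end Scattering

end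

end ExteriorNLS

/-! ### Joint measurability of continuous curves in L² -/

namespace ExteriorNLS

noncomputable section

section JointMeasurability

/-- A continuous curve in `L²` has a jointly measurable representative. -/
lemma exists_stronglyMeasurable_uncurry {α E : Type*} [MeasurableSpace α] {μ : Measure α}
    [NormedAddCommGroup E] [CompleteSpace E] [MeasurableSpace E] [BorelSpace E] [SecondCountableTopology E]
    {f : ℝ → Lp E 2 μ} (hf : Continuous f) :
    ∃ G : ℝ × α → E, StronglyMeasurable G ∧ ∀ t, (fun x => G (t, x)) =ᵐ[μ] f t := by
  classical
  set d : ℕ → Lp E 2 μ := fun j => f (TopologicalSpace.denseSeq ℝ j) with hd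
  have hex : ∀ k : ℕ, ∀ t : ℝ, ∃ j, dist (d j) (f t) < (1 / 2) ^ (k + 1) := by
    intro k t
    have ho : IsOpen (f ⁻¹' Metric.ball (f t) ((1 / 2) ^ (k + 1))) := Metric.isOpen_ball.preimage hf
    obtain ⟨j, h1⟩ := (TopologicalSpace.denseRange_denseSeq ℝ).exists_mem_open ho
      ⟨t, Metric.mem_ball_self (by positivity)⟩
    exact ⟨j, h1⟩
  -- A measurable selection: at time t take the first member of a countable dense family within
  -- 2^{-k-1} of f(t). Countably many representatives make g jointly measurable.
  set g : ℕ → ℝ × α → E := fun k z => d (Nat.find (hex k z.1)) z.2 with hg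
  have hgm : ∀ k, StronglyMeasurable (g k) := by
    intro k
    have hj : Measurable fun t : ℝ => Nat.find (hex k t) := by
      refine measurable_find (hex k) fun j => ?_
      exact (isOpen_lt (continuous_const.dist hf) continuous_const).measurableSet
    have hdm : Measurable fun z : ℕ × α => d z.1 z.2 :=
      measurable_from_prod_countable_right fun j => (Lp.stronglyMeasurable (d j)).measurable
    exact (hdm.comp ((hj.comp measurable_fst).prodMk measurable_snd)).stronglyMeasurable
  refine ⟨fun z => limUnder atTop fun k => g k z, StronglyMeasurable.limUnder hgm, fun t => ?_⟩
  set q : ℕ → Lp E 2 μ := fun k => d (Nat.find (hex k t)) with hq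
  have hdist : ∀ k, dist (q k) (f t) < (1 / 2) ^ (k + 1) := fun k => Nat.find_spec (hex k t)
  -- The approximations are summably close in L², so they converge almost everywhere for each t; a
  -- subsequence identifies the limit as f(t).
  have hcau : ∀ᵐ x ∂μ, ∃ l : E, Tendsto (fun k => q k x) atTop (𝓝 l) := by
    refine Lp.ae_tendsto_of_cauchy_eLpNorm (p := 2) (B := fun k => ENNReal.ofReal ((1 / 2) ^ k))
      (fun k => Lp.aestronglyMeasurable _) (by norm_num) ?_ ?_
    · rw [← ENNReal.ofReal_tsum_of_nonneg (fun k => by positivity)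
        (summable_geometric_of_lt_one (by norm_num) (by norm_num))]
      exact ENNReal.ofReal_ne_top
    · intro N n m hn hm
      rw [eLpNorm_congr_ae (Lp.coeFn_sub (q n) (q m)).symm, eLpNorm_eq_ofReal_norm,
        ENNReal.ofReal_lt_ofReal_iff (by positivity), ← dist_eq_norm]
      have e1 : ((1 : ℝ) / 2) ^ (n + 1) ≤ (1 / 2) ^ (N + 1) :=
        pow_le_pow_of_le_one (by norm_num) (by norm_num) (by omega)
      have e2 : ((1 : ℝ) / 2) ^ (m + 1) ≤ (1 / 2) ^ (N + 1) :=
        pow_le_pow_of_le_one (by norm_num) (by norm_num) (by omega)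
      calc dist (q n) (q m) ≤ dist (q n) (f t) + dist (q m) (f t) := dist_triangle_right _ _ _
        _ < (1 / 2) ^ (n + 1) + (1 / 2) ^ (m + 1) := add_lt_add (hdist n) (hdist m)
        _ ≤ (1 / 2) ^ (N + 1) + (1 / 2) ^ (N + 1) := add_le_add e1 e2
        _ = _ := by ring
  have hlim : Tendsto q atTop (𝓝 (f t)) := by
    refine tendsto_iff_dist_tendsto_zero.2 (squeeze_zero (fun _ => dist_nonneg) (fun k => (hdist k).le) ?_)
    exact (tendsto_pow_atTop_nhds_zero_of_lt_one (by norm_num) (by norm_num)).comp (tendsto_add_atTop_nat 1)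
  obtain ⟨ns, hns, hae⟩ := (tendstoInMeasure_of_tendsto_Lp hlim).exists_seq_tendsto_ae
  filter_upwards [hcau, hae] with x ⟨l, hl⟩ h2
  rw [tendsto_nhds_unique h2 (hl.comp hns.tendsto_atTop)]
  exact hl.limUnder_eq

end JointMeasurability

/-! ### Lebesgue norms of the gradient -/

section GradientBounds

/-- Hölder between L² and L⁶. The relation on q is admissibility cleared of denominators, and it
makes the exponent of ∫|f|⁶ equal to 1/3 for every r. -/
lemma eLpNorm_rpow_le {α E : Type*} [MeasurableSpace α] {μ : Measure α} [NormedAddCommGroup E] {f : α → E}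
    (hf : AEStronglyMeasurable f μ) {r : ℝ≥0∞} {q : ℝ} (hr2 : 2 ≤ r.toReal) (hr6 : r.toReal ≤ 6)
    (hq : 3 * (r.toReal - 2) * q = 4 * r.toReal) :
    eLpNorm f r μ ^ q ≤ (∫⁻ x, ‖f x‖ₑ ^ 2 ∂μ) ^ ((6 - r.toReal) / 4 * (q / r.toReal)) *
      (∫⁻ x, ‖f x‖ₑ ^ 6 ∂μ) ^ (1 / 3 : ℝ) := by
  have hr0 : r ≠ 0 := by rintro rfl; norm_num at hr2
  have hrt : r ≠ ⊤ := by rintro rfl; norm_num at hr2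
  set ρ := r.toReal with hρ
  have hρ0 : 0 < ρ := by linarith
  have hρ2 : 0 < ρ - 2 := by
    rcases hr2.eq_or_lt with h | h
    · rw [← h] at hq; norm_num at hq
    · linarith
  have hq0 : 0 < q := by
    have h : 0 < 3 * (ρ - 2) * q := by rw [hq]; positivity
    exact (mul_pos_iff_of_pos_left (by positivity)).1 h
  have key : ∫⁻ x, ‖f x‖ₑ ^ ρ ∂μ ≤ (∫⁻ x, ‖f x‖ₑ ^ 2 ∂μ) ^ ((6 - ρ) / 4) * (∫⁻ x, ‖f x‖ₑ ^ 6 ∂μ) ^ ((ρ - 2) / 4) := by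
    refine le_trans (le_of_eq ?_) (ENNReal.lintegral_mul_norm_pow_le (hf.enorm.pow_const 2) (hf.enorm.pow_const 6)
      (by linarith) (by linarith) (by ring))
    refine lintegral_congr fun x => ?_
    rw [← ENNReal.rpow_natCast, ← ENNReal.rpow_natCast, ← ENNReal.rpow_mul, ← ENNReal.rpow_mul,
      ← ENNReal.rpow_add_of_nonneg _ _ (by push_cast; linarith) (by push_cast; linarith)]
    congr 1
    push_cast
    ring
  rw [eLpNorm_eq_lintegral_rpow_enorm_toReal hr0 hrt, ← ENNReal.rpow_mul, ← hρ, div_mul_eq_mul_div, one_mul]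
  refine (ENNReal.rpow_le_rpow key (by positivity)).trans_eq ?_
  rw [ENNReal.mul_rpow_of_nonneg _ _ (by positivity), ← ENNReal.rpow_mul, ← ENNReal.rpow_mul]
  congr 2
  field_simp
  linarith

lemma sixNorm_hardy_le (p : HL2) : sixNorm (hardy p) ≤ 4 * ENNReal.ofReal (‖p‖ ^ 6) := by
  have hu := measurable_HL2 (hardy p)
  calc sixNorm (hardy p) ≤ ∫⁻ x, ENNReal.ofReal (‖p‖ ^ 4) * ‖hardy p x‖ₑ ^ 2 ∂halfLine := by
        refine lintegral_mono_ae ?_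
        filter_upwards [coeFn_hardy p, ae_halfLine_of_forall fun x hx => norm_profile_le' p (le_of_lt hx)] with x h1 h2
        calc ‖hardy p x‖ₑ ^ 6 = ‖hardy p x‖ₑ ^ 4 * ‖hardy p x‖ₑ ^ 2 := by rw [← pow_add]
          _ ≤ _ := by
              gcongr
              rw [ENNReal.ofReal_pow (norm_nonneg _), h1, ← ofReal_norm]
              gcongr
    _ = ENNReal.ofReal (‖p‖ ^ 4) * ‖hardy p‖ₑ ^ 2 := by
        rw [lintegral_const_mul _ (by fun_prop), ← enorm_sq_eq_lintegral]
    _ ≤ ENNReal.ofReal (‖p‖ ^ 4) * ENNReal.ofReal (2 * ‖p‖) ^ 2 := by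
        gcongr
        rw [← ofReal_norm]
        exact ENNReal.ofReal_le_ofReal (norm_hardy_le p)
    _ = _ := by
        rw [← ENNReal.ofReal_pow (by positivity), ← ENNReal.ofReal_mul (by positivity),
          show (4 : ℝ≥0∞) = ENNReal.ofReal 4 by norm_num, ← ENNReal.ofReal_mul (by positivity)]
        congr 1; ring

/-- Since r²·r^{-6} ≤ 1, the sixth power of the gradient is dominated by that of p - `hardy p` on
the half-line; the Hardy part is bounded and square integrable. -/
lemma lintegral_gradient_pow_six_le (p : HL2) :
    ∫⁻ x, ‖(lift p).gradient x‖ₑ ^ 6 ∂volOmega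
      ≤ ENNReal.ofReal (4 * Real.pi) * (15625 * sixNorm p + 16 * ENNReal.ofReal (‖p‖ ^ 6)) := by
  have hp := measurable_HL2 p
  have hu := measurable_profile p
  have e1 : ∫⁻ x, ‖(lift p).gradient x‖ₑ ^ 6 ∂volOmega
      = ∫⁻ x : E3, ENNReal.ofReal (‖p (‖x‖ - 1) - profile p (‖x‖ - 1)‖ / (1 + (‖x‖ - 1))) ^ 6 ∂volOmega := by
    refine lintegral_congr_ae ?_
    filter_upwards [gradient_lift p] with x hx
    rw [hx, ← ofReal_norm, norm_radialGrad, add_sub_cancel]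
  rw [e1, lintegral_radial (fun y => ENNReal.ofReal (‖p y - profile p y‖ / (1 + y)) ^ 6) (by fun_prop)]
  refine mul_le_mul' le_rfl ?_
  calc ∫⁻ y, ENNReal.ofReal ((1 + y) ^ 2) * ENNReal.ofReal (‖p y - profile p y‖ / (1 + y)) ^ 6 ∂halfLine
      ≤ ∫⁻ y, ‖(p - hardy p : HL2) y‖ₑ ^ 6 ∂halfLine := by
        refine lintegral_mono_ae ?_
        filter_upwards [Lp.coeFn_sub p (hardy p), coeFn_hardy p,
          ae_halfLine_of_forall (P := fun x => 0 < x) (fun x hx => hx)] with y h1 h2 h3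
        rw [h1, Pi.sub_apply, h2, ← ofReal_norm, ← ENNReal.ofReal_pow (by positivity),
          ← ENNReal.ofReal_pow (by positivity), ← ENNReal.ofReal_mul (by positivity)]
        refine ENNReal.ofReal_le_ofReal ?_
        rw [div_pow, mul_div_assoc', div_le_iff₀ (by positivity), mul_comm]
        gcongr
        · linarith
        · norm_num
    _ = sixNorm (p + (-1 : ℂ) • hardy p) := by rw [neg_one_smul, ← sub_eq_add_neg]; rfl
    _ ≤ 15625 * sixNorm p + 4 * sixNorm ((-1 : ℂ) • hardy p) := sixNorm_add_le _ _
    _ ≤ 15625 * sixNorm p + 4 * (4 * ENNReal.ofReal (‖p‖ ^ 6)) := by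
        rw [sixNorm_smul (by simp)]
        gcongr
        exact sixNorm_hardy_le p
    _ = _ := by rw [← mul_assoc]; norm_num

lemma lintegral_gradient_sq (f : RadialHdot) : ∫⁻ x, ‖f.gradient x‖ₑ ^ 2 ∂volOmega = ENNReal.ofReal (‖f‖ ^ 2) := by
  rw [lintegral_sq_eq_eLpNorm, eLpNorm_eq_ofReal_norm, ← RadialHdot.norm_eq, ENNReal.ofReal_pow (norm_nonneg _)]

end GradientBounds

/-! ### The assertions about solutions -/

section Solutions

variable {v : ℝ → HL2}

lemma isDuhamelPair_of_solution (hv : ∀ t, HasDerivAt v (field t (v t)) t) :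
    IsDuhamelPair 1 (-Complex.I) (fun t => flow t (v t)) v where
  sign := Or.inl rfl
  norm_const := by simp
  continuous := continuous_flow continuous_id (continuous_iff_continuousAt.2 fun t => (hv t).continuousAt)
  eq_flow t := by rw [one_mul]
  sub_eq a b := by
    have hc : Continuous v := continuous_iff_continuousAt.2 fun t => (hv t).continuousAt
    rw [← intervalIntegral.integral_eq_sub_of_hasDerivAt (fun t _ => hv t)
      ((continuous_field_comp hc).intervalIntegrable a b), ← intervalIntegral.integral_smul]
    simp only [field, one_mul]

lemma lintegral_tenNorm_ne_top {p : ℝ → HL2} {u : ℝ → RadialHdot} (hu : ∀ t, u t = lift (p t)) {S : Set ℝ}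
    (h : mixedNorm 10 10 S (fun t x => (u t).fn x) < ⊤) : ∫⁻ t in S, tenNorm (p t) ≠ ⊤ := by
  have e1 : ∀ t, ‖eLpNorm (fun x => (u t).fn x) 10 volOmega‖ₑ ^ 10 = ENNReal.ofReal (4 * Real.pi) * tenNorm (p t) := by
    intro t
    rw [tenNorm, ← lintegral_radialFn_pow, enorm_eq_self]
    have := lintegral_pow_eq_eLpNorm (fun x => (u t).fn x) volOmega (k := 10) (by norm_num)
    rw [Nat.cast_ofNat] at this
    rw [← this]
    refine lintegral_congr_ae ?_
    filter_upwards [hu t ▸ fn_lift (p t)] with x hx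
    rw [hx]
  have e2 := lintegral_pow_eq_eLpNorm (fun t => eLpNorm (fun x => (u t).fn x) 10 volOmega) (volume.restrict S)
    (k := 10) (by norm_num)
  simp_rw [e1] at e2
  rw [Nat.cast_ofNat, lintegral_const_mul' _ _ ENNReal.ofReal_ne_top] at e2
  have h3 : ENNReal.ofReal (4 * Real.pi) * ∫⁻ t in S, tenNorm (p t) ≠ ⊤ := by
    rw [e2]; exact ENNReal.pow_ne_top h.ne
  intro htop
  rw [htop] at h3
  exact h3 (ENNReal.mul_top (by simp [Real.pi_pos]))

/-- Asymptotic states are limits of the profiles along the flow. -/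
lemma tendsto_propagator_iff {u : ℝ → RadialHdot} (hu : ∀ t, u t = lift (flow t (v t))) {l : Filter ℝ} (w : HL2) :
    Tendsto (fun t => ‖propagator t (lift w) - u t‖) l (𝓝 0) ↔ Tendsto v l (𝓝 w) := by
  have e : ∀ t, ‖propagator t (lift w) - u t‖ = √(4 * Real.pi) * ‖v t - w‖ := fun t => by
    rw [hu, propagator_lift, ← map_sub, ← map_sub, norm_lift, norm_flow, norm_sub_rev]
  simp_rw [e]
  have hpi : √(4 * Real.pi) ≠ 0 := (Real.sqrt_pos.2 (by positivity)).ne'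
  rw [tendsto_iff_norm_sub_tendsto_zero (f := v)]
  constructor
  · intro h
    have := h.const_mul (√(4 * Real.pi))⁻¹
    simp_rw [inv_mul_cancel_left₀ hpi] at this
    rwa [mul_zero] at this
  · intro h
    simpa using h.const_mul √(4 * Real.pi)

lemma existsUnique_asymptotic_state {u : ℝ → RadialHdot} (hu : ∀ t, u t = lift (flow t (v t))) {l : Filter ℝ} [l.NeBot]
    (h : ∃ w, Tendsto v l (𝓝 w)) :
    ∃! f : RadialHdot, Tendsto (fun t => ‖propagator t f - u t‖) l (𝓝 0) := by
  obtain ⟨w, hw⟩ := h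
  refine ⟨lift w, (tendsto_propagator_iff hu w).2 hw, fun f hf => ?_⟩
  obtain ⟨w', rfl⟩ := lift.surjective f
  rw [tendsto_nhds_unique ((tendsto_propagator_iff hu w').1 hf) hw]

theorem scattering_forward (hv : ∀ t, HasDerivAt v (field t (v t)) t) {u : ℝ → RadialHdot}
    (hu : ∀ t, u t = lift (flow t (v t)))
    (h : mixedNorm 10 10 (Set.Ici (0 : ℝ)) (fun t x => (u t).fn x) < ⊤) :
    ∃! f : RadialHdot, Tendsto (fun t => ‖propagator t f - u t‖) atTop (𝓝 0) := by
  have hD := lintegral_tenNorm_ne_top hu h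
  refine existsUnique_asymptotic_state hu ((isDuhamelPair_of_solution hv).exists_tendsto (M := energyRadius (v 0))
    (fun t => ?_) (ne_top_of_le_ne_top hD (lintegral_mono_set Set.Ioi_subset_Ici_self)))
  rw [norm_flow]
  exact (norm_lt_energyRadius_of_solution hv t).le

/-- The reversed pair satisfies the abstract hypotheses with signs changed, so the forward argument
applies to it. -/
theorem scattering_backward (hv : ∀ t, HasDerivAt v (field t (v t)) t) {u : ℝ → RadialHdot}
    (hu : ∀ t, u t = lift (flow t (v t)))
    (h : mixedNorm 10 10 (Set.Iic (0 : ℝ)) (fun t x => (u t).fn x) < ⊤) :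
    ∃! f : RadialHdot, Tendsto (fun t => ‖propagator t f - u t‖) atBot (𝓝 0) := by
  have hD := lintegral_tenNorm_ne_top hu h
  have hD' : ∫⁻ t in Set.Ioi 0, tenNorm (flow (-t) (v (-t))) ≠ ⊤ := by
    have e := (Measure.measurePreserving_neg (volume : Measure ℝ)).setLIntegral_comp_preimage_emb
      (MeasurableEquiv.neg ℝ).measurableEmbedding (fun t => tenNorm (flow t (v t))) (Set.Iic 0)
    refine ne_top_of_le_ne_top (e ▸ hD) (lintegral_mono_set fun t ht => ?_)
    simpa using le_of_lt (show (0 : ℝ) < t from ht)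
  obtain ⟨w, hw⟩ := (isDuhamelPair_of_solution hv).reverse.exists_tendsto (M := energyRadius (v 0))
    (fun t => by rw [norm_flow]; exact (norm_lt_energyRadius_of_solution hv _).le) hD'
  refine existsUnique_asymptotic_state hu ⟨w, ?_⟩
  have := hw.comp tendsto_neg_atBot_atTop
  simpa [Function.comp_def] using this

lemma lintegral_sixNorm_solution_ne_top (hv : ∀ t, HasDerivAt v (field t (v t)) t) {J : Set ℝ} (hJ : IsCompact J) :
    ∫⁻ t in J, sixNorm (flow t (v t)) ≠ ⊤ := by
  obtain ⟨R, hR⟩ := hJ.isBounded.subset_closedBall 0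
  rw [Real.closedBall_eq_Icc, zero_sub, zero_add] at hR
  have hR' : J ⊆ Set.Ioc (-|R| - 1) |R| := fun t ht =>
    ⟨by linarith [(hR ht).1, le_abs_self R], (hR ht).2.trans (le_abs_self R)⟩
  exact ne_top_of_le_ne_top ((isDuhamelPair_of_solution hv).lintegral_sixNorm_ne_top
    (by linarith [abs_nonneg R])) (lintegral_mono_set hR')

lemma admissible_toReal {q r : ℝ≥0∞} (h : Admissible q r) (hr : r < 3) (hq : q ≠ ⊤) :
    2 ≤ r.toReal ∧ r.toReal ≤ 6 ∧ 3 * (r.toReal - 2) * q.toReal = 4 * r.toReal := by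
  obtain ⟨h1, h2⟩ := h
  have hr0 : r ≠ 0 := by
    rintro rfl
    rw [ENNReal.div_zero (by norm_num)] at h2
    have : (3 / 2 : ℝ≥0∞) ≠ ⊤ := ENNReal.div_ne_top (by norm_num) (by norm_num)
    simp [eq_comm, this] at h2
  have hrt : r ≠ ⊤ := hr.ne_top
  have hq0 : q ≠ 0 := by rintro rfl; norm_num at h1
  have e := congrArg ENNReal.toReal h2
  rw [ENNReal.toReal_add (ENNReal.div_ne_top (by norm_num) hq0) (ENNReal.div_ne_top (by norm_num) hr0),
    ENNReal.toReal_div, ENNReal.toReal_div, ENNReal.toReal_div] at e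
  simp only [ENNReal.toReal_ofNat] at e
  have hρ : 0 < r.toReal := ENNReal.toReal_pos hr0 hrt
  have hκ : 0 < q.toReal := ENNReal.toReal_pos hq0 hq
  have hr3 : r.toReal < 3 := by
    have := (ENNReal.toReal_lt_toReal hrt (by norm_num)).2 hr
    simpa using this
  have e' : 3 * (r.toReal - 2) * q.toReal = 4 * r.toReal := by
    field_simp at e
    linarith
  refine ⟨?_, by linarith, e'⟩
  -- For r < 2 the left side of the relation is negative and the right side positive.
  by_contra hlt
  push Not at hlt
  nlinarith

lemma admissible_top {r : ℝ≥0∞} (h : Admissible ⊤ r) : r = 2 := by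
  obtain ⟨-, h2⟩ := h
  rw [ENNReal.div_top, zero_add] at h2
  have hr0 : r ≠ 0 := by
    rintro rfl
    rw [ENNReal.div_zero (by norm_num)] at h2
    have : (3 / 2 : ℝ≥0∞) ≠ ⊤ := ENNReal.div_ne_top (by norm_num) (by norm_num)
    simp [eq_comm, this] at h2
  have hrt : r ≠ ⊤ := by
    rintro rfl
    rw [ENNReal.div_top] at h2
    exact ENNReal.div_ne_zero.2 ⟨by norm_num, by norm_num⟩ h2.symm
  have e := congrArg ENNReal.toReal h2
  rw [ENNReal.toReal_div, ENNReal.toReal_div] at e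
  simp only [ENNReal.toReal_ofNat] at e
  have hρ : 0 < r.toReal := ENNReal.toReal_pos hr0 hrt
  refine (ENNReal.toReal_eq_toReal_iff' hrt (by norm_num)).1 ?_
  rw [ENNReal.toReal_ofNat]
  rw [div_eq_div_iff hρ.ne' (by norm_num)] at e
  linarith

/-- For q = ∞ the pair is (∞, 2) and the energy bound suffices. Otherwise interpolation bounds the
q-th power of the spatial norm by a constant times 1 + ∫|∇u|⁶, which is integrable over bounded
times by the Strichartz bound for p. -/
theorem memMixed_gradient (hv : ∀ t, HasDerivAt v (field t (v t)) t) {u : ℝ → RadialHdot}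
    (hu : ∀ t, u t = lift (flow t (v t))) {q r : ℝ≥0∞} (hqr : Admissible q r) (hr : r < 3) {J : Set ℝ}
    (hJ : IsCompact J) : MemMixed q r J (fun t x => (u t).gradient x) := by
  have hp : Continuous fun t => flow t (v t) := (isDuhamelPair_of_solution hv).continuous
  have huc : Continuous u := by
    have : u = fun t => lift (flow t (v t)) := funext hu
    rw [this]
    exact lift.continuous.comp hp
  have hgc : Continuous fun t => (u t).gradient :=
    (AddMonoidHomClass.isometry_of_norm RadialHdot.gradient fun f => (RadialHdot.norm_eq f).symm).continuous.comp huc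
  obtain ⟨G, hG, hGu⟩ := exists_stronglyMeasurable_uncurry hgc
  refine ⟨⟨G, hG.aestronglyMeasurable, Eventually.of_forall hGu⟩, ?_⟩
  set M := √(4 * Real.pi) * energyRadius (v 0) with hM
  have hpM : ∀ t, ‖flow t (v t)‖ ≤ energyRadius (v 0) := fun t => by
    rw [norm_flow]; exact (norm_lt_energyRadius_of_solution hv t).le
  have huM : ∀ t, ‖u t‖ ≤ M := fun t => by
    rw [hu, norm_lift]
    exact mul_le_mul_of_nonneg_left (hpM t) (Real.sqrt_nonneg _)
  rcases eq_or_ne q ⊤ with rfl | hq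
  · rw [admissible_top hqr, mixedNorm, eLpNorm_exponent_top]
    refine (essSup_le_of_ae_le (ENNReal.ofReal M) (Eventually.of_forall fun t => ?_)).trans_lt ENNReal.ofReal_lt_top
    change ‖eLpNorm (fun x => (u t).gradient x) 2 volOmega‖ₑ ≤ _
    rw [enorm_eq_self, eLpNorm_eq_ofReal_norm, ← RadialHdot.norm_eq]
    exact ENNReal.ofReal_le_ofReal (huM t)
  · obtain ⟨hr2, hr6, he⟩ := admissible_toReal hqr hr hq
    have hq0 : q ≠ 0 := fun h => by
      have := hqr.1
      rw [h] at this
      norm_num at this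
    set s := (6 - r.toReal) / 4 * (q.toReal / r.toReal) with hs
    have hs0 : 0 ≤ s := mul_nonneg (by linarith) (by positivity)
    set K := ENNReal.ofReal (M ^ 2) ^ s with hK
    have hKt : K ≠ ⊤ := ENNReal.rpow_ne_top_of_nonneg hs0 ENNReal.ofReal_ne_top
    set c := ENNReal.ofReal (4 * Real.pi) with hc
    rw [mixedNorm, eLpNorm_lt_top_iff_lintegral_rpow_enorm_lt_top hq0 hq]
    have hb : ∀ t, ‖eLpNorm (fun x => (u t).gradient x) r volOmega‖ₑ ^ q.toReal ≤
        K * (c * 15625) * sixNorm (flow t (v t)) +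
          K * (1 + c * (16 * ENNReal.ofReal (energyRadius (v 0) ^ 6))) := by
      intro t
      rw [enorm_eq_self]
      refine (eLpNorm_rpow_le (Lp.aestronglyMeasurable _) hr2 hr6 he).trans ?_
      calc _ ≤ K * (1 + ∫⁻ x, ‖(u t).gradient x‖ₑ ^ 6 ∂volOmega) := by
            refine mul_le_mul' (ENNReal.rpow_le_rpow ?_ hs0) ?_
            · rw [lintegral_gradient_sq]
              gcongr
              exact huM t
            · set B := ∫⁻ x, ‖(u t).gradient x‖ₑ ^ 6 ∂volOmega
              -- The loss from the power 1/3 to 1 + B is harmless because J has finite measure.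
              calc B ^ (1 / 3 : ℝ) ≤ (1 + B) ^ (1 / 3 : ℝ) := by gcongr; exact le_add_self
                _ ≤ (1 + B) ^ (1 : ℝ) := ENNReal.rpow_le_rpow_of_exponent_le le_self_add (by norm_num)
                _ = 1 + B := ENNReal.rpow_one _
        _ ≤ K * (1 + c * (15625 * sixNorm (flow t (v t)) + 16 * ENNReal.ofReal (energyRadius (v 0) ^ 6))) := by
            gcongr
            rw [hu]
            refine (lintegral_gradient_pow_six_le _).trans ?_
            gcongr
            exact hpM t
        _ = _ := by ring
    refine (lintegral_mono hb).trans_lt ?_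
    rw [lintegral_add_left ((measurable_sixNorm_comp hp).const_mul _), lintegral_const, Measure.restrict_apply_univ,
      lintegral_const_mul _ (measurable_sixNorm_comp hp)]
    have hct : c ≠ ⊤ := ENNReal.ofReal_ne_top
    refine ENNReal.add_lt_top.2 ⟨ENNReal.mul_lt_top (ENNReal.mul_lt_top hKt.lt_top ?_)
      (lintegral_sixNorm_solution_ne_top hv hJ).lt_top, ENNReal.mul_lt_top (ENNReal.mul_lt_top hKt.lt_top ?_)
      hJ.measure_lt_top⟩
    · exact ENNReal.mul_lt_top hct.lt_top (by norm_num)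
    · exact ENNReal.add_lt_top.2 ⟨by norm_num, ENNReal.mul_lt_top hct.lt_top
        (ENNReal.mul_lt_top (by norm_num) ENNReal.ofReal_lt_top)⟩

end Solutions

end

end ExteriorNLS

/-! ### Assembly of the theorem -/

theorem theorem3p2 (u₀ : ExteriorNLS.RadialHdot) :
    (∃! u : ℝ → ExteriorNLS.RadialHdot, ExteriorNLS.IsGlobalSolution u ∧ u 0 = u₀) ∧
    ∀ u : ℝ → ExteriorNLS.RadialHdot, ExteriorNLS.IsGlobalSolution u → u 0 = u₀ →
      (∀ q r : ℝ≥0∞, ExteriorNLS.Admissible q r → r < 3 → ∀ J : Set ℝ, IsCompact J →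
        ExteriorNLS.MemMixed q r J (fun t x => (u t).gradient x)) ∧
      (∀ t : ℝ, ExteriorNLS.energy (u t) = ExteriorNLS.energy u₀) ∧
      (ExteriorNLS.mixedNorm 10 10 (Set.Ici (0 : ℝ)) (fun t x => (u t).fn x) < ⊤ →
        ∃! v : ExteriorNLS.RadialHdot,
          Tendsto (fun t => ‖ExteriorNLS.propagator t v - u t‖) atTop (𝓝 0)) ∧
      (ExteriorNLS.mixedNorm 10 10 (Set.Iic (0 : ℝ)) (fun t x => (u t).fn x) < ⊤ →
        ∃! v : ExteriorNLS.RadialHdot,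
          Tendsto (fun t => ‖ExteriorNLS.propagator t v - u t‖) atBot (𝓝 0)) := by
  open ExteriorNLS in
  refine ⟨?_, fun u hu h0 => ?_⟩
  · obtain ⟨p₀, rfl⟩ := lift.surjective u₀
    obtain ⟨v, hv0, hv⟩ := exists_solution p₀
    refine ⟨fun t => lift (flow t (v t)), ⟨isGlobalSolution_iff.2 ⟨v, hv, fun _ => rfl⟩, ?_⟩, ?_⟩
    · simp only [flow_zero, hv0]
    · rintro w ⟨hw, hw0⟩
      obtain ⟨v', hv', hwv⟩ := isGlobalSolution_iff.1 hw
      have h0 : v' 0 = v 0 := by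
        rw [hwv 0, flow_zero] at hw0
        rw [hv0, lift.injective hw0]
      rw [solution_unique hv' hv h0] at hwv
      exact funext hwv
  · obtain ⟨v, hv, huv⟩ := isGlobalSolution_iff.1 hu
    refine ⟨fun q r hqr hr J hJ => memMixed_gradient hv huv hqr hr hJ, fun t => ?_,
      scattering_forward hv huv, scattering_backward hv huv⟩
    rw [huv, energy_solution hv, ← h0, huv 0, flow_zero]
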